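/- **Setting.** Let $\pi:\mathcal X\to B$ be a proper holomorphic submersion of complex manifolds whose fibres $\mathcal X_b$ are connected of dimension $n$, and let $\mathcal L$ be a holomorphic $\mathbb Q$-line bundle on $\mathcal X$. Let $K$ be a compact Lie group with Lie algebra $\mathfrak k$, acting smoothly by biholomorphisms on $B$ and on $(\mathcal X,\mathcal L)$, such that $\pi$ is $K$-equivariant. Let $\omega_{\mathcal X}\in c_1(\mathcal L)$ be a $K$-invariant relatively Kähler metric, i.e. a closed real $(1,1)$-form which restricts to a Kähler form $\omega_b$ on every fibre $\mathcal X_b$ (so $\mathcal L$ is relatively ample). The elements $v+iw$ of $\mathfrak k\otimes\mathbb C$ induce holomorphic vector fields $v+Jw$ on $B$ and on $\mathcal X$, i.e. a local action of the complexification $G$ of $K$. Suppose that the $G$-orbit $B^o\subset B$ of some point $b_0$ is open and dense. The polarised fibres over $B^o$ are then all isomorphic to $(X,L):=(\mathcal X_{b_0},\mathcal L_{b_0})$. **Central charge.** Let $\rho_0,\dots,\rho_n\in\mathbb C$ with $\rho_n=i$, let $a_0,\dots,a_n\in\mathbb C$ with $a_0=a_1=1$, let $\varepsilon>0$, and let $\theta=1+\theta'$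 be a closed smooth complex form on $\mathcal X$ of type $\bigoplus_p(p,p)$, with $\theta'$ of positive degree. Assume that over $B^o$ the form $\theta$ is the one obtained by moving its restriction to a fibre by $G$: it is $G$-invariant and its pull-back under the (local) action map $G\times\mathcal X_{b}\to\mathcal X$ is the pull-back of $\theta|_{\mathcal X_{b}}$ under the projection to $\mathcal X_{b}$, for $b\in B^o$; equivalently, $\theta$ is invariant and its contractions with the vector fields induced by $\mathfrak k\otimes\mathbb C$ vanish. Put $$Z_\varepsilon(X,L)=\sum_{l,j=0}^n\rho_l\varepsilon^{-l}a_j\int_X L^l\cdot K_X^j\cdot[\theta],$$ assume $Z_\varepsilon(X,L)\neq0$, and let $\phi_\varepsilon=\arg Z_\varepsilon(X,L)$. For a fibre $\mathcal X_b$, write $\mathrm{Ric}\,\omega_b=-\frac{i}{2\pi}\partial\bar\partial\log\omega_b^n$, let $\Delta f=\frac{n}{2\pi}\,i\partial\bar\partial f\wedge\omega_b^{n-1}/\omega_b^n$ (so that $\frac{d}{dt}\big|_{t=0}\mathrm{Ric}(\omega_b+t\,i\partial\bar\partial f)=-i\partial\bar\partial\Delta f$), and $$\tilde Z_\varepsilon(\omega_b)=\sum_{l,j=0}^n\rho_l\varepsilon^{-l}(-1)^ja_j\left(\frac{\omega_b^l\wedge(\mathrm{Ric}\,\omega_b)^j\wedge\theta}{\omega_b^n}-\frac{j}{l+1}\Delta\left(\frac{\omega_b^{l+1}\wedge(\mathrm{Ric}\,\omega_b)^{j-1}\wedge\theta}{\omega_b^n}\right)\right),$$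 where only the parts of degree $2n$ of the numerators count, and the second term is absent for $j=0$. Let $\rho\in c_1(-K_{\mathcal X/B})$ be the curvature form of the metric on $-K_{\mathcal X/B}$ induced by $\omega_{\mathcal X}$, and define a $2$-form on $B$ by the fibre integral $$\Omega_\varepsilon=\operatorname{Im}\left(e^{-i\phi_\varepsilon}\int_{\mathcal X/B}\ \sum_{l,j=0}^n\rho_l\varepsilon^{-l}(-1)^ja_j\,\frac{1}{l+1}\,\omega_{\mathcal X}^{l+1}\wedge\rho^j\wedge\theta\right).$$ **Theorem.** For every $v\in\mathfrak k$ there is a smooth function $h_v:\mathcal X\to\mathbb R$ (a Hamiltonian) with $\mathcal L_{Jv}\omega_{\mathcal X}=i\partial\bar\partial h_v$, where $v$ is viewed as a vector field on $\mathcal X$. There is a map $\mu_\varepsilon:B\to\mathfrak k^*$ such that, for every $v\in\mathfrak k$, every such $h_v$, and every $b\in B$, $$\langle\mu_\varepsilon,v\rangle(b)=-\frac12\int_{\mathcal X_b}h_v|_{\mathcal X_b}\,\operatorname{Im}\big(e^{-i\phi_\varepsilon}\tilde Z_\varepsilon(\omega_b)\big)\,\omega_b^n .$$ The map $\mu_\varepsilon$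 is a moment map for the $K$-action on $B$ with respect to $\Omega_\varepsilon$: for all $v\in\mathfrak k$ the function $\langle\mu_\varepsilon,v\rangle$ is smooth with $$d\langle\mu_\varepsilon,v\rangle=-\iota_v\Omega_\varepsilon,$$ and $\mu_\varepsilon$ is $K$-equivariant for the coadjoint action on $\mathfrak k^*$. (The form $\Omega_\varepsilon$ need not be non-degenerate.) -/

import Mathlib

open scoped Manifold ContDiff Topology TensorProduct

noncomputable section

namespace ZMoment

/-! ### Exterior algebra of a complex vector space, with complex coefficients

Tangent vectors are real tangent vectors, forms are real-multilinear with values in `ℂ`. -/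

section Linear

variable {E : Type*} [NormedAddCommGroup E] [NormedSpace ℂ E]

/-- Complex-valued forms of inhomogeneous degree on the real vector space underlying `E`:
one alternating form for every degree. -/
abbrev Alt (E : Type*) [NormedAddCommGroup E] [NormedSpace ℂ E] : Type _ :=
  ∀ k : ℕ, E [⋀^Fin k]→L[ℝ] ℂ

/-- The exterior product of homogeneous forms, as a sum over shuffles:
`(α ∧ β)(v₁, …, vₖ) = ∑ sign σ • α (v_{σ 1}, …, v_{σ a}) β (v_{σ (a+1)}, …, v_{σ k})`. -/
def wedgeHom {a b k : ℕ} (h : a + b = k) (α : E [⋀^Fin a]→L[ℝ] ℂ) (β : E [⋀^Fin b]→L[ℝ] ℂ) :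
    E [⋀^Fin k]→L[ℝ] ℂ :=
  { ((LinearMap.mul' ℝ ℂ).compAlternatingMap
      (α.toAlternatingMap.domCoprod β.toAlternatingMap)).domDomCongr
        (finSumFinEquiv.trans (finCongr h)) with
    cont := by
      have key : ∀ σ : Equiv.Perm.ModSumCongr (Fin a) (Fin b), Continuous fun v : Fin k → E =>
          LinearMap.mul' ℝ ℂ (AlternatingMap.domCoprod.summand α.toAlternatingMap
            β.toAlternatingMap σ (fun i => v ((finSumFinEquiv.trans (finCongr h)) i))) := by
        intro σ
        induction σ using Quotient.inductionOn' with | _ σ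
        rw [AlternatingMap.domCoprod.summand_mk'']
        let e := finSumFinEquiv.trans (finCongr h)
        have hα : Continuous fun v : Fin k → E => α fun i => v (e (σ (Sum.inl i))) :=
          α.cont.comp (continuous_pi fun i => continuous_apply _)
        have hβ : Continuous fun v : Fin k → E => β fun i => v (e (σ (Sum.inr i))) :=
          β.cont.comp (continuous_pi fun i => continuous_apply _)
        refine ((hα.mul hβ).const_smul (Equiv.Perm.sign σ : ℤ)).congr fun v => ?_
        change _ = LinearMap.mul' ℝ ℂ ((Equiv.Perm.sign σ : ℤ) •
          ((α fun i => v (e (σ (Sum.inl i)))) ⊗ₜ[ℝ] (β fun i => v (e (σ (Sum.inr i))))))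
        rw [map_zsmul]
        rfl
      have := continuous_finsetSum Finset.univ (fun σ _ => key σ)
      refine this.congr fun v => ?_
      simp [AlternatingMap.domCoprod_apply, _root_.sum_apply, Function.comp_def] }

/-- The exterior product of inhomogeneous forms. -/
def wedge (α β : Alt E) : Alt E := fun k =>
  ∑ p : Finset.HasAntidiagonal.antidiagonal k,
    wedgeHom (Finset.HasAntidiagonal.mem_antidiagonal.mp p.2) (α p.1.1) (β p.1.2)

/-- The constant `1`, as a form of degree `0`. -/
def altOne : Alt E := Pi.single 0 (ContinuousAlternatingMap.constOfIsEmpty ℝ E (Fin 0) (1 : ℂ))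

/-- A form of degree `k`, as an inhomogeneous form. -/
def ofDegree (k : ℕ) (α : E [⋀^Fin k]→L[ℝ] ℂ) : Alt E := Pi.single k α

/-- Exterior powers `α ∧ ⋯ ∧ α` of a `2`-form. -/
def wpow (α : E [⋀^Fin 2]→L[ℝ] ℂ) : ℕ → Alt E
  | 0 => altOne
  | l + 1 => wedge (ofDegree 2 α) (wpow α l)

/-- `αˡ ∧ βʲ ∧ θ`. -/
def powWedge (α β : E [⋀^Fin 2]→L[ℝ] ℂ) (θ : Alt E) (l j : ℕ) : Alt E :=
  wedge (wpow α l) (wedge (wpow β j) θ)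

/-- Pull-back of inhomogeneous forms under a real-linear map. -/
def altComp {E' : Type*} [NormedAddCommGroup E'] [NormedSpace ℂ E'] (α : Alt E) (A : E' →L[ℝ] E) :
    Alt E' := fun k => (α k).compContinuousLinearMap A

/-- Multiplication by `i`. -/
def J : E →L[ℝ] E := (Complex.I • ContinuousLinearMap.id ℂ E).restrictScalars ℝ

/-- The positively oriented real frame `e₁, i e₁, …, eₙ, i eₙ` of `ℂⁿ`. -/
def stdFrame (n : ℕ) : Fin (2 * n) → (Fin n → ℂ) := fun k =>
  Pi.single ⟨k.1 / 2, by omega⟩ (if k.1 % 2 = 0 then 1 else Complex.I)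

/-- The quotient `α / β` of the top-degree parts of two forms on `ℂⁿ`. -/
def topRatio {n : ℕ} (α β : Alt (Fin n → ℂ)) : ℂ :=
  α (2 * n) (stdFrame n) / β (2 * n) (stdFrame n)

end Linear

/-! ### Differential forms on complex manifolds

`M` is a complex manifold modelled on `E`; the tangent space at `x` is `E`, identified by the
preferred chart at `x`, and its complex structure is multiplication by `i`. -/

section Forms

variable {E : Type*} [NormedAddCommGroup E] [NormedSpace ℂ E]
  {M : Type*} [TopologicalSpace M] [ChartedSpace E M]

/-- The expression of a form in a chart. -/
def coordRep {k : ℕ} (c : OpenPartialHomeomorph M E) (η : M → E [⋀^Fin k]→L[ℝ] ℂ) :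
    E → E [⋀^Fin k]→L[ℝ] ℂ := fun y =>
  (η (c.symm y)).compContinuousLinearMap (mfderiv 𝓘(ℝ, E) 𝓘(ℝ, E) c.symm y : E →L[ℝ] E)

/-- Smooth differential forms. -/
def SmoothForm {k : ℕ} (η : M → E [⋀^Fin k]→L[ℝ] ℂ) : Prop :=
  ∀ x : M, ContDiffOn ℝ ∞ (coordRep (chartAt E x) η) (chartAt E x).target

/-- The exterior derivative. -/
def dForm {k : ℕ} (η : M → E [⋀^Fin k]→L[ℝ] ℂ) : M → E [⋀^Fin (k + 1)]→L[ℝ] ℂ := fun x =>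
  extDeriv (coordRep (chartAt E x) η) (chartAt E x x)

/-- `dᶜ f = -df ∘ J = i (∂̄ f - ∂ f)`. -/
def dc (f : M → ℂ) : M → E [⋀^Fin 1]→L[ℝ] ℂ := fun x =>
  ContinuousAlternatingMap.ofSubsingleton ℝ E ℂ (0 : Fin 1)
    (-(ContinuousLinearMap.comp (mfderiv 𝓘(ℝ, E) 𝓘(ℝ, ℂ) f x : E →L[ℝ] ℂ) (J : E →L[ℝ] E)))

/-- `i ∂∂̄ f = ½ d dᶜ f`. -/
def ddbar (f : M → ℂ) : M → E [⋀^Fin 2]→L[ℝ] ℂ := fun x => (1 / 2 : ℝ) • dForm (dc f) x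

/-- The contraction `ι_Y η`. -/
def contract {k : ℕ} (Y : M → E) (η : M → E [⋀^Fin (k + 1)]→L[ℝ] ℂ) : M → E [⋀^Fin k]→L[ℝ] ℂ :=
  fun x => (η x).curryLeft (Y x)

/-- The Lie derivative of a form, `L_Y η = d ι_Y η + ι_Y d η`. -/
def lieDeriv {k : ℕ} (Y : M → E) (η : M → E [⋀^Fin (k + 1)]→L[ℝ] ℂ) :
    M → E [⋀^Fin (k + 1)]→L[ℝ] ℂ := fun x => dForm (contract Y η) x + contract Y (dForm η) x

/-- Pull-back of a form under a smooth map. -/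
def pullback {E' M' : Type*} [NormedAddCommGroup E'] [NormedSpace ℂ E'] [TopologicalSpace M']
    [ChartedSpace E' M'] {k : ℕ} (f : M' → M) (η : M → E [⋀^Fin k]→L[ℝ] ℂ) :
    M' → E' [⋀^Fin k]→L[ℝ] ℂ := fun x =>
  (η (f x)).compContinuousLinearMap (mfderiv 𝓘(ℝ, E') 𝓘(ℝ, E) f x : E' →L[ℝ] E)

/-- Forms with real values. -/
def RealForm {k : ℕ} (η : M → E [⋀^Fin k]→L[ℝ] ℂ) : Prop := ∀ x u, (η x u).im = 0

/-- Forms of type `⊕ₚ (p,p)`: a form of type `(p,q)` is multiplied by `c^(p-q)` when the complex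
number `c` of modulus one acts on the tangent space. -/
def BalancedType {k : ℕ} (η : M → E [⋀^Fin k]→L[ℝ] ℂ) : Prop :=
  ∀ x u (c : ℂ), ‖c‖ = 1 → η x (fun i => c • u i) = η x u

end Forms

/-! ### Compact complex manifolds of dimension `n` -/

theorem isManifold_real {E : Type*} [NormedAddCommGroup E] [NormedSpace ℂ E]
    {M : Type*} [TopologicalSpace M] [ChartedSpace E M] [IsManifold 𝓘(ℂ, E) ω M] :
    IsManifold 𝓘(ℝ, E) ∞ M := by
  refine isManifold_of_contDiffOn _ _ _ fun e e' he he' => ?_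
  have h := ((contDiffGroupoid ω 𝓘(ℂ, E)).compatible he he')
  rw [contDiffGroupoid, mem_groupoid_of_pregroupoid] at h
  have h1 := h.1
  simp only [contDiffPregroupoid, modelWithCornersSelf_coe, modelWithCornersSelf_coe_symm,
    Function.id_comp, Function.comp_id, Set.preimage_id, Set.range_id, Set.inter_univ] at h1
  simpa using (h1.restrict_scalars ℝ).of_le le_top

section Compact

variable {n : ℕ} {M : Type*} [TopologicalSpace M] [ChartedSpace (Fin n → ℂ) M]

theorem exists_partition (M : Type*) [TopologicalSpace M] [ChartedSpace (Fin n → ℂ) M]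
    [IsManifold 𝓘(ℂ, Fin n → ℂ) ω M] [T2Space M] [CompactSpace M] :
    ∃ f : SmoothPartitionOfUnity M 𝓘(ℝ, Fin n → ℂ) M Set.univ,
      f.IsSubordinate fun x => (chartAt (Fin n → ℂ) x).source :=
  haveI : IsManifold 𝓘(ℝ, Fin n → ℂ) ∞ M := isManifold_real
  SmoothPartitionOfUnity.exists_isSubordinate_chartAt_source 𝓘(ℝ, Fin n → ℂ) M

/-- A smooth partition of unity subordinate to the preferred charts. -/
def partition (M : Type*) [TopologicalSpace M] [ChartedSpace (Fin n → ℂ) M]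
    [IsManifold 𝓘(ℂ, Fin n → ℂ) ω M] [T2Space M] [CompactSpace M] :
    SmoothPartitionOfUnity M 𝓘(ℝ, Fin n → ℂ) M Set.univ :=
  (exists_partition M).choose

/-- The integral of a form of top degree over a compact complex manifold, with its complex
orientation. -/
def integral [IsManifold 𝓘(ℂ, Fin n → ℂ) ω M] [T2Space M] [CompactSpace M]
    (η : M → (Fin n → ℂ) [⋀^Fin (2 * n)]→L[ℝ] ℂ) : ℂ :=
  ∑ᶠ i : M, ∫ y in (chartAt (Fin n → ℂ) i).target,
    ((partition (n := n) M i ((chartAt (Fin n → ℂ) i).symm y) : ℝ) : ℂ) *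
      coordRep (chartAt (Fin n → ℂ) i) η y (stdFrame n)

/-- The Ricci form `-(i/2π) ∂∂̄ log ωⁿ`, where `ωⁿ` is evaluated on the frame of a holomorphic
chart. -/
def ricciForm (ω₂ : M → (Fin n → ℂ) [⋀^Fin 2]→L[ℝ] ℂ) : M → (Fin n → ℂ) [⋀^Fin 2]→L[ℝ] ℂ :=
  fun x => (-(1 / (2 * Real.pi)) : ℝ) • ddbar (fun y : M =>
    (Real.log (coordRep (chartAt (Fin n → ℂ) x) (fun z => wpow (ω₂ z) n (2 * n))
      (chartAt (Fin n → ℂ) x y) (stdFrame n)).re : ℂ)) x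

/-- The Laplacian of a Kähler metric, `Δ f = n (i/2π) ∂∂̄ f ∧ ωⁿ⁻¹ / ωⁿ`. This is the
normalisation for which the Ricci form of `ω + t i ∂∂̄ f` has derivative `-i ∂∂̄ Δ f` at `t = 0`. -/
def laplacian (ω₂ : M → (Fin n → ℂ) [⋀^Fin 2]→L[ℝ] ℂ) (f : M → ℂ) : M → ℂ := fun x =>
  (1 / (2 * Real.pi) : ℝ) * n *
    topRatio (wedge (ofDegree 2 (ddbar f x)) (wpow (ω₂ x) (n - 1))) (wpow (ω₂ x) n)

/-- The coefficients of a central charge: a stability vector `(ρ₀, …, ρₙ)` with `ρₙ = i` and a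
polynomial Chern form `∑ aⱼ K^j` with `a₀ = a₁ = 1`. -/
structure CentralCharge (n : ℕ) where
  stab : ℕ → ℂ
  stab_top : stab n = Complex.I
  chern : ℕ → ℂ
  chern_zero : chern 0 = 1
  chern_one : chern 1 = 1

/-- The coefficient of `Lˡ · (-K)ʲ · Θ` in `Z_ε`. -/
def CentralCharge.coeff (Z : CentralCharge n) (ε : ℝ) (l j : ℕ) : ℂ :=
  Z.stab l * ((ε⁻¹ : ℝ) : ℂ) ^ l * ((-1) ^ j * Z.chern j)

/-- The central charge `Z_ε = ∑ₗ ρₗ ε⁻ˡ ∫ Lˡ · f(K) · Θ`, computed with the representatives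
`ω ∈ c₁(L)`, `Ric ω ∈ c₁(-K)` and `θ ∈ Θ`. -/
def centralCharge [IsManifold 𝓘(ℂ, Fin n → ℂ) ω M] [T2Space M] [CompactSpace M]
    (Z : CentralCharge n) (ε : ℝ) (ω₂ : M → (Fin n → ℂ) [⋀^Fin 2]→L[ℝ] ℂ)
    (θ : M → Alt (Fin n → ℂ)) : ℂ :=
  ∑ l ∈ Finset.range (n + 1), ∑ j ∈ Finset.range (n + 1), Z.coeff ε l j *
    integral fun x => powWedge (ω₂ x) (ricciForm ω₂ x) (θ x) l j (2 * n)

/-- The function `Z̃_ε(ω)`: the sum, with the coefficients of the central charge, of the functions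
`ωˡ ∧ Ricʲ ∧ θ / ωⁿ - (j / (l + 1)) Δ (ωˡ⁺¹ ∧ Ricʲ⁻¹ ∧ θ / ωⁿ)`. -/
def zFunction (Z : CentralCharge n) (ε : ℝ) (ω₂ : M → (Fin n → ℂ) [⋀^Fin 2]→L[ℝ] ℂ)
    (θ : M → Alt (Fin n → ℂ)) : M → ℂ := fun x =>
  ∑ l ∈ Finset.range (n + 1), ∑ j ∈ Finset.range (n + 1), Z.coeff ε l j *
    (topRatio (powWedge (ω₂ x) (ricciForm ω₂ x) (θ x) l j) (wpow (ω₂ x) n) -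
      (j / (l + 1) : ℂ) * laplacian ω₂ (fun y =>
        topRatio (powWedge (ω₂ y) (ricciForm ω₂ y) (θ y) (l + 1) (j - 1)) (wpow (ω₂ y) n)) x)

end Compact

/-! ### Families -/

/-- A proper holomorphic submersion with connected fibres of dimension `n`. -/
structure Family (n : ℕ) (EX EB X B : Type*) [NormedAddCommGroup EX] [NormedSpace ℂ EX]
    [NormedAddCommGroup EB] [NormedSpace ℂ EB] [TopologicalSpace X] [ChartedSpace EX X]
    [TopologicalSpace B] [ChartedSpace EB B] where
  proj : X → B
  isSubmersion :
    Manifold.IsSubmersionOfComplement (Fin n → ℂ) 𝓘(ℂ, EX) 𝓘(ℂ, EB) ω proj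
  isProper : IsProperMap proj
  connected : ∀ b, IsConnected (proj ⁻¹' {b})

namespace Family

variable {n : ℕ} {EX EB X B : Type*} [NormedAddCommGroup EX] [NormedSpace ℂ EX]
  [NormedAddCommGroup EB] [NormedSpace ℂ EB]
  [TopologicalSpace X] [ChartedSpace EX X] [TopologicalSpace B] [ChartedSpace EB B]
  (p : Family n EX EB X B)

/-- A chart of the total space around `x` in which the projection is a linear projection. -/
def domChart (x : X) : OpenPartialHomeomorph X EX := (p.isSubmersion x).domChart

/-- The chart of the base that goes with `domChart`. -/
def codChart (x : X) : OpenPartialHomeomorph B EB := (p.isSubmersion x).codChart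

/-- The splitting of the model space that goes with `domChart` and `codChart`: the projection
reads `y ↦ (split x y).1`. -/
def split (x : X) : EX ≃L[ℂ] EB × (Fin n → ℂ) := (p.isSubmersion x).equiv

theorem codChart_proj (x : X) {z : X} (hz : z ∈ (p.domChart x).source) :
    p.codChart x (p.proj z) = (p.split x (p.domChart x z)).1 := by
  have hm : p.domChart x z ∈ ((p.domChart x).extend 𝓘(ℂ, EX)).target := by
    rw [OpenPartialHomeomorph.extend_target]
    simpa using (p.domChart x).map_source hz
  have h := (p.isSubmersion x).writtenInCharts hm
  have h2 : (p.domChart x).symm (p.domChart x z) = z := (p.domChart x).left_inv hz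
  simp only [Function.comp_apply, OpenPartialHomeomorph.extend_coe, modelWithCornersSelf_coe,
    OpenPartialHomeomorph.extend_coe_symm, modelWithCornersSelf_coe_symm, id] at h
  change p.codChart x (p.proj ((p.domChart x).symm (p.domChart x z))) = _ at h
  rwa [h2] at h

theorem proj_mem (x : X) {z : X} (hz : z ∈ (p.domChart x).source) :
    p.proj z ∈ (p.codChart x).source :=
  (p.isSubmersion x).source_subset_preimage_source hz

theorem proj_symm (x : X) {b : B} (hb : b ∈ (p.codChart x).source) {y : EX}
    (hy : y ∈ (p.domChart x).target) (h : (p.split x y).1 = p.codChart x b) :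
    p.proj ((p.domChart x).symm y) = b := by
  have hz := (p.domChart x).map_target hy
  refine (p.codChart x).injOn (p.proj_mem x hz) hb ?_
  rw [p.codChart_proj x hz, (p.domChart x).right_inv hy, h]

/-- The fibre over `b`. -/
@[ext]
structure Fiber (b : B) where
  val : X
  proj_val : p.proj val = b

/-- The inclusion of a fibre. -/
def incl (b : B) : p.Fiber b → X := Fiber.val

instance (b : B) : TopologicalSpace (p.Fiber b) := TopologicalSpace.induced Fiber.val inferInstance

theorem isEmbedding_val (b : B) : Topology.IsEmbedding (Fiber.val : p.Fiber b → X) :=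
  ⟨⟨rfl⟩, fun _ _ h => Fiber.ext h⟩

instance (b : B) [T2Space X] : T2Space (p.Fiber b) := (p.isEmbedding_val b).t2Space

instance (b : B) : CompactSpace (p.Fiber b) := by
  have hr : Set.range (Fiber.val : p.Fiber b → X) = p.proj ⁻¹' {b} :=
    Set.ext fun x => ⟨fun ⟨z, hz⟩ => hz ▸ z.proj_val, fun hx => ⟨⟨x, hx⟩, rfl⟩⟩
  refine ⟨(p.isEmbedding_val b).isCompact_iff.mpr ?_⟩
  rw [Set.image_univ, hr]
  exact p.isProper.isCompact_preimage isCompact_singleton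

/-- The point of the model space with vertical coordinates `y`, over `b`. -/
def lift {b : B} (x : p.Fiber b) (y : Fin n → ℂ) : EX :=
  (p.split x.1).symm (p.codChart x.1 b, y)

theorem mem_codChart {b : B} (x : p.Fiber b) : b ∈ (p.codChart x.1).source := by
  have := (p.isSubmersion x.1).mem_codChart_source
  rwa [x.2] at this

theorem lift_split {b : B} (x z : p.Fiber b) (hz : z.1 ∈ (p.domChart x.1).source) :
    p.lift x (p.split x.1 (p.domChart x.1 z.1)).2 = p.domChart x.1 z.1 := by
  have h := p.codChart_proj x.1 hz
  rw [z.2] at h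
  rw [lift, h]
  simp

open Classical in
/-- The point of the fibre over `b` with vertical coordinates `y` (junk outside of the chart). -/
def fiberInv {b : B} (x : p.Fiber b) (y : Fin n → ℂ) : p.Fiber b :=
  if h : p.lift x y ∈ (p.domChart x.1).target then
    ⟨(p.domChart x.1).symm (p.lift x y),
      p.proj_symm x.1 (p.mem_codChart x) h (by simp [lift])⟩
  else x

theorem fiberInv_val {b : B} (x : p.Fiber b) {y : Fin n → ℂ}
    (h : p.lift x y ∈ (p.domChart x.1).target) :
    (p.fiberInv x y).1 = (p.domChart x.1).symm (p.lift x y) := by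
  rw [fiberInv, dif_pos h]

/-- The chart of the fibre over `b` given by the vertical coordinates of `domChart x`. -/
def fiberChart {b : B} (x : p.Fiber b) : OpenPartialHomeomorph (p.Fiber b) (Fin n → ℂ) where
  toFun z := (p.split x.1 (p.domChart x.1 z.1)).2
  invFun := p.fiberInv x
  source := Fiber.val ⁻¹' (p.domChart x.1).source
  target := p.lift x ⁻¹' (p.domChart x.1).target
  map_source' := by
    intro z hz
    rw [Set.mem_preimage, p.lift_split x z hz]
    exact (p.domChart x.1).map_source hz
  map_target' := by
    intro y hy
    rw [Set.mem_preimage, p.fiberInv_val x hy]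
    exact (p.domChart x.1).map_target hy
  left_inv' := by
    intro z hz
    have h2 := (p.domChart x.1).map_source hz
    rw [← p.lift_split x z hz] at h2
    refine Fiber.ext ?_
    rw [p.fiberInv_val x h2, p.lift_split x z hz]
    exact (p.domChart x.1).left_inv hz
  right_inv' := by
    intro y hy
    rw [p.fiberInv_val x hy, (p.domChart x.1).right_inv hy]
    simp [lift]
  open_source := (p.domChart x.1).open_source.preimage (p.isEmbedding_val b).continuous
  open_target := (p.domChart x.1).open_target.preimage (by unfold lift; fun_prop)
  continuousOn_toFun := by
    have h1 : ContinuousOn (fun z : p.Fiber b => p.domChart x.1 z.1)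
        (Fiber.val ⁻¹' (p.domChart x.1).source) :=
      (p.domChart x.1).continuousOn.comp (p.isEmbedding_val b).continuous.continuousOn
        fun z hz => hz
    exact (continuous_snd.comp (p.split x.1).continuous).comp_continuousOn h1
  continuousOn_invFun := by
    refine (p.isEmbedding_val b).continuousOn_iff.mpr ?_
    have h1 : ContinuousOn (fun y : Fin n → ℂ => (p.domChart x.1).symm (p.lift x y))
        (p.lift x ⁻¹' (p.domChart x.1).target) :=
      (p.domChart x.1).continuousOn_symm.comp (by unfold lift; fun_prop) fun y hy => hy
    exact h1.congr fun y hy => p.fiberInv_val x hy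

instance (b : B) : ChartedSpace (Fin n → ℂ) (p.Fiber b) where
  atlas := Set.range fun x : p.Fiber b => p.fiberChart x
  chartAt x := p.fiberChart x
  mem_chart_source x := (p.isSubmersion x.1).mem_domChart_source
  chart_mem_atlas x := ⟨x, rfl⟩

instance (b : B) [IsManifold 𝓘(ℂ, EX) ω X] : IsManifold 𝓘(ℂ, Fin n → ℂ) ω (p.Fiber b) := by
  refine isManifold_of_contDiffOn _ _ _ ?_
  rintro _ _ ⟨x, rfl⟩ ⟨x', rfl⟩
  have hg := (contDiffGroupoid ω 𝓘(ℂ, EX)).compatible_of_mem_maximalAtlas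
    (p.isSubmersion x.1).domChart_mem_maximalAtlas (p.isSubmersion x'.1).domChart_mem_maximalAtlas
  rw [contDiffGroupoid, mem_groupoid_of_pregroupoid] at hg
  have h1 := hg.1
  simp only [contDiffPregroupoid, modelWithCornersSelf_coe, modelWithCornersSelf_coe_symm,
    Function.id_comp, Function.comp_id, Set.preimage_id, Set.range_id, Set.inter_univ] at h1
  simp only [modelWithCornersSelf_coe, modelWithCornersSelf_coe_symm,
    Function.id_comp, Function.comp_id, Set.preimage_id, Set.range_id, Set.inter_univ]
  have h2 : ContDiff ℂ ω (p.lift x) := by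
    unfold lift
    fun_prop
  have h3 : ContDiff ℂ ω fun y : EX => (p.split x'.1 y).2 := by fun_prop
  have key : ∀ y ∈ ((p.fiberChart x).symm.trans (p.fiberChart x')).source,
      p.lift x y ∈ (p.domChart x.1).target ∧
      (p.domChart x.1).symm (p.lift x y) ∈ (p.domChart x'.1).source := by
    rintro y ⟨hy1, hy2⟩
    have hy1' : p.lift x y ∈ (p.domChart x.1).target := hy1
    have : (p.fiberInv x y).1 ∈ (p.domChart x'.1).source := hy2
    exact ⟨hy1', p.fiberInv_val x hy1' ▸ this⟩
  refine ((h3.comp_contDiffOn h1).comp h2.contDiffOn (fun y hy => key y hy)).congr fun y hy => ?_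
  change (p.split x'.1 (p.domChart x'.1 (p.fiberInv x y).1)).2 = _
  rw [p.fiberInv_val x (key y hy).1]
  rfl

/-- The restriction of a form on the total space to a fibre. -/
def restrict (b : B) {k : ℕ} (η : X → EX [⋀^Fin k]→L[ℝ] ℂ) :
    p.Fiber b → (Fin n → ℂ) [⋀^Fin k]→L[ℝ] ℂ := pullback (p.incl b) η

/-- The restriction of an inhomogeneous form on the total space to a fibre. -/
def restrictAlt (b : B) (θ : X → Alt EX) : p.Fiber b → Alt (Fin n → ℂ) :=
  fun x k => p.restrict b (fun z => θ z k) x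

/-- The vertical coordinate frame `∂/∂y₁, i ∂/∂y₁, …, ∂/∂yₙ, i ∂/∂yₙ` of `domChart x`. -/
def verticalFrame (x z : X) : Fin (2 * n) → EX := fun k =>
  (mfderiv 𝓘(ℝ, EX) 𝓘(ℝ, EX) (p.domChart x).symm (p.domChart x z) : EX →L[ℝ] EX)
    ((p.split x).symm (0, stdFrame n k))

/-- The curvature form of the metric on the relative anticanonical bundle that is induced by a
relatively Kähler metric: `-(i/2π) ∂∂̄ log` of the squared norm of `∂/∂y₁ ∧ ⋯ ∧ ∂/∂yₙ`, which is
a constant multiple of the value of `ωⁿ` on the vertical coordinate frame. -/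
def relativeCurvature (ω₂ : X → EX [⋀^Fin 2]→L[ℝ] ℂ) : X → EX [⋀^Fin 2]→L[ℝ] ℂ := fun x =>
  (-(1 / (2 * Real.pi)) : ℝ) •
    ddbar (fun z : X => (Real.log (wpow (ω₂ z) n (2 * n) (p.verticalFrame x z)).re : ℂ)) x

/-- Relatively Kähler metrics: closed real `(1,1)`-forms which are positive on the fibres. -/
structure IsRelativelyKahler (ω₂ : X → EX [⋀^Fin 2]→L[ℝ] ℂ) : Prop where
  smooth : SmoothForm ω₂
  closed : ∀ x, dForm ω₂ x = 0
  real : RealForm ω₂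
  type : BalancedType ω₂
  pos : ∀ (x : X) (u : EX), (mfderiv 𝓘(ℝ, EX) 𝓘(ℝ, EB) p.proj x : EX →L[ℝ] EB) u = 0 → u ≠ 0 →
    0 < (ω₂ x ![u, Complex.I • u]).re

/-- Some tangent vector at `x` that is mapped to `u` by the differential of the projection. -/
def tangentLift (x : X) (u : EB) : EX :=
  Classical.epsilon fun w : EX => (mfderiv 𝓘(ℝ, EX) 𝓘(ℝ, EB) p.proj x : EX →L[ℝ] EB) w = u

/-- The fibre integral of the part of degree `2n + 2` of a form on the total space, evaluated on
the tangent vectors `u, w` of the base at `b`: lift `u` and `w` to the total space along the fibre,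
contract with the lifts, restrict to the fibre, and integrate. -/
def fibreIntegral (Ξ : X → Alt EX) (b : B) [IsManifold 𝓘(ℂ, EX) ω X] [T2Space X] (u w : EB) : ℂ :=
  integral fun x : p.Fiber b =>
    (((Ξ x.1 (2 * n + 2)).curryLeft (p.tangentLift x.1 u)).curryLeft
      (p.tangentLift x.1 w)).compContinuousLinearMap
        (mfderiv 𝓘(ℝ, Fin n → ℂ) 𝓘(ℝ, EX) (p.incl b) x : (Fin n → ℂ) →L[ℝ] EX)

/-- The form `Z̃_ε(𝒳, ℒ)` on the total space: the sum, with the coefficients of the central charge,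
of the forms `ωˡ⁺¹ ∧ ρʲ ∧ θ / (l + 1)`, where `ρ` is the relative curvature. -/
def zForm (Z : CentralCharge n) (ε : ℝ) (ω₂ : X → EX [⋀^Fin 2]→L[ℝ] ℂ) (θ : X → Alt EX) :
    X → Alt EX := fun x =>
  ∑ l ∈ Finset.range (n + 1), ∑ j ∈ Finset.range (n + 1), (Z.coeff ε l j * (1 / (l + 1) : ℂ)) •
    powWedge (ω₂ x) (p.relativeCurvature ω₂ x) (θ x) (l + 1) j

section

variable [IsManifold 𝓘(ℂ, EX) ω X] [T2Space X]

/-- The central charge of the fibre over `b`. -/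
def fibreCharge (Z : CentralCharge n) (ε : ℝ) (ω₂ : X → EX [⋀^Fin 2]→L[ℝ] ℂ) (θ : X → Alt EX)
    (b : B) : ℂ :=
  centralCharge Z ε (p.restrict b ω₂) (p.restrictAlt b θ)

/-- The form `Ω_ε = Im (e^{-iφ} ∫_{𝒳/B} Z̃_ε(𝒳, ℒ))` on the base, for the phase `φ`. -/
def momentForm (Z : CentralCharge n) (ε φ : ℝ) (ω₂ : X → EX [⋀^Fin 2]→L[ℝ] ℂ) (θ : X → Alt EX)
    (b : B) (u w : EB) : ℝ :=
  (Complex.exp (-(Complex.I * φ)) * p.fibreIntegral (p.zForm Z ε ω₂ θ) b u w).im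

/-- `-½ ∫_{𝒳_b} h Im (e^{-iφ} Z̃_ε(ω_b)) ω_bⁿ`, for the phase `φ`. -/
def momentPairing (Z : CentralCharge n) (ε φ : ℝ) (ω₂ : X → EX [⋀^Fin 2]→L[ℝ] ℂ) (θ : X → Alt EX)
    (h : X → ℝ) (b : B) : ℝ :=
  -(1 / 2) * (integral fun x : p.Fiber b =>
    ((h x.1 * (Complex.exp (-(Complex.I * φ)) *
      zFunction Z ε (p.restrict b ω₂) (p.restrictAlt b θ) x).im : ℝ) : ℂ) •
        wpow (p.restrict b ω₂ x) n (2 * n)).re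

end

end Family

/-! ### Holomorphic line bundles -/

section LineBundle

open Bundle (TotalSpace)

variable {E : Type*} [NormedAddCommGroup E] [NormedSpace ℂ E]
  {M : Type*} [TopologicalSpace M] [ChartedSpace E M]
  (N : M → Type*) [∀ x, AddCommGroup (N x)] [∀ x, Module ℂ (N x)] [∀ x, TopologicalSpace (N x)]
  [TopologicalSpace (TotalSpace ℂ N)] [FiberBundle ℂ N] [VectorBundle ℂ ℂ N]

/-- Smooth Hermitian metrics on a line bundle, through their squared norm. -/
structure HermitianMetric where
  normSq : TotalSpace ℂ N → ℝ
  smooth : ContMDiff (𝓘(ℝ, E).prod 𝓘(ℝ, ℂ)) 𝓘(ℝ, ℝ) ∞ normSq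
  homogeneous : ∀ (x : M) (c : ℂ) (e : N x), normSq ⟨x, c • e⟩ = ‖c‖ ^ 2 * normSq ⟨x, e⟩
  pos : ∀ (x : M) (e : N x), e ≠ 0 → 0 < normSq ⟨x, e⟩

/-- The curvature form `-(i/2π) ∂∂̄ log |s|²` of a Hermitian metric, for the local holomorphic
frame `s` given by a trivialisation. -/
def HermitianMetric.curvature {N : M → Type*} [∀ x, AddCommGroup (N x)] [∀ x, Module ℂ (N x)]
    [∀ x, TopologicalSpace (N x)] [TopologicalSpace (TotalSpace ℂ N)] [FiberBundle ℂ N]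
    [VectorBundle ℂ ℂ N] (H : HermitianMetric (E := E) N) : M → E [⋀^Fin 2]→L[ℝ] ℂ := fun x =>
  (-(1 / (2 * Real.pi)) : ℝ) • ddbar (fun y : M =>
    (Real.log (H.normSq ⟨y, (trivializationAt ℂ N x).symm y (1 : ℂ)⟩) : ℂ)) x

/-- `ω₂ ∈ c₁(L)` for the `ℚ`-line bundle `L = (1/r) N`: the form `r ω₂` differs from the
curvature form of a Hermitian metric on `N` by the differential of a real `1`-form. -/
def RepresentsFirstChern (r : ℕ) (ω₂ : M → E [⋀^Fin 2]→L[ℝ] ℂ) : Prop :=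
  ∃ (H : HermitianMetric (E := E) N) (γ : M → E [⋀^Fin 1]→L[ℝ] ℂ), SmoothForm γ ∧ RealForm γ ∧
    ∀ x, (r : ℝ) • ω₂ x = H.curvature x + dForm γ x

end LineBundle

/-! ### Actions of a Lie group -/

section Actions

open Bundle (TotalSpace)

variable (EK : Type*) [NormedAddCommGroup EK] [NormedSpace ℝ EK]
  (K : Type*) [Group K] [TopologicalSpace K] [ChartedSpace EK K]
  {E : Type*} [NormedAddCommGroup E] [NormedSpace ℂ E]

/-- Smooth actions of a Lie group by biholomorphisms of a complex manifold. -/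
structure IsHolomorphicAction (E M : Type*) [NormedAddCommGroup E] [NormedSpace ℂ E]
    [TopologicalSpace M] [ChartedSpace E M] [MulAction K M] : Prop where
  smooth : ContMDiff (𝓘(ℝ, EK).prod 𝓘(ℝ, E)) 𝓘(ℝ, E) ∞ fun q : K × M => q.1 • q.2
  holomorphic : ∀ k : K, ContMDiff 𝓘(ℂ, E) 𝓘(ℂ, E) ω fun x : M => k • x

variable {M : Type*} [TopologicalSpace M] [ChartedSpace E M] [MulAction K M]

/-- Lifts of an action to a holomorphic line bundle: smooth actions on the total space by
biholomorphisms which map fibres linearly to fibres. -/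
structure IsLinearisation (N : M → Type*) [∀ x, AddCommGroup (N x)] [∀ x, Module ℂ (N x)]
    [∀ x, TopologicalSpace (N x)] [TopologicalSpace (TotalSpace ℂ N)] [FiberBundle ℂ N]
    [MulAction K (TotalSpace ℂ N)] : Prop where
  smooth : ContMDiff (𝓘(ℝ, EK).prod (𝓘(ℝ, E).prod 𝓘(ℝ, ℂ))) (𝓘(ℝ, E).prod 𝓘(ℝ, ℂ)) ∞
    fun q : K × TotalSpace ℂ N => q.1 • q.2
  holomorphic : ∀ k : K, ContMDiff (𝓘(ℂ, E).prod 𝓘(ℂ, ℂ)) (𝓘(ℂ, E).prod 𝓘(ℂ, ℂ)) ω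
    fun q : TotalSpace ℂ N => k • q
  linear : ∀ (k : K) (x : M), ∃ A : N x →ₗ[ℂ] N (k • x),
    ∀ e : N x, k • (⟨x, e⟩ : TotalSpace ℂ N) = ⟨k • x, A e⟩

/-- Invariant forms. -/
def InvariantForm {k : ℕ} (η : M → E [⋀^Fin k]→L[ℝ] ℂ) : Prop :=
  ∀ g : K, pullback (fun x : M => g • x) η = η

variable {EK K}

/-- The vector field on `M` induced by `v` in the Lie algebra: its value at `x` is the derivative
of `k ↦ k • x` at the identity in the direction `v`. -/
def inducedField (v : GroupLieAlgebra 𝓘(ℝ, EK) K) (x : M) : E :=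
  (mfderiv 𝓘(ℝ, EK) 𝓘(ℝ, E) (fun k : K => k • x) 1 : EK →L[ℝ] E) v

/-- The adjoint action on the Lie algebra. -/
def adjoint (k : K) (v : GroupLieAlgebra 𝓘(ℝ, EK) K) : GroupLieAlgebra 𝓘(ℝ, EK) K :=
  (mfderiv 𝓘(ℝ, EK) 𝓘(ℝ, EK) (fun g : K => k * g * k⁻¹) 1 : EK →L[ℝ] EK) v

variable (EK K) in
/-- One step along the local action of the complexification of `K`: apply an element of `K`, or
follow for time one an integral curve of the field `v + J w` induced by an element `v + i w` of the
complexified Lie algebra. -/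
def LocalStep (b b' : M) : Prop :=
  (∃ k : K, b' = k • b) ∨
  ∃ (v w : GroupLieAlgebra 𝓘(ℝ, EK) K) (γ : ℝ → M),
    IsMIntegralCurveOn (I := 𝓘(ℝ, E)) γ
      (fun x => (inducedField v x + Complex.I • inducedField w x : E)) (Set.Icc 0 1) ∧
    γ 0 = b ∧ γ 1 = b'

variable (EK K E) in
/-- The orbit of `b` under the local action of the complexification of `K`. -/
def localOrbit (b : M) : Set M := {b' | Relation.ReflTransGen (LocalStep (E := E) EK K) b b'}

/-- `h` is a Hamiltonian for `v`: `L_{Jv} ω₂ = i ∂∂̄ h`, where `v` is viewed as a vector field. -/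
structure IsHamiltonian (ω₂ : M → E [⋀^Fin 2]→L[ℝ] ℂ) (v : GroupLieAlgebra 𝓘(ℝ, EK) K)
    (h : M → ℝ) : Prop where
  smooth : ContMDiff 𝓘(ℝ, E) 𝓘(ℝ, ℝ) ∞ h
  eq : ∀ x, lieDeriv (fun x => (Complex.I • inducedField v x : E)) ω₂ x =
    ddbar (fun x => (h x : ℂ)) x

/-- `μ : M → 𝔨*` is a moment map with respect to the form `Ω`: it is smooth, satisfies
`d⟨μ, v⟩ = -ι_v Ω` for all `v ∈ 𝔨`, and is equivariant for the coadjoint action. -/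
structure IsMomentMap (Ω : M → E → E → ℝ)
    (μ : M → Module.Dual ℝ (GroupLieAlgebra 𝓘(ℝ, EK) K)) : Prop where
  smooth : ∀ v, ContMDiff 𝓘(ℝ, E) 𝓘(ℝ, ℝ) ∞ fun b => μ b v
  deriv : ∀ v b u, (mfderiv 𝓘(ℝ, E) 𝓘(ℝ, ℝ) (fun b => μ b v) b : E →L[ℝ] ℝ) u =
    -Ω b (inducedField v b) u
  equivariant : ∀ (k : K) b v, μ (k • b) (adjoint k v) = μ b v

end Actions

/-- Closed forms representing a unipotent class: forms `θ = 1 + θ'`, of type `⊕ₚ (p,p)`, where `θ'`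
has positive degree. -/
structure IsUnipotentForm {E M : Type*} [NormedAddCommGroup E] [NormedSpace ℂ E]
    [TopologicalSpace M] [ChartedSpace E M] (θ : M → Alt E) : Prop where
  smooth : ∀ k, SmoothForm fun x => θ x k
  closed : ∀ k x, dForm (fun x => θ x k) x = 0
  type : ∀ k, BalancedType fun x => θ x k
  unipotent : ∀ x, θ x 0 = ContinuousAlternatingMap.constOfIsEmpty ℝ E (Fin 0) (1 : ℂ)

/-- Over the set `B₀` of the base, `θ` is obtained by moving its restriction to a fibre with the
action of the complexification `G` of `K`, that is, the pull-back of `θ` under the action map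
`G × 𝒳_b → 𝒳` is the pull-back of its restriction to `𝒳_b` under the projection `G × 𝒳_b → 𝒳_b`:
`θ` is invariant, and its contraction with all vector fields induced by the Lie algebra of `G`
vanishes. -/
structure Family.IsTransported {n : ℕ} {EX EB X B : Type*} [NormedAddCommGroup EX]
    [NormedSpace ℂ EX] [NormedAddCommGroup EB] [NormedSpace ℂ EB]
    [TopologicalSpace X] [ChartedSpace EX X] [TopologicalSpace B] [ChartedSpace EB B]
    (p : Family n EX EB X B) (EK K : Type*) [NormedAddCommGroup EK] [NormedSpace ℝ EK]
    [Group K] [TopologicalSpace K] [ChartedSpace EK K] [MulAction K X] (B₀ : Set B)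
    (θ : X → Alt EX) : Prop where
  invariant : ∀ k, InvariantForm K fun x => θ x k
  horizontal : ∀ x, p.proj x ∈ B₀ → ∀ (v : GroupLieAlgebra 𝓘(ℝ, EK) K) (k : ℕ),
    (θ x (k + 1)).curryLeft (inducedField v x) = 0 ∧
      (θ x (k + 1)).curryLeft (Complex.I • inducedField v x) = 0

end ZMoment

end

set_option maxSynthPendingDepth 3
set_option linter.unusedSectionVars false

noncomputable section

namespace ZMoment

section WedgeAlgebra

theorem sum_perm_cons {E : Type*} {m : ℕ} (G : (Fin (m + 1) → E) → ℂ) (x : E) (w : Fin m → E) :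
    ∑ σ : Equiv.Perm (Fin (m + 1)), (Equiv.Perm.sign σ : ℤ) •
        G ((Fin.cons x w : Fin (m + 1) → E) ∘ σ) =
      ∑ p : Fin (m + 1), (-1 : ℂ) ^ p.1 * ∑ σ : Equiv.Perm (Fin m), (Equiv.Perm.sign σ : ℤ) •
        G (p.insertNth x (w ∘ σ)) := by
  let F : Fin (m + 1) × Equiv.Perm (Fin m) → Equiv.Perm (Fin (m + 1)) := fun q =>
    Equiv.Perm.decomposeFin.symm (0, q.2) * Fin.cycleRange q.1
  have hF0 : ∀ q, F q q.1 = 0 := fun q => by simp [F]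
  have hinj : Function.Injective F := by
    rintro ⟨p, σ⟩ ⟨p', σ'⟩ h
    have hp : p = p' := by
      refine (F (p', σ')).injective ?_
      rw [hF0 (p', σ'), ← h, hF0 (p, σ)]
    subst hp
    have h2 := mul_right_cancel h
    have h3 := Equiv.Perm.decomposeFin.symm.injective h2
    simpa using h3
  have hbij : Function.Bijective F := by
    rw [Fintype.bijective_iff_injective_and_card]
    refine ⟨hinj, ?_⟩
    rw [Fintype.card_prod, Fintype.card_perm, Fintype.card_perm, Fintype.card_fin,
      Fintype.card_fin, Nat.factorial_succ]
  rw [← hbij.sum_comp, Fintype.sum_prod_type]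
  refine Finset.sum_congr rfl fun p _ => ?_
  rw [Finset.mul_sum]
  refine Finset.sum_congr rfl fun σ _ => ?_
  have hs : (Equiv.Perm.sign (F (p, σ)) : ℤ) = (-1) ^ p.1 * (Equiv.Perm.sign σ : ℤ) := by
    simp [F, Fin.sign_cycleRange, mul_comm]
  have hf : ((Fin.cons x w : Fin (m + 1) → E) ∘ F (p, σ)) = p.insertNth x (w ∘ σ) := by
    funext i
    induction i using p.succAboveCases with
    | x => simp [F]
    | p i => simp [F]
  rw [hs, hf]
  simp [mul_assoc]

variable {E : Type*} [NormedAddCommGroup E] [NormedSpace ℂ E]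

theorem wedgeHom_apply {a b k : ℕ} (h : a + b = k) (α : E [⋀^Fin a]→L[ℝ] ℂ)
    (β : E [⋀^Fin b]→L[ℝ] ℂ) (v : Fin k → E) :
    ((a.factorial * b.factorial : ℕ) : ℂ) * wedgeHom h α β v =
      ∑ σ : Equiv.Perm (Fin k), (Equiv.Perm.sign σ : ℤ) •
        (α (fun i => (v ∘ σ) (Fin.cast h (Fin.castAdd b i))) *
          β (fun i => (v ∘ σ) (Fin.cast h (Fin.natAdd a i)))) := by
  have key := MultilinearMap.domCoprod_alternization_eq α.toAlternatingMap β.toAlternatingMap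
  let e := finSumFinEquiv.trans (finCongr h)
  have key2 := congrArg (fun F => LinearMap.mul' ℝ ℂ (F (v ∘ e))) key
  have hL : LinearMap.mul' ℝ ℂ (((Fintype.card (Fin a)).factorial * (Fintype.card (Fin b)).factorial) •
      (α.toAlternatingMap.domCoprod β.toAlternatingMap) (v ∘ e)) =
      ((a.factorial * b.factorial : ℕ) : ℂ) * wedgeHom h α β v := by
    rw [map_nsmul, nsmul_eq_mul, Fintype.card_fin, Fintype.card_fin]
    rfl
  refine hL.symm.trans (key2.symm.trans ?_)
  simp only [MultilinearMap.alternatization_apply, map_sum]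
  refine Fintype.sum_equiv e.permCongr _ _ fun σ => ?_
  rw [Equiv.Perm.sign_permCongr]
  change LinearMap.mul' ℝ ℂ ((Equiv.Perm.sign σ : ℤ) •
    (α (fun i => v (e (σ (Sum.inl i)))) ⊗ₜ[ℝ] β (fun i => v (e (σ (Sum.inr i)))))) = _
  rw [map_zsmul]
  have h1 : ∀ i : Fin a, Fin.cast h (Fin.castAdd b i) = e (Sum.inl i) := fun i => rfl
  have h2 : ∀ i : Fin b, Fin.cast h (Fin.natAdd a i) = e (Sum.inr i) := fun i => rfl
  simp [h1, h2, Equiv.permCongr_apply]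

/-- `wedgeHom`, extended by zero to all degrees. -/
def wedgeDeg (k : ℕ) {a b : ℕ} (α : E [⋀^Fin a]→L[ℝ] ℂ) (β : E [⋀^Fin b]→L[ℝ] ℂ) :
    E [⋀^Fin k]→L[ℝ] ℂ :=
  if h : a + b = k then wedgeHom h α β else 0

theorem wedge_apply (α β : Alt E) (k : ℕ) :
    wedge α β k = ∑ p ∈ Finset.HasAntidiagonal.antidiagonal k, wedgeDeg k (α p.1) (β p.2) := by
  rw [wedge, ← Finset.sum_coe_sort (Finset.HasAntidiagonal.antidiagonal k)]
  refine Finset.sum_congr rfl fun p _ => ?_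
  rw [wedgeDeg, dif_pos (Finset.HasAntidiagonal.mem_antidiagonal.mp p.2)]

theorem insertNth_castAdd {a b k : ℕ} (h : a + 1 + b = k + 1) (h' : a + b = k) (i : Fin (a + 1))
    (x : E) (y : Fin k → E) :
    (fun i' => (Fin.insertNth (Fin.cast h (Fin.castAdd b i)) x y : Fin (k + 1) → E)
        (Fin.cast h (Fin.castAdd b i'))) =
      i.insertNth x (fun i' => y (Fin.cast h' (Fin.castAdd b i'))) ∧
    (fun j => (Fin.insertNth (Fin.cast h (Fin.castAdd b i)) x y : Fin (k + 1) → E)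
        (Fin.cast h (Fin.natAdd (a + 1) j))) =
      (fun j => y (Fin.cast h' (Fin.natAdd a j))) := by
  constructor
  · funext i'
    induction i' using i.succAboveCases with
    | x => simp
    | p i' =>
      have : Fin.cast h (Fin.castAdd b (i.succAbove i')) =
          (Fin.cast h (Fin.castAdd b i)).succAbove (Fin.cast h' (Fin.castAdd b i')) := by
        ext; simp only [Fin.succAbove, Fin.lt_def]; simp; split_ifs <;> simp
      rw [this]; simp
  · funext j
    have : Fin.cast h (Fin.natAdd (a + 1) j) =
        (Fin.cast h (Fin.castAdd b i)).succAbove (Fin.cast h' (Fin.natAdd a j)) := by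
      ext; simp only [Fin.succAbove, Fin.lt_def]; simp; split_ifs <;> simp <;> omega
    rw [this]; simp

theorem insertNth_natAdd {a b k : ℕ} (h : a + (b + 1) = k + 1) (h' : a + b = k) (i : Fin (b + 1))
    (x : E) (y : Fin k → E) :
    (fun i' => (Fin.insertNth (Fin.cast h (Fin.natAdd a i)) x y : Fin (k + 1) → E)
        (Fin.cast h (Fin.natAdd a i'))) =
      i.insertNth x (fun i' => y (Fin.cast h' (Fin.natAdd a i'))) ∧
    (fun j => (Fin.insertNth (Fin.cast h (Fin.natAdd a i)) x y : Fin (k + 1) → E)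
        (Fin.cast h (Fin.castAdd (b + 1) j))) =
      (fun j => y (Fin.cast h' (Fin.castAdd b j))) := by
  constructor
  · funext i'
    induction i' using i.succAboveCases with
    | x => simp
    | p i' =>
      have : Fin.cast h (Fin.natAdd a (i.succAbove i')) =
          (Fin.cast h (Fin.natAdd a i)).succAbove (Fin.cast h' (Fin.natAdd a i')) := by
        ext; simp only [Fin.succAbove, Fin.lt_def]; simp; split_ifs <;> simp <;> omega
      rw [this]; simp
  · funext j
    have : Fin.cast h (Fin.castAdd (b + 1) j) =
        (Fin.cast h (Fin.natAdd a i)).succAbove (Fin.cast h' (Fin.castAdd b j)) := by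
      ext; simp only [Fin.succAbove, Fin.lt_def]; simp; split_ifs <;> simp <;> omega
    rw [this]; simp

theorem neg_one_pow_mul_insertNth {a : ℕ} (α : E [⋀^Fin (a + 1)]→L[ℝ] ℂ) (i : Fin (a + 1))
    (x : E) (y : Fin a → E) :
    (-1 : ℂ) ^ i.1 * α (i.insertNth x y) = α.curryLeft x y := by
  have := α.neg_one_pow_smul_map_insertNth i x y
  rw [ContinuousAlternatingMap.curryLeft_apply_apply, ← this]
  simp

/-- The part of the contraction of `α ∧ β` where the vector is inserted into `α`. -/
def contractLeft (x : E) : {a : ℕ} → (k : ℕ) → {b : ℕ} → (E [⋀^Fin a]→L[ℝ] ℂ) →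
    (E [⋀^Fin b]→L[ℝ] ℂ) → E [⋀^Fin k]→L[ℝ] ℂ
  | 0, _, _, _, _ => 0
  | _ + 1, k, _, α, β => wedgeDeg k (α.curryLeft x) β

/-- The part of the contraction of `α ∧ β` where the vector is inserted into `β`. -/
def contractRight (x : E) : {b : ℕ} → (k : ℕ) → {a : ℕ} → (E [⋀^Fin a]→L[ℝ] ℂ) →
    (E [⋀^Fin b]→L[ℝ] ℂ) → E [⋀^Fin k]→L[ℝ] ℂ
  | 0, _, _, _, _ => 0
  | _ + 1, k, a, α, β => (-1 : ℂ) ^ a • wedgeDeg k α (β.curryLeft x)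

theorem contractLeft_eq (x : E) {a b k : ℕ} (h : a + b = k + 1) (α : E [⋀^Fin a]→L[ℝ] ℂ)
    (β : E [⋀^Fin b]→L[ℝ] ℂ) (w : Fin k → E) :
    ∑ i : Fin a, (-1 : ℂ) ^ i.1 * ∑ σ : Equiv.Perm (Fin k), (Equiv.Perm.sign σ : ℤ) •
      (α (fun i' => (Fin.insertNth (Fin.cast h (Fin.castAdd b i)) x (w ∘ σ) : Fin (k + 1) → E)
        (Fin.cast h (Fin.castAdd b i'))) *
       β (fun i' => (Fin.insertNth (Fin.cast h (Fin.castAdd b i)) x (w ∘ σ) : Fin (k + 1) → E)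
        (Fin.cast h (Fin.natAdd a i')))) =
      ((a.factorial * b.factorial : ℕ) : ℂ) * contractLeft x k α β w := by
  cases a with
  | zero => simp [contractLeft]
  | succ a =>
    have h' : a + b = k := by omega
    have : ∀ i : Fin (a + 1), (-1 : ℂ) ^ i.1 * ∑ σ : Equiv.Perm (Fin k),
        (Equiv.Perm.sign σ : ℤ) •
      (α (fun i' => (Fin.insertNth (Fin.cast h (Fin.castAdd b i)) x (w ∘ σ) : Fin (k + 1) → E)
        (Fin.cast h (Fin.castAdd b i'))) *
       β (fun i' => (Fin.insertNth (Fin.cast h (Fin.castAdd b i)) x (w ∘ σ) : Fin (k + 1) → E)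
        (Fin.cast h (Fin.natAdd (a + 1) i')))) =
        ((a.factorial * b.factorial : ℕ) : ℂ) * wedgeHom h' (α.curryLeft x) β w := by
      intro i
      rw [wedgeHom_apply, Finset.mul_sum]
      refine Finset.sum_congr rfl fun σ _ => ?_
      obtain ⟨e1, e2⟩ := insertNth_castAdd h h' i x (w ∘ σ)
      rw [e1, e2, ← neg_one_pow_mul_insertNth α i, zsmul_eq_mul, zsmul_eq_mul]
      ring
    rw [Finset.sum_congr rfl fun i _ => this i]
    simp only [contractLeft, wedgeDeg, dif_pos h', Nat.factorial_succ]
    simp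
    ring

theorem contractRight_eq (x : E) {a b k : ℕ} (h : a + b = k + 1) (α : E [⋀^Fin a]→L[ℝ] ℂ)
    (β : E [⋀^Fin b]→L[ℝ] ℂ) (w : Fin k → E) :
    ∑ i : Fin b, (-1 : ℂ) ^ (a + i.1) * ∑ σ : Equiv.Perm (Fin k), (Equiv.Perm.sign σ : ℤ) •
      (α (fun i' => (Fin.insertNth (Fin.cast h (Fin.natAdd a i)) x (w ∘ σ) : Fin (k + 1) → E)
        (Fin.cast h (Fin.castAdd b i'))) *
       β (fun i' => (Fin.insertNth (Fin.cast h (Fin.natAdd a i)) x (w ∘ σ) : Fin (k + 1) → E)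
        (Fin.cast h (Fin.natAdd a i')))) =
      ((a.factorial * b.factorial : ℕ) : ℂ) * contractRight x k α β w := by
  cases b with
  | zero => simp [contractRight]
  | succ b =>
    have h' : a + b = k := by omega
    have : ∀ i : Fin (b + 1), (-1 : ℂ) ^ (a + i.1) * ∑ σ : Equiv.Perm (Fin k),
        (Equiv.Perm.sign σ : ℤ) •
      (α (fun i' => (Fin.insertNth (Fin.cast h (Fin.natAdd a i)) x (w ∘ σ) : Fin (k + 1) → E)
        (Fin.cast h (Fin.castAdd (b + 1) i'))) *
       β (fun i' => (Fin.insertNth (Fin.cast h (Fin.natAdd a i)) x (w ∘ σ) : Fin (k + 1) → E)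
        (Fin.cast h (Fin.natAdd a i')))) =
        (-1) ^ a * (((a.factorial * b.factorial : ℕ) : ℂ) * wedgeHom h' α (β.curryLeft x) w) := by
      intro i
      rw [wedgeHom_apply, Finset.mul_sum, Finset.mul_sum]
      refine Finset.sum_congr rfl fun σ _ => ?_
      obtain ⟨e1, e2⟩ := insertNth_natAdd h h' i x (w ∘ σ)
      rw [e1, e2, ← neg_one_pow_mul_insertNth β i, zsmul_eq_mul, zsmul_eq_mul, pow_add]
      ring
    rw [Finset.sum_congr rfl fun i _ => this i]
    simp only [contractRight, wedgeDeg, dif_pos h', Nat.factorial_succ]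
    simp
    ring

theorem curryLeft_wedgeHom {a b k : ℕ} (h : a + b = k + 1) (α : E [⋀^Fin a]→L[ℝ] ℂ)
    (β : E [⋀^Fin b]→L[ℝ] ℂ) (x : E) :
    (wedgeHom h α β).curryLeft x = contractLeft x k α β + contractRight x k α β := by
  ext w
  have hne : ((a.factorial * b.factorial : ℕ) : ℂ) ≠ 0 := by
    exact_mod_cast mul_ne_zero a.factorial_ne_zero b.factorial_ne_zero
  refine mul_left_cancel₀ hne ?_
  rw [ContinuousAlternatingMap.curryLeft_apply_apply, wedgeHom_apply]
  have h1 := sum_perm_cons (fun u : Fin (k + 1) → E => α (fun i => u (Fin.cast h (Fin.castAdd b i))) *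
    β (fun i => u (Fin.cast h (Fin.natAdd a i)))) x w
  refine h1.trans ?_
  rw [← Equiv.sum_comp (finSumFinEquiv.trans (finCongr h)), Fintype.sum_sum_type,
    ContinuousAlternatingMap.add_apply, mul_add, ← contractLeft_eq x h, ← contractRight_eq x h]
  rfl

/-- The contraction of an inhomogeneous form with a vector. -/
def iota (x : E) (α : Alt E) : Alt E := fun k => (α (k + 1)).curryLeft x

/-- The sign involution on inhomogeneous forms. -/
def signAlt (α : Alt E) : Alt E := fun k => (-1 : ℂ) ^ k • α k

theorem iota_wedge (x : E) (α β : Alt E) :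
    iota x (wedge α β) = wedge (iota x α) β + wedge (signAlt α) (iota x β) := by
  funext k
  have hc : ∀ s : Finset (ℕ × ℕ), ∀ F : ℕ × ℕ → E [⋀^Fin (k + 1)]→L[ℝ] ℂ,
      (∑ p ∈ s, F p).curryLeft x = ∑ p ∈ s, (F p).curryLeft x := by
    intro s F
    ext w
    simp [ContinuousAlternatingMap.sum_apply]
  have h1 : iota x (wedge α β) k = ∑ p ∈ Finset.HasAntidiagonal.antidiagonal (k + 1),
      (contractLeft x k (α p.1) (β p.2) + contractRight x k (α p.1) (β p.2)) := by
    rw [iota, wedge_apply, hc]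
    refine Finset.sum_congr rfl fun p hp => ?_
    rw [wedgeDeg, dif_pos (Finset.HasAntidiagonal.mem_antidiagonal.mp hp), curryLeft_wedgeHom]
  rw [h1, Finset.sum_add_distrib, Finset.Nat.sum_antidiagonal_succ, Pi.add_apply, wedge_apply,
    wedge_apply, Finset.Nat.sum_antidiagonal_succ']
  have hs : ∀ (c : ℂ) {a b : ℕ} (α : E [⋀^Fin a]→L[ℝ] ℂ) (β : E [⋀^Fin b]→L[ℝ] ℂ),
      wedgeDeg k (c • α) β = c • wedgeDeg k α β := by
    intro c a b α β
    rw [wedgeDeg, wedgeDeg]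
    split_ifs with h
    · ext w
      have hne : ((a.factorial * b.factorial : ℕ) : ℂ) ≠ 0 := by
        exact_mod_cast mul_ne_zero a.factorial_ne_zero b.factorial_ne_zero
      refine mul_left_cancel₀ hne ?_
      rw [ContinuousAlternatingMap.smul_apply, smul_eq_mul, mul_left_comm, wedgeHom_apply,
        wedgeHom_apply, Finset.mul_sum]
      refine Finset.sum_congr rfl fun σ _ => ?_
      simp [mul_assoc, mul_left_comm]
    · simp
  simp only [contractLeft, contractRight, iota, signAlt, hs, zero_add]

theorem wedgeDeg_apply {a b k : ℕ} (h : a + b = k) (α : E [⋀^Fin a]→L[ℝ] ℂ)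
    (β : E [⋀^Fin b]→L[ℝ] ℂ) (v : Fin k → E) :
    wedgeDeg k α β v = ((a.factorial * b.factorial : ℕ) : ℂ)⁻¹ *
      ∑ σ : Equiv.Perm (Fin k), (Equiv.Perm.sign σ : ℤ) •
        (α (fun i => (v ∘ σ) (Fin.cast h (Fin.castAdd b i))) *
          β (fun i => (v ∘ σ) (Fin.cast h (Fin.natAdd a i)))) := by
  have hne : ((a.factorial * b.factorial : ℕ) : ℂ) ≠ 0 := by
    exact_mod_cast mul_ne_zero a.factorial_ne_zero b.factorial_ne_zero
  rw [← wedgeHom_apply, inv_mul_cancel_left₀ hne, wedgeDeg, dif_pos h]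

theorem wedgeDeg_add_left (k : ℕ) {a b : ℕ} (α α' : E [⋀^Fin a]→L[ℝ] ℂ)
    (β : E [⋀^Fin b]→L[ℝ] ℂ) :
    wedgeDeg k (α + α') β = wedgeDeg k α β + wedgeDeg k α' β := by
  by_cases h : a + b = k
  · ext v
    rw [ContinuousAlternatingMap.add_apply, wedgeDeg_apply h, wedgeDeg_apply h, wedgeDeg_apply h,
      ← mul_add, ← Finset.sum_add_distrib]
    congr 1
    exact Finset.sum_congr rfl fun σ _ => by rw [← smul_add, ← add_mul]; rfl
  · simp [wedgeDeg, h]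

theorem wedgeDeg_add_right (k : ℕ) {a b : ℕ} (α : E [⋀^Fin a]→L[ℝ] ℂ)
    (β β' : E [⋀^Fin b]→L[ℝ] ℂ) :
    wedgeDeg k α (β + β') = wedgeDeg k α β + wedgeDeg k α β' := by
  by_cases h : a + b = k
  · ext v
    rw [ContinuousAlternatingMap.add_apply, wedgeDeg_apply h, wedgeDeg_apply h, wedgeDeg_apply h,
      ← mul_add, ← Finset.sum_add_distrib]
    congr 1
    exact Finset.sum_congr rfl fun σ _ => by rw [← smul_add, ← mul_add]; rfl
  · simp [wedgeDeg, h]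

theorem wedgeDeg_smul_left (k : ℕ) {a b : ℕ} (c : ℂ) (α : E [⋀^Fin a]→L[ℝ] ℂ)
    (β : E [⋀^Fin b]→L[ℝ] ℂ) : wedgeDeg k (c • α) β = c • wedgeDeg k α β := by
  by_cases h : a + b = k
  · ext v
    rw [ContinuousAlternatingMap.smul_apply, wedgeDeg_apply h, wedgeDeg_apply h, smul_eq_mul,
      mul_left_comm]
    congr 1
    rw [Finset.mul_sum]
    exact Finset.sum_congr rfl fun σ _ => by simp [mul_assoc, mul_left_comm]
  · ext v; simp [wedgeDeg, h]

theorem wedgeDeg_smul_right (k : ℕ) {a b : ℕ} (c : ℂ) (α : E [⋀^Fin a]→L[ℝ] ℂ)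
    (β : E [⋀^Fin b]→L[ℝ] ℂ) : wedgeDeg k α (c • β) = c • wedgeDeg k α β := by
  by_cases h : a + b = k
  · ext v
    rw [ContinuousAlternatingMap.smul_apply, wedgeDeg_apply h, wedgeDeg_apply h, smul_eq_mul,
      mul_left_comm]
    congr 1
    rw [Finset.mul_sum]
    exact Finset.sum_congr rfl fun σ _ => by simp [mul_left_comm]
  · ext v; simp [wedgeDeg, h]

theorem real_smul_alt {k : ℕ} (c : ℝ) (α : E [⋀^Fin k]→L[ℝ] ℂ) : c • α = (c : ℂ) • α := by
  ext v; simp [ContinuousAlternatingMap.smul_apply]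

/-- The exterior product as a real bilinear map. -/
def wedgeLin (k a b : ℕ) : (E [⋀^Fin a]→L[ℝ] ℂ) →ₗ[ℝ] (E [⋀^Fin b]→L[ℝ] ℂ) →ₗ[ℝ]
    (E [⋀^Fin k]→L[ℝ] ℂ) :=
  LinearMap.mk₂ ℝ (fun α β => wedgeDeg k α β) (wedgeDeg_add_left k)
    (fun c α β => by simp only [real_smul_alt, wedgeDeg_smul_left]) (wedgeDeg_add_right k)
    (fun c α β => by simp only [real_smul_alt, wedgeDeg_smul_right])

theorem wedge_add_left (α α' β : Alt E) : wedge (α + α') β = wedge α β + wedge α' β := by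
  funext k
  simp only [wedge_apply, Pi.add_apply, wedgeDeg_add_left, Finset.sum_add_distrib]

theorem wedge_add_right (α β β' : Alt E) : wedge α (β + β') = wedge α β + wedge α β' := by
  funext k
  simp only [wedge_apply, Pi.add_apply, wedgeDeg_add_right, Finset.sum_add_distrib]

theorem wedge_smul_left (c : ℂ) (α β : Alt E) : wedge (c • α) β = c • wedge α β := by
  funext k
  simp only [wedge_apply, Pi.smul_apply, wedgeDeg_smul_left, Finset.smul_sum]

theorem wedge_smul_right (c : ℂ) (α β : Alt E) : wedge α (c • β) = c • wedge α β := by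
  funext k
  simp only [wedge_apply, Pi.smul_apply, wedgeDeg_smul_right, Finset.smul_sum]

theorem wedge_zero_left (β : Alt E) : wedge 0 β = 0 := by
  have := wedge_smul_left (0 : ℂ) 0 β
  simpa using this

theorem wedge_zero_right (β : Alt E) : wedge β 0 = 0 := by
  have := wedge_smul_right (0 : ℂ) β 0
  simpa using this

theorem wedge_neg_left (α β : Alt E) : wedge (-α) β = -wedge α β := by
  have := wedge_smul_left (-1 : ℂ) α β
  simpa using this

theorem wedge_neg_right (α β : Alt E) : wedge α (-β) = -wedge α β := by
  have := wedge_smul_right (-1 : ℂ) α β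
  simpa using this

theorem wedge_zero_apply (α β : Alt E) (v : Fin 0 → E) : wedge α β 0 v = α 0 v * β 0 v := by
  rw [wedge_apply]
  simp only [Finset.HasAntidiagonal.antidiagonal_zero, Finset.sum_singleton]
  rw [wedgeDeg_apply (rfl : 0 + 0 = 0)]
  simp only [Nat.factorial_zero, mul_one, Nat.cast_one, inv_one, one_mul]
  rw [Fintype.sum_subsingleton _ (1 : Equiv.Perm (Fin 0))]
  simp only [Equiv.Perm.sign_one, Units.val_one, one_smul]
  congr 1 <;> exact congrArg _ (Subsingleton.elim _ _)

theorem iota_add (x : E) (α β : Alt E) : iota x (α + β) = iota x α + iota x β := by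
  funext k; simp [iota]

theorem iota_smul (x : E) (c : ℂ) (α : Alt E) : iota x (c • α) = c • iota x α := by
  funext k; ext v; simp [iota, ContinuousAlternatingMap.smul_apply]

theorem iota_neg (x : E) (α : Alt E) : iota x (-α) = -iota x α := by
  have := iota_smul x (-1 : ℂ) α
  simpa using this

theorem iota_zero (x : E) : iota x (0 : Alt E) = 0 := by
  have := iota_smul x (0 : ℂ) (0 : Alt E)
  simpa using this

theorem iota_add_vec (x y : E) (α : Alt E) : iota (x + y) α = iota x α + iota y α := by
  funext k; simp [iota]

theorem iota_iota_self (x : E) (α : Alt E) : iota x (iota x α) = 0 := by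
  funext k; simp [iota]

theorem iota_apply (x : E) (α : Alt E) (k : ℕ) (v : Fin k → E) :
    iota x α k v = α (k + 1) (Matrix.vecCons x v) := rfl

theorem signAlt_smul (c : ℂ) (α : Alt E) : signAlt (c • α) = c • signAlt α := by
  funext k
  change (-1 : ℂ) ^ k • c • α k = c • (-1 : ℂ) ^ k • α k
  rw [smul_comm]

theorem signAlt_signAlt (α : Alt E) : signAlt (signAlt α) = α := by
  funext k; simp only [signAlt, smul_smul, ← mul_pow]; norm_num

theorem iota_signAlt (x : E) (α : Alt E) : iota x (signAlt α) = -signAlt (iota x α) := by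
  funext k; ext v
  simp [signAlt, iota, pow_succ]

theorem signAlt_wedge (α β : Alt E) : signAlt (wedge α β) = wedge (signAlt α) (signAlt β) := by
  funext k
  simp only [signAlt, wedge_apply, Finset.smul_sum]
  refine Finset.sum_congr rfl fun p hp => ?_
  rw [wedgeDeg_smul_left, wedgeDeg_smul_right, smul_smul, ← pow_add,
    Finset.HasAntidiagonal.mem_antidiagonal.mp hp]

theorem alt_ext_step {k : ℕ} {α β : Alt E} (h : ∀ x, iota x α k = iota x β k) :
    α (k + 1) = β (k + 1) := by
  ext v
  have := congrArg (fun F => F (Fin.tail v)) (h (v 0))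
  simp only [iota, ContinuousAlternatingMap.curryLeft_apply_apply] at this
  simpa [Matrix.vecCons, Fin.cons_self_tail] using this

theorem wedge_assoc (α β γ : Alt E) : wedge (wedge α β) γ = wedge α (wedge β γ) := by
  funext k
  induction k generalizing α β γ with
  | zero => ext v; simp only [wedge_zero_apply, mul_assoc]
  | succ k ih =>
    refine alt_ext_step fun x => ?_
    simp only [iota_wedge, wedge_add_left, wedge_add_right, signAlt_wedge, Pi.add_apply, ih,
      add_assoc]

theorem wedge_comm_aux (k : ℕ) (α β : Alt E) :
    (signAlt α = α → wedge α β k = wedge β α k) ∧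
    (signAlt α = -α → wedge α β k = wedge (signAlt β) α k) := by
  induction k generalizing α β with
  | zero =>
    constructor
    · intro _; ext v; simp only [wedge_zero_apply, mul_comm]
    · intro _; ext v; simp [wedge_zero_apply, mul_comm, signAlt]
  | succ k ih =>
    constructor
    · intro h
      refine alt_ext_step fun x => ?_
      have h2 : signAlt (iota x α) = -iota x α := by
        have := iota_signAlt x α
        rw [h] at this
        exact (neg_eq_iff_eq_neg.mpr this).symm
      rw [iota_wedge, iota_wedge, h, Pi.add_apply, Pi.add_apply, (ih _ _).2 h2, (ih α _).1 h,
        add_comm]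
    · intro h
      refine alt_ext_step fun x => ?_
      have h2 : signAlt (iota x α) = iota x α := by
        have := iota_signAlt x α
        rw [h, iota_neg] at this
        exact (neg_injective this).symm
      rw [iota_wedge, iota_wedge, h, signAlt_signAlt, iota_signAlt, wedge_neg_left, wedge_neg_left,
        Pi.add_apply, Pi.add_apply, (ih _ _).1 h2, Pi.neg_apply, Pi.neg_apply, (ih α _).2 h,
        add_comm]

theorem wedge_comm_of_even {α : Alt E} (h : signAlt α = α) (β : Alt E) :
    wedge α β = wedge β α := funext fun k => (wedge_comm_aux k α β).1 h

theorem signAlt_ofDegree_two (α : E [⋀^Fin 2]→L[ℝ] ℂ) : signAlt (ofDegree 2 α) = ofDegree 2 α := by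
  funext k
  by_cases hk : k = 2
  · subst hk; simp [signAlt]
  · simp [signAlt, ofDegree, Pi.single_eq_of_ne hk]

theorem signAlt_ofDegree_one (α : E [⋀^Fin 1]→L[ℝ] ℂ) :
    signAlt (ofDegree 1 α) = -ofDegree 1 α := by
  funext k
  by_cases hk : k = 1
  · subst hk; simp [signAlt]
  · simp [signAlt, ofDegree, Pi.single_eq_of_ne hk]

theorem iota_ofDegree (x : E) {k : ℕ} (α : E [⋀^Fin (k + 1)]→L[ℝ] ℂ) :
    iota x (ofDegree (k + 1) α) = ofDegree k (α.curryLeft x) := by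
  funext j
  by_cases hk : j = k
  · subst hk; simp [iota, ofDegree]
  · have : j + 1 ≠ k + 1 := by omega
    simp [iota, ofDegree, Pi.single_eq_of_ne hk, Pi.single_eq_of_ne this]

theorem iota_altOne (x : E) : iota x (altOne : Alt E) = 0 := by
  funext j
  simp [iota, altOne]

theorem signAlt_altOne : signAlt (altOne : Alt E) = altOne := by
  funext k
  by_cases hk : k = 0
  · subst hk; simp [signAlt]
  · simp [signAlt, altOne, Pi.single_eq_of_ne hk]

theorem altOne_wedge (α : Alt E) : wedge altOne α = α := by
  funext k
  induction k generalizing α with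
  | zero => ext v; simp [wedge_zero_apply, altOne]
  | succ k ih =>
    refine alt_ext_step fun x => ?_
    rw [iota_wedge, iota_altOne, wedge_zero_left, signAlt_altOne, zero_add, ih]

theorem signAlt_wpow (α : E [⋀^Fin 2]→L[ℝ] ℂ) (l : ℕ) : signAlt (wpow α l) = wpow α l := by
  induction l with
  | zero => exact signAlt_altOne
  | succ l ih => rw [wpow, signAlt_wedge, ih, signAlt_ofDegree_two]

/-- An even form commutes past any form. -/
theorem wedge_left_comm {α : Alt E} (h : signAlt α = α) (β γ : Alt E) :
    wedge β (wedge α γ) = wedge α (wedge β γ) := by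
  rw [← wedge_assoc, ← wedge_comm_of_even h β, wedge_assoc]

theorem iota_wpow (x : E) (α : E [⋀^Fin 2]→L[ℝ] ℂ) (l : ℕ) :
    iota x (wpow α l) = (l : ℂ) • wedge (ofDegree 1 (α.curryLeft x)) (wpow α (l - 1)) := by
  induction l with
  | zero => simp [wpow, iota_altOne]
  | succ l ih =>
    rw [wpow, iota_wedge, signAlt_ofDegree_two, ih, iota_ofDegree, wedge_smul_right]
    cases l with
    | zero => simp
    | succ l =>
      rw [Nat.add_sub_cancel, Nat.add_sub_cancel, wpow,
        wedge_left_comm (signAlt_ofDegree_two α)]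
      push_cast
      module

theorem iota_powWedge (x : E) (α β : E [⋀^Fin 2]→L[ℝ] ℂ) (θ : Alt E) (hθ : iota x θ = 0)
    (l j : ℕ) :
    iota x (powWedge α β θ l j) =
      (l : ℂ) • wedge (ofDegree 1 (α.curryLeft x)) (powWedge α β θ (l - 1) j) +
      (j : ℂ) • wedge (ofDegree 1 (β.curryLeft x)) (powWedge α β θ l (j - 1)) := by
  rw [powWedge, iota_wedge, iota_wedge, hθ, wedge_zero_right, add_zero, iota_wpow, iota_wpow,
    signAlt_wpow, wedge_smul_left, wedge_smul_left, wedge_smul_right, wedge_assoc, wedge_assoc,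
    ← wedge_left_comm (signAlt_wpow α l)]
  rfl

variable {E' : Type*} [NormedAddCommGroup E'] [NormedSpace ℂ E']

theorem altComp_wedge (α β : Alt E) (A : E' →L[ℝ] E) :
    altComp (wedge α β) A = wedge (altComp α A) (altComp β A) := by
  funext k
  ext v
  rw [altComp, ContinuousAlternatingMap.compContinuousLinearMap_apply, wedge_apply, wedge_apply,
    ContinuousAlternatingMap.sum_apply, ContinuousAlternatingMap.sum_apply]
  refine Finset.sum_congr rfl fun p hp => ?_
  have h := Finset.HasAntidiagonal.mem_antidiagonal.mp hp
  rw [wedgeDeg_apply h, wedgeDeg_apply h]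
  rfl

theorem altComp_ofDegree {k : ℕ} (α : E [⋀^Fin k]→L[ℝ] ℂ) (A : E' →L[ℝ] E) :
    altComp (ofDegree k α) A = ofDegree k (α.compContinuousLinearMap A) := by
  funext j
  by_cases hk : j = k
  · subst hk; simp [altComp, ofDegree]
  · simp only [altComp, ofDegree, Pi.single_eq_of_ne hk]; rfl

theorem altComp_altOne (A : E' →L[ℝ] E) : altComp (altOne : Alt E) A = altOne := by
  rw [altOne, altOne]
  exact altComp_ofDegree _ A

theorem altComp_wpow (α : E [⋀^Fin 2]→L[ℝ] ℂ) (l : ℕ) (A : E' →L[ℝ] E) :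
    altComp (wpow α l) A = wpow (α.compContinuousLinearMap A) l := by
  induction l with
  | zero => exact altComp_altOne A
  | succ l ih => rw [wpow, wpow, altComp_wedge, ih, altComp_ofDegree]

theorem altComp_powWedge (α β : E [⋀^Fin 2]→L[ℝ] ℂ) (θ : Alt E) (l j : ℕ) (A : E' →L[ℝ] E) :
    altComp (powWedge α β θ l j) A =
      powWedge (α.compContinuousLinearMap A) (β.compContinuousLinearMap A) (altComp θ A) l j := by
  rw [powWedge, powWedge, altComp_wedge, altComp_wedge, altComp_wpow, altComp_wpow]

theorem altComp_iota (x : E') (α : Alt E) (A : E' →L[ℝ] E) :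
    altComp (iota (A x) α) A = iota x (altComp α A) := by
  funext k
  simp [altComp, iota]

theorem altComp_comp {E'' : Type*} [NormedAddCommGroup E''] [NormedSpace ℂ E''] (α : Alt E)
    (A : E' →L[ℝ] E) (A' : E'' →L[ℝ] E') :
    altComp (altComp α A) A' = altComp α (A.comp A') := rfl

end WedgeAlgebra

section AltCalculus

variable {E : Type*} [NormedAddCommGroup E] [NormedSpace ℂ E] [FiniteDimensional ℂ E]

instance finiteDimensional_alternating (k : ℕ) :
    FiniteDimensional ℝ (E [⋀^Fin k]→L[ℝ] ℂ) := by
  let F : (E [⋀^Fin k]→L[ℝ] ℂ) →ₗ[ℝ] MultilinearMap ℝ (fun _ : Fin k => E) ℂ :=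
    { toFun := fun α => α.toMultilinearMap
      map_add' := fun _ _ => rfl
      map_smul' := fun _ _ => rfl }
  refine FiniteDimensional.of_injective F fun α β h => ?_
  ext v
  exact congrArg (fun G : MultilinearMap ℝ (fun _ : Fin k => E) ℂ => G v) h

/-- The exterior product as a continuous bilinear map. -/
def wedgeCLM (k a b : ℕ) : (E [⋀^Fin a]→L[ℝ] ℂ) →L[ℝ] (E [⋀^Fin b]→L[ℝ] ℂ) →L[ℝ]
    (E [⋀^Fin k]→L[ℝ] ℂ) :=
  LinearMap.toContinuousLinearMap (LinearMap.toContinuousLinearMap.toLinearMap ∘ₗ wedgeLin k a b)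

/-- Smoothness at a point of an inhomogeneous form on a vector space. -/
def ContDiffAlt {V : Type*} [NormedAddCommGroup V] [NormedSpace ℝ V] (α : V → Alt E) (x : V) :
    Prop := ∀ k, ContDiffAt ℝ ∞ (fun y => α y k) x

/-- The derivative of an inhomogeneous form in a direction. -/
def dirAlt {V : Type*} [NormedAddCommGroup V] [NormedSpace ℝ V] (α : V → Alt E) (x v : V) :
    Alt E := fun k => fderiv ℝ (fun y => α y k) x v

/-- The exterior derivative of an inhomogeneous form on a vector space. -/
def dAlt (α : E → Alt E) (x : E) : Alt E
  | 0 => 0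
  | k + 1 => extDeriv (fun y => α y k) x

variable {V : Type*} [NormedAddCommGroup V] [NormedSpace ℝ V]

theorem ContDiffAlt.wedge {α β : V → Alt E} {x : V} (hα : ContDiffAlt α x)
    (hβ : ContDiffAlt β x) : ContDiffAlt (fun y => wedge (α y) (β y)) x := by
  intro k
  simp only [wedge_apply]
  refine ContDiffAt.sum fun p _ => ?_
  exact ((wedgeCLM k p.1 p.2).contDiff.contDiffAt.comp x (hα p.1)).clm_apply (hβ p.2)

theorem ContDiffAlt.diff {α : V → Alt E} {x : V} (hα : ContDiffAlt α x) (k : ℕ) :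
    DifferentiableAt ℝ (fun y => α y k) x := (hα k).differentiableAt (by simp)

theorem dirAlt_wedge {α β : V → Alt E} {x : V} (hα : ContDiffAlt α x)
    (hβ : ContDiffAlt β x) (v : V) :
    dirAlt (fun y => wedge (α y) (β y)) x v =
      wedge (dirAlt α x v) (β x) + wedge (α x) (dirAlt β x v) := by
  funext k
  have h : HasFDerivAt (fun y => wedge (α y) (β y) k) (∑ p ∈ Finset.HasAntidiagonal.antidiagonal k,
      (((wedgeCLM k p.1 p.2).precompR V (α x p.1) (fderiv ℝ (fun y => β y p.2) x)) +
        ((wedgeCLM k p.1 p.2).precompL V (fderiv ℝ (fun y => α y p.1) x) (β x p.2)))) x := by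
    simp only [wedge_apply]
    refine HasFDerivAt.fun_sum fun p _ => ?_
    exact (wedgeCLM k p.1 p.2).hasFDerivAt_of_bilinear (hα.diff p.1).hasFDerivAt
      (hβ.diff p.2).hasFDerivAt
  rw [dirAlt, h.fderiv, Pi.add_apply, wedge_apply, wedge_apply, _root_.sum_apply,
    ← Finset.sum_add_distrib]
  refine Finset.sum_congr rfl fun p _ => ?_
  rw [_root_.add_apply, ContinuousLinearMap.precompR_apply,
    ContinuousLinearMap.precompL_apply, add_comm]
  rfl

theorem curryLeft_extDeriv {k : ℕ} {η : E → E [⋀^Fin (k + 1)]→L[ℝ] ℂ} {x : E}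
    (h : DifferentiableAt ℝ η x) (v : E) :
    (extDeriv η x).curryLeft v = fderiv ℝ η x v - extDeriv (fun y => (η y).curryLeft v) x := by
  ext w
  let L : (E [⋀^Fin (k + 1)]→L[ℝ] ℂ) →L[ℝ] (E [⋀^Fin k]→L[ℝ] ℂ) :=
    LinearMap.toContinuousLinearMap
      { toFun := fun α => α.curryLeft v
        map_add' := fun _ _ => by simp
        map_smul' := fun _ _ => by simp }
  have h2 : fderiv ℝ (fun y => (η y).curryLeft v) x = L.comp (fderiv ℝ η x) :=
    (L.hasFDerivAt.comp x h.hasFDerivAt).fderiv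
  rw [ContinuousAlternatingMap.curryLeft_apply_apply, extDeriv,
    ContinuousAlternatingMap.alternatizeUncurryFin_apply, Fin.sum_univ_succ,
    ContinuousAlternatingMap.sub_apply, extDeriv,
    ContinuousAlternatingMap.alternatizeUncurryFin_apply, h2, sub_eq_add_neg,
    ← Finset.sum_neg_distrib]
  congr 1
  · simp
  · refine Finset.sum_congr rfl fun i _ => ?_
    have : (i.succ.removeNth (Matrix.vecCons v w)) = Matrix.vecCons v (i.removeNth w) := by
      funext j
      cases j using Fin.cases <;> simp [Fin.removeNth]
    rw [this]
    simp [pow_succ, L]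

theorem ContDiffAlt.iota {α : V → Alt E} {x : V} (hα : ContDiffAlt α x) (v : E) :
    ContDiffAlt (fun y => iota v (α y)) x := by
  intro k
  let L : (E [⋀^Fin (k + 1)]→L[ℝ] ℂ) →L[ℝ] (E [⋀^Fin k]→L[ℝ] ℂ) :=
    LinearMap.toContinuousLinearMap
      { toFun := fun α => α.curryLeft v
        map_add' := fun _ _ => by simp
        map_smul' := fun _ _ => by simp }
  exact L.contDiff.contDiffAt.comp x (hα (k + 1))

theorem ContDiffAlt.signAlt {α : V → Alt E} {x : V} (hα : ContDiffAlt α x) :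
    ContDiffAlt (fun y => signAlt (α y)) x := fun k => (hα k).const_smul ((-1 : ℂ) ^ k)

theorem iota_dAlt {α : E → Alt E} {x : E} (hα : ContDiffAlt α x) (v : E) :
    iota v (dAlt α x) = dirAlt α x v - dAlt (fun y => iota v (α y)) x := by
  funext k
  cases k with
  | zero =>
    ext w
    simp only [iota, dAlt, dirAlt, Pi.sub_apply, sub_zero]
    rw [ContinuousAlternatingMap.curryLeft_apply_apply, extDeriv,
      ContinuousAlternatingMap.alternatizeUncurryFin_apply]
    simp
  | succ k => exact curryLeft_extDeriv (hα.diff (k + 1)) v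

theorem dAlt_add {α β : E → Alt E} {x : E} (hα : ContDiffAlt α x) (hβ : ContDiffAlt β x) :
    dAlt (fun y => α y + β y) x = dAlt α x + dAlt β x := by
  funext k
  cases k with
  | zero => simp [dAlt]
  | succ k => exact extDeriv_fun_add (hα.diff k) (hβ.diff k)

theorem extDeriv_const_smul {k : ℕ} (c : ℂ) {η : E → E [⋀^Fin k]→L[ℝ] ℂ} {x : E}
    (h : DifferentiableAt ℝ η x) : extDeriv (fun y => c • η y) x = c • extDeriv η x := by
  ext v
  rw [extDeriv, extDeriv, fderiv_fun_const_smul h c]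
  simp [ContinuousAlternatingMap.alternatizeUncurryFin_apply, Finset.mul_sum,
    ContinuousAlternatingMap.smul_apply]

theorem dAlt_signAlt {α : E → Alt E} {x : E} (hα : ContDiffAlt α x) :
    dAlt (fun y => signAlt (α y)) x = -signAlt (dAlt α x) := by
  funext k
  cases k with
  | zero => simp [dAlt, signAlt]
  | succ k =>
    simp only [dAlt, signAlt, Pi.neg_apply]
    rw [extDeriv_const_smul _ (hα.diff k), pow_succ]
    simp

theorem dAlt_wedge {α β : E → Alt E} {x : E} (hα : ContDiffAlt α x) (hβ : ContDiffAlt β x) :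
    dAlt (fun y => wedge (α y) (β y)) x =
      wedge (dAlt α x) (β x) + wedge (signAlt (α x)) (dAlt β x) := by
  funext k
  induction k generalizing α β with
  | zero => ext v; simp [wedge_zero_apply, dAlt]
  | succ k ih =>
    refine alt_ext_step fun v => ?_
    have e : (fun y => iota v (wedge (α y) (β y))) =
        fun y => wedge (iota v (α y)) (β y) + wedge (signAlt (α y)) (iota v (β y)) :=
      funext fun y => iota_wedge v _ _
    rw [iota_dAlt (hα.wedge hβ), e, dAlt_add ((hα.iota v).wedge hβ) (hα.signAlt.wedge (hβ.iota v)),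
      Pi.sub_apply, Pi.add_apply, ih (hα.iota v) hβ, ih hα.signAlt (hβ.iota v),
      dirAlt_wedge hα hβ, iota_add, iota_wedge, iota_wedge, iota_dAlt hα, iota_dAlt hβ,
      dAlt_signAlt hα, iota_signAlt, signAlt_signAlt]
    simp only [sub_eq_add_neg, wedge_add_left, wedge_add_right, wedge_neg_left, wedge_neg_right,
      Pi.add_apply, Pi.neg_apply]
    abel

end AltCalculus

section AltSmooth

variable {E : Type*} [NormedAddCommGroup E] [NormedSpace ℂ E] [FiniteDimensional ℂ E]
  {V : Type*} [NormedAddCommGroup V] [NormedSpace ℝ V]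

theorem contDiffAt_alt_apply {m : WithTop ℕ∞} {k : ℕ} {α : V → E [⋀^Fin k]→L[ℝ] ℂ}
    {v : Fin k → V → E} {x : V}
    (hα : ContDiffAt ℝ m α x) (hv : ∀ i, ContDiffAt ℝ m (v i) x) :
    ContDiffAt ℝ m (fun y => α y (fun i => v i y)) x := by
  induction k with
  | zero =>
    let L : (E [⋀^Fin 0]→L[ℝ] ℂ) →L[ℝ] ℂ := LinearMap.toContinuousLinearMap
      { toFun := fun α => α ![]
        map_add' := fun _ _ => rfl
        map_smul' := fun _ _ => rfl }
    refine (L.contDiff.contDiffAt.comp x hα).congr_of_eventuallyEq (Filter.Eventually.of_forall ?_)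
    intro y
    exact congrArg (α y) (Subsingleton.elim _ _)
  | succ k ih =>
    let C := (ContinuousAlternatingMap.curryLeftLI (𝕜 := ℝ) (E := E) (F := ℂ)
      (n := k)).toContinuousLinearMap
    have h1 : ContDiffAt ℝ m (fun y => C (α y) (v 0 y)) x :=
      (C.contDiff.contDiffAt.comp x hα).clm_apply (hv 0)
    refine (ih h1 (fun i => hv i.succ)).congr_of_eventuallyEq (Filter.Eventually.of_forall ?_)
    intro y
    change α y (fun i => v i y) = (α y).curryLeft (v 0 y) (fun i => v i.succ y)
    rw [ContinuousAlternatingMap.curryLeft_apply_apply]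
    congr 1
    funext i
    cases i using Fin.cases <;> rfl

theorem exists_alt_coords (E : Type*) [NormedAddCommGroup E] [NormedSpace ℂ E]
    [FiniteDimensional ℂ E] (k : ℕ) :
    ∃ (m : ℕ) (u : Fin m → Fin k → E) (L : (Fin m → ℂ) →L[ℝ] (E [⋀^Fin k]→L[ℝ] ℂ)),
      ∀ α : E [⋀^Fin k]→L[ℝ] ℂ, α = L (fun i => α (u i)) := by
  let b := Module.finBasis ℝ E
  let e := Fintype.equivFin (Fin k → Fin (Module.finrank ℝ E))
  let u : Fin (Fintype.card (Fin k → Fin (Module.finrank ℝ E))) → Fin k → E :=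
    fun i j => b (e.symm i j)
  let ev : (E [⋀^Fin k]→L[ℝ] ℂ) →ₗ[ℝ]
      (Fin (Fintype.card (Fin k → Fin (Module.finrank ℝ E))) → ℂ) :=
    { toFun := fun α i => α (u i)
      map_add' := fun _ _ => rfl
      map_smul' := fun _ _ => rfl }
  have hinj : LinearMap.ker ev = ⊥ := by
    rw [LinearMap.ker_eq_bot']
    intro α hα
    have : α.toMultilinearMap = 0 := by
      refine Module.Basis.ext_multilinear (fun _ => b) fun i => ?_
      have h := congrFun hα (e i)
      simpa [ev, u] using h
    ext v
    exact congrArg (fun G : MultilinearMap ℝ (fun _ : Fin k => E) ℂ => G v) this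
  obtain ⟨g, hg⟩ := LinearMap.exists_leftInverse_of_injective ev hinj
  exact ⟨_, u, LinearMap.toContinuousLinearMap g, fun α => (LinearMap.congr_fun hg α).symm⟩

theorem contDiffAt_alt_iff {m : WithTop ℕ∞} {k : ℕ} {α : V → E [⋀^Fin k]→L[ℝ] ℂ} {x : V} :
    ContDiffAt ℝ m α x ↔ ∀ u, ContDiffAt ℝ m (fun y => α y u) x := by
  constructor
  · intro h u
    exact contDiffAt_alt_apply h fun i => contDiffAt_const
  · intro h
    obtain ⟨p, u, L, hL⟩ := exists_alt_coords E k
    have : ContDiffAt ℝ m (fun y => L (fun i => α y (u i))) x :=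
      L.contDiff.contDiffAt.comp x (contDiffAt_pi.mpr fun i => h (u i))
    exact this.congr_of_eventuallyEq (Filter.Eventually.of_forall fun y => hL (α y))

theorem continuous_alt_iff {T : Type*} [TopologicalSpace T] {k : ℕ} {s : Set T}
    {α : T → E [⋀^Fin k]→L[ℝ] ℂ} :
    ContinuousOn α s ↔ ∀ u, ContinuousOn (fun y => α y u) s := by
  constructor
  · intro h u
    let L : (E [⋀^Fin k]→L[ℝ] ℂ) →L[ℝ] ℂ := LinearMap.toContinuousLinearMap
      { toFun := fun α => α u
        map_add' := fun _ _ => rfl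
        map_smul' := fun _ _ => rfl }
    exact L.continuous.comp_continuousOn h
  · intro h
    obtain ⟨p, u, L, hL⟩ := exists_alt_coords E k
    have : ContinuousOn (fun y => L (fun i => α y (u i))) s :=
      L.continuous.comp_continuousOn (continuousOn_pi.mpr fun i => h (u i))
    exact this.congr fun y _ => hL (α y)

variable {E' : Type*} [NormedAddCommGroup E'] [NormedSpace ℂ E'] [FiniteDimensional ℂ E']

theorem contDiffAt_alt_comp {m : WithTop ℕ∞} {k : ℕ} {α : V → E [⋀^Fin k]→L[ℝ] ℂ}
    {A : V → E' →L[ℝ] E} {x : V} (hα : ContDiffAt ℝ m α x) (hA : ContDiffAt ℝ m A x) :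
    ContDiffAt ℝ m (fun y => (α y).compContinuousLinearMap (A y)) x := by
  rw [contDiffAt_alt_iff]
  intro u
  have h := contDiffAt_alt_apply (v := fun i y => A y (u i)) hα
    fun i => hA.clm_apply contDiffAt_const
  exact h

end AltSmooth

section Derivative

variable {E' : Type*} [NormedAddCommGroup E'] [NormedSpace ℝ E']
  {M' : Type*} [TopologicalSpace M'] [ChartedSpace E' M']
  {E : Type*} [NormedAddCommGroup E] [NormedSpace ℝ E]
  {M : Type*} [TopologicalSpace M] [ChartedSpace E M]
  {E'' : Type*} [NormedAddCommGroup E''] [NormedSpace ℝ E'']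
  {M'' : Type*} [TopologicalSpace M''] [ChartedSpace E'' M'']

variable (E' E) in
/-- The differential of a map of manifolds, as a map of model spaces. -/
def mD (f : M' → M) (x : M') : E' →L[ℝ] E := mfderiv 𝓘(ℝ, E') 𝓘(ℝ, E) f x

theorem mD_comp {g : M → M''} {f : M' → M} {x : M'}
    (hg : MDifferentiableAt 𝓘(ℝ, E) 𝓘(ℝ, E'') g (f x))
    (hf : MDifferentiableAt 𝓘(ℝ, E') 𝓘(ℝ, E) f x) :
    mD E' E'' (fun y => g (f y)) x = (mD E E'' g (f x)).comp (mD E' E f x) :=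
  mfderiv_comp x hg hf

theorem mD_id (x : M) : mD E E (fun y : M => y) x = ContinuousLinearMap.id ℝ E := mfderiv_id

theorem mD_eq_fderiv (f : E' → E) (x : E') : mD E' E f x = fderiv ℝ f x := mfderiv_eq_fderiv

theorem mD_congr {f g : M' → M} {x : M'} (h : f =ᶠ[𝓝 x] g) : mD E' E f x = mD E' E g x :=
  h.mfderiv_eq

theorem mD_eq {f : M' → M} {x : M'} (h : MDifferentiableAt 𝓘(ℝ, E') 𝓘(ℝ, E) f x) :
    mD E' E f x = fderiv ℝ (fun y => chartAt E (f x) (f ((chartAt E' x).symm y)))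
      (chartAt E' x x) := by
  have h2 := h.mfderiv
  simp only [writtenInExtChartAt, extChartAt, OpenPartialHomeomorph.extend,
    modelWithCornersSelf_partialEquiv, PartialEquiv.trans_refl, modelWithCornersSelf_coe,
    Set.range_id, fderivWithin_univ] at h2
  exact h2

end Derivative

section ManifoldForms

variable {E : Type*} [NormedAddCommGroup E] [NormedSpace ℂ E]
  {M : Type*} [TopologicalSpace M] [ChartedSpace E M]
  {E' : Type*} [NormedAddCommGroup E'] [NormedSpace ℂ E']
  {M' : Type*} [TopologicalSpace M'] [ChartedSpace E' M']

theorem HasMFDerivAt.to_real {f : M' → M} {x : M'} {A : E' →L[ℂ] E}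
    (h : HasMFDerivAt 𝓘(ℂ, E') 𝓘(ℂ, E) f x A) :
    HasMFDerivAt 𝓘(ℝ, E') 𝓘(ℝ, E) f x (A.restrictScalars ℝ) := by
  refine ⟨h.1, ?_⟩
  have h2 := h.2
  simp only [writtenInExtChartAt, extChartAt, OpenPartialHomeomorph.extend,
    modelWithCornersSelf_partialEquiv, PartialEquiv.trans_refl, modelWithCornersSelf_coe,
    Set.range_id] at h2 ⊢
  exact HasFDerivWithinAt.restrictScalars ℝ h2

theorem ContMDiffAt.to_real {f : M' → M} {x : M'}
    (h : ContMDiffAt 𝓘(ℂ, E') 𝓘(ℂ, E) ω f x) : ContMDiffAt 𝓘(ℝ, E') 𝓘(ℝ, E) ∞ f x := by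
  rw [contMDiffAt_iff] at h ⊢
  refine ⟨h.1, ?_⟩
  have h2 := h.2
  simp only [extChartAt, OpenPartialHomeomorph.extend,
    modelWithCornersSelf_partialEquiv, PartialEquiv.trans_refl, modelWithCornersSelf_coe,
    Set.range_id] at h2 ⊢
  exact (h2.restrict_scalars ℝ).of_le le_top

theorem mD_J {f : M' → M} {x : M'} (h : MDifferentiableAt 𝓘(ℂ, E') 𝓘(ℂ, E) f x) (u : E') :
    mD E' E f x (Complex.I • u) = Complex.I • mD E' E f x u := by
  have h1 : mD E' E f x =
      ContinuousLinearMap.restrictScalars ℝ (mfderiv 𝓘(ℂ, E') 𝓘(ℂ, E) f x : E' →L[ℂ] E) :=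
    (HasMFDerivAt.to_real h.hasMFDerivAt).mfderiv
  rw [h1]
  exact ContinuousLinearMap.map_smul (mfderiv 𝓘(ℂ, E') 𝓘(ℂ, E) f x : E' →L[ℂ] E) Complex.I u

/-- The differential of the inverse of a chart. -/
def cD (c : OpenPartialHomeomorph M E) (y : E) : E →L[ℝ] E := mD E E c.symm y

section
variable {c : OpenPartialHomeomorph M E} (hc : c ∈ IsManifold.maximalAtlas 𝓘(ℂ, E) ω M)
include hc

theorem mdifferentiableAt_chart {x : M} (hx : x ∈ c.source) :
    MDifferentiableAt 𝓘(ℂ, E) 𝓘(ℂ, E) c x :=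
  ((contMDiffOn_of_mem_maximalAtlas hc).contMDiffAt (c.open_source.mem_nhds hx)).mdifferentiableAt
    (by simp)

theorem mdifferentiableAt_chart_symm {y : E} (hy : y ∈ c.target) :
    MDifferentiableAt 𝓘(ℂ, E) 𝓘(ℂ, E) c.symm y :=
  ((contMDiffOn_symm_of_mem_maximalAtlas hc).contMDiffAt
    (c.open_target.mem_nhds hy)).mdifferentiableAt (by simp)

theorem contMDiffAt_chart {x : M} (hx : x ∈ c.source) :
    ContMDiffAt 𝓘(ℝ, E) 𝓘(ℝ, E) ∞ c x :=
  ContMDiffAt.to_real ((contMDiffOn_of_mem_maximalAtlas hc).contMDiffAt (c.open_source.mem_nhds hx))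

theorem contMDiffAt_chart_symm {y : E} (hy : y ∈ c.target) :
    ContMDiffAt 𝓘(ℝ, E) 𝓘(ℝ, E) ∞ c.symm y :=
  ContMDiffAt.to_real ((contMDiffOn_symm_of_mem_maximalAtlas hc).contMDiffAt
    (c.open_target.mem_nhds hy))

theorem cD_J {y : E} (hy : y ∈ c.target) (u : E) :
    cD c y (Complex.I • u) = Complex.I • cD c y u :=
  mD_J (mdifferentiableAt_chart_symm hc hy) u

theorem mD_cD {y : E} (hy : y ∈ c.target) :
    (mD E E c (c.symm y)).comp (cD c y) = ContinuousLinearMap.id ℝ E := by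
  have h := mD_comp (E := E) (E' := E) (E'' := E) (g := c) (f := c.symm) (x := y)
    ((contMDiffAt_chart hc (c.map_target hy)).mdifferentiableAt (by simp))
    ((contMDiffAt_chart_symm hc hy).mdifferentiableAt (by simp))
  refine h.symm.trans ?_
  have e : (fun y => c (c.symm y)) =ᶠ[𝓝 y] fun y => y := by
    filter_upwards [c.open_target.mem_nhds hy] with z hz using c.right_inv hz
  rw [mD_congr e, mD_id]

theorem cD_mD {x : M} (hx : x ∈ c.source) :
    (cD c (c x)).comp (mD E E c x) = ContinuousLinearMap.id ℝ E := by
  have hy := c.map_source hx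
  have h := mD_comp (E := E) (E' := E) (E'' := E) (g := c.symm) (f := c) (x := x)
    ((contMDiffAt_chart_symm hc hy).mdifferentiableAt (by simp))
    ((contMDiffAt_chart hc hx).mdifferentiableAt (by simp))
  refine h.symm.trans ?_
  have e : (fun y => c.symm (c y)) =ᶠ[𝓝 x] fun y => y := by
    filter_upwards [c.open_source.mem_nhds hx] with z hz using c.left_inv hz
  rw [mD_congr e, mD_id]

variable {c' : OpenPartialHomeomorph M' E'}

theorem mD_comp_cD (hc' : c' ∈ IsManifold.maximalAtlas 𝓘(ℂ, E') ω M') {f : M' → M} {y : E'}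
    (hf : MDifferentiableAt 𝓘(ℝ, E') 𝓘(ℝ, E) f (c'.symm y)) (hy : y ∈ c'.target)
    (hfy : f (c'.symm y) ∈ c.source) :
    (mD E' E f (c'.symm y)).comp (cD c' y) =
      (cD c (c (f (c'.symm y)))).comp (fderiv ℝ (fun z => c (f (c'.symm z))) y) := by
  have h1 : MDifferentiableAt 𝓘(ℝ, E') 𝓘(ℝ, E') c'.symm y :=
    (contMDiffAt_chart_symm hc' hy).mdifferentiableAt (by simp)
  have h2 : MDifferentiableAt 𝓘(ℝ, E) 𝓘(ℝ, E) c (f (c'.symm y)) :=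
    (contMDiffAt_chart hc hfy).mdifferentiableAt (by simp)
  have h3 := mD_comp (E'' := E) (E := E') (E' := E') (g := f) (f := c'.symm) hf h1
  have h4 := mD_comp (E'' := E) (E := E) (E' := E') (g := c) (f := fun z => f (c'.symm z)) h2
    (hf.comp y h1)
  rw [← mD_eq_fderiv, h4, ← ContinuousLinearMap.comp_assoc, cD_mD hc hfy,
    ContinuousLinearMap.id_comp, h3]
  rfl

theorem coordRep_pullback (hc' : c' ∈ IsManifold.maximalAtlas 𝓘(ℂ, E') ω M') {f : M' → M} {y : E'}
    (hf : MDifferentiableAt 𝓘(ℝ, E') 𝓘(ℝ, E) f (c'.symm y)) (hy : y ∈ c'.target)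
    (hfy : f (c'.symm y) ∈ c.source) {k : ℕ} (η : M → E [⋀^Fin k]→L[ℝ] ℂ) :
    coordRep c' (pullback f η) y = (coordRep c η (c (f (c'.symm y)))).compContinuousLinearMap
      (fderiv ℝ (fun z => c (f (c'.symm z))) y) := by
  have h := mD_comp_cD hc hc' hf hy hfy
  ext u
  change η (f (c'.symm y)) (fun i => ((mD E' E f (c'.symm y)).comp (cD c' y)) (u i)) =
    η (c.symm (c (f (c'.symm y)))) (fun i => ((cD c (c (f (c'.symm y)))).comp
      (fderiv ℝ (fun z => c (f (c'.symm z))) y)) (u i))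
  rw [h, c.left_inv hfy]

theorem contDiffAt_coord (hc' : c' ∈ IsManifold.maximalAtlas 𝓘(ℂ, E') ω M') {f : M' → M} {x : M'}
    (hf : ContMDiffAt 𝓘(ℝ, E') 𝓘(ℝ, E) ∞ f x) (hx : x ∈ c'.source) (hfx : f x ∈ c.source) :
    ContDiffAt ℝ ∞ (fun z => c (f (c'.symm z))) (c' x) := by
  rw [← contMDiffAt_iff_contDiffAt]
  have hy := c'.map_source hx
  have e : c'.symm (c' x) = x := c'.left_inv hx
  have h1 : ContMDiffAt 𝓘(ℝ, E') 𝓘(ℝ, E) ∞ f (c'.symm (c' x)) := by rwa [e]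
  have h2 : f (c'.symm (c' x)) ∈ c.source := by rwa [e]
  exact (contMDiffAt_chart hc h2).comp (c' x) (h1.comp (c' x) (contMDiffAt_chart_symm hc' hy))

theorem coordRep_pullback_eventually (hc' : c' ∈ IsManifold.maximalAtlas 𝓘(ℂ, E') ω M')
    [IsManifold 𝓘(ℂ, E) ω M] [IsManifold 𝓘(ℂ, E') ω M']
    {f : M' → M} {x : M'}
    (hf : ContMDiffAt 𝓘(ℝ, E') 𝓘(ℝ, E) ∞ f x) (hx : x ∈ c'.source) (hfx : f x ∈ c.source) {k : ℕ}
    (η : M → E [⋀^Fin k]→L[ℝ] ℂ) :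
    coordRep c' (pullback f η) =ᶠ[𝓝 (c' x)]
      fun y => (coordRep c η (c (f (c'.symm y)))).compContinuousLinearMap
        (fderiv ℝ (fun z => c (f (c'.symm z))) y) := by
  have : IsManifold 𝓘(ℝ, E) ∞ M := isManifold_real
  have : IsManifold 𝓘(ℝ, E') ∞ M' := isManifold_real
  have : IsManifold 𝓘(ℝ, E) 1 M := IsManifold.of_le (n := ∞) (by simp)
  have : IsManifold 𝓘(ℝ, E') 1 M' := IsManifold.of_le (n := ∞) (by simp)
  have h1 : ∀ᶠ z in 𝓝 x, ContMDiffAt 𝓘(ℝ, E') 𝓘(ℝ, E) 1 f z :=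
    (contMDiffAt_iff_contMDiffAt_nhds (by simp)).1 (hf.of_le (m := 1) (by simp))
  have h2 : ∀ᶠ z in 𝓝 x, f z ∈ c.source := hf.continuousAt (c.open_source.mem_nhds hfx)
  have h3 : Filter.Tendsto c'.symm (𝓝 (c' x)) (𝓝 x) := c'.tendsto_symm hx
  filter_upwards [h3.eventually h1, h3.eventually h2, c'.open_target.mem_nhds (c'.map_source hx)]
    with y hy1 hy2 hy3
  exact coordRep_pullback hc hc' (hy1.mdifferentiableAt (by simp)) hy3 hy2 η

end

theorem coordRep_eq_pullback {k : ℕ} (c : OpenPartialHomeomorph M E)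
    (η : M → E [⋀^Fin k]→L[ℝ] ℂ) : coordRep c η = pullback c.symm η := rfl

theorem pullback_apply {k : ℕ} (f : M' → M) (η : M → E [⋀^Fin k]→L[ℝ] ℂ) (x : M') (u : Fin k → E') :
    pullback f η x u = η (f x) fun i => mD E' E f x (u i) := rfl

theorem coordRep_apply {k : ℕ} (c : OpenPartialHomeomorph M E) (η : M → E [⋀^Fin k]→L[ℝ] ℂ)
    (y : E) (u : Fin k → E) : coordRep c η y u = η (c.symm y) fun i => cD c y (u i) := rfl

theorem pullback_id {k : ℕ} (η : M → E [⋀^Fin k]→L[ℝ] ℂ) : pullback (fun x : M => x) η = η := by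
  funext x
  ext u
  rw [pullback_apply, mD_id]
  rfl

theorem pullback_pullback {E'' M'' : Type*} [NormedAddCommGroup E''] [NormedSpace ℂ E'']
    [TopologicalSpace M''] [ChartedSpace E'' M''] {k : ℕ} {g : M' → M} {f : M'' → M'} {x : M''}
    (hg : MDifferentiableAt 𝓘(ℝ, E') 𝓘(ℝ, E) g (f x))
    (hf : MDifferentiableAt 𝓘(ℝ, E'') 𝓘(ℝ, E') f x) (η : M → E [⋀^Fin k]→L[ℝ] ℂ) :
    pullback (E' := E'') f (pullback (E' := E') g η) x =
      pullback (E' := E'') (fun y => g (f y)) η x := by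
  ext u
  rw [pullback_apply, pullback_apply, pullback_apply, mD_comp hg hf]
  rfl

section Smooth

variable [IsManifold 𝓘(ℂ, E) ω M] [IsManifold 𝓘(ℂ, E') ω M']

theorem chartAt_mem (x : M) : chartAt E x ∈ IsManifold.maximalAtlas 𝓘(ℂ, E) ω M :=
  IsManifold.chart_mem_maximalAtlas x

theorem cD_chartAt (x : M) : cD (chartAt E x) (chartAt E x x) = ContinuousLinearMap.id ℝ E := by
  have h := cD_mD (chartAt_mem x) (mem_chart_source E x)
  have h2 : mD E E (chartAt E x) x = ContinuousLinearMap.id ℝ E := by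
    rw [mD_eq ((contMDiffAt_chart (chartAt_mem x) (mem_chart_source E x)).mdifferentiableAt
      (by simp))]
    have e : (fun y => chartAt E (chartAt E x x) (chartAt E x ((chartAt E x).symm y)))
        =ᶠ[𝓝 (chartAt E x x)] fun y => y := by
      filter_upwards [(chartAt E x).open_target.mem_nhds (mem_chart_target E x)] with z hz
      rw [(chartAt E x).right_inv hz]
      rfl
    rw [e.fderiv_eq]
    exact fderiv_id
  rwa [h2, ContinuousLinearMap.comp_id] at h

theorem coordRep_chartAt {k : ℕ} (η : M → E [⋀^Fin k]→L[ℝ] ℂ) (x : M) :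
    coordRep (chartAt E x) η (chartAt E x x) = η x := by
  ext u
  rw [coordRep_apply, cD_chartAt, (chartAt E x).left_inv (mem_chart_source E x)]
  rfl

/-- Smoothness of a form at a point. -/
def SmoothAt {k : ℕ} (η : M → E [⋀^Fin k]→L[ℝ] ℂ) (x : M) : Prop :=
  ContDiffAt ℝ ∞ (coordRep (chartAt E x) η) (chartAt E x x)

variable [FiniteDimensional ℂ E] [FiniteDimensional ℂ E']

theorem smoothAt_pullback_aux {c : OpenPartialHomeomorph M E}
    (hc : c ∈ IsManifold.maximalAtlas 𝓘(ℂ, E) ω M) {c' : OpenPartialHomeomorph M' E'}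
    (hc' : c' ∈ IsManifold.maximalAtlas 𝓘(ℂ, E') ω M') {f : M' → M} {x : M'}
    (hf : ContMDiffAt 𝓘(ℝ, E') 𝓘(ℝ, E) ∞ f x) (hx : x ∈ c'.source) (hfx : f x ∈ c.source) {k : ℕ}
    {η : M → E [⋀^Fin k]→L[ℝ] ℂ} (hη : ContDiffAt ℝ ∞ (coordRep c η) (c (f x))) :
    ContDiffAt ℝ ∞ (coordRep c' (pullback f η)) (c' x) := by
  have hF := contDiffAt_coord hc hc' hf hx hfx
  have e : c'.symm (c' x) = x := c'.left_inv hx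
  refine ContDiffAt.congr_of_eventuallyEq ?_ (coordRep_pullback_eventually hc hc' hf hx hfx η)
  have h1 : ContDiffAt ℝ ∞ (fun y => coordRep c η (c (f (c'.symm y)))) (c' x) := by
    refine ContDiffAt.comp (g := coordRep c η) (c' x) ?_ hF
    rwa [e]
  exact contDiffAt_alt_comp h1 (hF.fderiv_right (m := ∞) (by simp))

theorem smoothAt_iff {c : OpenPartialHomeomorph M E}
    (hc : c ∈ IsManifold.maximalAtlas 𝓘(ℂ, E) ω M) {x : M} (hx : x ∈ c.source) {k : ℕ}
    {η : M → E [⋀^Fin k]→L[ℝ] ℂ} : SmoothAt η x ↔ ContDiffAt ℝ ∞ (coordRep c η) (c x) := by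
  constructor <;> intro h
  · have := smoothAt_pullback_aux (chartAt_mem (E := E) x) hc (f := fun x : M => x) contMDiffAt_id hx
      (mem_chart_source E x) h
    rwa [pullback_id] at this
  · have := smoothAt_pullback_aux hc (chartAt_mem (E := E) x) (f := fun x : M => x) contMDiffAt_id
      (mem_chart_source E x) hx h
    rwa [pullback_id] at this

theorem smoothForm_iff {k : ℕ} {η : M → E [⋀^Fin k]→L[ℝ] ℂ} :
    SmoothForm η ↔ ∀ x, SmoothAt η x := by
  constructor
  · intro h x
    exact (h x).contDiffAt ((chartAt E x).open_target.mem_nhds (mem_chart_target E x))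
  · intro h x y hy
    have hs := (chartAt E x).map_target hy
    have h1 := (smoothAt_iff (chartAt_mem (E := E) x) hs).1 (h ((chartAt E x).symm y))
    rw [(chartAt E x).right_inv hy] at h1
    exact h1.contDiffWithinAt

theorem SmoothAt.pullback {f : M' → M} {x : M'}
    (hf : ContMDiffAt 𝓘(ℝ, E') 𝓘(ℝ, E) ∞ f x) {k : ℕ} {η : M → E [⋀^Fin k]→L[ℝ] ℂ}
    (hη : SmoothAt η (f x)) : SmoothAt (pullback (E' := E') f η) x :=
  smoothAt_pullback_aux (chartAt_mem _) (chartAt_mem x) hf (mem_chart_source E' x)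
    (mem_chart_source E _) hη

theorem coordRep_congr {k : ℕ} {η η' : M → E [⋀^Fin k]→L[ℝ] ℂ} {c : OpenPartialHomeomorph M E}
    {x : M} (hx : x ∈ c.source) (h : η =ᶠ[𝓝 x] η') : coordRep c η =ᶠ[𝓝 (c x)] coordRep c η' := by
  filter_upwards [(c.tendsto_symm hx).eventually h] with y hy
  simp only [coordRep, hy]

theorem SmoothAt.congr {k : ℕ} {η η' : M → E [⋀^Fin k]→L[ℝ] ℂ} {x : M} (h : SmoothAt η x)
    (e : η' =ᶠ[𝓝 x] η) : SmoothAt η' x :=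
  ContDiffAt.congr_of_eventuallyEq h (coordRep_congr (mem_chart_source E x) e)

theorem dForm_congr {k : ℕ} {η η' : M → E [⋀^Fin k]→L[ℝ] ℂ} {x : M}
    (e : η =ᶠ[𝓝 x] η') : dForm η x = dForm η' x :=
  (coordRep_congr (mem_chart_source E x) e).extDeriv_eq

theorem dForm_pullback {f : M' → M} {x : M'}
    (hf : ContMDiffAt 𝓘(ℝ, E') 𝓘(ℝ, E) ∞ f x) {k : ℕ} {η : M → E [⋀^Fin k]→L[ℝ] ℂ}
    (hη : SmoothAt η (f x)) : dForm (pullback (E' := E') f η) x =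
      pullback (E' := E') f (dForm η) x := by
  have e := coordRep_pullback_eventually (chartAt_mem (E := E) (f x)) (chartAt_mem (E := E') x) hf
    (mem_chart_source E' x) (mem_chart_source E _) η
  have hF := contDiffAt_coord (chartAt_mem (E := E) (f x)) (chartAt_mem (E := E') x) hf
    (mem_chart_source E' x) (mem_chart_source E _)
  have e2 : (chartAt E' x).symm (chartAt E' x x) = x := (chartAt E' x).left_inv (mem_chart_source _ _)
  have hη' : DifferentiableAt ℝ (coordRep (chartAt E (f x)) η)
      (chartAt E (f x) (f ((chartAt E' x).symm (chartAt E' x x)))) := by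
    rw [e2]
    exact ContDiffAt.differentiableAt hη (by simp)
  have h3 := extDeriv_pullback
    (f := fun z => chartAt E (f x) (f ((chartAt E' x).symm z))) hη' hF (by simpa using (WithTop.coe_le_coe.2 le_top :
    ((2 : ℕ∞) : WithTop ℕ∞) ≤ ∞))
  rw [dForm, e.extDeriv_eq]
  refine h3.trans ?_
  ext u
  rw [pullback_apply, mD_eq (hf.mdifferentiableAt (by simp)), dForm]
  simp only [ContinuousAlternatingMap.compContinuousLinearMap_apply]
  rw [e2]
  rfl

theorem dForm_eq_extDeriv {k : ℕ} (η : E → E [⋀^Fin k]→L[ℝ] ℂ) (y : E) :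
    dForm η y = extDeriv η y := by
  rw [dForm]
  congr 1
  funext z
  ext u
  have : cD (chartAt E y) z = ContinuousLinearMap.id ℝ E := mD_id (E := E) z
  rw [coordRep_apply, this]
  rfl

theorem smoothAt_iff_contDiffAt {k : ℕ} (η : E → E [⋀^Fin k]→L[ℝ] ℂ) (y : E) :
    SmoothAt η y ↔ ContDiffAt ℝ ∞ η y := by
  have : coordRep (chartAt E y) η = η := by
    funext z
    ext u
    have : cD (chartAt E y) z = ContinuousLinearMap.id ℝ E := mD_id (E := E) z
    rw [coordRep_apply, this]
    rfl
  rw [SmoothAt, this]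
  rfl

theorem coordRep_dForm {c : OpenPartialHomeomorph M E}
    (hc : c ∈ IsManifold.maximalAtlas 𝓘(ℂ, E) ω M) {y : E} (hy : y ∈ c.target) {k : ℕ}
    {η : M → E [⋀^Fin k]→L[ℝ] ℂ} (hη : SmoothAt η (c.symm y)) :
    coordRep c (dForm η) y = extDeriv (coordRep c η) y := by
  rw [coordRep_eq_pullback, coordRep_eq_pullback, ← dForm_eq_extDeriv,
    dForm_pullback (contMDiffAt_chart_symm hc hy) hη]

theorem SmoothAt.dForm {k : ℕ} {η : M → E [⋀^Fin k]→L[ℝ] ℂ} {x : M}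
    (h : ∀ᶠ z in 𝓝 x, SmoothAt η z) : SmoothAt (dForm η) x := by
  have h1 : coordRep (chartAt E x) (ZMoment.dForm η) =ᶠ[𝓝 (chartAt E x x)]
      extDeriv (coordRep (chartAt E x) η) := by
    filter_upwards [((chartAt E x).tendsto_symm (mem_chart_source E x)).eventually h,
      (chartAt E x).open_target.mem_nhds (mem_chart_target E x)] with y hy1 hy2
    exact coordRep_dForm (chartAt_mem x) hy2 hy1
  refine ContDiffAt.congr_of_eventuallyEq ?_ h1
  have h2 : ContDiffAt ℝ ∞ (coordRep (chartAt E x) η) (chartAt E x x) := h.self_of_nhds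
  exact (ContinuousAlternatingMap.alternatizeUncurryFinCLM ℝ E ℂ).contDiff.contDiffAt.comp _
    (h2.fderiv_right (m := ∞) (by simp))

theorem dForm_dForm {k : ℕ} {η : M → E [⋀^Fin k]→L[ℝ] ℂ} {x : M}
    (h : ∀ᶠ z in 𝓝 x, SmoothAt η z) : dForm (dForm η) x = 0 := by
  have h1 : coordRep (chartAt E x) (ZMoment.dForm η) =ᶠ[𝓝 (chartAt E x x)]
      extDeriv (coordRep (chartAt E x) η) := by
    filter_upwards [((chartAt E x).tendsto_symm (mem_chart_source E x)).eventually h,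
      (chartAt E x).open_target.mem_nhds (mem_chart_target E x)] with y hy1 hy2
    exact coordRep_dForm (chartAt_mem x) hy2 hy1
  have h2 : ContDiffAt ℝ ∞ (coordRep (chartAt E x) η) (chartAt E x x) := h.self_of_nhds
  rw [ZMoment.dForm, h1.extDeriv_eq]
  exact extDeriv_extDeriv_apply h2 (by simpa using (WithTop.coe_le_coe.2 le_top :
    ((2 : ℕ∞) : WithTop ℕ∞) ≤ ∞))

end Smooth

end ManifoldForms

section Functions

variable {E : Type*} [NormedAddCommGroup E] [NormedSpace ℂ E]
  {M : Type*} [TopologicalSpace M] [ChartedSpace E M]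
  {E' : Type*} [NormedAddCommGroup E'] [NormedSpace ℂ E']
  {M' : Type*} [TopologicalSpace M'] [ChartedSpace E' M']

variable (E) in
/-- Smoothness of a complex-valued function at a point. -/
abbrev SmFun (f : M → ℂ) (x : M) : Prop := ContMDiffAt 𝓘(ℝ, E) 𝓘(ℝ, ℂ) ∞ f x

theorem SmFun.mdiff {f : M → ℂ} {x : M} (h : SmFun E f x) :
    MDifferentiableAt 𝓘(ℝ, E) 𝓘(ℝ, ℂ) f x := ContMDiffAt.mdifferentiableAt h (by simp)

theorem smFun_iff_contDiffAt {f : E → ℂ} {y : E} : SmFun E f y ↔ ContDiffAt ℝ ∞ f y :=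
  contMDiffAt_iff_contDiffAt

theorem smFun_iff {c : OpenPartialHomeomorph M E}
    (hc : c ∈ IsManifold.maximalAtlas 𝓘(ℂ, E) ω M) {x : M} (hx : x ∈ c.source) {f : M → ℂ} :
    SmFun E f x ↔ ContDiffAt ℝ ∞ (fun y => f (c.symm y)) (c x) := by
  have e : c.symm (c x) = x := c.left_inv hx
  constructor
  · intro h
    rw [← contMDiffAt_iff_contDiffAt]
    refine ContMDiffAt.comp (c x) ?_ (contMDiffAt_chart_symm hc (c.map_source hx))
    rwa [e]
  · intro h
    rw [← contMDiffAt_iff_contDiffAt] at h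
    refine (ContMDiffAt.comp x h (contMDiffAt_chart hc hx)).congr_of_eventuallyEq ?_
    filter_upwards [c.open_source.mem_nhds hx] with z hz
    simp [c.left_inv hz]

/-- The differential of a function, as a `1`-form. -/
def dF (f : M → ℂ) : M → E [⋀^Fin 1]→L[ℝ] ℂ := fun x =>
  ContinuousAlternatingMap.ofSubsingleton ℝ E ℂ (0 : Fin 1) (mD E ℂ f x)

theorem dF_apply (f : M → ℂ) (x : M) (u : Fin 1 → E) : dF f x u = mD E ℂ f x (u 0) := rfl

theorem dc_apply (f : M → ℂ) (x : M) (u : Fin 1 → E) :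
    dc f x u = -mD E ℂ f x (Complex.I • u 0) := rfl

theorem pullback_dF {F : M' → M} {f : M → ℂ} {x : M'}
    (hf : MDifferentiableAt 𝓘(ℝ, E) 𝓘(ℝ, ℂ) f (F x))
    (hF : MDifferentiableAt 𝓘(ℝ, E') 𝓘(ℝ, E) F x) :
    pullback (E' := E') F (dF (E := E) f) x = dF (fun y => f (F y)) x := by
  ext u
  rw [pullback_apply, dF_apply, dF_apply, mD_comp hf hF]
  rfl

theorem HasMFDerivAt.mdifferentiableAt_real {F : M' → M} {x : M'}
    (hF : MDifferentiableAt 𝓘(ℂ, E') 𝓘(ℂ, E) F x) :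
    MDifferentiableAt 𝓘(ℝ, E') 𝓘(ℝ, E) F x :=
  (HasMFDerivAt.to_real hF.hasMFDerivAt).mdifferentiableAt

theorem pullback_dc {F : M' → M} {f : M → ℂ} {x : M'}
    (hf : MDifferentiableAt 𝓘(ℝ, E) 𝓘(ℝ, ℂ) f (F x))
    (hF : MDifferentiableAt 𝓘(ℂ, E') 𝓘(ℂ, E) F x) :
    pullback (E' := E') F (dc (E := E) f) x = dc (fun y => f (F y)) x := by
  ext u
  rw [pullback_apply, dc_apply, dc_apply, mD_comp hf (HasMFDerivAt.mdifferentiableAt_real hF),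
    ContinuousLinearMap.comp_apply, mD_J hF]

theorem dF_eq (g : E → ℂ) (y : E) :
    dF g y = ContinuousAlternatingMap.ofSubsingleton ℝ E ℂ (0 : Fin 1) (fderiv ℝ g y) := by
  rw [dF, mD_eq_fderiv]

theorem dc_eq (g : E → ℂ) (y : E) :
    dc g y = -ContinuousAlternatingMap.ofSubsingleton ℝ E ℂ (0 : Fin 1)
      ((fderiv ℝ g y).comp (J : E →L[ℝ] E)) := by
  ext u
  rw [dc_apply, mD_eq_fderiv]
  rfl

theorem dc_congr {f g : M → ℂ} {x : M} (h : f =ᶠ[𝓝 x] g) : dc f x = dc (E := E) g x := by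
  ext u
  rw [dc_apply, dc_apply, mD_congr h]

variable [FiniteDimensional ℂ E] [FiniteDimensional ℂ E'] [IsManifold 𝓘(ℂ, E) ω M]
  [IsManifold 𝓘(ℂ, E') ω M']

theorem SmFun.eventually_mdiff {f : M → ℂ} {x : M} (h : SmFun E f x) :
    ∀ᶠ z in 𝓝 x, MDifferentiableAt 𝓘(ℝ, E) 𝓘(ℝ, ℂ) f z := by
  have : IsManifold 𝓘(ℝ, E) ∞ M := isManifold_real
  have : IsManifold 𝓘(ℝ, E) 1 M := IsManifold.of_le (n := ∞) (by simp)
  filter_upwards [(contMDiffAt_iff_contMDiffAt_nhds (by simp)).1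
    (ContMDiffAt.of_le (m := 1) h (by simp))] with z hz using hz.mdifferentiableAt (by simp)

theorem contDiffAt_ofSubsingleton {V : Type*} [NormedAddCommGroup V] [NormedSpace ℝ V]
    {A : V → E →L[ℝ] ℂ} {y : V} (h : ContDiffAt ℝ ∞ A y) :
    ContDiffAt ℝ ∞ (fun z => ContinuousAlternatingMap.ofSubsingleton ℝ E ℂ (0 : Fin 1) (A z)) y := by
  rw [contDiffAt_alt_iff]
  intro u
  exact h.clm_apply contDiffAt_const

theorem smoothAt_of_coord {c : OpenPartialHomeomorph M E}
    (hc : c ∈ IsManifold.maximalAtlas 𝓘(ℂ, E) ω M) {x : M} (hx : x ∈ c.source) {k : ℕ}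
    {η : M → E [⋀^Fin k]→L[ℝ] ℂ} {η' : E → E [⋀^Fin k]→L[ℝ] ℂ}
    (h : ∀ᶠ z in 𝓝 x, pullback (E' := E) c.symm η (c z) = η' (c z))
    (h' : ContDiffAt ℝ ∞ η' (c x)) :
    SmoothAt η x := by
  rw [smoothAt_iff hc hx]
  refine h'.congr_of_eventuallyEq ?_
  filter_upwards [(c.tendsto_symm hx).eventually h, c.open_target.mem_nhds (c.map_source hx)]
    with y hy1 hy2
  rwa [c.right_inv hy2] at hy1

theorem SmFun.dF {f : M → ℂ} {x : M} (h : SmFun E f x) : SmoothAt (dF (E := E) f) x := by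
  have hc := chartAt_mem (E := E) x
  have hx := mem_chart_source E x
  refine smoothAt_of_coord hc hx (η' := ZMoment.dF fun y => f ((chartAt E x).symm y)) ?_ ?_
  · filter_upwards [h.eventually_mdiff, (chartAt E x).open_source.mem_nhds hx] with z hz hz'
    refine pullback_dF ?_ (HasMFDerivAt.mdifferentiableAt_real
      (mdifferentiableAt_chart_symm hc ((chartAt E x).map_source hz')))
    rwa [(chartAt E x).left_inv hz']
  · simp only [funext (dF_eq _)]
    exact contDiffAt_ofSubsingleton (((smFun_iff hc hx).1 h).fderiv_right (m := ∞) (by simp))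

theorem SmFun.dc {f : M → ℂ} {x : M} (h : SmFun E f x) : SmoothAt (dc (E := E) f) x := by
  have hc := chartAt_mem (E := E) x
  have hx := mem_chart_source E x
  refine smoothAt_of_coord hc hx (η' := ZMoment.dc fun y => f ((chartAt E x).symm y)) ?_ ?_
  · filter_upwards [h.eventually_mdiff, (chartAt E x).open_source.mem_nhds hx] with z hz hz'
    refine pullback_dc ?_ (mdifferentiableAt_chart_symm hc ((chartAt E x).map_source hz'))
    rwa [(chartAt E x).left_inv hz']
  · simp only [funext (dc_eq _)]
    refine ContDiffAt.neg (contDiffAt_ofSubsingleton ?_)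
    exact (((smFun_iff hc hx).1 h).fderiv_right (m := ∞) (by simp)).clm_comp contDiffAt_const

theorem coordRep_constOfIsEmpty (c : OpenPartialHomeomorph M E) (f : M → ℂ) :
    coordRep c (fun x => ContinuousAlternatingMap.constOfIsEmpty ℝ E (Fin 0) (f x)) =
      fun y => ContinuousAlternatingMap.constOfIsEmpty ℝ E (Fin 0) (f (c.symm y)) := rfl

theorem SmFun.smoothAt {f : M → ℂ} {x : M} (h : SmFun E f x) :
    SmoothAt (fun x => ContinuousAlternatingMap.constOfIsEmpty ℝ E (Fin 0) (f x)) x := by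
  rw [SmoothAt, coordRep_constOfIsEmpty]
  rw [contDiffAt_alt_iff]
  intro u
  exact (smFun_iff (chartAt_mem x) (mem_chart_source E x)).1 h

theorem mD_eq_fderiv_chart {f : M → ℂ} {x : M} (h : MDifferentiableAt 𝓘(ℝ, E) 𝓘(ℝ, ℂ) f x) :
    mD E ℂ f x = fderiv ℝ (fun y => f ((chartAt E x).symm y)) (chartAt E x x) := mD_eq h

theorem dForm_constOfIsEmpty {f : M → ℂ} {x : M} (h : MDifferentiableAt 𝓘(ℝ, E) 𝓘(ℝ, ℂ) f x) :
    dForm (fun x => ContinuousAlternatingMap.constOfIsEmpty ℝ E (Fin 0) (f x)) x = dF f x := by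
  rw [dForm, coordRep_constOfIsEmpty, extDeriv_constOfIsEmpty, dF, mD_eq_fderiv_chart h]

theorem dForm_dF {f : M → ℂ} {x : M} (h : ∀ᶠ z in 𝓝 x, SmFun E f z) :
    dForm (dF (E := E) f) x = 0 := by
  have e : dF (E := E) f =ᶠ[𝓝 x]
      dForm fun x => ContinuousAlternatingMap.constOfIsEmpty ℝ E (Fin 0) (f x) := by
    filter_upwards [h] with z hz using (dForm_constOfIsEmpty hz.mdiff).symm
  rw [dForm_congr e]
  exact dForm_dForm (by filter_upwards [h] with z hz using hz.smoothAt)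

theorem ddbar_congr {f g : M → ℂ} {x : M} (h : f =ᶠ[𝓝 x] g) : ddbar f x = ddbar (E := E) g x := by
  rw [ddbar, ddbar]
  congr 1
  refine dForm_congr ?_
  filter_upwards [h.eventuallyEq_nhds] with z hz using dc_congr hz

theorem pullback_smul {k : ℕ} (F : M' → M) (η : M → E [⋀^Fin k]→L[ℝ] ℂ) (a : ℝ) (x : M') :
    pullback (E' := E') F (fun y => a • η y) x = a • pullback (E' := E') F η x := rfl

theorem pullback_ddbar {F : M' → M} {f : M → ℂ} {x : M'} (hf : SmFun E f (F x))
    (hF : ∀ᶠ z in 𝓝 x, MDifferentiableAt 𝓘(ℂ, E') 𝓘(ℂ, E) F z)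
    (hF' : ContMDiffAt 𝓘(ℝ, E') 𝓘(ℝ, E) ∞ F x) :
    pullback (E' := E') F (ddbar (E := E) f) x = ddbar (fun y => f (F y)) x := by
  have e : pullback (E' := E') F (dc (E := E) f) =ᶠ[𝓝 x] dc fun y => f (F y) := by
    filter_upwards [hF, hF'.continuousAt.eventually hf.eventually_mdiff] with z hz hz'
    exact pullback_dc hz' hz
  change (1 / 2 : ℝ) • pullback (E' := E') F (dForm (dc (E := E) f)) x = _
  rw [← dForm_pullback hF' hf.dc, dForm_congr e, ddbar]

theorem SmoothAt.const_smul {k : ℕ} {η : M → E [⋀^Fin k]→L[ℝ] ℂ} {x : M} (h : SmoothAt η x) (a : ℝ) :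
    SmoothAt (fun y => a • η y) x := ContDiffAt.const_smul a h

theorem dForm_const_smul {k : ℕ} (η : M → E [⋀^Fin k]→L[ℝ] ℂ) (x : M) (a : ℝ) :
    dForm (fun y => a • η y) x = a • dForm η x :=
  extDeriv_smul (x := chartAt E x x) a (coordRep (chartAt E x) η)

theorem smoothAt_ddbar {f : M → ℂ} {x : M} (h : ∀ᶠ z in 𝓝 x, SmFun E f z) :
    SmoothAt (ddbar (E := E) f) x :=
  (SmoothAt.dForm (by filter_upwards [h] with z hz using hz.dc)).const_smul _

theorem dForm_ddbar {f : M → ℂ} {x : M} (h : ∀ᶠ z in 𝓝 x, SmFun E f z) :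
    dForm (ddbar (E := E) f) x = 0 := by
  have : ddbar (E := E) f = fun x => (1 / 2 : ℝ) • dForm (dc f) x := rfl
  rw [this, dForm_const_smul, dForm_dForm (by filter_upwards [h] with z hz using hz.dc), smul_zero]

theorem SmoothAt.add {k : ℕ} {η η' : M → E [⋀^Fin k]→L[ℝ] ℂ} {x : M} (h : SmoothAt η x)
    (h' : SmoothAt η' x) : SmoothAt (fun y => η y + η' y) x := ContDiffAt.add h h'

theorem dForm_add {k : ℕ} {η η' : M → E [⋀^Fin k]→L[ℝ] ℂ} {x : M} (h : SmoothAt η x)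
    (h' : SmoothAt η' x) : dForm (fun y => η y + η' y) x = dForm η x + dForm η' x :=
  extDeriv_fun_add (ContDiffAt.differentiableAt h (by simp))
    (ContDiffAt.differentiableAt h' (by simp))

theorem mD_add {f g : M → ℂ} {x : M} (hf : MDifferentiableAt 𝓘(ℝ, E) 𝓘(ℝ, ℂ) f x)
    (hg : MDifferentiableAt 𝓘(ℝ, E) 𝓘(ℝ, ℂ) g x) :
    mD E ℂ (fun y => f y + g y) x = mD E ℂ f x + mD E ℂ g x := mfderiv_add hf hg

theorem mD_const_smul {f : M → ℂ} {x : M} (hf : MDifferentiableAt 𝓘(ℝ, E) 𝓘(ℝ, ℂ) f x) (a : ℝ) :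
    mD E ℂ (fun y => a • f y) x = a • mD E ℂ f x := const_smul_mfderiv hf a

theorem dc_add {f g : M → ℂ} {x : M} (hf : MDifferentiableAt 𝓘(ℝ, E) 𝓘(ℝ, ℂ) f x)
    (hg : MDifferentiableAt 𝓘(ℝ, E) 𝓘(ℝ, ℂ) g x) :
    dc (E := E) (fun y => f y + g y) x = dc f x + dc g x := by
  ext u
  rw [dc_apply, mD_add hf hg, ContinuousAlternatingMap.add_apply, dc_apply, dc_apply,
    _root_.add_apply, neg_add]

theorem ddbar_add {f g : M → ℂ} {x : M} (hf : SmFun E f x) (hg : SmFun E g x) :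
    ddbar (E := E) (fun y => f y + g y) x = ddbar f x + ddbar g x := by
  have e : dc (E := E) (fun y => f y + g y) =ᶠ[𝓝 x] fun y => dc f y + dc g y := by
    filter_upwards [hf.eventually_mdiff, hg.eventually_mdiff] with z hz hz' using dc_add hz hz'
  rw [ddbar, dForm_congr e, dForm_add hf.dc hg.dc, smul_add]
  rfl

theorem ddbar_const_smul {f : M → ℂ} {x : M} (hf : SmFun E f x) (a : ℝ) :
    ddbar (E := E) (fun y => a • f y) x = a • ddbar f x := by
  have e : dc (E := E) (fun y => a • f y) =ᶠ[𝓝 x] fun y => a • dc f y := by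
    filter_upwards [hf.eventually_mdiff] with z hz
    ext u
    rw [dc_apply, mD_const_smul hz]
    simp [dc_apply]
  rw [ddbar, dForm_congr e, dForm_const_smul, smul_comm]
  rfl

/-- Real parts of holomorphic functions are pluriharmonic. -/
theorem ddbar_re {H : E → ℂ} {y : E} (h : ∀ᶠ z in 𝓝 y, DifferentiableAt ℂ H z ∧ ContDiffAt ℝ ∞ H z) :
    ddbar (E := E) (fun z => ((H z).re : ℂ)) y = 0 := by
  obtain ⟨U, hU, hUo, hyU⟩ := eventually_nhds_iff.1 h
  have hs : ∀ z ∈ U, ContDiffAt ℝ ∞ H z := fun z hz => (hU z hz).2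
  have hIm : ∀ z ∈ U, SmFun E (fun z => ((H z).im : ℂ)) z := fun z hz =>
    smFun_iff_contDiffAt.2 ((Complex.ofRealCLM.comp Complex.imCLM).contDiff.contDiffAt.comp z (hs z hz))
  have e : dc (E := E) (fun z => ((H z).re : ℂ)) =ᶠ[𝓝 y] dF fun z => ((H z).im : ℂ) := by
    filter_upwards [hUo.mem_nhds hyU] with z hz
    ext u
    have hd := (hU z hz).1.hasFDerivAt
    have h1 : HasFDerivAt (fun z => ((H z).re : ℂ)) ((Complex.ofRealCLM.comp Complex.reCLM).comp
        ((fderiv ℂ H z).restrictScalars ℝ)) z :=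
      (Complex.ofRealCLM.comp Complex.reCLM).hasFDerivAt.comp z (hd.restrictScalars ℝ)
    have h2 : HasFDerivAt (fun z => ((H z).im : ℂ)) ((Complex.ofRealCLM.comp Complex.imCLM).comp
        ((fderiv ℂ H z).restrictScalars ℝ)) z :=
      (Complex.ofRealCLM.comp Complex.imCLM).hasFDerivAt.comp z (hd.restrictScalars ℝ)
    rw [dc_apply, dF_apply, mD_eq_fderiv, mD_eq_fderiv, h1.fderiv, h2.fderiv]
    simp
  rw [ddbar, dForm_congr e, dForm_dF, smul_zero]
  filter_upwards [hUo.mem_nhds hyU] with z hz using hIm z hz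

theorem ddbar_log_normSq {g : E → ℂ} {y : E}
    (h : ∀ᶠ z in 𝓝 y, DifferentiableAt ℂ g z ∧ ContDiffAt ℝ ∞ g z)
    (hy : g y ≠ 0) : ddbar (E := E) (fun z => (Real.log (‖g z‖ ^ 2) : ℂ)) y = 0 := by
  have hc : ContinuousAt g y := h.self_of_nhds.1.continuousAt
  have h1 : ∀ᶠ z in 𝓝 y, g z / g y ∈ Complex.slitPlane := by
    have : ContinuousAt (fun z => g z / g y) y := hc.div_const _
    refine this (Complex.isOpen_slitPlane.mem_nhds ?_)
    change g y / g y ∈ _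
    rw [div_self hy]
    exact Complex.one_mem_slitPlane
  have e : (fun z => (Real.log (‖g z‖ ^ 2) : ℂ)) =ᶠ[𝓝 y]
      fun z => (((2 * Complex.log (g z / g y) + 2 * Real.log ‖g y‖ : ℂ)).re : ℂ) := by
    filter_upwards [h1, hc.eventually_ne hy] with z hz hz'
    have : (2 * Complex.log (g z / g y) + 2 * Real.log ‖g y‖ : ℂ).re =
        2 * Real.log ‖g z / g y‖ + 2 * Real.log ‖g y‖ := by
      simp [Complex.log_re]
    rw [this, norm_div, Real.log_div (by simpa) (by simpa), Real.log_pow]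
    push_cast
    ring
  rw [ddbar_congr e]
  refine ddbar_re ?_
  filter_upwards [h, h1] with z hz hz'
  have hd : DifferentiableAt ℂ (fun z => g z / g y) z := by
    simpa only [div_eq_mul_inv] using hz.1.mul_const (g y)⁻¹
  have hs : ContDiffAt ℝ ∞ (fun z => g z / g y) z := hz.2.div_const _
  refine ⟨((hd.clog hz').const_mul _).add_const _, ?_⟩
  exact (contDiffAt_const.mul (((Complex.contDiffAt_log hz').restrict_scalars ℝ).comp z hs)).add
    contDiffAt_const

theorem ddbar_eq {g : E → ℂ} {y : E} (h : ContDiffAt ℝ 2 g y) (u : Fin 2 → E) :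
    ddbar (E := E) g y u = (1 / 2 : ℝ) • (fderiv ℝ (fderiv ℝ g) y (u 1) (Complex.I • u 0) -
      fderiv ℝ (fderiv ℝ g) y (u 0) (Complex.I • u 1)) := by
  have hd : DifferentiableAt ℝ (fderiv ℝ g) y :=
    (h.fderiv_right (m := 1) (by norm_num)).differentiableAt (by simp)
  have hdd : DifferentiableAt ℝ (dc (E := E) g) y := by
    have e : dc (E := E) g = fun z => dc g z := rfl
    rw [e]
    simp only [dc_eq]
    refine DifferentiableAt.neg ?_
    let T : (E →L[ℝ] ℂ) →L[ℝ] (E [⋀^Fin 1]→L[ℝ] ℂ) := LinearMap.toContinuousLinearMap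
      { toFun := fun A => ContinuousAlternatingMap.ofSubsingleton ℝ E ℂ (0 : Fin 1) A
        map_add' := fun _ _ => rfl
        map_smul' := fun _ _ => rfl }
    exact T.differentiableAt.comp y (hd.clm_comp (differentiableAt_const (J : E →L[ℝ] E)))
  have h3 : ∀ (v : E) (w : Fin 1 → E), fderiv ℝ (fun z => dc (E := E) g z w) y v =
      -fderiv ℝ (fderiv ℝ g) y v (Complex.I • w 0) := by
    intro v w
    have e : (fun z => dc (E := E) g z w) = fun z => -(fderiv ℝ g z (Complex.I • w 0)) := by
      funext z
      rw [dc_apply, mD_eq_fderiv]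
    rw [e, fderiv_fun_neg, _root_.neg_apply,
      fderiv_clm_apply hd (differentiableAt_const _)]
    simp
  rw [ddbar, ContinuousAlternatingMap.smul_apply, dForm_eq_extDeriv, extDeriv_apply hdd]
  simp only [h3]
  simp [Fin.removeNth]
  ring

end Functions

section HolomorphicField

variable {E : Type*} [NormedAddCommGroup E] [NormedSpace ℂ E] [FiniteDimensional ℂ E]

/-- If the derivative of a function `u` along a holomorphic vector field `ξ` is pluriharmonic,
`ξ u = -2 Re κ`, then the contraction of `ξ` with `i ∂∂̄ u` is exact. -/
theorem ddbar_holomorphicField {u : E → ℂ} {ξ : E → E} {κ : E → ℂ} {y : E}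
    (hu : ContDiffAt ℝ 2 u y) (hξ : DifferentiableAt ℂ ξ y) (hκ : DifferentiableAt ℂ κ y)
    (h : ∀ᶠ z in 𝓝 y, fderiv ℝ u z (ξ z) = ((-2 * (κ z).re : ℝ) : ℂ)) (w : E) :
    ddbar (E := E) u y ![ξ y, w] = (1 / 2 : ℝ) • fderiv ℝ (fun z =>
      fderiv ℝ u z (Complex.I • ξ z) - ((2 * (κ z).im : ℝ) : ℂ)) y w := by
  have hd : DifferentiableAt ℝ (fderiv ℝ u) y :=
    (hu.fderiv_right (m := 1) (by norm_num)).differentiableAt (by simp)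
  have hξR : HasFDerivAt ξ ((fderiv ℂ ξ y).restrictScalars ℝ) y :=
    hξ.hasFDerivAt.restrictScalars ℝ
  have hκR : HasFDerivAt κ ((fderiv ℂ κ y).restrictScalars ℝ) y :=
    hκ.hasFDerivAt.restrictScalars ℝ
  have hJξ : HasFDerivAt (fun z => Complex.I • ξ z)
      (((Complex.I • ContinuousLinearMap.id ℂ E).comp (fderiv ℂ ξ y)).restrictScalars ℝ) y :=
    (((Complex.I • ContinuousLinearMap.id ℂ E).hasFDerivAt).comp y
      hξ.hasFDerivAt).restrictScalars ℝ
  have hre : HasFDerivAt (fun z => ((-2 * (κ z).re : ℝ) : ℂ))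
      (((-2 : ℝ) • (Complex.ofRealCLM.comp Complex.reCLM) : ℂ →L[ℝ] ℂ).comp
        ((fderiv ℂ κ y).restrictScalars ℝ)) y := by
    refine ((((-2 : ℝ) • (Complex.ofRealCLM.comp Complex.reCLM) : ℂ →L[ℝ] ℂ).hasFDerivAt).comp y
      hκR).congr_of_eventuallyEq (Filter.Eventually.of_forall fun z => ?_)
    simp
  have him : HasFDerivAt (fun z => ((2 * (κ z).im : ℝ) : ℂ))
      (((2 : ℝ) • (Complex.ofRealCLM.comp Complex.imCLM) : ℂ →L[ℝ] ℂ).comp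
        ((fderiv ℂ κ y).restrictScalars ℝ)) y := by
    refine ((((2 : ℝ) • (Complex.ofRealCLM.comp Complex.imCLM) : ℂ →L[ℝ] ℂ).hasFDerivAt).comp y
      hκR).congr_of_eventuallyEq (Filter.Eventually.of_forall fun z => ?_)
    simp
  have h1 : fderiv ℝ (fun z => fderiv ℝ u z (ξ z)) y =
      fderiv ℝ (fun z => ((-2 * (κ z).re : ℝ) : ℂ)) y := Filter.EventuallyEq.fderiv_eq h
  rw [fderiv_clm_apply hd hξR.differentiableAt, hre.fderiv, hξR.fderiv] at h1
  have h2 := DFunLike.congr_fun h1 (Complex.I • w)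
  rw [fderiv_fun_sub (hd.clm_apply hJξ.differentiableAt) him.differentiableAt,
    fderiv_clm_apply hd hJξ.differentiableAt, hJξ.fderiv, him.fderiv, ddbar_eq hu]
  simp at h2 ⊢
  have h3 := hu.isSymmSndFDerivAt (by simp)
  rw [h3 (ξ y) (Complex.I • w)]
  linear_combination -h2

end HolomorphicField

section Inhomogeneous

variable {E : Type*} [NormedAddCommGroup E] [NormedSpace ℂ E]
  {M : Type*} [TopologicalSpace M] [ChartedSpace E M]
  {E' : Type*} [NormedAddCommGroup E'] [NormedSpace ℂ E']
  {M' : Type*} [TopologicalSpace M'] [ChartedSpace E' M']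

/-- The expression of an inhomogeneous form in a chart. -/
def coordAlt (c : OpenPartialHomeomorph M E) (θ : M → Alt E) (y : E) : Alt E :=
  altComp (θ (c.symm y)) (cD c y)

/-- The exterior derivative of an inhomogeneous form. -/
def dA (θ : M → Alt E) (x : M) : Alt E
  | 0 => 0
  | k + 1 => dForm (fun z => θ z k) x

/-- The pull-back of an inhomogeneous form. -/
def pullAlt (f : M' → M) (θ : M → Alt E) (x : M') : Alt E' := altComp (θ (f x)) (mD E' E f x)

theorem dA_eq_dAlt (θ : M → Alt E) (x : M) :
    dA θ x = dAlt (coordAlt (chartAt E x) θ) (chartAt E x x) := by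
  funext k
  cases k <;> rfl

variable [IsManifold 𝓘(ℂ, E) ω M]

/-- Smoothness of an inhomogeneous form at a point. -/
def SmoothAltAt (θ : M → Alt E) (x : M) : Prop := ∀ k, SmoothAt (fun z => θ z k) x

theorem SmoothAltAt.coord {θ : M → Alt E} {x : M} (h : SmoothAltAt θ x) :
    ContDiffAlt (coordAlt (chartAt E x) θ) (chartAt E x x) := h

theorem coordAlt_chartAt (θ : M → Alt E) (x : M) :
    coordAlt (chartAt E x) θ (chartAt E x x) = θ x :=
  funext fun k => coordRep_chartAt (fun z => θ z k) x

variable [FiniteDimensional ℂ E]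

theorem SmoothAltAt.wedge {α β : M → Alt E} {x : M} (hα : SmoothAltAt α x)
    (hβ : SmoothAltAt β x) : SmoothAltAt (fun z => wedge (α z) (β z)) x := by
  have h := hα.coord.wedge hβ.coord
  simp only [coordAlt, ← altComp_wedge] at h
  exact h

theorem dA_wedge {α β : M → Alt E} {x : M} (hα : SmoothAltAt α x) (hβ : SmoothAltAt β x) :
    dA (fun z => wedge (α z) (β z)) x =
      wedge (dA α x) (β x) + wedge (signAlt (α x)) (dA β x) := by
  have h := dAlt_wedge hα.coord hβ.coord
  simp only [coordAlt_chartAt, ← dA_eq_dAlt] at h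
  rw [← h, dA_eq_dAlt]
  simp only [coordAlt, ← altComp_wedge]
  rfl

theorem SmoothAltAt.add {α β : M → Alt E} {x : M} (hα : SmoothAltAt α x)
    (hβ : SmoothAltAt β x) : SmoothAltAt (fun z => α z + β z) x := fun k => (hα k).add (hβ k)

theorem dA_add {α β : M → Alt E} {x : M} (hα : SmoothAltAt α x) (hβ : SmoothAltAt β x) :
    dA (fun z => α z + β z) x = dA α x + dA β x := by
  funext k
  cases k with
  | zero => simp [dA]
  | succ k => exact dForm_add (hα k) (hβ k)

theorem smoothAt_zero {k : ℕ} (x : M) : SmoothAt (fun _ : M => (0 : E [⋀^Fin k]→L[ℝ] ℂ)) x :=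
  contDiffAt_const (c := (0 : E [⋀^Fin k]→L[ℝ] ℂ))

theorem dForm_zero {k : ℕ} (x : M) : dForm (fun _ : M => (0 : E [⋀^Fin k]→L[ℝ] ℂ)) x = 0 := by
  have := dForm_const_smul (fun _ : M => (0 : E [⋀^Fin k]→L[ℝ] ℂ)) x 0
  simpa using this

theorem SmoothAltAt.const_smul {α : M → Alt E} {x : M} (hα : SmoothAltAt α x) (a : ℂ) :
    SmoothAltAt (fun z => a • α z) x := fun k => ContDiffAt.const_smul a (hα k)

theorem dA_const_smul {α : M → Alt E} {x : M} (hα : SmoothAltAt α x) (a : ℂ) :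
    dA (fun z => a • α z) x = a • dA α x := by
  funext k
  cases k with
  | zero => simp [dA]
  | succ k => exact extDeriv_const_smul a (hα.coord.diff k)

theorem SmoothAltAt.sum {ι : Type*} (s : Finset ι) {α : ι → M → Alt E} {x : M}
    (hα : ∀ i ∈ s, SmoothAltAt (α i) x) : SmoothAltAt (fun z => ∑ i ∈ s, α i z) x := by
  classical
  induction s using Finset.induction_on with
  | empty =>
    intro k
    simpa using smoothAt_zero x
  | insert i s hi ih =>
    simp only [Finset.sum_insert hi]
    exact (hα i (Finset.mem_insert_self i s)).add (ih fun j hj => hα j (Finset.mem_insert_of_mem hj))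

theorem dA_zero (x : M) : dA (fun _ : M => (0 : Alt E)) x = 0 := by
  funext k
  cases k with
  | zero => rfl
  | succ k => exact dForm_zero x

theorem dA_sum {ι : Type*} (s : Finset ι) {α : ι → M → Alt E} {x : M}
    (hα : ∀ i ∈ s, SmoothAltAt (α i) x) :
    dA (fun z => ∑ i ∈ s, α i z) x = ∑ i ∈ s, dA (α i) x := by
  classical
  induction s using Finset.induction_on with
  | empty => simpa using dA_zero x
  | insert i s hi ih =>
    simp only [Finset.sum_insert hi]
    rw [dA_add (hα i (Finset.mem_insert_self i s))
      (SmoothAltAt.sum s fun j hj => hα j (Finset.mem_insert_of_mem hj)),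
      ih fun j hj => hα j (Finset.mem_insert_of_mem hj)]

theorem smoothAltAt_ofDegree {k : ℕ} {η : M → E [⋀^Fin k]→L[ℝ] ℂ} {x : M} (h : SmoothAt η x) :
    SmoothAltAt (fun z => ofDegree k (η z)) x := by
  intro j
  by_cases hj : j = k
  · subst hj
    simpa [ofDegree] using h
  · simpa [ofDegree, hj] using smoothAt_zero x

theorem dA_ofDegree {k : ℕ} (η : M → E [⋀^Fin k]→L[ℝ] ℂ) (x : M) :
    dA (fun z => ofDegree k (η z)) x = ofDegree (k + 1) (dForm η x) := by
  funext j
  cases j with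
  | zero => simp [dA, ofDegree]
  | succ j =>
    by_cases hj : j = k
    · subst hj
      simp [ofDegree, dA]
    · simpa [ofDegree, hj, dA] using dForm_zero x

theorem altOne_eq : (altOne : Alt E) =
    ofDegree 0 (ContinuousAlternatingMap.constOfIsEmpty ℝ E (Fin 0) (1 : ℂ)) := rfl

theorem smul_altOne (a : ℂ) : a • (altOne : Alt E) =
    ofDegree 0 (ContinuousAlternatingMap.constOfIsEmpty ℝ E (Fin 0) a) := by
  funext j
  by_cases hj : j = 0
  · subst hj
    ext
    simp [altOne, ofDegree]
  · simp [altOne, ofDegree, hj]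

theorem smul_eq_wedge (a : ℂ) (θ : Alt E) : a • θ =
    wedge (ofDegree 0 (ContinuousAlternatingMap.constOfIsEmpty ℝ E (Fin 0) a)) θ := by
  rw [← smul_altOne, wedge_smul_left, altOne_wedge]

theorem SmoothAltAt.fun_smul {f : M → ℂ} {θ : M → Alt E} {x : M} (hf : SmFun E f x)
    (hθ : SmoothAltAt θ x) : SmoothAltAt (fun z => f z • θ z) x := by
  simp only [smul_eq_wedge]
  exact (smoothAltAt_ofDegree hf.smoothAt).wedge hθ

theorem dA_fun_smul {f : M → ℂ} {θ : M → Alt E} {x : M} (hf : SmFun E f x)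
    (hθ : SmoothAltAt θ x) :
    dA (fun z => f z • θ z) x = wedge (ofDegree 1 (dF f x)) (θ x) + f x • dA θ x := by
  simp only [smul_eq_wedge]
  rw [dA_wedge (smoothAltAt_ofDegree hf.smoothAt) hθ, dA_ofDegree, dForm_constOfIsEmpty hf.mdiff,
    ← smul_altOne, signAlt_smul, signAlt_altOne]

theorem smoothAltAt_altOne (x : M) : SmoothAltAt (fun _ : M => (altOne : Alt E)) x := by
  have : SmFun E (fun _ : M => (1 : ℂ)) x := contMDiffAt_const
  simp only [altOne_eq]
  exact smoothAltAt_ofDegree this.smoothAt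

theorem dA_altOne (x : M) : dA (fun _ : M => (altOne : Alt E)) x = 0 := by
  have h : SmFun E (fun _ : M => (1 : ℂ)) x := contMDiffAt_const
  have h2 : dF (E := E) (fun _ : M => (1 : ℂ)) x = 0 := by
    ext u
    have : mD E ℂ (fun _ : M => (1 : ℂ)) x = 0 := mfderiv_const
    rw [dF_apply, this]
    rfl
  simp only [altOne_eq]
  rw [dA_ofDegree, dForm_constOfIsEmpty h.mdiff, h2]
  simp [ofDegree]

theorem SmoothAltAt.wpow {η : M → E [⋀^Fin 2]→L[ℝ] ℂ} {x : M} (h : SmoothAt η x) (l : ℕ) :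
    SmoothAltAt (fun z => wpow (η z) l) x := by
  induction l with
  | zero => exact smoothAltAt_altOne x
  | succ l ih => exact (smoothAltAt_ofDegree h).wedge ih

theorem dA_wpow {η : M → E [⋀^Fin 2]→L[ℝ] ℂ} {x : M} (h : SmoothAt η x) (h0 : dForm η x = 0)
    (l : ℕ) : dA (fun z => wpow (η z) l) x = 0 := by
  induction l with
  | zero => exact dA_altOne x
  | succ l ih =>
    simp only [ZMoment.wpow]
    rw [dA_wedge (smoothAltAt_ofDegree h) (SmoothAltAt.wpow h l), ih, dA_ofDegree, h0,
      wedge_zero_right]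
    simp [ofDegree, wedge_zero_left]

theorem SmoothAltAt.powWedge {η ζ : M → E [⋀^Fin 2]→L[ℝ] ℂ} {θ : M → Alt E} {x : M}
    (h : SmoothAt η x) (h' : SmoothAt ζ x) (hθ : SmoothAltAt θ x) (l j : ℕ) :
    SmoothAltAt (fun z => powWedge (η z) (ζ z) (θ z) l j) x :=
  (SmoothAltAt.wpow h l).wedge ((SmoothAltAt.wpow h' j).wedge hθ)

theorem dA_powWedge {η ζ : M → E [⋀^Fin 2]→L[ℝ] ℂ} {θ : M → Alt E} {x : M}
    (h : SmoothAt η x) (h' : SmoothAt ζ x) (hθ : SmoothAltAt θ x) (h0 : dForm η x = 0)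
    (h0' : dForm ζ x = 0) (hθ0 : dA θ x = 0) (l j : ℕ) :
    dA (fun z => powWedge (η z) (ζ z) (θ z) l j) x = 0 := by
  simp only [ZMoment.powWedge]
  rw [dA_wedge (SmoothAltAt.wpow h l) ((SmoothAltAt.wpow h' j).wedge hθ),
    dA_wedge (SmoothAltAt.wpow h' j) hθ, dA_wpow h h0, dA_wpow h' h0', hθ0]
  simp [wedge_zero_left, wedge_zero_right]

theorem SmoothAt.fun_smul {f : M → ℂ} {k : ℕ} {η : M → E [⋀^Fin k]→L[ℝ] ℂ} {x : M}
    (hf : SmFun E f x) (hη : SmoothAt η x) : SmoothAt (fun z => f z • η z) x :=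
  ContDiffAt.smul ((smFun_iff (chartAt_mem x) (mem_chart_source E x)).1 hf) hη

end Inhomogeneous

section Atlas

variable {E : Type*} [NormedAddCommGroup E] [NormedSpace ℂ E]
  {M : Type*} [TopologicalSpace M] [ChartedSpace E M] [IsManifold 𝓘(ℂ, E) ω M]

theorem mem_maximalAtlas_of_contMDiffOn {c : OpenPartialHomeomorph M E}
    (h : ContMDiffOn 𝓘(ℂ, E) 𝓘(ℂ, E) ω c c.source)
    (h' : ContMDiffOn 𝓘(ℂ, E) 𝓘(ℂ, E) ω c.symm c.target) :
    c ∈ IsManifold.maximalAtlas 𝓘(ℂ, E) ω M := by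
  have key : ∀ e e' : OpenPartialHomeomorph M E,
      ContMDiffOn 𝓘(ℂ, E) 𝓘(ℂ, E) ω e.symm e.target →
      ContMDiffOn 𝓘(ℂ, E) 𝓘(ℂ, E) ω e' e'.source →
      ContDiffOn ℂ ω (e.symm.trans e') (e.symm.trans e').source := by
    intro e e' h1 h2
    rw [← contMDiffOn_iff_contDiffOn]
    rw [OpenPartialHomeomorph.trans_source]
    exact h2.comp (h1.mono Set.inter_subset_left) fun y hy => hy.2
  rw [IsManifold.maximalAtlas, mem_maximalAtlas_iff]
  intro e he
  have he' : e ∈ IsManifold.maximalAtlas 𝓘(ℂ, E) ω M :=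
    IsManifold.subset_maximalAtlas he
  have h1 := contMDiffOn_of_mem_maximalAtlas he'
  have h2 := contMDiffOn_symm_of_mem_maximalAtlas he'
  simp only [contDiffGroupoid, mem_groupoid_of_pregroupoid, contDiffPregroupoid,
    modelWithCornersSelf_coe, modelWithCornersSelf_coe_symm,
    Function.id_comp, Function.comp_id, Set.preimage_id, Set.range_id, Set.inter_univ]
  exact ⟨⟨key c e h' h1, key e c h2 h⟩, ⟨key e c h2 h, key c e h' h1⟩⟩

end Atlas

section Determinant

/-- The standard frame as a real basis. -/
def stdBasis (n : ℕ) : Module.Basis (Fin (2 * n)) ℝ (Fin n → ℂ) :=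
  (Pi.basis (fun _ : Fin n => Complex.basisOneI)).reindex
    (((Equiv.sigmaEquivProd (Fin n) (Fin 2)).trans finProdFinEquiv).trans
      (finCongr (Nat.mul_comm n 2)))

theorem stdBasis_apply (n : ℕ) (k : Fin (2 * n)) : stdBasis n k = stdFrame n k := by
  rw [stdBasis, Module.Basis.reindex_apply]
  set e := ((Equiv.sigmaEquivProd (Fin n) (Fin 2)).trans finProdFinEquiv).trans
      (finCongr (Nat.mul_comm n 2)) with he
  obtain ⟨⟨i, j⟩, rfl⟩ := e.surjective k
  rw [Equiv.symm_apply_apply, Pi.basis_apply, stdFrame]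
  have h1 : (e ⟨i, j⟩ : Fin (2 * n)).1 = j.1 + 2 * i.1 := rfl
  have h2 : (⟨(e ⟨i, j⟩ : Fin (2 * n)).1 / 2, by omega⟩ : Fin n) = i := by
    refine Fin.ext ?_
    simp only [h1]
    omega
  rw [h2]
  have h3 : (e ⟨i, j⟩ : Fin (2 * n)).1 % 2 = j.1 := by rw [h1]; omega
  rw [h3]
  congr 1
  fin_cases j <;> simp [Complex.coe_basisOneI]

theorem top_apply_comp {n : ℕ} (α : (Fin n → ℂ) [⋀^Fin (2 * n)]→L[ℝ] ℂ)
    (A : (Fin n → ℂ) →ₗ[ℝ] (Fin n → ℂ)) :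
    α (fun i => A (stdFrame n i)) = ((LinearMap.det A : ℝ) : ℂ) * α (stdFrame n) := by
  have key : ∀ L : ℂ →ₗ[ℝ] ℝ,
      L (α (fun i => A (stdFrame n i))) = LinearMap.det A * L (α (stdFrame n)) := by
    intro L
    have h := (L.compAlternatingMap α.toAlternatingMap).eq_smul_basis_det (stdBasis n)
    have hb : (stdFrame n : Fin (2 * n) → _) = stdBasis n := funext fun k => (stdBasis_apply n k).symm
    have h1 := congrArg (fun F => F (A ∘ stdBasis n)) h
    have h2 : L (α (A ∘ stdBasis n)) = L (α (stdBasis n)) * (stdBasis n).det (A ∘ stdBasis n) := h1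
    rw [Module.Basis.det_comp, Module.Basis.det_self, mul_one] at h2
    rw [hb]
    exact h2.trans (mul_comm _ _)
  refine Complex.ext ?_ ?_
  · simpa using key Complex.reLm
  · simpa using key Complex.imLm

theorem top_eq_zero {n : ℕ} {α : (Fin n → ℂ) [⋀^Fin (2 * n)]→L[ℝ] ℂ}
    (h : α (stdFrame n) = 0) : α = 0 := by
  have key : ∀ L : ℂ →ₗ[ℝ] ℝ, ∀ v, L (α v) = 0 := by
    intro L v
    have hb : (stdFrame n : Fin (2 * n) → _) = stdBasis n := funext fun k => (stdBasis_apply n k).symm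
    have h1 := ((L.compAlternatingMap α.toAlternatingMap).map_basis_eq_zero_iff (stdBasis n)).1 (by
      rw [← hb]
      change L (α (stdFrame n)) = 0
      rw [h, map_zero])
    exact congrArg (fun F => F v) h1
  ext v
  exact Complex.ext (key Complex.reLm v) (key Complex.imLm v)

theorem det_complex_linear {n : ℕ} (A : (Fin n → ℂ) →ₗ[ℂ] (Fin n → ℂ)) :
    LinearMap.det (A.restrictScalars ℝ) = ‖LinearMap.det A‖ ^ 2 := by
  rw [LinearMap.det_restrictScalars, Algebra.norm_complex_eq]
  simp [Complex.normSq_eq_norm_sq]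

end Determinant

section ZeroExtension

variable {E : Type*} [NormedAddCommGroup E] [NormedSpace ℂ E] [FiniteDimensional ℂ E]
  {M : Type*} [TopologicalSpace M] [ChartedSpace E M] [IsManifold 𝓘(ℂ, E) ω M]

open Classical in
/-- The expression of a form in a chart, extended by zero. -/
def extForm {k : ℕ} (c : OpenPartialHomeomorph M E) (η : M → E [⋀^Fin k]→L[ℝ] ℂ) (y : E) :
    E [⋀^Fin k]→L[ℝ] ℂ :=
  if y ∈ c.target then coordRep c η y else 0

theorem extForm_of_mem {k : ℕ} {c : OpenPartialHomeomorph M E} (η : M → E [⋀^Fin k]→L[ℝ] ℂ) {y : E}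
    (hy : y ∈ c.target) : extForm c η y = coordRep c η y := if_pos hy

theorem extForm_of_notMem {k : ℕ} {c : OpenPartialHomeomorph M E} (η : M → E [⋀^Fin k]→L[ℝ] ℂ)
    {y : E} (hy : y ∉ c.target) : extForm c η y = 0 := if_neg hy

theorem coordRep_eq_zero {k : ℕ} {c : OpenPartialHomeomorph M E} {η : M → E [⋀^Fin k]→L[ℝ] ℂ} {y : E}
    (h : η (c.symm y) = 0) : coordRep c η y = 0 := by
  ext u
  rw [coordRep_apply, h]
  rfl

theorem extForm_eq_zero {k : ℕ} {c : OpenPartialHomeomorph M E} {η : M → E [⋀^Fin k]→L[ℝ] ℂ} {y : E}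
    (hy : y ∉ c '' tsupport η) : extForm c η y = 0 := by
  by_cases h : y ∈ c.target
  · rw [extForm_of_mem _ h]
    refine coordRep_eq_zero (image_eq_zero_of_notMem_tsupport fun h' => hy ?_)
    exact ⟨_, h', c.right_inv h⟩
  · exact extForm_of_notMem _ h

section

variable {k : ℕ} {c : OpenPartialHomeomorph M E} (hc : c ∈ IsManifold.maximalAtlas 𝓘(ℂ, E) ω M)
  {η : M → E [⋀^Fin k]→L[ℝ] ℂ} (hη : ∀ x, SmoothAt η x) (hK : IsCompact (tsupport η))
  (hs : tsupport η ⊆ c.source)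

include hK hs in
theorem isClosed_image_tsupport : IsClosed (c '' tsupport η) :=
  (hK.image_of_continuousOn (c.continuousOn.mono hs)).isClosed

include hc hη in
theorem contDiffAt_coordRep {y : E} (hy : y ∈ c.target) : ContDiffAt ℝ ∞ (coordRep c η) y := by
  have h := (smoothAt_iff hc (c.map_target hy)).1 (hη (c.symm y))
  rwa [c.right_inv hy] at h

theorem extForm_eventuallyEq (η : M → E [⋀^Fin k]→L[ℝ] ℂ) {y : E} (hy : y ∈ c.target) :
    extForm c η =ᶠ[𝓝 y] coordRep c η := by
  filter_upwards [c.open_target.mem_nhds hy] with z hz using extForm_of_mem η hz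

include hK hs in
theorem extForm_eventuallyEq_zero {y : E} (hy : y ∉ c.target) :
    extForm c η =ᶠ[𝓝 y] fun _ => 0 := by
  have : y ∉ c '' tsupport η := by
    rintro ⟨x, hx, rfl⟩
    exact hy (c.map_source (hs hx))
  filter_upwards [(isClosed_image_tsupport hK hs).isOpen_compl.mem_nhds this] with z hz
  exact extForm_eq_zero hz

include hc hη hK hs

theorem contDiff_extForm : ContDiff ℝ ∞ (extForm c η) := by
  rw [contDiff_iff_contDiffAt]
  intro y
  by_cases hy : y ∈ c.target
  · exact (contDiffAt_coordRep hc hη hy).congr_of_eventuallyEq (extForm_eventuallyEq η hy)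
  · exact contDiffAt_const.congr_of_eventuallyEq (extForm_eventuallyEq_zero hK hs hy)

omit hη hs hc in
theorem hasCompactSupport_extForm_apply (hs : tsupport η ⊆ c.source) (u : Fin k → E) :
    HasCompactSupport fun y => extForm c η y u := by
  refine HasCompactSupport.intro (hK.image_of_continuousOn (c.continuousOn.mono hs)) fun y hy => ?_
  rw [extForm_eq_zero hy]
  rfl

theorem extForm_dForm (y : E) : extForm c (dForm η) y = extDeriv (extForm c η) y := by
  by_cases hy : y ∈ c.target
  · rw [extForm_of_mem _ hy, coordRep_dForm hc hy (hη _), (extForm_eventuallyEq η hy).extDeriv_eq]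
  · rw [extForm_of_notMem _ hy, (extForm_eventuallyEq_zero hK hs hy).extDeriv_eq]
    have := extDeriv_smul (𝕜 := ℝ) (x := y) 0 (fun _ : E => (0 : E [⋀^Fin k]→L[ℝ] ℂ))
    have h : (0 : E [⋀^Fin (k + 1)]→L[ℝ] ℂ) = extDeriv (0 : E → E [⋀^Fin k]→L[ℝ] ℂ) y := by
      simpa using this.symm
    exact h

end

end ZeroExtension

section Divergence

variable {V : Type*} [NormedAddCommGroup V] [NormedSpace ℝ V] [FiniteDimensional ℝ V]
  [MeasurableSpace V] [BorelSpace V] (μ : MeasureTheory.Measure V) [μ.IsAddHaarMeasure]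

theorem integral_fderiv_eq_zero {g : V → ℂ} (hg : ContDiff ℝ ∞ g) (hs : HasCompactSupport g) (v : V) :
    ∫ y, fderiv ℝ g y v ∂μ = 0 := by
  have hc : Continuous fun y => fderiv ℝ g y v :=
    (hg.continuous_fderiv (by simp)).clm_apply continuous_const
  have hs' : HasCompactSupport fun y => fderiv ℝ g y v := hs.fderiv_apply ℝ v
  have h := integral_bilinear_hasFDerivAt_right_eq_neg_left_of_integrable (μ := μ)
    (f := fun _ : V => (1 : ℂ)) (f' := fun _ => 0) (g := g) (g' := fderiv ℝ g) (v := v)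
    (B := ContinuousLinearMap.mul ℝ ℂ) (by simp)
    (by simpa using hc.integrable_of_hasCompactSupport hs')
    (by simpa using hg.continuous.integrable_of_hasCompactSupport hs)
    (fun x _ => hasFDerivAt_const _ _)
    (fun x _ => (hg.differentiable (by simp) x).hasFDerivAt)
  simpa using h

end Divergence

section Integral

open MeasureTheory

variable {n : ℕ} {M : Type*} [TopologicalSpace M] [ChartedSpace (Fin n → ℂ) M]
  [IsManifold 𝓘(ℂ, Fin n → ℂ) ω M]

/-- The integral of a form of top degree over the domain of a chart. -/
def chartIntegral (c : OpenPartialHomeomorph M (Fin n → ℂ))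
    (η : M → (Fin n → ℂ) [⋀^Fin (2 * n)]→L[ℝ] ℂ) : ℂ :=
  ∫ y in c.target, coordRep c η y (stdFrame n)

theorem setIntegral_coordRep (c : OpenPartialHomeomorph M (Fin n → ℂ))
    (η : M → (Fin n → ℂ) [⋀^Fin (2 * n)]→L[ℝ] ℂ) {S : Set M} (hS : S ⊆ c.source)
    (h : ∀ x ∉ S, η x = 0) :
    chartIntegral c η = ∫ y in c '' S, coordRep c η y (stdFrame n) := by
  refine setIntegral_eq_of_subset_of_forall_sdiff_eq_zero (t := c.target) (s := c '' S)
    (f := fun y => coordRep c η y (stdFrame n)) c.open_target.measurableSet ?_ ?_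
  · rintro _ ⟨x, hx, rfl⟩
    exact c.map_source (hS hx)
  · rintro y ⟨hy, hy'⟩
    rw [coordRep_eq_zero (h _ fun h' => hy' ⟨_, h', c.right_inv hy⟩)]
    rfl

theorem chartIntegral_eq {c c' : OpenPartialHomeomorph M (Fin n → ℂ)}
    (hc : c ∈ IsManifold.maximalAtlas 𝓘(ℂ, Fin n → ℂ) ω M)
    (hc' : c' ∈ IsManifold.maximalAtlas 𝓘(ℂ, Fin n → ℂ) ω M)
    {η : M → (Fin n → ℂ) [⋀^Fin (2 * n)]→L[ℝ] ℂ}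
    (h : ∀ x ∉ c.source, η x = 0) (h' : ∀ x ∉ c'.source, η x = 0) :
    chartIntegral c η = chartIntegral c' η := by
  have hz : ∀ x ∉ c.source ∩ c'.source, η x = 0 := by
    intro x hx
    by_cases h1 : x ∈ c.source
    · exact h' x fun h2 => hx ⟨h1, h2⟩
    · exact h x h1
  have hSo : IsOpen (c.source ∩ c'.source) := c.open_source.inter c'.open_source
  rw [setIntegral_coordRep c η Set.inter_subset_left hz,
    setIntegral_coordRep c' η Set.inter_subset_right hz]
  set S := c.source ∩ c'.source
  set f := fun y => c' (c.symm y)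
  have hf : f '' (c '' S) = c' '' S := by
    rw [Set.image_image]
    refine Set.image_congr fun x hx => ?_
    simp only [f, c.left_inv hx.1]
  have ho : IsOpen (c '' S) := c.isOpen_image_of_subset_source hSo Set.inter_subset_left
  have hmem : ∀ y ∈ c '' S, y ∈ c.target ∧ c.symm y ∈ c'.source := by
    rintro _ ⟨x, hx, rfl⟩
    rw [c.left_inv hx.1]
    exact ⟨c.map_source hx.1, hx.2⟩
  have hd : ∀ y ∈ c '' S, DifferentiableAt ℂ f y := by
    intro y hy
    rw [← mdifferentiableAt_iff_differentiableAt]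
    exact (mdifferentiableAt_chart hc' (hmem y hy).2).comp y
      (mdifferentiableAt_chart_symm hc (hmem y hy).1)
  have hinj : Set.InjOn f (c '' S) := by
    intro y hy z hz hyz
    have := c'.injOn (hmem y hy).2 (hmem z hz).2 hyz
    exact c.symm.injOn (hmem y hy).1 (hmem z hz).1 this
  rw [← hf, integral_image_eq_integral_abs_det_fderiv_smul volume ho.measurableSet
    (f' := fun y => fderiv ℝ f y)
    (fun y hy => ((hd y hy).restrictScalars ℝ).hasFDerivAt.hasFDerivWithinAt) hinj]
  refine setIntegral_congr_fun ho.measurableSet fun y hy => ?_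
  have h1 := coordRep_pullback hc' hc (f := fun x : M => x) mdifferentiableAt_id (hmem y hy).1
    (hmem y hy).2 η
  rw [pullback_id] at h1
  have hA : fderiv ℝ f y = (fderiv ℂ f y).restrictScalars ℝ :=
    ((hd y hy).hasFDerivAt.restrictScalars ℝ).fderiv
  have h2 := top_apply_comp (coordRep c' η (c' (c.symm y))) (fderiv ℝ f y : _ →ₗ[ℝ] _)
  have hdet : (0 : ℝ) ≤ LinearMap.det ((fderiv ℝ f y : (Fin n → ℂ) →L[ℝ] (Fin n → ℂ)) :
      (Fin n → ℂ) →ₗ[ℝ] (Fin n → ℂ)) := by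
    rw [hA]
    have := det_complex_linear ((fderiv ℂ f y : (Fin n → ℂ) →L[ℂ] (Fin n → ℂ)) :
      (Fin n → ℂ) →ₗ[ℂ] (Fin n → ℂ))
    exact this.symm ▸ sq_nonneg _
  change coordRep c η y (stdFrame n) = |LinearMap.det ((fderiv ℝ f y :
    (Fin n → ℂ) →L[ℝ] (Fin n → ℂ)) : (Fin n → ℂ) →ₗ[ℝ] (Fin n → ℂ))| •
      coordRep c' η (c' (c.symm y)) (stdFrame n)
  rw [abs_of_nonneg hdet, Complex.real_smul, ← h2, h1]
  rfl

theorem integrableOn_coordRep {c : OpenPartialHomeomorph M (Fin n → ℂ)}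
    (hc : c ∈ IsManifold.maximalAtlas 𝓘(ℂ, Fin n → ℂ) ω M)
    {η : M → (Fin n → ℂ) [⋀^Fin (2 * n)]→L[ℝ] ℂ} (hη : ∀ x, SmoothAt η x)
    (hK : IsCompact (tsupport η)) (hs : tsupport η ⊆ c.source) :
    IntegrableOn (fun y => coordRep c η y (stdFrame n)) c.target := by
  have h1 : Integrable fun y => extForm c η y (stdFrame n) := by
    have := contDiff_extForm hc hη hK hs
    refine Continuous.integrable_of_hasCompactSupport ?_
      (hasCompactSupport_extForm_apply hK hs _)
    rw [← continuousOn_univ]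
    exact continuous_alt_iff.1 this.continuous.continuousOn _
  refine (integrableOn_congr_fun (fun y hy => ?_) c.open_target.measurableSet).1 h1.integrableOn
  exact congrArg (fun α => α (stdFrame n)) (extForm_of_mem _ hy)

theorem chartIntegral_eq_integral (c : OpenPartialHomeomorph M (Fin n → ℂ))
    (η : M → (Fin n → ℂ) [⋀^Fin (2 * n)]→L[ℝ] ℂ) :
    chartIntegral c η = ∫ y, extForm c η y (stdFrame n) := by
  rw [chartIntegral, ← integral_indicator c.open_target.measurableSet]
  congr 1
  funext y
  by_cases hy : y ∈ c.target
  · rw [Set.indicator_of_mem hy, extForm_of_mem _ hy]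
  · rw [Set.indicator_of_notMem hy, extForm_of_notMem _ hy]
    rfl

variable [T2Space M] [CompactSpace M]

variable (M) in
/-- The functions of the partition of unity that defines the integral, with complex values. -/
def cutoff (i : M) : M → ℂ := fun x => ((partition (n := n) M i x : ℝ) : ℂ)

theorem smFun_ofReal {E N : Type*} [NormedAddCommGroup E] [NormedSpace ℂ E] [TopologicalSpace N]
    [ChartedSpace E N] {f : N → ℝ} {x : N} (h : ContMDiffAt 𝓘(ℝ, E) 𝓘(ℝ, ℝ) ∞ f x) :
    SmFun E (fun y => (f y : ℂ)) x :=
  ContMDiffAt.comp (g := fun t : ℝ => (t : ℂ)) x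
    (contMDiffAt_iff_contDiffAt.2 Complex.ofRealCLM.contDiff.contDiffAt) h

theorem cutoff_smooth (i x : M) : SmFun (Fin n → ℂ) (cutoff (n := n) M i) x :=
  smFun_ofReal ((partition (n := n) M i).contMDiff x)

theorem tsupport_cutoff_smul {k : ℕ} (i : M) (η : M → (Fin n → ℂ) [⋀^Fin k]→L[ℝ] ℂ) :
    tsupport (fun x => cutoff (n := n) M i x • η x) ⊆ (chartAt (Fin n → ℂ) i).source := by
  refine subset_trans (closure_mono ?_) ((exists_partition (n := n) M).choose_spec i)
  intro x hx h
  refine hx ?_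
  simp only [cutoff]
  have : (partition (n := n) M i x : ℝ) = 0 := by
    by_contra h0
    exact h0 h
  rw [this]
  simp

theorem tsupport_cutoff_smul_subset {k : ℕ} (i : M) (η : M → (Fin n → ℂ) [⋀^Fin k]→L[ℝ] ℂ) :
    tsupport (fun x => cutoff (n := n) M i x • η x) ⊆ tsupport η :=
  closure_mono fun x hx h => hx (by simp only [h, smul_zero])

variable (n M) in
/-- The indices of the nonzero functions of the partition of unity. -/
def cutoffs : Finset M :=
  ((partition (n := n) M).locallyFinite.finite_nonempty_of_compact).toFinset

theorem cutoff_eq_zero {i : M} (hi : i ∉ cutoffs n M) (x : M) : cutoff (n := n) M i x = 0 := by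
  rw [cutoffs, Set.Finite.mem_toFinset] at hi
  have : partition (n := n) M i x = 0 := by
    by_contra h
    exact hi ⟨x, h⟩
  simp [cutoff, this]

theorem sum_cutoff (x : M) : ∑ i ∈ cutoffs n M, cutoff (n := n) M i x = 1 := by
  have h1 := (partition (n := n) M).sum_eq_one (Set.mem_univ x)
  rw [finsum_eq_sum_of_support_subset (s := cutoffs n M)] at h1
  · simp only [cutoff]
    exact_mod_cast congrArg (fun t : ℝ => (t : ℂ)) h1
  · intro i hi
    by_contra h
    have := cutoff_eq_zero h x
    simp only [cutoff, Complex.ofReal_eq_zero] at this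
    exact hi this

theorem integral_eq_sum (η : M → (Fin n → ℂ) [⋀^Fin (2 * n)]→L[ℝ] ℂ) :
    integral η = ∑ i ∈ cutoffs n M, chartIntegral (chartAt (Fin n → ℂ) i)
      fun x => cutoff (n := n) M i x • η x := by
  rw [integral, finsum_eq_sum_of_support_subset (s := cutoffs n M)]
  · rfl
  · intro i hi
    by_contra h
    refine hi ?_
    have : ∀ x, (partition (n := n) M i x : ℝ) = 0 := by
      intro x
      have := cutoff_eq_zero h x
      simpa only [cutoff, Complex.ofReal_eq_zero] using this
    simp [this]

theorem smoothAt_cutoff_smul {k : ℕ} {η : M → (Fin n → ℂ) [⋀^Fin k]→L[ℝ] ℂ}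
    (hη : ∀ x, SmoothAt η x) (i x : M) : SmoothAt (fun x => cutoff (n := n) M i x • η x) x :=
  (hη x).fun_smul (cutoff_smooth i x)

theorem integrableOn_cutoff {η : M → (Fin n → ℂ) [⋀^Fin (2 * n)]→L[ℝ] ℂ}
    (hη : ∀ x, SmoothAt η x) (i : M) :
    IntegrableOn (fun y => coordRep (chartAt (Fin n → ℂ) i)
      (fun x => cutoff (n := n) M i x • η x) y (stdFrame n)) (chartAt (Fin n → ℂ) i).target :=
  integrableOn_coordRep (chartAt_mem i) (smoothAt_cutoff_smul hη i)
    (isClosed_tsupport _).isCompact (tsupport_cutoff_smul i η)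

/-- The integral of a form that is supported in the domain of a chart. -/
theorem integral_eq_chartIntegral {c : OpenPartialHomeomorph M (Fin n → ℂ)}
    (hc : c ∈ IsManifold.maximalAtlas 𝓘(ℂ, Fin n → ℂ) ω M)
    {η : M → (Fin n → ℂ) [⋀^Fin (2 * n)]→L[ℝ] ℂ} (hη : ∀ x, SmoothAt η x)
    (hs : tsupport η ⊆ c.source) : integral η = chartIntegral c η := by
  have h0 : ∀ x ∉ c.source, η x = 0 := fun x hx =>
    image_eq_zero_of_notMem_tsupport fun h => hx (hs h)
  have h1 : ∀ i, chartIntegral (chartAt (Fin n → ℂ) i) (fun x => cutoff (n := n) M i x • η x) =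
      chartIntegral c fun x => cutoff (n := n) M i x • η x := by
    intro i
    refine chartIntegral_eq (chartAt_mem i) hc (fun x hx => ?_) fun x hx => ?_
    · exact image_eq_zero_of_notMem_tsupport
        (f := fun x => cutoff (n := n) M i x • η x) fun h => hx (tsupport_cutoff_smul i η h)
    · rw [h0 x hx, smul_zero]
  rw [integral_eq_sum, Finset.sum_congr rfl fun i _ => h1 i]
  simp only [chartIntegral]
  rw [← integral_finsetSum]
  · refine setIntegral_congr_fun c.open_target.measurableSet fun y _ => ?_
    have : ∀ i, coordRep c (fun x => cutoff (n := n) M i x • η x) y (stdFrame n) =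
        cutoff (n := n) M i (c.symm y) * coordRep c η y (stdFrame n) := fun i => rfl
    simp only [this]
    rw [← Finset.sum_mul, sum_cutoff, one_mul]
  · intro i _
    exact integrableOn_coordRep hc (smoothAt_cutoff_smul hη i) (isClosed_tsupport _).isCompact
      ((tsupport_cutoff_smul_subset i η).trans hs)

theorem integral_add {η ζ : M → (Fin n → ℂ) [⋀^Fin (2 * n)]→L[ℝ] ℂ}
    (hη : ∀ x, SmoothAt η x) (hζ : ∀ x, SmoothAt ζ x) :
    integral (fun x => η x + ζ x) = integral η + integral ζ := by
  rw [integral_eq_sum, integral_eq_sum, integral_eq_sum, ← Finset.sum_add_distrib]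
  refine Finset.sum_congr rfl fun i _ => ?_
  simp only [chartIntegral]
  rw [← MeasureTheory.integral_add (integrableOn_cutoff hη i) (integrableOn_cutoff hζ i)]
  refine setIntegral_congr_fun (chartAt (Fin n → ℂ) i).open_target.measurableSet fun y _ => ?_
  exact mul_add _ _ _

theorem integral_const_smul (η : M → (Fin n → ℂ) [⋀^Fin (2 * n)]→L[ℝ] ℂ) (a : ℂ) :
    integral (fun x => a • η x) = a * integral η := by
  rw [integral_eq_sum, integral_eq_sum, Finset.mul_sum]
  refine Finset.sum_congr rfl fun i _ => ?_
  simp only [chartIntegral]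
  rw [← MeasureTheory.integral_const_mul]
  refine setIntegral_congr_fun (chartAt (Fin n → ℂ) i).open_target.measurableSet fun y _ => ?_
  exact mul_left_comm _ _ _

theorem integral_zero : integral (fun _ : M => (0 : (Fin n → ℂ) [⋀^Fin (2 * n)]→L[ℝ] ℂ)) = 0 := by
  have := integral_const_smul (fun _ : M => (0 : (Fin n → ℂ) [⋀^Fin (2 * n)]→L[ℝ] ℂ)) 0
  simpa using this

theorem smoothAt_sum {E N ι : Type*} [NormedAddCommGroup E] [NormedSpace ℂ E]
    [FiniteDimensional ℂ E] [TopologicalSpace N]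
    [ChartedSpace E N] [IsManifold 𝓘(ℂ, E) ω N] {k : ℕ} (s : Finset ι)
    {η : ι → N → E [⋀^Fin k]→L[ℝ] ℂ} {x : N} (hη : ∀ i ∈ s, SmoothAt (η i) x) :
    SmoothAt (fun x => ∑ i ∈ s, η i x) x := by
  classical
  induction s using Finset.induction_on with
  | empty => simpa using smoothAt_zero x
  | insert i s hi ih =>
    simp only [Finset.sum_insert hi]
    exact (hη i (Finset.mem_insert_self i s)).add (ih fun j hj => hη j (Finset.mem_insert_of_mem hj))

theorem dForm_sum {E N ι : Type*} [NormedAddCommGroup E] [NormedSpace ℂ E]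
    [FiniteDimensional ℂ E] [TopologicalSpace N]
    [ChartedSpace E N] [IsManifold 𝓘(ℂ, E) ω N] {k : ℕ} (s : Finset ι)
    {η : ι → N → E [⋀^Fin k]→L[ℝ] ℂ} {x : N} (hη : ∀ i ∈ s, SmoothAt (η i) x) :
    dForm (fun x => ∑ i ∈ s, η i x) x = ∑ i ∈ s, dForm (η i) x := by
  classical
  induction s using Finset.induction_on with
  | empty => simpa using dForm_zero x
  | insert i s hi ih =>
    simp only [Finset.sum_insert hi]
    rw [dForm_add (hη i (Finset.mem_insert_self i s))
      (smoothAt_sum s fun j hj => hη j (Finset.mem_insert_of_mem hj)),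
      ih fun j hj => hη j (Finset.mem_insert_of_mem hj)]

theorem integral_sum {ι : Type*} (s : Finset ι)
    {η : ι → M → (Fin n → ℂ) [⋀^Fin (2 * n)]→L[ℝ] ℂ} (hη : ∀ i ∈ s, ∀ x, SmoothAt (η i) x) :
    integral (fun x => ∑ i ∈ s, η i x) = ∑ i ∈ s, integral (η i) := by
  classical
  induction s using Finset.induction_on with
  | empty => simpa using integral_zero (n := n) (M := M)
  | insert i s hi ih =>
    simp only [Finset.sum_insert hi]
    rw [integral_add (hη i (Finset.mem_insert_self i s))
      (fun x => smoothAt_sum s fun j hj => hη j (Finset.mem_insert_of_mem hj) x),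
      ih fun j hj => hη j (Finset.mem_insert_of_mem hj)]

theorem integral_postcomp {η ζ : M → (Fin n → ℂ) [⋀^Fin (2 * n)]→L[ℝ] ℂ} (L : ℂ →L[ℝ] ℂ)
    (hη : ∀ x, SmoothAt η x) (h : ∀ x u, ζ x u = L (η x u)) :
    integral ζ = L (integral η) := by
  rw [integral_eq_sum, integral_eq_sum, map_sum]
  refine Finset.sum_congr rfl fun i _ => ?_
  simp only [chartIntegral]
  rw [← L.integral_comp_comm (integrableOn_cutoff hη i)]
  refine setIntegral_congr_fun (chartAt (Fin n → ℂ) i).open_target.measurableSet fun y _ => ?_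
  change (((partition (n := n) M i _ : ℝ) : ℂ)) * ζ _ _ =
    L ((((partition (n := n) M i _ : ℝ) : ℂ)) * η _ _)
  rw [← Complex.real_smul, ← Complex.real_smul, map_smul, h]

theorem eq_sum_cutoff {k : ℕ} (η : M → (Fin n → ℂ) [⋀^Fin k]→L[ℝ] ℂ) (x : M) :
    ∑ i ∈ cutoffs n M, cutoff (n := n) M i x • η x = η x := by
  rw [← Finset.sum_smul, sum_cutoff, one_smul]

theorem integral_extDeriv_eq_zero {m : ℕ}
    {G : (Fin (m + 1) → ℂ) → (Fin (m + 1) → ℂ) [⋀^Fin (2 * m + 1)]→L[ℝ] ℂ}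
    (hG : ContDiff ℝ ∞ G) (hs : ∀ u, HasCompactSupport fun y => G y u)
    (v : Fin (2 * m + 1 + 1) → Fin (m + 1) → ℂ) :
    ∫ y, extDeriv G y v = 0 := by
  have hg : ∀ u, ContDiff ℝ ∞ fun y => G y u := fun u =>
    contDiff_iff_contDiffAt.2 fun y => contDiffAt_alt_iff.1 hG.contDiffAt u
  have h1 : ∀ y, extDeriv G y v =
      ∑ i, (-1 : ℂ) ^ i.val * fderiv ℝ (fun z => G z (i.removeNth v)) y (v i) := by
    intro y
    rw [extDeriv_apply (hG.differentiable (by simp) y) v]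
    simp
  simp only [h1]
  have hint : ∀ (u) (w : Fin (m + 1) → ℂ), Integrable fun y => fderiv ℝ (fun z => G z u) y w := by
    intro u w
    refine Continuous.integrable_of_hasCompactSupport ?_ ((hs u).fderiv_apply ℝ w)
    exact ((hg u).continuous_fderiv (by simp)).clm_apply continuous_const
  rw [integral_finsetSum _ fun i _ => (hint _ _).const_mul ((-1 : ℂ) ^ i.val)]
  refine Finset.sum_eq_zero fun i _ => ?_
  rw [MeasureTheory.integral_const_mul, integral_fderiv_eq_zero volume (hg _) (hs _), mul_zero]

/-- Stokes' theorem on a compact complex manifold. -/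
theorem integral_dA {θ : M → Alt (Fin n → ℂ)} (hθ : ∀ x, SmoothAltAt θ x) :
    integral (fun x => dA θ x (2 * n)) = 0 := by
  obtain _ | m := n
  · exact integral_zero
  set η : M → (Fin (m + 1) → ℂ) [⋀^Fin (2 * m + 1)]→L[ℝ] ℂ := fun x => θ x (2 * m + 1)
  have hη : ∀ x, SmoothAt η x := fun x => hθ x _
  change integral (fun x => dForm η x) = 0
  have h1 : (fun x => dForm η x) = fun x => ∑ i ∈ cutoffs (m + 1) M,
      dForm (fun x => cutoff (n := m + 1) M i x • η x) x := by
    funext x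
    rw [← dForm_sum _ fun i _ => smoothAt_cutoff_smul hη i x]
    simp only [eq_sum_cutoff]
  rw [h1, integral_sum]
  · refine Finset.sum_eq_zero fun i _ => ?_
    have hsm := smoothAt_cutoff_smul hη i
    set ζ := fun x => cutoff (n := m + 1) M i x • η x
    have hs : tsupport ζ ⊆ _ := tsupport_cutoff_smul i η
    have hK : IsCompact (tsupport ζ) := (isClosed_tsupport _).isCompact
    have hs' : tsupport (fun x => dForm ζ x) ⊆ (chartAt (Fin (m + 1) → ℂ) i).source := by
      refine subset_trans (closure_minimal ?_ (isClosed_tsupport ζ)) hs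
      intro x hx
      by_contra h
      refine hx ?_
      have e : ζ =ᶠ[𝓝 x] fun _ => 0 := notMem_tsupport_iff_eventuallyEq.1 h
      exact (dForm_congr e).trans (dForm_zero x)
    rw [integral_eq_chartIntegral (chartAt_mem i)
      (fun x => SmoothAt.dForm (Filter.Eventually.of_forall hsm)) hs', chartIntegral_eq_integral]
    have h5 : ∀ y, extForm (chartAt (Fin (m + 1) → ℂ) i) (dForm ζ) y =
        extDeriv (extForm (chartAt (Fin (m + 1) → ℂ) i) ζ) y :=
      extForm_dForm (chartAt_mem i) hsm hK hs
    change ∫ y, extForm (chartAt (Fin (m + 1) → ℂ) i) (dForm ζ) y (stdFrame (m + 1)) = 0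
    simp only [h5]
    exact integral_extDeriv_eq_zero (contDiff_extForm (chartAt_mem i) hsm hK hs)
      (fun u => hasCompactSupport_extForm_apply hK hs u) _
  · intro i _ x
    exact SmoothAt.dForm (Filter.Eventually.of_forall (smoothAt_cutoff_smul hη i))

end Integral

section Naturality

variable {n : ℕ} {M : Type*} [TopologicalSpace M] [ChartedSpace (Fin n → ℂ) M]
  [IsManifold 𝓘(ℂ, Fin n → ℂ) ω M] [T2Space M] [CompactSpace M]
  {M' : Type*} [TopologicalSpace M'] [ChartedSpace (Fin n → ℂ) M']
  [IsManifold 𝓘(ℂ, Fin n → ℂ) ω M'] [T2Space M'] [CompactSpace M']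

theorem pullback_sum {E E' N N' ι : Type*} [NormedAddCommGroup E] [NormedSpace ℂ E]
    [NormedAddCommGroup E'] [NormedSpace ℂ E'] [TopologicalSpace N] [TopologicalSpace N']
    [ChartedSpace E N] [ChartedSpace E' N'] {k : ℕ} (s : Finset ι) (F : N' → N)
    (η : ι → N → E [⋀^Fin k]→L[ℝ] ℂ) (x : N') :
    pullback (E' := E') F (fun z => ∑ i ∈ s, η i z) x =
      ∑ i ∈ s, pullback (E' := E') F (η i) x := by
  classical
  induction s using Finset.induction_on with
  | empty => rfl
  | insert i s hi ih =>
    simp only [Finset.sum_insert hi]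
    rw [← ih]
    rfl

/-- The integral is invariant under biholomorphic maps. -/
theorem integral_pullback (e : M ≃ₜ M') (he : ContMDiff 𝓘(ℂ, Fin n → ℂ) 𝓘(ℂ, Fin n → ℂ) ω e)
    (he' : ContMDiff 𝓘(ℂ, Fin n → ℂ) 𝓘(ℂ, Fin n → ℂ) ω e.symm)
    {η : M' → (Fin n → ℂ) [⋀^Fin (2 * n)]→L[ℝ] ℂ} (hη : ∀ x, SmoothAt η x) :
    integral (pullback (E' := Fin n → ℂ) e η) = integral η := by
  have h1 : pullback (E' := Fin n → ℂ) e η = fun x => ∑ i ∈ cutoffs n M',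
      pullback (E' := Fin n → ℂ) e (fun z => cutoff (n := n) M' i z • η z) x := by
    funext x
    rw [← pullback_sum]
    simp only [eq_sum_cutoff]
  have h2 : integral η = ∑ i ∈ cutoffs n M', integral fun z => cutoff (n := n) M' i z • η z := by
    rw [← integral_sum _ fun i _ => smoothAt_cutoff_smul hη i]
    simp only [eq_sum_cutoff]
  have her : ∀ x, ContMDiffAt 𝓘(ℝ, Fin n → ℂ) 𝓘(ℝ, Fin n → ℂ) ∞ e x := fun x =>
    ContMDiffAt.to_real (he x)
  rw [h1, h2, integral_sum _ fun i _ x =>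
    SmoothAt.pullback (her x) (smoothAt_cutoff_smul hη i (e x))]
  refine Finset.sum_congr rfl fun i _ => ?_
  have hζ := smoothAt_cutoff_smul hη i
  have hs := tsupport_cutoff_smul i η
  set ζ := fun z => cutoff (n := n) M' i z • η z
  set c' := chartAt (Fin n → ℂ) i
  have hc' : c' ∈ IsManifold.maximalAtlas 𝓘(ℂ, Fin n → ℂ) ω M' := chartAt_mem i
  set c : OpenPartialHomeomorph M (Fin n → ℂ) := e.toOpenPartialHomeomorph.trans c' with hcdef
  have hsrc : c.source = e ⁻¹' c'.source := by simp [hcdef]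
  have htgt : c.target = c'.target := by simp [hcdef]
  have hc : c ∈ IsManifold.maximalAtlas 𝓘(ℂ, Fin n → ℂ) ω M := by
    refine mem_maximalAtlas_of_contMDiffOn ?_ ?_
    · refine (contMDiffOn_of_mem_maximalAtlas hc').comp he.contMDiffOn ?_
      intro x hx
      rw [hsrc] at hx
      exact hx
    · refine he'.contMDiffOn.comp (t := Set.univ) ?_ fun _ _ => Set.mem_univ _
      rw [htgt]
      exact contMDiffOn_symm_of_mem_maximalAtlas hc'
  have hs2 : tsupport (pullback (E' := Fin n → ℂ) e ζ) ⊆ c.source := by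
    rw [hsrc]
    refine subset_trans (closure_minimal ?_ ((isClosed_tsupport ζ).preimage e.continuous))
      (Set.preimage_mono hs)
    intro x hx
    refine subset_tsupport ζ fun h => hx ?_
    ext u
    rw [pullback_apply, h]
    rfl
  rw [integral_eq_chartIntegral hc' hζ hs, integral_eq_chartIntegral hc
    (fun x => SmoothAt.pullback (her x) (hζ (e x))) hs2, chartIntegral, chartIntegral, htgt]
  refine MeasureTheory.setIntegral_congr_fun c'.open_target.measurableSet fun y hy => ?_
  have hy' : y ∈ c.target := htgt ▸ hy
  have h3 : pullback (E' := Fin n → ℂ) c.symm (pullback (E' := Fin n → ℂ) e ζ) y =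
      pullback (E' := Fin n → ℂ) (fun z => e (c.symm z)) ζ y :=
    pullback_pullback ((her _).mdifferentiableAt (by simp))
      ((contMDiffAt_chart_symm hc hy').mdifferentiableAt (by simp)) ζ
  have h4 : (fun z => e (c.symm z)) = c'.symm := by
    funext z
    simp [hcdef]
  rw [h4] at h3
  exact congrArg (fun α => α (stdFrame n)) h3

end Naturality

section Laplacian

variable {n : ℕ}

theorem topRatio_smul {α β : Alt (Fin n → ℂ)} (hβ : β (2 * n) (stdFrame n) ≠ 0) :
    topRatio α β • β (2 * n) = α (2 * n) := by
  rw [← sub_eq_zero]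
  refine top_eq_zero ?_
  rw [ContinuousAlternatingMap.sub_apply, ContinuousAlternatingMap.smul_apply, topRatio,
    smul_eq_mul, div_mul_cancel₀ _ hβ, sub_self]

theorem topRatio_altComp {α β : Alt (Fin n → ℂ)} (A : (Fin n → ℂ) →L[ℝ] (Fin n → ℂ))
    (hA : LinearMap.det (A : (Fin n → ℂ) →ₗ[ℝ] (Fin n → ℂ)) ≠ 0) :
    topRatio (altComp α A) (altComp β A) = topRatio α β := by
  have h1 := top_apply_comp (α (2 * n)) (A : (Fin n → ℂ) →ₗ[ℝ] (Fin n → ℂ))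
  have h2 := top_apply_comp (β (2 * n)) (A : (Fin n → ℂ) →ₗ[ℝ] (Fin n → ℂ))
  change α (2 * n) (fun i => A (stdFrame n i)) / β (2 * n) (fun i => A (stdFrame n i)) = _
  have h1' : α (2 * n) (fun i => A (stdFrame n i)) = _ := h1
  have h2' : β (2 * n) (fun i => A (stdFrame n i)) = _ := h2
  rw [h1', h2', topRatio, mul_div_mul_left]
  exact_mod_cast hA

theorem altComp_J_top (α : Alt (Fin n → ℂ)) : altComp α J (2 * n) = α (2 * n) := by
  rw [← sub_eq_zero]
  refine top_eq_zero ?_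
  have h1 := top_apply_comp (α (2 * n))
    ((Complex.I • (LinearMap.id : (Fin n → ℂ) →ₗ[ℂ] (Fin n → ℂ))).restrictScalars ℝ)
  rw [det_complex_linear, LinearMap.det_smul] at h1
  have h2 : altComp α J (2 * n) (stdFrame n) = α (2 * n) (stdFrame n) := by
    refine Eq.trans h1 ?_
    simp
  rw [ContinuousAlternatingMap.sub_apply, h2, sub_self]

variable {E : Type*} [NormedAddCommGroup E] [NormedSpace ℂ E]

theorem wedge_ofDegree_one_comm (α β : E [⋀^Fin 1]→L[ℝ] ℂ) :
    wedge (ofDegree 1 α) (ofDegree 1 β) = -wedge (ofDegree 1 β) (ofDegree 1 α) := by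
  funext k
  rw [(wedge_comm_aux k _ _).2 (signAlt_ofDegree_one α), signAlt_ofDegree_one, wedge_neg_left]

variable {M : Type*} [TopologicalSpace M] [ChartedSpace (Fin n → ℂ) M]
  [IsManifold 𝓘(ℂ, Fin n → ℂ) ω M]

theorem altComp_add (α β : Alt E) {E' : Type*} [NormedAddCommGroup E'] [NormedSpace ℂ E']
    (A : E' →L[ℝ] E) : altComp (α + β) A = altComp α A + altComp β A := rfl

theorem dF_comp_J {N : Type*} [TopologicalSpace N] [ChartedSpace E N] (f : N → ℂ) (x : N) :
    (dF (E := E) f x).compContinuousLinearMap (J : E →L[ℝ] E) = -dc f x := by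
  ext u
  rw [ContinuousAlternatingMap.neg_apply, dc_apply, neg_neg]
  rfl

theorem dc_comp_J {N : Type*} [TopologicalSpace N] [ChartedSpace E N] (f : N → ℂ) (x : N) :
    (dc (E := E) f x).compContinuousLinearMap (J : E →L[ℝ] E) = dF f x := by
  ext u
  rw [dF_apply]
  change -mD E ℂ f x (Complex.I • Complex.I • u 0) = _
  rw [smul_smul, Complex.I_mul_I, neg_one_smul, map_neg, neg_neg]

/-- `(dg ∧ dᶜh - dh ∧ dᶜg) ∧ ωˡ` has no component of top degree. -/
theorem wedge_dF_dc_top (f g : M → ℂ) (x : M) (η : (Fin n → ℂ) [⋀^Fin 2]→L[ℝ] ℂ)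
    (hη : η.compContinuousLinearMap J = η) (l : ℕ) :
    wedge (wedge (ofDegree 1 (dF g x)) (ofDegree 1 (dc f x))) (wpow η l) (2 * n) =
      wedge (wedge (ofDegree 1 (dF f x)) (ofDegree 1 (dc g x))) (wpow η l) (2 * n) := by
  have h := altComp_J_top
    (wedge (wedge (ofDegree 1 (dF g x)) (ofDegree 1 (dc f x))) (wpow η l))
  rw [← h, altComp_wedge, altComp_wedge, altComp_ofDegree, altComp_ofDegree, altComp_wpow, hη,
    dF_comp_J, dc_comp_J]
  have h2 : ofDegree 1 (-dc g x) = -ofDegree 1 (dc (E := Fin n → ℂ) g x) := Pi.single_neg _ _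
  rw [h2, wedge_neg_left, wedge_ofDegree_one_comm, neg_neg]

theorem integral_congr_form [T2Space M] [CompactSpace M]
    {η ζ : M → (Fin n → ℂ) [⋀^Fin (2 * n)]→L[ℝ] ℂ} (h : ∀ x, η x = ζ x) :
    integral η = integral ζ := by
  rw [funext h]

variable [T2Space M] [CompactSpace M]

theorem laplacian_smul {η : M → (Fin n → ℂ) [⋀^Fin 2]→L[ℝ] ℂ} (f : M → ℂ) (x : M)
    (hη : wpow (η x) n (2 * n) (stdFrame n) ≠ 0) :
    laplacian η f x • wpow (η x) n (2 * n) = (((1 / (2 * Real.pi) : ℝ) : ℂ) * n) •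
      wedge (ofDegree 2 (ddbar f x)) (wpow (η x) (n - 1)) (2 * n) := by
  rw [laplacian, mul_smul, topRatio_smul hη]

/-- The Laplacian of a Kähler metric on a compact manifold is symmetric. -/
theorem integral_laplacian_comm {η : M → (Fin n → ℂ) [⋀^Fin 2]→L[ℝ] ℂ}
    (hη : ∀ x, SmoothAt η x) (hd : ∀ x, dForm η x = 0)
    (hJ : ∀ x, (η x).compContinuousLinearMap J = η x)
    (h0 : ∀ x, wpow (η x) n (2 * n) (stdFrame n) ≠ 0) {f g : M → ℂ}
    (hf : ∀ x, SmFun (Fin n → ℂ) f x) (hg : ∀ x, SmFun (Fin n → ℂ) g x) :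
    integral (fun x => g x • laplacian η f x • wpow (η x) n (2 * n)) =
      integral (fun x => f x • laplacian η g x • wpow (η x) n (2 * n)) := by
  have key : integral (fun x => g x •
        wedge (ofDegree 2 (ddbar f x)) (wpow (η x) (n - 1)) (2 * n)) =
      integral (fun x => f x • wedge (ofDegree 2 (ddbar g x)) (wpow (η x) (n - 1)) (2 * n)) := by
    have hsm : ∀ u v : M → ℂ, (∀ x, SmFun (Fin n → ℂ) u x) → (∀ x, SmFun (Fin n → ℂ) v x) →
        ∀ x, SmoothAltAt (fun z => v z • wedge (ofDegree 1 (dc u z)) (wpow (η z) (n - 1))) x :=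
      fun u v hu hv x => SmoothAltAt.fun_smul (hv x)
        ((smoothAltAt_ofDegree (hu x).dc).wedge (SmoothAltAt.wpow (hη x) _))
    have hdA : ∀ u v : M → ℂ, (∀ x, SmFun (Fin n → ℂ) u x) → (∀ x, SmFun (Fin n → ℂ) v x) →
        ∀ x, dA (fun z => v z • wedge (ofDegree 1 (dc u z)) (wpow (η z) (n - 1))) x =
          wedge (wedge (ofDegree 1 (dF v x)) (ofDegree 1 (dc u x))) (wpow (η x) (n - 1)) +
          (2 : ℂ) • v x • wedge (ofDegree 2 (ddbar u x)) (wpow (η x) (n - 1)) := by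
      intro u v hu hv x
      have h2 : ofDegree 2 (dForm (dc u) x) = (2 : ℂ) • ofDegree 2 (ddbar (E := Fin n → ℂ) u x) := by
        rw [ofDegree, ofDegree, ← Pi.single_smul, ddbar, real_smul_alt, smul_smul]
        norm_num
      rw [dA_fun_smul (hv x) ((smoothAltAt_ofDegree (hu x).dc).wedge (SmoothAltAt.wpow (hη x) _)),
        dA_wedge (smoothAltAt_ofDegree (hu x).dc) (SmoothAltAt.wpow (hη x) _), dA_wpow (hη x) (hd x),
        wedge_zero_right, add_zero, dA_ofDegree, wedge_assoc, h2, wedge_smul_left, smul_comm]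
    have hS : ∀ u v : M → ℂ, (∀ x, SmFun (Fin n → ℂ) u x) → (∀ x, SmFun (Fin n → ℂ) v x) →
        integral (fun x => wedge (wedge (ofDegree 1 (dF v x)) (ofDegree 1 (dc u x)))
          (wpow (η x) (n - 1)) (2 * n)) +
          2 * integral (fun x => v x • wedge (ofDegree 2 (ddbar u x)) (wpow (η x) (n - 1)) (2 * n))
          = 0 := by
      intro u v hu hv
      have h := integral_dA (hsm u v hu hv)
      simp only [hdA u v hu hv, Pi.add_apply, Pi.smul_apply] at h
      rw [← integral_const_smul, ← integral_add, h]
      · exact fun x => (((smoothAltAt_ofDegree (hv x).dF).wedge (smoothAltAt_ofDegree (hu x).dc)).wedge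
          (SmoothAltAt.wpow (hη x) _)) _
      · exact fun x => (SmoothAltAt.const_smul (SmoothAltAt.fun_smul (hv x) ((smoothAltAt_ofDegree
          (smoothAt_ddbar (Filter.Eventually.of_forall hu))).wedge
            (SmoothAltAt.wpow (hη x) _))) 2) _
    have h1 := hS f g hf hg
    have h2 := hS g f hg hf
    have h3 := integral_congr_form fun x => wedge_dF_dc_top f g x (η x) (hJ x) (n - 1)
    rw [h3] at h1
    have h4 := h1.trans h2.symm
    exact mul_left_cancel₀ (two_ne_zero) (add_left_cancel h4)
  have h1 : ∀ u v : M → ℂ, integral (fun x => v x • laplacian η u x • wpow (η x) n (2 * n)) =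
      (((1 / (2 * Real.pi) : ℝ) : ℂ) * n) * integral (fun x => v x •
        wedge (ofDegree 2 (ddbar u x)) (wpow (η x) (n - 1)) (2 * n)) := by
    intro u v
    rw [← integral_const_smul]
    refine integral_congr_form fun x => ?_
    rw [laplacian_smul u x (h0 x), smul_comm]
  rw [h1, h1, key]

end Laplacian

section ParametricIntegral

open MeasureTheory

variable {Y : Type*} [TopologicalSpace Y] [T2Space Y] [MeasurableSpace Y] [OpensMeasurableSpace Y]
  {V : Type*} [NormedAddCommGroup V] [NormedSpace ℝ V] [FiniteDimensional ℝ V]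

/-- Integrals over a compact set of a class of functions that is closed under directional
derivatives with respect to the parameter. -/
theorem hasFDerivAt_integral_of_class (μ : Measure Y) [IsFiniteMeasureOnCompacts μ] {S : Set Y}
    (hS : IsCompact S) (hSm : MeasurableSet S) {U : Set V} (hU : IsOpen U) (C : Set (Y → V → ℂ))
    (hcont : ∀ F ∈ C, ContinuousOn (fun q : Y × V => F q.1 q.2) (S ×ˢ U))
    (hdiff : ∀ F ∈ C, ∀ y ∈ S, ∀ v ∈ U, DifferentiableAt ℝ (F y) v)
    (hC : ∀ F ∈ C, ∀ e, (fun y v => fderiv ℝ (F y) v e) ∈ C) {F : Y → V → ℂ} (hF : F ∈ C) {v : V}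
    (hv : v ∈ U) :
    HasFDerivAt (fun v => ∫ y in S, F y v ∂μ) (∫ y in S, fderiv ℝ (F y) v ∂μ) v ∧
      ∀ e, (∫ y in S, fderiv ℝ (F y) v ∂μ) e = ∫ y in S, fderiv ℝ (F y) v e ∂μ := by
  have hslice : ∀ v ∈ U, ∀ y ∈ S, (y, v) ∈ S ×ˢ U := fun v hv y hy => ⟨hy, hv⟩
  have hc1 : ∀ G ∈ C, ∀ v ∈ U, ContinuousOn (fun y => G y v) S := fun G hG v hv =>
    (hcont G hG).comp (f := fun y => (y, v)) (by fun_prop) (hslice v hv)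
  have hD : ContinuousOn (fun q : Y × V => fderiv ℝ (F q.1) q.2) (S ×ˢ U) :=
    continuousOn_clm_apply.2 fun e => hcont _ (hC F hF e)
  have hD1 : ContinuousOn (fun y => fderiv ℝ (F y) v) S :=
    hD.comp (f := fun y => (y, v)) (by fun_prop) (hslice v hv)
  obtain ⟨N, hNv, hNU, hNc⟩ := local_compact_nhds (hU.mem_nhds hv)
  obtain ⟨R, hR⟩ := (hS.prod hNc).exists_bound_of_continuousOn
    (hD.mono (Set.prod_mono_right hNU))
  refine ⟨?_, fun e => ?_⟩
  · refine hasFDerivAt_integral_of_dominated_of_fderiv_le (𝕜 := ℝ)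
      (F' := fun v y => fderiv ℝ (F y) v) (bound := fun _ => R) hNv ?_
      ((hc1 F hF v hv).integrableOn_compact hS) (hD1.aestronglyMeasurable_of_isCompact hS hSm) ?_
      (integrableOn_const hS.measure_lt_top.ne) ?_
    · filter_upwards [hU.mem_nhds hv] with w hw
      exact (hc1 F hF w hw).aestronglyMeasurable_of_isCompact hS hSm
    · filter_upwards [ae_restrict_mem hSm] with y hy w hw using hR (y, w) ⟨hy, hw⟩
    · filter_upwards [ae_restrict_mem hSm] with y hy w hw
      exact (hdiff F hF y hy w (hNU hw)).hasFDerivAt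
  · rw [ContinuousLinearMap.integral_apply (hD1.integrableOn_compact hS)]

theorem contDiffOn_integral_of_class (μ : Measure Y) [IsFiniteMeasureOnCompacts μ] {S : Set Y}
    (hS : IsCompact S) (hSm : MeasurableSet S) {U : Set V} (hU : IsOpen U) (C : Set (Y → V → ℂ))
    (hcont : ∀ F ∈ C, ContinuousOn (fun q : Y × V => F q.1 q.2) (S ×ˢ U))
    (hdiff : ∀ F ∈ C, ∀ y ∈ S, ∀ v ∈ U, DifferentiableAt ℝ (F y) v)
    (hC : ∀ F ∈ C, ∀ e, (fun y v => fderiv ℝ (F y) v e) ∈ C) {F : Y → V → ℂ} (hF : F ∈ C) :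
    ContDiffOn ℝ ∞ (fun v => ∫ y in S, F y v ∂μ) U := by
  rw [contDiffOn_infty]
  intro m
  induction m generalizing F with
  | zero =>
    rw [Nat.cast_zero, contDiffOn_zero]
    intro v hv
    exact (hasFDerivAt_integral_of_class μ hS hSm hU C hcont hdiff hC hF
      hv).1.continuousAt.continuousWithinAt
  | succ m ih =>
    rw [Nat.cast_succ, contDiffOn_succ_iff_fderiv_of_isOpen hU]
    refine ⟨fun v hv => (hasFDerivAt_integral_of_class μ hS hSm hU C hcont hdiff hC hF
      hv).1.differentiableAt.differentiableWithinAt, by simp, ?_⟩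
    rw [contDiffOn_clm_apply]
    intro e
    refine (ih (hC F hF e)).congr fun v hv => ?_
    have h := hasFDerivAt_integral_of_class μ hS hSm hU C hcont hdiff hC hF hv
    rw [h.1.fderiv, h.2]

end ParametricIntegral

namespace Family

variable {n : ℕ} {EX EB X B : Type*} [NormedAddCommGroup EX] [NormedSpace ℂ EX]
  [NormedAddCommGroup EB] [NormedSpace ℂ EB]
  [TopologicalSpace X] [ChartedSpace EX X] [TopologicalSpace B] [ChartedSpace EB B]
  (p : Family n EX EB X B)

theorem domChart_mem (x : X) : p.domChart x ∈ IsManifold.maximalAtlas 𝓘(ℂ, EX) ω X :=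
  (p.isSubmersion x).domChart_mem_maximalAtlas

theorem codChart_mem (x : X) : p.codChart x ∈ IsManifold.maximalAtlas 𝓘(ℂ, EB) ω B :=
  (p.isSubmersion x).codChart_mem_maximalAtlas

theorem mem_domChart (x : X) : x ∈ (p.domChart x).source :=
  (p.isSubmersion x).mem_domChart_source

theorem exists_fiber (b : B) : Nonempty (p.Fiber b) := by
  obtain ⟨x, hx⟩ := (p.connected b).nonempty
  exact ⟨⟨x, hx⟩⟩

/-- The point of the model space with vertical coordinates `y` over `b`, in the chart `domChart x`
at a point `x` that need not lie over `b`. -/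
def liftAt (x : X) (b : B) (y : Fin n → ℂ) : EX := (p.split x).symm (p.codChart x b, y)

theorem liftAt_eq (x : X) (b : B) (y : Fin n → ℂ) :
    p.liftAt x b y = (p.split x).symm (p.codChart x b, 0) + (p.split x).symm (0, y) := by
  rw [← map_add, Prod.mk_add_mk, add_zero, zero_add]
  rfl

/-- The inclusion of the vertical directions. -/
def vert (x : X) : (Fin n → ℂ) →L[ℂ] EX :=
  ((p.split x).symm : EB × (Fin n → ℂ) →L[ℂ] EX).comp
    (ContinuousLinearMap.inr ℂ EB (Fin n → ℂ))

theorem vert_apply (x : X) (y : Fin n → ℂ) : p.vert x y = (p.split x).symm (0, y) := rfl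

theorem liftAt_split {x : X} {b : B} {z : X} (hz : z ∈ (p.domChart x).source) (hb : p.proj z = b) :
    p.liftAt x b (p.split x (p.domChart x z)).2 = p.domChart x z := by
  have h := p.codChart_proj x hz
  rw [hb] at h
  rw [liftAt, h]
  simp

open Classical in
/-- The point of the fibre over `b` with given vertical coordinates. -/
def fibreInv (x : X) {b : B} (hb : b ∈ (p.codChart x).source) (y : Fin n → ℂ) : p.Fiber b :=
  if h : p.liftAt x b y ∈ (p.domChart x).target then
    ⟨(p.domChart x).symm (p.liftAt x b y), p.proj_symm x hb h (by simp [liftAt])⟩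
  else (p.exists_fiber b).some

theorem fibreInv_val (x : X) {b : B} (hb : b ∈ (p.codChart x).source) {y : Fin n → ℂ}
    (h : p.liftAt x b y ∈ (p.domChart x).target) :
    (p.fibreInv x hb y).1 = (p.domChart x).symm (p.liftAt x b y) := by
  rw [fibreInv, dif_pos h]

theorem continuous_liftAt (x : X) (b : B) : Continuous (p.liftAt x b) := by
  unfold liftAt
  fun_prop

/-- The chart of the fibre over `b` given by the vertical coordinates of `domChart x`. -/
def fibreChart (x : X) {b : B} (hb : b ∈ (p.codChart x).source) :
    OpenPartialHomeomorph (p.Fiber b) (Fin n → ℂ) where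
  toFun z := (p.split x (p.domChart x z.1)).2
  invFun := p.fibreInv x hb
  source := Fiber.val ⁻¹' (p.domChart x).source
  target := p.liftAt x b ⁻¹' (p.domChart x).target
  map_source' := by
    intro z hz
    rw [Set.mem_preimage, p.liftAt_split hz z.2]
    exact (p.domChart x).map_source hz
  map_target' := by
    intro y hy
    rw [Set.mem_preimage, p.fibreInv_val x hb hy]
    exact (p.domChart x).map_target hy
  left_inv' := by
    intro z hz
    have h2 := (p.domChart x).map_source hz
    rw [← p.liftAt_split hz z.2] at h2
    refine Fiber.ext ?_
    rw [p.fibreInv_val x hb h2, p.liftAt_split hz z.2]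
    exact (p.domChart x).left_inv hz
  right_inv' := by
    intro y hy
    rw [p.fibreInv_val x hb hy, (p.domChart x).right_inv hy]
    simp [liftAt]
  open_source := (p.domChart x).open_source.preimage (p.isEmbedding_val b).continuous
  open_target := (p.domChart x).open_target.preimage (p.continuous_liftAt x b)
  continuousOn_toFun := by
    have h1 : ContinuousOn (fun z : p.Fiber b => p.domChart x z.1)
        (Fiber.val ⁻¹' (p.domChart x).source) :=
      (p.domChart x).continuousOn.comp (p.isEmbedding_val b).continuous.continuousOn
        fun z hz => hz
    exact (continuous_snd.comp (p.split x).continuous).comp_continuousOn h1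
  continuousOn_invFun := by
    refine (p.isEmbedding_val b).continuousOn_iff.mpr ?_
    have h1 : ContinuousOn (fun y : Fin n → ℂ => (p.domChart x).symm (p.liftAt x b y))
        (p.liftAt x b ⁻¹' (p.domChart x).target) :=
      (p.domChart x).continuousOn_symm.comp (p.continuous_liftAt x b).continuousOn fun y hy => hy
    exact h1.congr fun y hy => p.fibreInv_val x hb hy

theorem fibreChart_symm_val (x : X) {b : B} (hb : b ∈ (p.codChart x).source) {y : Fin n → ℂ}
    (h : y ∈ (p.fibreChart x hb).target) :
    ((p.fibreChart x hb).symm y).1 = (p.domChart x).symm (p.liftAt x b y) :=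
  p.fibreInv_val x hb h

theorem contDiff_liftAt (x : X) (b : B) : ContDiff ℂ ω (p.liftAt x b) := by
  unfold liftAt
  fun_prop

variable [IsManifold 𝓘(ℂ, EX) ω X]

theorem contMDiff_proj [IsManifold 𝓘(ℂ, EB) ω B] : ContMDiff 𝓘(ℂ, EX) 𝓘(ℂ, EB) ω p.proj :=
  p.isSubmersion.contMDiff

theorem contMDiff_incl (b : B) : ContMDiff 𝓘(ℂ, Fin n → ℂ) 𝓘(ℂ, EX) ω (p.incl b) := by
  intro x
  have hb := p.mem_codChart x
  have h1 : ContMDiffAt 𝓘(ℂ, Fin n → ℂ) 𝓘(ℂ, Fin n → ℂ) ω (chartAt (Fin n → ℂ) x) x :=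
    contMDiffAt_of_mem_maximalAtlas (chartAt_mem x) (mem_chart_source _ x)
  have h2 : ContMDiffAt 𝓘(ℂ, Fin n → ℂ) 𝓘(ℂ, EX) ω
      (fun z => p.liftAt x.1 b (chartAt (Fin n → ℂ) x z)) x :=
    (contMDiffAt_iff_contDiffAt.2 (p.contDiff_liftAt x.1 b).contDiffAt).comp x h1
  have e : p.liftAt x.1 b (chartAt (Fin n → ℂ) x x) = p.domChart x.1 x.1 :=
    p.liftAt_split (p.mem_domChart x.1) x.2
  have h3 : ContMDiffAt 𝓘(ℂ, EX) 𝓘(ℂ, EX) ω (p.domChart x.1).symm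
      (p.liftAt x.1 b (chartAt (Fin n → ℂ) x x)) := by
    rw [e]
    exact (contMDiffOn_symm_of_mem_maximalAtlas (p.domChart_mem x.1)).contMDiffAt
      ((p.domChart x.1).open_target.mem_nhds ((p.domChart x.1).map_source (p.mem_domChart x.1)))
  refine (h3.comp x h2).congr_of_eventuallyEq ?_
  filter_upwards [(chartAt (Fin n → ℂ) x).open_source.mem_nhds (mem_chart_source _ x)] with z hz
  have hz' : z.1 ∈ (p.domChart x.1).source := hz
  change z.1 = (p.domChart x.1).symm (p.liftAt x.1 b (p.split x.1 (p.domChart x.1 z.1)).2)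
  rw [p.liftAt_split hz' z.2, (p.domChart x.1).left_inv hz']

theorem contMDiffAt_fiber {E' M' : Type*} [NormedAddCommGroup E'] [NormedSpace ℂ E']
    [TopologicalSpace M'] [ChartedSpace E' M'] {b : B} {f : M' → p.Fiber b} {x : M'}
    (h : ContMDiffAt 𝓘(ℂ, E') 𝓘(ℂ, EX) ω (fun z => (f z).1) x) :
    ContMDiffAt 𝓘(ℂ, E') 𝓘(ℂ, Fin n → ℂ) ω f x := by
  rw [contMDiffAt_iff_target]
  refine ⟨(p.isEmbedding_val b).continuousAt_iff.2 h.continuousAt, ?_⟩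
  have h1 : ContMDiffAt 𝓘(ℂ, EX) 𝓘(ℂ, EX) ω (p.domChart (f x).1) (f x).1 :=
    contMDiffAt_of_mem_maximalAtlas (p.domChart_mem _) (p.mem_domChart _)
  have h2 : ContDiff ℂ ω fun y : EX => (p.split (f x).1 y).2 := by fun_prop
  exact (contMDiffAt_iff_contDiffAt.2 h2.contDiffAt).comp x (h1.comp x h)

theorem fibreChart_mem (x : X) {b : B} (hb : b ∈ (p.codChart x).source) :
    p.fibreChart x hb ∈ IsManifold.maximalAtlas 𝓘(ℂ, Fin n → ℂ) ω (p.Fiber b) := by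
  refine mem_maximalAtlas_of_contMDiffOn (fun z hz => ?_) fun y hy => ?_
  · refine ContMDiffAt.contMDiffWithinAt ?_
    have h1 : ContMDiffAt 𝓘(ℂ, EX) 𝓘(ℂ, EX) ω (p.domChart x) z.1 :=
      contMDiffAt_of_mem_maximalAtlas (p.domChart_mem _) hz
    have h2 : ContDiff ℂ ω fun y : EX => (p.split x y).2 := by fun_prop
    exact (contMDiffAt_iff_contDiffAt.2 h2.contDiffAt).comp z
      (h1.comp z (p.contMDiff_incl b z))
  · refine ContMDiffAt.contMDiffWithinAt (p.contMDiffAt_fiber ?_)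
    have h3 : ContMDiffAt 𝓘(ℂ, EX) 𝓘(ℂ, EX) ω (p.domChart x).symm (p.liftAt x b y) :=
      (contMDiffOn_symm_of_mem_maximalAtlas (p.domChart_mem x)).contMDiffAt
        ((p.domChart x).open_target.mem_nhds hy)
    refine (h3.comp y (contMDiffAt_iff_contDiffAt.2
      (p.contDiff_liftAt x b).contDiffAt)).congr_of_eventuallyEq ?_
    filter_upwards [(p.fibreChart x hb).open_target.mem_nhds hy] with z hz
    exact p.fibreChart_symm_val x hb hz

theorem contMDiffAt_incl_real {b : B} (x : p.Fiber b) :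
    ContMDiffAt 𝓘(ℝ, Fin n → ℂ) 𝓘(ℝ, EX) ∞ (p.incl b) x :=
  ContMDiffAt.to_real (p.contMDiff_incl b x)

theorem fderiv_liftAt (x : X) (b : B) (y : Fin n → ℂ) :
    fderiv ℝ (p.liftAt x b) y = (p.vert x).restrictScalars ℝ := by
  have : p.liftAt x b = fun y => (p.split x).symm (p.codChart x b, 0) +
      (p.vert x).restrictScalars ℝ y := funext fun y => p.liftAt_eq x b y
  rw [this, fderiv_const_add]
  exact ContinuousLinearMap.fderiv _

/-- The differential of the inclusion of a fibre, in charts. -/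
theorem mD_incl_cD (x : X) {b : B} (hb : b ∈ (p.codChart x).source) {y : Fin n → ℂ}
    (hy : y ∈ (p.fibreChart x hb).target) :
    (mD (Fin n → ℂ) EX (p.incl b) ((p.fibreChart x hb).symm y)).comp (cD (p.fibreChart x hb) y) =
      (cD (p.domChart x) (p.liftAt x b y)).comp ((p.vert x).restrictScalars ℝ) := by
  have hy' : p.liftAt x b y ∈ (p.domChart x).target := hy
  have e : p.incl b ((p.fibreChart x hb).symm y) = (p.domChart x).symm (p.liftAt x b y) :=
    p.fibreChart_symm_val x hb hy
  rw [mD_comp_cD (p.domChart_mem x) (p.fibreChart_mem x hb)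
    ((p.contMDiffAt_incl_real _).mdifferentiableAt (by simp)) hy
    (by rw [e]; exact (p.domChart x).map_target hy'), e, (p.domChart x).right_inv hy']
  have h : (fun z => p.domChart x (p.incl b ((p.fibreChart x hb).symm z))) =ᶠ[𝓝 y]
      p.liftAt x b := by
    filter_upwards [(p.fibreChart x hb).open_target.mem_nhds hy] with z hz
    have hz' : p.liftAt x b z ∈ (p.domChart x).target := hz
    change p.domChart x (((p.fibreChart x hb).symm z).1) = _
    rw [p.fibreChart_symm_val x hb hz, (p.domChart x).right_inv hz']
  rw [h.fderiv_eq, fderiv_liftAt]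

theorem coordRep_restrict (x : X) {b : B} (hb : b ∈ (p.codChart x).source) {y : Fin n → ℂ}
    (hy : y ∈ (p.fibreChart x hb).target) {k : ℕ} (η : X → EX [⋀^Fin k]→L[ℝ] ℂ) :
    coordRep (p.fibreChart x hb) (p.restrict b η) y =
      (coordRep (p.domChart x) η (p.liftAt x b y)).compContinuousLinearMap
        ((p.vert x).restrictScalars ℝ) := by
  ext u
  have h := p.mD_incl_cD x hb hy
  have e : p.incl b ((p.fibreChart x hb).symm y) = (p.domChart x).symm (p.liftAt x b y) :=
    p.fibreChart_symm_val x hb hy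
  change η (p.incl b ((p.fibreChart x hb).symm y)) (fun i => ((mD (Fin n → ℂ) EX (p.incl b)
    ((p.fibreChart x hb).symm y)).comp (cD (p.fibreChart x hb) y)) (u i)) = _
  rw [h, e]
  rfl

end Family

section ModelFibre

open MeasureTheory

variable {n : ℕ} {EX EB : Type*} [NormedAddCommGroup EX] [NormedSpace ℂ EX]
  [FiniteDimensional ℂ EX] [NormedAddCommGroup EB] [NormedSpace ℂ EB] [FiniteDimensional ℂ EB]
  (e : EX ≃L[ℂ] EB × (Fin n → ℂ)) {F : EX → EX [⋀^Fin (2 * n)]→L[ℝ] ℂ}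

/-- The integral of a form over the vertical slice over `β`. -/
def modelInt (F : EX → EX [⋀^Fin (2 * n)]→L[ℝ] ℂ) (β : EB) : ℂ :=
  ∫ y, F (e.symm (β, y)) fun i => e.symm (0, stdFrame n i)

/-- The inclusion of the vertical directions in the model space. -/
def modelVert : (Fin n → ℂ) →L[ℝ] EX :=
  ((e.symm : EB × (Fin n → ℂ) →L[ℂ] EX).comp
    (ContinuousLinearMap.inr ℂ EB (Fin n → ℂ))).restrictScalars ℝ

theorem modelVert_apply (y : Fin n → ℂ) : modelVert e y = e.symm (0, y) := rfl

theorem fderiv_slice (β : EB) (y : Fin n → ℂ) :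
    fderiv ℝ (fun y => e.symm (β, y)) y = modelVert e := by
  have : (fun y => e.symm (β, y)) = fun y => e.symm (β, 0) + modelVert e y := by
    funext y
    rw [modelVert_apply, ← map_add, Prod.mk_add_mk, add_zero, zero_add]
  rw [this, fderiv_const_add]
  exact ContinuousLinearMap.fderiv _

theorem contDiff_slice : ContDiff ℝ ∞ fun q : EB × (Fin n → ℂ) => e.symm q :=
  ((e.symm : EB × (Fin n → ℂ) →L[ℂ] EX).restrictScalars ℝ).contDiff

theorem contDiff_slice_right (β : EB) : ContDiff ℝ ∞ fun y : Fin n → ℂ => e.symm (β, y) :=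
  (contDiff_slice e).comp (contDiff_const.prodMk contDiff_id)

theorem contDiff_alt_apply {V : Type*} [NormedAddCommGroup V] [NormedSpace ℝ V] {k : ℕ}
    {α : V → EX [⋀^Fin k]→L[ℝ] ℂ} (h : ContDiff ℝ ∞ α) (u : Fin k → EX) :
    ContDiff ℝ ∞ fun y => α y u :=
  contDiff_iff_contDiffAt.2 fun _ => contDiffAt_alt_iff.1 h.contDiffAt u

theorem hasCompactSupport_slice {K : Set EX} (hK : IsCompact K) {T : Type*} [Zero T] {G : EX → T}
    (h : ∀ y ∉ K, G y = 0) (β : EB) : HasCompactSupport fun y : Fin n → ℂ => G (e.symm (β, y)) := by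
  refine HasCompactSupport.intro (K := (fun z => (e z).2) '' K)
    (hK.image (continuous_snd.comp e.continuous)) fun y hy => h _ fun hm => hy ⟨_, hm, by simp⟩

variable (hF : ContDiff ℝ ∞ F) {K : Set EX} (hK : IsCompact K) (hs : ∀ y ∉ K, F y = 0)
include hF hK hs

theorem integral_vertical_divergence (β : EB) (v : EX) :
    ∫ y, dAlt (fun z => iota v (ofDegree (2 * n) (F z))) (e.symm (β, y)) (2 * n)
      (fun i => e.symm (0, stdFrame n i)) = 0 := by
  obtain _ | m := n
  · simp [dAlt]
  set H : EX → EX [⋀^Fin (2 * m + 1)]→L[ℝ] ℂ := fun z =>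
    ((F z : EX [⋀^Fin (2 * m + 1 + 1)]→L[ℝ] ℂ)).curryLeft v with hH
  have hiota : (fun z => iota v (ofDegree (2 * (m + 1)) (F z)) (2 * m + 1)) = H := by
    funext z
    exact congrFun (iota_ofDegree v (k := 2 * m + 1) (F z)) (2 * m + 1) |>.trans
      (Pi.single_eq_same _ _)
  have hHs : ContDiff ℝ ∞ H := contDiff_iff_contDiffAt.2 fun z => contDiffAt_alt_iff.2 fun u =>
    contDiffAt_alt_iff.1 hF.contDiffAt (Matrix.vecCons v u)
  have h1 : ∀ y, extDeriv (fun y => (H (e.symm (β, y))).compContinuousLinearMap (modelVert e)) y =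
      (extDeriv H (e.symm (β, y))).compContinuousLinearMap (modelVert e) := by
    intro y
    have := extDeriv_pullback (𝕜 := ℝ) (r := ∞) (x := y) (f := fun y => e.symm (β, y))
      (hHs.differentiable (by simp) (e.symm (β, y))) (contDiff_slice_right e β).contDiffAt
      (by simpa using (WithTop.coe_le_coe.2 le_top : ((2 : ℕ∞) : WithTop ℕ∞) ≤ ∞))
    simpa only [fderiv_slice] using this
  have h2 := integral_extDeriv_eq_zero (m := m)
    (G := fun y => (H (e.symm (β, y))).compContinuousLinearMap (modelVert e)) ?_ ?_
    (stdFrame (m + 1))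
  · simp only [h1] at h2
    refine Eq.trans ?_ h2
    refine integral_congr_ae (Filter.Eventually.of_forall fun y => ?_)
    change extDeriv (fun z => iota v (ofDegree (2 * (m + 1)) (F z)) (2 * m + 1)) (e.symm (β, y)) _
      = _
    rw [hiota]
    rfl
  · exact contDiff_iff_contDiffAt.2 fun y => contDiffAt_alt_comp
      (hHs.comp (contDiff_slice_right e β)).contDiffAt contDiffAt_const
  · intro u
    refine hasCompactSupport_slice e hK (G := fun z => H z fun i => modelVert e (u i)) (fun z hz => ?_) β
    simp only [hH, hs z hz]
    rfl

theorem contDiff_modelInt_aux {G : EX → ℂ} (hG : ContDiff ℝ ∞ G) (h0 : ∀ y ∉ K, G y = 0) :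
    ContDiff ℝ ∞ (fun β : EB => ∫ y, G (e.symm (β, y))) ∧
      ∀ β u, fderiv ℝ (fun β : EB => ∫ y, G (e.symm (β, y))) β u =
        ∫ y, fderiv ℝ G (e.symm (β, y)) (e.symm (u, 0)) := by
  set S : Set (Fin n → ℂ) := (fun z => (e z).2) '' K
  have hSc : IsCompact S := hK.image (continuous_snd.comp e.continuous)
  set C : Set ((Fin n → ℂ) → EB → ℂ) :=
    {F | ContDiff ℝ ∞ fun q : (Fin n → ℂ) × EB => F q.1 q.2}
  have hmem : ∀ F ∈ C, ContDiff ℝ ∞ fun q : (Fin n → ℂ) × EB => F q.1 q.2 := fun F hF => hF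
  have hslice : ∀ F ∈ C, ∀ y, ContDiff ℝ ∞ (F y) := fun F hF y =>
    ContDiff.comp (g := fun q : (Fin n → ℂ) × EB => F q.1 q.2) (hmem F hF)
      (contDiff_const.prodMk contDiff_id)
  have hC : ∀ F ∈ C, ∀ e, (fun y v => fderiv ℝ (F y) v e) ∈ C := by
    intro F hF u
    have h : ∀ q : (Fin n → ℂ) × EB, fderiv ℝ (F q.1) q.2 u =
        fderiv ℝ (fun q : (Fin n → ℂ) × EB => F q.1 q.2) q (0, u) := by
      intro q
      have h1 : HasFDerivAt (fun v : EB => (q.1, v))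
          (ContinuousLinearMap.inr ℝ (Fin n → ℂ) EB) q.2 := hasFDerivAt_prodMk_right _ _
      have h2 := (ContDiff.differentiable (f := fun q : (Fin n → ℂ) × EB => F q.1 q.2) (hmem F hF)
        (by simp) q).hasFDerivAt
      have h3 := (HasFDerivAt.comp q.2 (g := fun q : (Fin n → ℂ) × EB => F q.1 q.2) h2 h1).fderiv
      change fderiv ℝ (F q.1) q.2 = _ at h3
      rw [h3]
      rfl
    change ContDiff ℝ ∞ fun q : (Fin n → ℂ) × EB => fderiv ℝ (F q.1) q.2 u
    simp only [h]
    exact (ContDiff.fderiv_right (m := ∞) (hmem F hF) le_rfl).clm_apply contDiff_const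
  set Φ : (Fin n → ℂ) → EB → ℂ := fun y β => G (e.symm (β, y))
  have hΦ : Φ ∈ C := hG.comp ((contDiff_slice e).comp (contDiff_snd.prodMk contDiff_fst))
  have hz : ∀ β : EB, ∀ y ∉ S, e.symm (β, y) ∉ K := fun β y hy hm => hy ⟨_, hm, by simp⟩
  have hrw : (fun β : EB => ∫ y, G (e.symm (β, y))) = fun β => ∫ y in S, Φ y β := by
    funext β
    exact (setIntegral_eq_integral_of_forall_compl_eq_zero fun y hy => h0 _ (hz β y hy)).symm
  have hcont : ∀ F ∈ C, ContinuousOn (fun q : (Fin n → ℂ) × EB => F q.1 q.2) (S ×ˢ Set.univ) :=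
    fun F hF => (hmem F hF).continuous.continuousOn
  have hdiff : ∀ F ∈ C, ∀ y ∈ S, ∀ v ∈ Set.univ, DifferentiableAt ℝ (F y) v :=
    fun F hF y _ v _ => (hslice F hF y).differentiable (by simp) v
  have hKc : IsClosed K := hK.isClosed
  constructor
  · rw [hrw, ← contDiffOn_univ]
    exact contDiffOn_integral_of_class volume hSc hSc.measurableSet isOpen_univ C hcont hdiff hC hΦ
  · intro β u
    have h := hasFDerivAt_integral_of_class volume hSc hSc.measurableSet isOpen_univ C hcont hdiff
      hC hΦ (Set.mem_univ β)
    rw [hrw, h.1.fderiv, h.2]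
    have h1 : ∀ y, fderiv ℝ (Φ y) β u = fderiv ℝ G (e.symm (β, y)) (e.symm (u, 0)) := by
      intro y
      have h1 : HasFDerivAt (fun β : EB => e.symm (β, y))
          (((e.symm : EB × (Fin n → ℂ) →L[ℂ] EX).restrictScalars ℝ).comp
            (ContinuousLinearMap.inl ℝ EB (Fin n → ℂ))) β :=
        (((e.symm : EB × (Fin n → ℂ) →L[ℂ] EX).restrictScalars ℝ).hasFDerivAt).comp β
          (hasFDerivAt_prodMk_left _ _)
      have h2 := (((hG.differentiable (by simp) _).hasFDerivAt).comp β h1).fderiv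
      change fderiv ℝ (Φ y) β = _ at h2
      rw [h2]
      rfl
    simp only [h1]
    refine setIntegral_eq_integral_of_forall_compl_eq_zero fun y hy => ?_
    have : G =ᶠ[𝓝 (e.symm (β, y))] fun _ => 0 := by
      filter_upwards [hKc.isOpen_compl.mem_nhds (hz β y hy)] with z hz using h0 z hz
    rw [this.fderiv_eq]
    simp

theorem contDiff_modelInt : ContDiff ℝ ∞ (modelInt e F) :=
  (contDiff_modelInt_aux e hF hK hs (G := fun z => F z fun i => e.symm (0, stdFrame n i))
    (contDiff_alt_apply hF _) fun y hy => by rw [hs y hy]; rfl).1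

theorem fderiv_modelInt (β u : EB) : fderiv ℝ (modelInt e F) β u =
    ∫ y, extDeriv F (e.symm (β, y))
      (Matrix.vecCons (e.symm (u, 0)) fun i => e.symm (0, stdFrame n i)) := by
  have h := (contDiff_modelInt_aux e hF hK hs (G := fun z => F z fun i => e.symm (0, stdFrame n i))
    (contDiff_alt_apply hF _) fun y hy => by rw [hs y hy]; rfl).2 β u
  refine h.trans ?_
  have hd : ∀ z, ContDiffAlt (fun z => ofDegree (2 * n) (F z)) z := by
    intro z k
    rcases eq_or_ne k (2 * n) with rfl | hk
    · simpa [ofDegree] using hF.contDiffAt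
    · simpa [ofDegree, hk] using contDiffAt_const
  have hF' : (fun z => ofDegree (2 * n) (F z) (2 * n)) = F := funext fun z => by simp [ofDegree]
  have key : ∀ y, fderiv ℝ (fun z => F z fun i => e.symm (0, stdFrame n i)) (e.symm (β, y))
      (e.symm (u, 0)) = extDeriv F (e.symm (β, y))
        (Matrix.vecCons (e.symm (u, 0)) fun i => e.symm (0, stdFrame n i)) +
      dAlt (fun z => iota (e.symm (u, 0)) (ofDegree (2 * n) (F z))) (e.symm (β, y)) (2 * n)
        (fun i => e.symm (0, stdFrame n i)) := by
    intro y
    have h1 := congrArg (fun α : Alt EX => α (2 * n) fun i => e.symm (0, stdFrame n i))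
      (iota_dAlt (hd (e.symm (β, y))) (e.symm (u, 0)))
    have h2 : dAlt (fun z => ofDegree (2 * n) (F z)) (e.symm (β, y)) (2 * n + 1) =
        extDeriv F (e.symm (β, y)) := by
      change extDeriv (fun z => ofDegree (2 * n) (F z) (2 * n)) _ = _
      rw [hF']
    have h3 : dirAlt (fun z => ofDegree (2 * n) (F z)) (e.symm (β, y)) (e.symm (u, 0)) (2 * n) =
        fderiv ℝ F (e.symm (β, y)) (e.symm (u, 0)) := by
      change fderiv ℝ (fun z => ofDegree (2 * n) (F z) (2 * n)) _ _ = _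
      rw [hF']
    simp only [iota_apply, Pi.sub_apply, h2, ContinuousAlternatingMap.sub_apply, h3] at h1
    rw [h1, sub_add_cancel]
    have h4 : HasFDerivAt (fun z => F z fun i => e.symm (0, stdFrame n i))
        ((ContinuousAlternatingMap.apply ℝ EX ℂ fun i => e.symm (0, stdFrame n i)).comp
          (fderiv ℝ F (e.symm (β, y)))) (e.symm (β, y)) :=
      (ContinuousAlternatingMap.apply ℝ EX ℂ fun i => e.symm (0, stdFrame n i)).hasFDerivAt.comp _
        (hF.differentiable (by simp) _).hasFDerivAt
    rw [h4.fderiv]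
    rfl
  simp only [key]
  have hexs : ∀ y ∉ K, extDeriv F y = 0 := by
    intro y hy
    have : F =ᶠ[𝓝 y] fun _ => 0 := by
      filter_upwards [hK.isClosed.isOpen_compl.mem_nhds hy] with z hz using hs z hz
    rw [← dForm_eq_extDeriv, dForm_congr this, dForm_zero]
  have hexc : ContDiff ℝ ∞ (extDeriv F) := by
    refine contDiff_iff_contDiffAt.2 fun y => ?_
    have := (smoothAt_iff_contDiffAt _ y).1 (SmoothAt.dForm (η := F) (x := y)
      (Filter.Eventually.of_forall fun z => (smoothAt_iff_contDiffAt _ z).2 hF.contDiffAt))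
    refine this.congr_of_eventuallyEq (Filter.Eventually.of_forall fun z => ?_)
    exact (dForm_eq_extDeriv F z).symm
  have hi1 : Integrable fun y => extDeriv F (e.symm (β, y))
      (Matrix.vecCons (e.symm (u, 0)) fun i => e.symm (0, stdFrame n i)) :=
    Continuous.integrable_of_hasCompactSupport
      ((contDiff_alt_apply hexc _).continuous.comp (contDiff_slice_right e β).continuous)
      (hasCompactSupport_slice e hK (G := fun z => extDeriv F z
        (Matrix.vecCons (e.symm (u, 0)) fun i => e.symm (0, stdFrame n i)))
        (fun z hz => by rw [hexs z hz]; rfl) β)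
  have hi2 : Integrable fun y => fderiv ℝ (fun z => F z fun i => e.symm (0, stdFrame n i))
      (e.symm (β, y)) (e.symm (u, 0)) := by
    refine Continuous.integrable_of_hasCompactSupport
      ((((contDiff_alt_apply hF _).continuous_fderiv (by simp)).comp
        (contDiff_slice_right e β).continuous).clm_apply continuous_const)
      (hasCompactSupport_slice e hK (G := fun z => fderiv ℝ
        (fun z => F z fun i => e.symm (0, stdFrame n i)) z (e.symm (u, 0))) (fun z hz => ?_) β)
    have : (fun z => F z fun i => e.symm (0, stdFrame n i)) =ᶠ[𝓝 z] fun _ => 0 := by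
      filter_upwards [hK.isClosed.isOpen_compl.mem_nhds hz] with w hw
      rw [hs w hw]
      rfl
    rw [this.fderiv_eq]
    simp
  rw [MeasureTheory.integral_add hi1, integral_vertical_divergence e hF hK hs, add_zero]
  refine (hi2.sub hi1).congr (Filter.Eventually.of_forall fun y => ?_)
  simp only [Pi.sub_apply, key, add_sub_cancel_left]

end ModelFibre

namespace Family

variable {n : ℕ} {EX EB X B : Type*} [NormedAddCommGroup EX] [NormedSpace ℂ EX]
  [FiniteDimensional ℂ EX] [NormedAddCommGroup EB] [NormedSpace ℂ EB] [FiniteDimensional ℂ EB]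
  [TopologicalSpace X] [ChartedSpace EX X] [TopologicalSpace B] [ChartedSpace EB B]
  [IsManifold 𝓘(ℂ, EX) ω X] [IsManifold 𝓘(ℂ, EB) ω B]
  (p : Family n EX EB X B)

theorem contMDiffAt_proj_real (x : X) : ContMDiffAt 𝓘(ℝ, EX) 𝓘(ℝ, EB) ∞ p.proj x :=
  ContMDiffAt.to_real (p.contMDiff_proj x)

/-- The differential of the projection, in charts. -/
theorem split_mD_domChart (x : X) {z : X} (hz : z ∈ (p.domChart x).source) (w : EX) :
    (p.split x (mD EX EX (p.domChart x) z w)).1 =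
      mD EB EB (p.codChart x) (p.proj z) (mD EX EB p.proj z w) := by
  have h1 : mD EX EB (fun z => p.codChart x (p.proj z)) z =
      (mD EB EB (p.codChart x) (p.proj z)).comp (mD EX EB p.proj z) :=
    mD_comp ((contMDiffAt_chart (p.codChart_mem x) (p.proj_mem x hz)).mdifferentiableAt (by simp))
      ((p.contMDiffAt_proj_real z).mdifferentiableAt (by simp))
  set L : EX →L[ℝ] EB := ((ContinuousLinearMap.fst ℂ EB (Fin n → ℂ)).comp
    (p.split x : EX →L[ℂ] EB × (Fin n → ℂ))).restrictScalars ℝ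
  have h2 : mD EX EB (fun z => L (p.domChart x z)) z =
      (mD EX EB L (p.domChart x z)).comp (mD EX EX (p.domChart x) z) :=
    mD_comp (g := L) (L.contMDiff.contMDiffAt.mdifferentiableAt (n := ∞) (by simp))
      ((contMDiffAt_chart (p.domChart_mem x) hz).mdifferentiableAt (by simp))
  have h3 : (fun z => p.codChart x (p.proj z)) =ᶠ[𝓝 z] fun z => L (p.domChart x z) := by
    filter_upwards [(p.domChart x).open_source.mem_nhds hz] with y hy
    exact p.codChart_proj x hy
  rw [mD_congr h3, h2, mD_eq_fderiv, L.fderiv] at h1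
  exact congrFun (congrArg DFunLike.coe h1) w

theorem eq_cD_vert (x : X) {z : X} (hz : z ∈ (p.domChart x).source) {w : EX}
    (hw : mD EX EB p.proj z w = 0) : ∃ w', w = cD (p.domChart x) (p.domChart x z) (p.vert x w') := by
  refine ⟨(p.split x (mD EX EX (p.domChart x) z w)).2, ?_⟩
  have h := p.split_mD_domChart x hz w
  rw [hw, map_zero] at h
  rw [vert_apply, ← h, Prod.mk.eta, ContinuousLinearEquiv.symm_apply_apply]
  exact (congrFun (congrArg DFunLike.coe (cD_mD (p.domChart_mem x) hz)) w).symm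

theorem mD_proj_cD (x : X) {y : EX} (hy : y ∈ (p.domChart x).target) (w : EX) :
    mD EB EB (p.codChart x) (p.proj ((p.domChart x).symm y))
      (mD EX EB p.proj ((p.domChart x).symm y) (cD (p.domChart x) y w)) = (p.split x w).1 := by
  rw [← p.split_mD_domChart x ((p.domChart x).map_target hy)]
  have := congrFun (congrArg DFunLike.coe (mD_cD (p.domChart_mem x) hy)) w
  exact congrArg (fun z => (p.split x z).1) this

/-- The contraction of a form on the total space with a lift of a tangent vector of the base,
restricted to a fibre. -/
def contractFibre {b : B} {k : ℕ} (w : p.Fiber b → EX) (Ξ : X → EX [⋀^Fin (k + 1)]→L[ℝ] ℂ) :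
    p.Fiber b → (Fin n → ℂ) [⋀^Fin k]→L[ℝ] ℂ := fun x =>
  ((Ξ x.1).curryLeft (w x)).compContinuousLinearMap (mD (Fin n → ℂ) EX (p.incl b) x)

theorem top_vertical_eq_zero (Ξ : EX [⋀^Fin (2 * n + 1)]→L[ℝ] ℂ) (A : (Fin n → ℂ) →L[ℝ] EX)
    (v : Fin (2 * n + 1) → Fin n → ℂ) : Ξ (fun i => A (v i)) = 0 := by
  have : ¬ LinearIndependent ℝ v := fun h => by
    have := h.fintype_card_le_finrank
    have h2 : Module.finrank ℝ (Fin n → ℂ) = 2 * n := by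
      rw [Module.finrank_eq_card_basis (stdBasis n)]
      simp
    simp [h2] at this
  exact (Ξ.compContinuousLinearMap A).toAlternatingMap.map_linearDependent v this

theorem coordRep_contractFibre (x : X) {b : B} (hb : b ∈ (p.codChart x).source) {y : Fin n → ℂ}
    (hy : y ∈ (p.fibreChart x hb).target) {u : EB} {w : p.Fiber b → EX}
    (hw : ∀ z : p.Fiber b, mD EX EB p.proj z.1 (w z) = u)
    (Ξ : X → EX [⋀^Fin (2 * n + 1)]→L[ℝ] ℂ) (v : Fin (2 * n) → Fin n → ℂ) :
    coordRep (p.fibreChart x hb) (p.contractFibre w Ξ) y v =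
      coordRep (p.domChart x) Ξ (p.liftAt x b y)
        (Matrix.vecCons ((p.split x).symm (mD EB EB (p.codChart x) b u, 0))
          fun i => p.vert x (v i)) := by
  have hy' : p.liftAt x b y ∈ (p.domChart x).target := hy
  have e : ((p.fibreChart x hb).symm y).1 = (p.domChart x).symm (p.liftAt x b y) :=
    p.fibreChart_symm_val x hb hy
  set z := (p.fibreChart x hb).symm y with hz
  have hzs : z.1 ∈ (p.domChart x).source := by rw [e]; exact (p.domChart x).map_target hy'
  have hcz : p.domChart x z.1 = p.liftAt x b y := by rw [e, (p.domChart x).right_inv hy']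
  have h := p.mD_incl_cD x hb hy
  have hl : coordRep (p.fibreChart x hb) (p.contractFibre w Ξ) y v =
      Ξ z.1 (Matrix.vecCons (w z) fun i => cD (p.domChart x) (p.liftAt x b y) (p.vert x (v i))) := by
    have : ∀ i, mD (Fin n → ℂ) EX (p.incl b) z (cD (p.fibreChart x hb) y (v i)) =
        cD (p.domChart x) (p.liftAt x b y) (p.vert x (v i)) := fun i =>
      congrFun (congrArg DFunLike.coe h) (v i)
    simp only [← this]
    rfl
  set s := (p.split x).symm (mD EB EB (p.codChart x) b u, (0 : Fin n → ℂ)) with hs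
  have hr : coordRep (p.domChart x) Ξ (p.liftAt x b y) (Matrix.vecCons s fun i => p.vert x (v i)) =
      Ξ z.1 (Matrix.vecCons (cD (p.domChart x) (p.liftAt x b y) s)
        fun i => cD (p.domChart x) (p.liftAt x b y) (p.vert x (v i))) := by
    rw [coordRep_apply, e]
    congr 1
    funext i
    refine Fin.cases rfl (fun j => rfl) i
  rw [hl, hr]
  obtain ⟨w', hw'⟩ : ∃ w', w z - cD (p.domChart x) (p.liftAt x b y) s =
      cD (p.domChart x) (p.liftAt x b y) (p.vert x w') := by
    rw [← hcz]
    refine p.eq_cD_vert x hzs ?_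
    have h1 := p.mD_proj_cD x hy' s
    rw [← e, z.2, hs, ContinuousLinearEquiv.apply_symm_apply] at h1
    have hinj : Function.Injective (mD EB EB (p.codChart x) b) := by
      intro a a' haa
      have := cD_mD (p.codChart_mem x) hb
      have h2 := congrArg (cD (p.codChart x) (p.codChart x b)) haa
      rw [← ContinuousLinearMap.comp_apply, this, ← ContinuousLinearMap.comp_apply, this] at h2
      exact h2
    rw [map_sub, hw, hcz, sub_eq_zero]
    exact (hinj h1).symm
  have hsub := (Ξ z.1).toMultilinearMap.cons_add
    (fun i => cD (p.domChart x) (p.liftAt x b y) (p.vert x (v i)))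
    (w z - cD (p.domChart x) (p.liftAt x b y) s) (cD (p.domChart x) (p.liftAt x b y) s)
  rw [sub_add_cancel] at hsub
  refine hsub.trans ?_
  rw [hw']
  refine (add_eq_right).2 ?_
  refine Eq.trans ?_ (top_vertical_eq_zero (Ξ z.1)
    ((cD (p.domChart x) (p.liftAt x b y)).comp ((p.vert x).restrictScalars ℝ))
    (Matrix.vecCons w' v))
  change Ξ z.1 _ = _
  congr 1
  funext i
  refine Fin.cases rfl (fun j => rfl) i

theorem smoothAt_contractFibre {b : B} {u : EB} {w : p.Fiber b → EX}
    (hw : ∀ z : p.Fiber b, mD EX EB p.proj z.1 (w z) = u)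
    {Ξ : X → EX [⋀^Fin (2 * n + 1)]→L[ℝ] ℂ} (hΞ : ∀ x, SmoothAt Ξ x) (x : p.Fiber b) :
    SmoothAt (p.contractFibre w Ξ) x := by
  have hb : b ∈ (p.codChart x.1).source := p.mem_codChart x
  have hx : x ∈ (p.fibreChart x.1 hb).source := p.mem_domChart x.1
  rw [smoothAt_iff (p.fibreChart_mem x.1 hb) hx, contDiffAt_alt_iff]
  intro v
  have hx' := (p.fibreChart x.1 hb).map_source hx
  have hm : p.liftAt x.1 b (p.fibreChart x.1 hb x) ∈ (p.domChart x.1).target := hx'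
  have h1 : ContDiffAt ℝ ∞ (coordRep (p.domChart x.1) Ξ) (p.liftAt x.1 b (p.fibreChart x.1 hb x)) :=
    contDiffAt_coordRep (p.domChart_mem x.1) hΞ hm
  have h2 : ContDiff ℝ ∞ (p.liftAt x.1 b) :=
    ((p.contDiff_liftAt x.1 b).restrict_scalars ℝ).of_le le_top
  refine ContDiffAt.congr_of_eventuallyEq ((contDiffAt_alt_iff.1 h1
    (Matrix.vecCons ((p.split x.1).symm (mD EB EB (p.codChart x.1) b u, 0))
      fun i => p.vert x.1 (v i))).comp _ h2.contDiffAt) ?_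
  filter_upwards [(p.fibreChart x.1 hb).open_target.mem_nhds hx'] with y hy
  exact p.coordRep_contractFibre x.1 hb hy hw Ξ v

theorem smoothAt_restrict {b : B} {k : ℕ} {η : X → EX [⋀^Fin k]→L[ℝ] ℂ} {x : p.Fiber b}
    (h : SmoothAt η x.1) : SmoothAt (p.restrict b η) x :=
  SmoothAt.pullback (E := EX) (p.contMDiffAt_incl_real x) h

theorem tsupport_restrict (b : B) {k : ℕ} (η : X → EX [⋀^Fin k]→L[ℝ] ℂ) :
    tsupport (p.restrict b η) ⊆ Fiber.val ⁻¹' tsupport η := by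
  refine closure_minimal ?_ ((isClosed_tsupport η).preimage (p.isEmbedding_val b).continuous)
  intro x hx
  refine subset_tsupport η fun h => hx ?_
  change (η x.1).compContinuousLinearMap _ = 0
  rw [h]
  rfl

theorem tsupport_contractFibre {b : B} {k : ℕ} (w : p.Fiber b → EX)
    (η : X → EX [⋀^Fin (k + 1)]→L[ℝ] ℂ) :
    tsupport (p.contractFibre w η) ⊆ Fiber.val ⁻¹' tsupport η := by
  refine closure_minimal ?_ ((isClosed_tsupport η).preimage (p.isEmbedding_val b).continuous)
  intro x hx
  refine subset_tsupport η fun h => hx ?_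
  change ((η x.1).curryLeft _).compContinuousLinearMap _ = 0
  rw [h]
  rfl

variable [T2Space X]

section Local

variable (x : X) {Ψ : X → EX [⋀^Fin (2 * n)]→L[ℝ] ℂ} (hΨ : ∀ z, SmoothAt Ψ z)
  (hK : IsCompact (tsupport Ψ)) (hs : tsupport Ψ ⊆ (p.domChart x).source)
include hΨ hs

theorem integral_restrict_eq {b : B} (hb : b ∈ (p.codChart x).source) :
    integral (p.restrict b Ψ) =
      modelInt (p.split x) (extForm (p.domChart x) Ψ) (p.codChart x b) := by
  rw [integral_eq_chartIntegral (p.fibreChart_mem x hb) (fun z => p.smoothAt_restrict (hΨ z.1))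
    ((p.tsupport_restrict b Ψ).trans fun z hz => hs hz), chartIntegral_eq_integral]
  refine MeasureTheory.integral_congr_ae (Filter.Eventually.of_forall fun y => ?_)
  change extForm (p.fibreChart x hb) (p.restrict b Ψ) y (stdFrame n) =
    extForm (p.domChart x) Ψ (p.liftAt x b y) fun i => p.vert x (stdFrame n i)
  by_cases hy : y ∈ (p.fibreChart x hb).target
  · rw [extForm_of_mem _ hy, p.coordRep_restrict x hb hy, extForm_of_mem (c := p.domChart x) _ hy]
    rfl
  · rw [extForm_of_notMem _ hy, extForm_of_notMem (c := p.domChart x) _ hy]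
    rfl

include hK in
theorem integral_contractFibre_eq {b : B} (hb : b ∈ (p.codChart x).source) {u : EB}
    {w : p.Fiber b → EX} (hw : ∀ z : p.Fiber b, mD EX EB p.proj z.1 (w z) = u) :
    integral (p.contractFibre w (dForm Ψ)) = fderiv ℝ (modelInt (p.split x)
      (extForm (p.domChart x) Ψ)) (p.codChart x b) (mD EB EB (p.codChart x) b u) := by
  have hdΨ : ∀ z, SmoothAt (dForm Ψ) z := fun z => SmoothAt.dForm (Filter.Eventually.of_forall hΨ)
  have hdt : tsupport (dForm Ψ) ⊆ tsupport Ψ := by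
    refine closure_minimal ?_ (isClosed_tsupport Ψ)
    intro x hx
    by_contra h
    exact hx ((dForm_congr (notMem_tsupport_iff_eventuallyEq.1 h)).trans (dForm_zero x))
  rw [fderiv_modelInt (p.split x) (contDiff_extForm (p.domChart_mem x) hΨ hK hs)
    (hK.image_of_continuousOn ((p.domChart x).continuousOn.mono hs)) fun y hy =>
      extForm_eq_zero hy]
  rw [integral_eq_chartIntegral (p.fibreChart_mem x hb) (fun z => p.smoothAt_contractFibre hw hdΨ z)
    ((p.tsupport_contractFibre w _).trans fun z hz => hs (hdt hz)), chartIntegral_eq_integral]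
  refine MeasureTheory.integral_congr_ae (Filter.Eventually.of_forall fun y => ?_)
  change extForm (p.fibreChart x hb) (p.contractFibre w (dForm Ψ)) y (stdFrame n) =
    extDeriv (extForm (p.domChart x) Ψ) (p.liftAt x b y)
      (Matrix.vecCons ((p.split x).symm (mD EB EB (p.codChart x) b u, 0))
          fun i => p.vert x (stdFrame n i))
  rw [← extForm_dForm (p.domChart_mem x) hΨ hK hs]
  by_cases hy : y ∈ (p.fibreChart x hb).target
  · rw [extForm_of_mem _ hy, p.coordRep_contractFibre x hb hy hw, extForm_of_mem (c := p.domChart x) _ hy]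
  · rw [extForm_of_notMem _ hy, extForm_of_notMem (c := p.domChart x) _ hy]
    rfl

include hK in
theorem fibre_integration_local [T2Space B] (b : B) :
    SmFun EB (fun b => integral (p.restrict b Ψ)) b ∧
      ∀ (u : EB) (w : p.Fiber b → EX), (∀ z : p.Fiber b, mD EX EB p.proj z.1 (w z) = u) →
        mD EB ℂ (fun b => integral (p.restrict b Ψ)) b u =
          integral (p.contractFibre w (dForm Ψ)) := by
  by_cases hb : b ∈ (p.codChart x).source
  · have he : (fun b => integral (p.restrict b Ψ)) =ᶠ[𝓝 b] fun b =>
        modelInt (p.split x) (extForm (p.domChart x) Ψ) (p.codChart x b) := by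
      filter_upwards [(p.codChart x).open_source.mem_nhds hb] with b' hb'
      exact p.integral_restrict_eq x hΨ hs hb'
    have hsm : ContDiff ℝ ∞ (modelInt (p.split x) (extForm (p.domChart x) Ψ)) :=
      contDiff_modelInt (p.split x) (contDiff_extForm (p.domChart_mem x) hΨ hK hs)
        (hK.image_of_continuousOn ((p.domChart x).continuousOn.mono hs)) fun y hy =>
          extForm_eq_zero hy
    have hc := contMDiffAt_chart (p.codChart_mem x) hb
    have hm : ContMDiffAt 𝓘(ℝ, EB) 𝓘(ℝ, ℂ) ∞ (modelInt (p.split x) (extForm (p.domChart x) Ψ))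
      (p.codChart x b) := hsm.contDiffAt.contMDiffAt
    refine ⟨(hm.comp b hc).congr_of_eventuallyEq he, fun u w hw => ?_⟩
    rw [p.integral_contractFibre_eq x hΨ hK hs hb hw, mD_congr he,
      mD_comp (hm.mdifferentiableAt (by simp)) (hc.mdifferentiableAt (by simp)), mD_eq_fderiv]
    rfl
  · have hcl : IsClosed (p.proj '' tsupport Ψ) := (hK.image p.isProper.continuous).isClosed
    have hnb : b ∉ p.proj '' tsupport Ψ := by
      rintro ⟨z, hz, rfl⟩
      exact hb (p.proj_mem x (hs hz))
    have he : (fun b => integral (p.restrict b Ψ)) =ᶠ[𝓝 b] fun _ => 0 := by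
      filter_upwards [hcl.isOpen_compl.mem_nhds hnb] with b' hb'
      have : p.restrict b' Ψ = fun _ => 0 := by
        funext z
        have hz : Ψ z.1 = 0 := image_eq_zero_of_notMem_tsupport fun h => hb' ⟨_, h, z.2⟩
        change (Ψ z.1).compContinuousLinearMap _ = 0
        rw [hz]
        rfl
      rw [this, integral_zero]
    refine ⟨contMDiffAt_const.congr_of_eventuallyEq he, fun u w hw => ?_⟩
    have : p.contractFibre w (dForm Ψ) = fun _ => 0 := by
      funext z
      have hz : z.1 ∉ tsupport Ψ := fun h => hnb ⟨_, h, z.2⟩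
      have h0 : dForm Ψ z.1 = 0 :=
        (dForm_congr (notMem_tsupport_iff_eventuallyEq.1 hz)).trans (dForm_zero z.1)
      change ((dForm Ψ z.1).curryLeft _).compContinuousLinearMap _ = 0
      rw [h0]
      rfl
    rw [this, integral_zero, mD_congr he]
    exact congrFun (congrArg DFunLike.coe (mfderiv_const (I := 𝓘(ℝ, EB)) (I' := 𝓘(ℝ, ℂ)))) u

end Local

theorem exists_finite_partition [T2Space B] [SecondCountableTopology X] (b : B) :
    ∃ (I : Finset X) (f : X → X → ℂ), (∀ i x, SmFun EX (f i) x) ∧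
      (∀ i ∈ I, IsCompact (tsupport (f i)) ∧ tsupport (f i) ⊆ (p.domChart i).source) ∧
      ∀ᶠ b' in 𝓝 b, ∀ x, p.proj x = b' → ∑ i ∈ I, f i x = 1 := by
  have _ : IsManifold 𝓘(ℝ, EX) ∞ X := isManifold_real
  have _ : IsManifold 𝓘(ℝ, EB) ∞ B := isManifold_real
  have _ : FiniteDimensional ℝ EX := FiniteDimensional.complexToReal EX
  have _ : FiniteDimensional ℝ EB := FiniteDimensional.complexToReal EB
  have _ : LocallyCompactSpace X := ChartedSpace.locallyCompactSpace EX X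
  obtain ⟨f, hf⟩ := SmoothPartitionOfUnity.exists_isSubordinate 𝓘(ℝ, EX) (isClosed_univ (X := X))
    (fun x => (p.domChart x).source) (fun x => (p.domChart x).open_source)
    fun x _ => Set.mem_iUnion.2 ⟨x, p.mem_domChart x⟩
  let τ : SmoothBumpFunction 𝓘(ℝ, EB) b := Classical.arbitrary _
  have hτ : IsCompact (p.proj ⁻¹' tsupport τ) := p.isProper.isCompact_preimage τ.hasCompactSupport
  have hfin := f.locallyFinite.finite_nonempty_inter_compact hτ
  refine ⟨hfin.toFinset, fun i x => ((τ (p.proj x) * f i x : ℝ) : ℂ), fun i x => ?_,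
    fun i _ => ?_, ?_⟩
  · exact smFun_ofReal (((τ.contMDiff.contMDiffAt).comp x (p.contMDiffAt_proj_real x)).mul
      (f i).contMDiff.contMDiffAt)
  · have h1 : tsupport (fun x => ((τ (p.proj x) * f i x : ℝ) : ℂ)) ⊆ p.proj ⁻¹' tsupport τ := by
      refine closure_minimal ?_ ((isClosed_tsupport _).preimage p.isProper.continuous)
      intro x hx
      refine subset_tsupport _ fun h => hx ?_
      simp [h]
    have h2 : tsupport (fun x => ((τ (p.proj x) * f i x : ℝ) : ℂ)) ⊆ tsupport (f i) := by
      refine closure_mono fun x hx => ?_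
      intro h
      refine hx ?_
      simp [h]
    exact ⟨hτ.of_isClosed_subset (isClosed_tsupport _) h1, h2.trans (hf i)⟩
  · have h1 : ∀ᶠ b' in 𝓝 b, τ b' = 1 := τ.eventuallyEq_one
    filter_upwards [h1] with b' hb' x hx
    have hx1 : p.proj x ∈ tsupport τ := subset_tsupport _ (by simp [hx, hb'])
    have h2 := f.sum_eq_one (Set.mem_univ x)
    rw [finsum_eq_sum_of_support_subset (s := hfin.toFinset)] at h2
    · rw [← Complex.ofReal_sum, ← Finset.mul_sum, h2, hx, hb']
      simp
    · intro i hi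
      simp only [Set.Finite.coe_toFinset, Set.mem_ofPred_eq]
      exact ⟨x, hi, hx1⟩

/-- The fibre integral of a form of degree `2n` is smooth, and its differential is the fibre
integral of the exterior derivative. -/
theorem fibre_integration [T2Space B] [SecondCountableTopology X]
    {Ψ : X → EX [⋀^Fin (2 * n)]→L[ℝ] ℂ} (hΨ : ∀ z, SmoothAt Ψ z) (b : B) :
    SmFun EB (fun b => integral (p.restrict b Ψ)) b ∧
      ∀ (u : EB) (w : p.Fiber b → EX), (∀ z : p.Fiber b, mD EX EB p.proj z.1 (w z) = u) →
        mD EB ℂ (fun b => integral (p.restrict b Ψ)) b u =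
          integral (p.contractFibre w (dForm Ψ)) := by
  obtain ⟨I, f, hf, hI, h1⟩ := p.exists_finite_partition b
  set Φ : X → X → EX [⋀^Fin (2 * n)]→L[ℝ] ℂ := fun i x => f i x • Ψ x with hΦ
  have hΦs : ∀ i x, SmoothAt (Φ i) x := fun i x => SmoothAt.fun_smul (hf i x) (hΨ x)
  have hΦt : ∀ i, tsupport (Φ i) ⊆ tsupport (f i) := fun i =>
    closure_mono fun x hx h => hx (by rw [hΦ]; simp [h])
  have hloc : ∀ i ∈ I, _ := fun i hi => p.fibre_integration_local i (hΦs i)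
    ((hI i hi).1.of_isClosed_subset (isClosed_tsupport _) (hΦt i))
    ((hΦt i).trans (hI i hi).2) b
  have he : (fun b => integral (p.restrict b Ψ)) =ᶠ[𝓝 b]
      fun b => ∑ i ∈ I, integral (p.restrict b (Φ i)) := by
    filter_upwards [h1] with b' hb'
    rw [← integral_sum I fun i _ x => p.smoothAt_restrict (hΦs i x.1)]
    refine integral_congr_form fun x => ?_
    have : Ψ x.1 = ∑ i ∈ I, Φ i x.1 := by
      rw [hΦ, ← Finset.sum_smul, hb' x.1 x.2, one_smul]
    ext u
    change Ψ x.1 _ = _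
    rw [this, ContinuousAlternatingMap.sum_apply, ContinuousAlternatingMap.sum_apply]
    rfl
  have hs : ∀ J : Finset X, J ⊆ I → SmFun EB (fun b => ∑ i ∈ J, integral (p.restrict b (Φ i))) b ∧
      mD EB ℂ (fun b => ∑ i ∈ J, integral (p.restrict b (Φ i))) b =
        ∑ i ∈ J, mD EB ℂ (fun b => integral (p.restrict b (Φ i))) b := by
    intro J
    induction J using Finset.cons_induction with
    | empty =>
      intro _
      simp only [Finset.sum_empty]
      exact ⟨contMDiffAt_const, mfderiv_const⟩
    | cons i J hi ih =>
      intro hJ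
      simp only [Finset.sum_cons]
      have hi := hloc i (hJ (Finset.mem_cons_self _ _))
      have ih := ih fun j hj => hJ (Finset.mem_cons_of_mem hj)
      exact ⟨ContMDiffAt.add hi.1 ih.1, by rw [mD_add hi.1.mdiff ih.1.mdiff, ih.2]⟩
  obtain ⟨hs1, hs2⟩ := hs I subset_rfl
  refine ⟨hs1.congr_of_eventuallyEq he, fun u w hw => ?_⟩
  rw [mD_congr he, hs2, _root_.sum_apply,
    Finset.sum_congr rfl fun i hi => (hloc i hi).2 u w hw,
    ← integral_sum I fun i _ x => p.smoothAt_contractFibre hw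
      (fun z => SmoothAt.dForm (Filter.Eventually.of_forall (hΦs i))) x]
  refine integral_congr_form fun x => ?_
  have hx : dForm Ψ x.1 = ∑ i ∈ I, dForm (Φ i) x.1 := by
    rw [← dForm_sum I fun i _ => hΦs i x.1]
    refine dForm_congr ?_
    have := p.isProper.continuous.continuousAt (x := x.1)
    rw [← x.2] at h1
    filter_upwards [this h1] with z hz
    rw [hΦ, ← Finset.sum_smul, hz z rfl, one_smul]
  ext u
  change _ = dForm Ψ x.1 _
  rw [hx, ContinuousAlternatingMap.sum_apply, ContinuousAlternatingMap.sum_apply]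
  rfl

end Family

section Positivity

theorem wedge_real {E : Type*} [NormedAddCommGroup E] [NormedSpace ℂ E] (k : ℕ) :
    ∀ α β : Alt E, (∀ l u, (α l u).im = 0) → (∀ l u, (β l u).im = 0) →
      ∀ u, (wedge α β k u).im = 0 := by
  induction k with
  | zero =>
    intro α β hα hβ u
    rw [wedge_zero_apply, Complex.mul_im, hα, hβ]
    simp
  | succ k ih =>
    intro α β hα hβ u
    have e : wedge α β (k + 1) u = iota (u 0) (wedge α β) k (Fin.tail u) := by
      rw [iota_apply]
      congr 1
      exact (Fin.cons_self_tail u).symm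
    have hs : ∀ l u, (signAlt α l u).im = 0 := by
      intro l u
      change ((-1 : ℂ) ^ l * α l u).im = 0
      rcases Nat.even_or_odd l with h | h
      · rw [h.neg_one_pow, one_mul, hα]
      · rw [h.neg_one_pow, neg_one_mul, Complex.neg_im, hα, neg_zero]
    rw [e, iota_wedge, Pi.add_apply, ContinuousAlternatingMap.add_apply, Complex.add_im,
      ih (iota (u 0) α) β (fun l v => hα _ _) hβ, ih (signAlt α) (iota (u 0) β) hs fun l v => hβ _ _,
      add_zero]

theorem ofDegree_real {E : Type*} [NormedAddCommGroup E] [NormedSpace ℂ E] {k : ℕ}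
    {α : E [⋀^Fin k]→L[ℝ] ℂ} (h : ∀ u, (α u).im = 0) (l : ℕ) (u : Fin l → E) :
    (ofDegree k α l u).im = 0 := by
  rcases eq_or_ne l k with rfl | hl
  · simpa [ofDegree] using h u
  · simp [ofDegree, hl]

theorem wpow_real {E : Type*} [NormedAddCommGroup E] [NormedSpace ℂ E]
    {α : E [⋀^Fin 2]→L[ℝ] ℂ} (h : ∀ u, (α u).im = 0) (m : ℕ) :
    ∀ l u, (wpow α m l u).im = 0 := by
  induction m with
  | zero => exact fun l u => ofDegree_real (fun _ => by simp) l u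
  | succ m ih => exact fun l u => wedge_real l _ _ (ofDegree_real h) ih u

/-- The top exterior power of a positive `(1,1)`-form does not vanish. -/
theorem exists_wpow_ne_zero (n : ℕ) : ∀ {V : Type*} [NormedAddCommGroup V] [NormedSpace ℂ V]
    [FiniteDimensional ℂ V] (_ : Module.finrank ℂ V = n) (α : V [⋀^Fin 2]→L[ℝ] ℂ)
    (_ : ∀ u, (α u).im = 0) (_ : ∀ u v, α ![Complex.I • u, Complex.I • v] = α ![u, v])
    (_ : ∀ u, u ≠ 0 → α ![u, Complex.I • u] ≠ 0),
    ∃ v, wpow α n (2 * n) v ≠ 0 := by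
  induction n with
  | zero =>
    intro V _ _ _ _ α _ _ _
    exact ⟨Fin.elim0, by simp [wpow, altOne]⟩
  | succ n ih =>
    intro V _ _ _ hV α hre hJ hpos
    have : Nontrivial V := Module.nontrivial_of_finrank_pos (R := ℂ) (by omega)
    obtain ⟨x, hx⟩ := exists_ne (0 : V)
    have hup : ∀ u w : V, Function.update ![u, 0] 1 w = ![u, w] := by
      intro u w
      funext i
      fin_cases i <;> simp
    have hadd : ∀ u v w, α ![u, v + w] = α ![u, v] + α ![u, w] := by
      intro u v w
      have := α.map_update_add ![u, 0] 1 v w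
      rwa [hup, hup, hup] at this
    have hsm : ∀ (u v : V) (c : ℝ), α ![u, c • v] = c • α ![u, v] := by
      intro u v c
      have := α.map_update_smul ![u, 0] 1 c v
      rwa [hup, hup] at this
    have hJ' : ∀ u v, α ![u, Complex.I • v] = -α ![Complex.I • u, v] := by
      intro u v
      rw [← hJ u (Complex.I • v), smul_smul, Complex.I_mul_I, neg_one_smul]
      have := hsm (Complex.I • u) v (-1)
      simpa using this
    let f : V →ₗ[ℂ] ℂ :=
      { toFun := fun w => α ![x, w] + Complex.I * α ![Complex.I • x, w]
        map_add' := fun v w => by rw [hadd, hadd]; ring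
        map_smul' := fun c w => by
          have h : ∀ u, α ![u, c • w] = c.re * α ![u, w] + c.im * α ![u, Complex.I • w] := by
            intro u
            have e : c • w = c.re • w + c.im • (Complex.I • w) := by
              conv_lhs => rw [← Complex.re_add_im c]
              rw [add_smul, mul_smul, Complex.coe_smul, Complex.coe_smul]
            rw [e, hadd, hsm, hsm]
            simp
          rw [h, h, hJ x w, hJ' x w]
          simp only [RingHom.id_apply, smul_eq_mul]
          linear_combination (α ![x, w] + Complex.I * α ![Complex.I • x, w]) *
            Complex.re_add_im c - α ![Complex.I • x, w] * c.im * Complex.I_sq }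
    have hf : ∀ w, f w = 0 ↔ α ![x, w] = 0 ∧ α ![Complex.I • x, w] = 0 := by
      intro w
      refine ⟨fun h => ?_, fun h => by simp [f, h]⟩
      have h1 : α ![x, w] + Complex.I * α ![Complex.I • x, w] = 0 := h
      have h2 := congrArg Complex.re h1
      have h3 := congrArg Complex.im h1
      simp [hre] at h2 h3
      exact ⟨Complex.ext h2 (hre _), Complex.ext h3 (hre _)⟩
    have hfne : f ≠ 0 := by
      intro h
      have := (hf (Complex.I • x)).1 (by rw [h]; rfl)
      exact hpos x hx this.1
    have hrank : Module.finrank ℂ (LinearMap.ker f) = n := by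
      have h1 := f.finrank_range_add_finrank_ker
      have h2 : LinearMap.range f = ⊤ := LinearMap.range_eq_top.2 (LinearMap.surjective hfne)
      rw [h2, finrank_top, hV, Module.finrank_self] at h1
      omega
    let ι : LinearMap.ker f →L[ℝ] V := (LinearMap.ker f).subtypeL.restrictScalars ℝ
    obtain ⟨v, hv⟩ := ih (V := LinearMap.ker f) hrank (α.compContinuousLinearMap ι)
      (fun u => hre _) (fun u v => by
        have := hJ u.1 v.1
        refine Eq.trans ?_ (this.trans ?_)
        · change α _ = _
          congr 1
          funext i
          fin_cases i <;> rfl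
        · change _ = α _
          congr 1
          funext i
          fin_cases i <;> rfl)
      (fun u hu => by
        have := hpos u.1 fun h => hu (Subtype.ext h)
        refine fun h => this (Eq.trans ?_ h)
        change _ = α _
        congr 1
        funext i
        fin_cases i <;> rfl)
    refine ⟨Matrix.vecCons x (Matrix.vecCons (Complex.I • x) fun i => (v i : V)), ?_⟩
    have ha : altComp (ofDegree 1 (α.curryLeft x)) ι = 0 := by
      rw [altComp_ofDegree]
      have : (α.curryLeft x).compContinuousLinearMap ι = 0 := by
        ext u
        have := ((hf (u 0).1).1 (u 0).2).1
        refine Eq.trans ?_ this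
        change α _ = α _
        congr 1
        funext i
        fin_cases i <;> rfl
      rw [this]
      exact Pi.single_zero 1
    have hval : iota (Complex.I • x) (ofDegree 1 (α.curryLeft x)) =
        α ![x, Complex.I • x] • (altOne : Alt V) := by
      rw [iota_ofDegree, smul_altOne]
      congr 1
      ext u
      change α _ = α _
      congr 1
      funext i
      fin_cases i <;> rfl
    have h1 : wpow α (n + 1) (2 * (n + 1))
        (Matrix.vecCons x (Matrix.vecCons (Complex.I • x) fun i => (v i : V))) =
        altComp (iota (Complex.I • x) (iota x (wpow α (n + 1)))) ι (2 * n) v := rfl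
    rw [h1, iota_wpow, iota_smul, iota_wedge, hval, Nat.add_sub_cancel]
    have h2 : ∀ A B C : Alt V, altComp C ι = 0 →
        altComp (((n + 1 : ℕ) : ℂ) • (A + wedge (signAlt C) B)) ι =
          ((n + 1 : ℕ) : ℂ) • altComp A ι := by
      intro A B C hC
      have h3 : altComp (wedge (signAlt C) B) ι = 0 := by
        have : altComp (signAlt C) ι = signAlt (altComp C ι) := rfl
        rw [altComp_wedge, this, hC]
        have : signAlt (0 : Alt (LinearMap.ker f)) = 0 := by
          funext k
          exact smul_zero _
        rw [this, wedge_zero_left]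
      have h4 : altComp (((n + 1 : ℕ) : ℂ) • (A + wedge (signAlt C) B)) ι =
        ((n + 1 : ℕ) : ℂ) • (altComp A ι + altComp (wedge (signAlt C) B) ι) := rfl
      rw [h4, h3, add_zero]
    rw [h2 _ _ _ ha, wedge_smul_left, altOne_wedge]
    have h5 : altComp (α ![x, Complex.I • x] • wpow α n) ι =
      α ![x, Complex.I • x] • altComp (wpow α n) ι := rfl
    rw [h5, altComp_wpow]
    refine mul_ne_zero ?_ (mul_ne_zero (hpos x hx) hv)
    exact_mod_cast Nat.succ_ne_zero n

theorem wpow_stdFrame_ne_zero {n : ℕ} (α : (Fin n → ℂ) [⋀^Fin 2]→L[ℝ] ℂ)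
    (hre : ∀ u, (α u).im = 0) (hJ : ∀ u v, α ![Complex.I • u, Complex.I • v] = α ![u, v])
    (hpos : ∀ u, u ≠ 0 → α ![u, Complex.I • u] ≠ 0) : wpow α n (2 * n) (stdFrame n) ≠ 0 := by
  obtain ⟨v, hv⟩ := exists_wpow_ne_zero n (V := Fin n → ℂ) (by simp) α hre hJ hpos
  intro h
  rw [top_eq_zero h] at hv
  exact hv rfl

end Positivity

theorem contDiffAt_det {V : Type*} [NormedAddCommGroup V] [NormedSpace ℂ V] {n : ℕ}
    {m : WithTop ℕ∞} {A : V → (Fin n → ℂ) →L[ℂ] (Fin n → ℂ)} {y : V} (h : ContDiffAt ℂ m A y) :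
    ContDiffAt ℂ m (fun z => LinearMap.det (A z : (Fin n → ℂ) →ₗ[ℂ] (Fin n → ℂ))) y := by
  have e : ∀ z, LinearMap.det (A z : (Fin n → ℂ) →ₗ[ℂ] (Fin n → ℂ)) =
      ∑ σ : Equiv.Perm (Fin n), (Equiv.Perm.sign σ : ℤ) •
        ∏ i, A z (Pi.single i 1) (σ i) := by
    intro z
    rw [← LinearMap.det_toMatrix', Matrix.det_apply]
    refine Finset.sum_congr rfl fun σ _ => ?_
    simp only [LinearMap.toMatrix'_apply]
    rfl
  simp only [e]
  refine ContDiffAt.sum fun σ _ => ?_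
  simp only [zsmul_eq_mul]
  refine contDiffAt_const.mul (contDiffAt_prod fun i _ => ?_)
  exact contDiffAt_pi.1 (h.clm_apply contDiffAt_const) (σ i)

namespace Family

variable {n : ℕ} {EX EB X B : Type*} [NormedAddCommGroup EX] [NormedSpace ℂ EX]
  [FiniteDimensional ℂ EX] [NormedAddCommGroup EB] [NormedSpace ℂ EB] [FiniteDimensional ℂ EB]
  [TopologicalSpace X] [ChartedSpace EX X] [TopologicalSpace B] [ChartedSpace EB B]
  (p : Family n EX EB X B) {η : X → EX [⋀^Fin 2]→L[ℝ] ℂ}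

theorem BalancedType.apply_I {k : ℕ} {E M : Type*} [NormedAddCommGroup E] [NormedSpace ℂ E]
    {η : M → E [⋀^Fin k]→L[ℝ] ℂ} (h : BalancedType η) (x : M) (u : Fin k → E) :
    η x (fun i => Complex.I • u i) = η x u := h x u Complex.I (by simp)

/-- The vertical coordinate directions in the tangent space. -/
def vertMap (x z : X) : (Fin n → ℂ) →L[ℝ] EX :=
  (cD (p.domChart x) (p.domChart x z)).comp ((p.vert x).restrictScalars ℝ)

/-- The value of `ηⁿ` on the vertical coordinate frame. -/
def vertVol (η : X → EX [⋀^Fin 2]→L[ℝ] ℂ) (x z : X) : ℂ :=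
  wpow (η z) n (2 * n) (p.verticalFrame x z)

/-- The logarithm of the vertical volume. -/
def vertLog (η : X → EX [⋀^Fin 2]→L[ℝ] ℂ) (x z : X) : ℂ := (Real.log (p.vertVol η x z).re : ℂ)

theorem relativeCurvature_eq (x : X) : p.relativeCurvature η x =
    (-(1 / (2 * Real.pi)) : ℝ) • ddbar (p.vertLog η x) x := rfl

theorem vertVol_eq (x z : X) : p.vertVol η x z =
    wpow ((η z).compContinuousLinearMap (p.vertMap x z)) n (2 * n) (stdFrame n) := by
  rw [← altComp_wpow]
  rfl

variable [IsManifold 𝓘(ℂ, EX) ω X] [IsManifold 𝓘(ℂ, EB) ω B]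

theorem mD_proj_vertMap (x : X) {z : X} (hz : z ∈ (p.domChart x).source) (u : Fin n → ℂ) :
    mD EX EB p.proj z (p.vertMap x z u) = 0 := by
  have hy := (p.domChart x).map_source hz
  have h := p.mD_proj_cD x hy (p.vert x u)
  rw [(p.domChart x).left_inv hz, vert_apply, ContinuousLinearEquiv.apply_symm_apply] at h
  have h2 := congrFun (congrArg DFunLike.coe (cD_mD (p.codChart_mem x) (p.proj_mem x hz)))
    (mD EX EB p.proj z (p.vertMap x z u))
  refine h2.symm.trans ?_
  change cD _ _ (mD EB EB (p.codChart x) (p.proj z) (mD EX EB p.proj z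
    (cD (p.domChart x) (p.domChart x z) ((p.split x).symm (0, u))))) = 0
  rw [h, map_zero]

theorem vertMap_injective (x : X) {z : X} (hz : z ∈ (p.domChart x).source) :
    Function.Injective (p.vertMap x z) := by
  intro u v huv
  have h := mD_cD (p.domChart_mem x) ((p.domChart x).map_source hz)
  have h2 := congrArg (mD EX EX (p.domChart x) ((p.domChart x).symm (p.domChart x z))) huv
  have h3 : ∀ w, mD EX EX (p.domChart x) ((p.domChart x).symm (p.domChart x z)) (p.vertMap x z w) =
    p.vert x w := fun w => congrFun (congrArg DFunLike.coe h) (p.vert x w)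
  rw [h3, h3, vert_apply, vert_apply] at h2
  simpa using (p.split x).symm.injective h2

theorem vertMap_I (x : X) {z : X} (hz : z ∈ (p.domChart x).source) (u : Fin n → ℂ) :
    p.vertMap x z (Complex.I • u) = Complex.I • p.vertMap x z u := by
  change cD _ _ (p.vert x (Complex.I • u)) = _
  rw [map_smul, cD_J (p.domChart_mem x) ((p.domChart x).map_source hz)]
  rfl

/-- The top power of a relatively Kähler form does not vanish on vertical tangent vectors. -/
theorem IsRelativelyKahler.wpow_comp_ne_zero {p : Family n EX EB X B} (hη : p.IsRelativelyKahler η)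
    {x : X} (A : (Fin n → ℂ) →L[ℝ] EX) (hA : Function.Injective A)
    (hAI : ∀ u, A (Complex.I • u) = Complex.I • A u) (hAp : ∀ u, mD EX EB p.proj x (A u) = 0) :
    wpow ((η x).compContinuousLinearMap A) n (2 * n) (stdFrame n) ≠ 0 := by
  refine wpow_stdFrame_ne_zero _ (fun u => hη.real _ _) (fun u v => ?_) fun u hu h => ?_
  · refine Eq.trans ?_ (BalancedType.apply_I hη.type x (fun i => A (![u, v] i)))
    change η x _ = η x _
    congr 1
    funext i
    fin_cases i <;> simp [hAI]
  · have h1 := hη.pos x (A u) (hAp u) fun h => hu (hA (h.trans (map_zero A).symm))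
    refine h1.ne' ?_
    have e : (η x) ![A u, Complex.I • A u] =
        (η x).compContinuousLinearMap A ![u, Complex.I • u] := by
      change η x _ = η x _
      congr 1
      funext i
      fin_cases i <;> simp [hAI]
    rw [e, h]
    rfl

theorem vertVol_ne_zero (hη : p.IsRelativelyKahler η) (x : X) {z : X}
    (hz : z ∈ (p.domChart x).source) : p.vertVol η x z ≠ 0 := by
  rw [vertVol_eq]
  exact hη.wpow_comp_ne_zero _ (p.vertMap_injective x hz) (p.vertMap_I x hz)
    (p.mD_proj_vertMap x hz)

theorem vertVol_real (hη : p.IsRelativelyKahler η) (x z : X) :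
    ((p.vertVol η x z).re : ℂ) = p.vertVol η x z :=
  Complex.ext rfl (wpow_real (hη.real z) _ _ _).symm

theorem vertVol_re_ne_zero (hη : p.IsRelativelyKahler η) (x : X) {z : X}
    (hz : z ∈ (p.domChart x).source) : (p.vertVol η x z).re ≠ 0 := by
  intro h
  refine p.vertVol_ne_zero hη x hz ?_
  rw [← p.vertVol_real hη, h, Complex.ofReal_zero]

theorem smFun_vertVol (hη : ∀ x, SmoothAt η x) (x : X) {z : X}
    (hz : z ∈ (p.domChart x).source) : SmFun EX (p.vertVol η x) z := by
  rw [smFun_iff (p.domChart_mem x) hz]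
  have h1 := (smoothAt_iff (p.domChart_mem x) hz).1 ((SmoothAltAt.wpow (hη z) n) (2 * n))
  refine (contDiffAt_alt_iff.1 h1 fun i => p.vert x (stdFrame n i)).congr_of_eventuallyEq ?_
  filter_upwards [(p.domChart x).open_target.mem_nhds ((p.domChart x).map_source hz)] with y hy
  change wpow (η ((p.domChart x).symm y)) n (2 * n) (fun i =>
    cD (p.domChart x) (p.domChart x ((p.domChart x).symm y)) (p.vert x (stdFrame n i))) = _
  rw [(p.domChart x).right_inv hy]
  rfl

theorem smFun_vertLog (hη : p.IsRelativelyKahler η) (x : X) {z : X}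
    (hz : z ∈ (p.domChart x).source) : SmFun EX (p.vertLog η x) z := by
  have h1 := p.smFun_vertVol (smoothForm_iff.1 hη.smooth) x hz
  rw [smFun_iff (p.domChart_mem x) hz] at h1 ⊢
  have h2 : ContDiffAt ℝ ∞ (fun y => (p.vertVol η x ((p.domChart x).symm y)).re)
      (p.domChart x z) := Complex.reCLM.contDiff.contDiffAt.comp _ h1
  refine Complex.ofRealCLM.contDiff.contDiffAt.comp _ (h2.log ?_)
  rw [(p.domChart x).left_inv hz]
  exact p.vertVol_re_ne_zero hη x hz

section Transform

variable {F : X → X} (hF : ContMDiff 𝓘(ℂ, EX) 𝓘(ℂ, EX) ω F)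
  (hv : ∀ z w, mD EX EB p.proj z w = 0 → mD EX EB p.proj (F z) (mD EX EX F z w) = 0)
  (hinv : pullback F η = η)

/-- The vertical block of the differential of a map, in charts. -/
def vertBlock (F : X → X) (x₁ x₂ : X) (y : EX) : (Fin n → ℂ) →L[ℂ] (Fin n → ℂ) :=
  ((ContinuousLinearMap.snd ℂ EB (Fin n → ℂ)).comp
    (p.split x₂ : EX →L[ℂ] EB × (Fin n → ℂ))).comp
      ((fderiv ℂ (fun z => p.domChart x₂ (F ((p.domChart x₁).symm z))) y).comp (p.vert x₁))

include hF in
theorem contDiffAt_transition {x₁ x₂ z : X} (hz : z ∈ (p.domChart x₁).source)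
    (hFz : F z ∈ (p.domChart x₂).source) :
    ContDiffAt ℂ ω (fun z => p.domChart x₂ (F ((p.domChart x₁).symm z))) (p.domChart x₁ z) := by
  rw [← contMDiffAt_iff_contDiffAt]
  have h1 : ContMDiffAt 𝓘(ℂ, EX) 𝓘(ℂ, EX) ω (p.domChart x₁).symm (p.domChart x₁ z) :=
    (contMDiffOn_symm_of_mem_maximalAtlas (p.domChart_mem x₁)).contMDiffAt
      ((p.domChart x₁).open_target.mem_nhds ((p.domChart x₁).map_source hz))
  have e := (p.domChart x₁).left_inv hz
  have h2 : ContMDiffAt 𝓘(ℂ, EX) 𝓘(ℂ, EX) ω (p.domChart x₂)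
      (F ((p.domChart x₁).symm (p.domChart x₁ z))) := by
    rw [e]
    exact contMDiffAt_of_mem_maximalAtlas (p.domChart_mem x₂) hFz
  exact h2.comp (p.domChart x₁ z) (ContMDiffAt.comp (p.domChart x₁ z) (hF _) h1)

include hF hv in
theorem mD_vertMap {x₁ x₂ z : X} (hz : z ∈ (p.domChart x₁).source)
    (hFz : F z ∈ (p.domChart x₂).source) (u : Fin n → ℂ) :
    mD EX EX F z (p.vertMap x₁ z u) =
      p.vertMap x₂ (F z) (p.vertBlock F x₁ x₂ (p.domChart x₁ z) u) := by
  have hy := (p.domChart x₁).map_source hz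
  have e := (p.domChart x₁).left_inv hz
  have hH := p.contDiffAt_transition hF hz hFz
  have h1 := mD_comp_cD (p.domChart_mem x₂) (p.domChart_mem x₁) (f := F) (y := p.domChart x₁ z)
    ((ContMDiffAt.to_real (hF _)).mdifferentiableAt (by simp)) hy (by rwa [e])
  rw [e] at h1
  have h2 := (hH.differentiableAt (by simp)).fderiv_restrictScalars ℝ
  rw [h2] at h1
  have h3 : mD EX EX F z (p.vertMap x₁ z u) = cD (p.domChart x₂) (p.domChart x₂ (F z))
      (fderiv ℂ (fun z => p.domChart x₂ (F ((p.domChart x₁).symm z))) (p.domChart x₁ z)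
        (p.vert x₁ u)) := congrFun (congrArg DFunLike.coe h1) (p.vert x₁ u)
  have h4 := hv z _ (p.mD_proj_vertMap x₁ hz u)
  rw [h3] at h4 ⊢
  have h5 := p.mD_proj_cD x₂ ((p.domChart x₂).map_source hFz)
    (fderiv ℂ (fun z => p.domChart x₂ (F ((p.domChart x₁).symm z))) (p.domChart x₁ z)
        (p.vert x₁ u))
  rw [(p.domChart x₂).left_inv hFz, h4, map_zero] at h5
  change _ = cD (p.domChart x₂) (p.domChart x₂ (F z)) (p.vert x₂ _)
  congr 1
  rw [vert_apply p x₂, ContinuousLinearEquiv.eq_symm_apply]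
  exact Prod.ext h5.symm rfl

include hF hv hinv in
theorem vertVol_transform {x₁ x₂ z : X} (hz : z ∈ (p.domChart x₁).source)
    (hFz : F z ∈ (p.domChart x₂).source) :
    p.vertVol η x₁ z = ((‖LinearMap.det (p.vertBlock F x₁ x₂ (p.domChart x₁ z) :
      (Fin n → ℂ) →ₗ[ℂ] (Fin n → ℂ))‖ ^ 2 : ℝ) : ℂ) * p.vertVol η x₂ (F z) := by
  rw [← det_complex_linear]
  have h := top_apply_comp (altComp (wpow (η (F z)) n) (p.vertMap x₂ (F z)) (2 * n))
    ((p.vertBlock F x₁ x₂ (p.domChart x₁ z) : (Fin n → ℂ) →ₗ[ℂ] (Fin n → ℂ)).restrictScalars ℝ)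
  refine Eq.trans ?_ h
  have h1 : wpow (η z) n = altComp (wpow (η (F z)) n) (mD EX EX F z) := by
    rw [altComp_wpow]
    have := congrFun hinv z
    exact congrArg (fun a => wpow a n) this.symm
  change wpow (η z) n (2 * n) (fun i => p.vertMap x₁ z (stdFrame n i)) = _
  rw [h1]
  change wpow (η (F z)) n (2 * n) (fun i => mD EX EX F z (p.vertMap x₁ z (stdFrame n i))) = _
  simp only [p.mD_vertMap hF hv hz hFz]
  rfl

include hF hv hinv in
theorem pullback_ddbar_vertLog (hη : p.IsRelativelyKahler η) {x₁ x₂ z : X}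
    (hz : z ∈ (p.domChart x₁).source) (hFz : F z ∈ (p.domChart x₂).source) :
    pullback (E' := EX) F (ddbar (E := EX) (p.vertLog η x₂)) z = ddbar (p.vertLog η x₁) z := by
  set g : EX → ℂ := fun y => LinearMap.det (p.vertBlock F x₁ x₂ y :
      (Fin n → ℂ) →ₗ[ℂ] (Fin n → ℂ)) with hg
  have hFc : ∀ z, MDifferentiableAt 𝓘(ℂ, EX) 𝓘(ℂ, EX) F z := fun z =>
    (hF z).mdifferentiableAt (by simp)
  have hsm2 := p.smFun_vertLog hη x₂ hFz
  have hgs : ContDiffAt ℂ ω g (p.domChart x₁ z) := by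
    refine contDiffAt_det (contDiffAt_const.clm_comp (ContDiffAt.clm_comp ?_ contDiffAt_const))
    exact (p.contDiffAt_transition hF hz hFz).fderiv_right (m := ω) le_top
  have hg0 : g (p.domChart x₁ z) ≠ 0 := by
    intro h
    refine p.vertVol_ne_zero hη x₁ hz ?_
    rw [p.vertVol_transform hF hv hinv hz hFz]
    change (((‖g (p.domChart x₁ z)‖ ^ 2 : ℝ) : ℂ)) * _ = 0
    rw [h]
    simp
  have hev : ∀ᶠ y in 𝓝 (p.domChart x₁ z), DifferentiableAt ℂ g y ∧ ContDiffAt ℝ ∞ g y := by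
    filter_upwards [hgs.eventually (by simp)] with y hy
    exact ⟨hy.differentiableAt (by simp), (hy.restrict_scalars ℝ).of_le le_top⟩
  have h0 := ddbar_log_normSq hev hg0
  have hgl : ContDiffAt ℝ ∞ (fun y => ((Real.log (‖g y‖ ^ 2) : ℝ) : ℂ)) (p.domChart x₁ z) := by
    have h1 := ((hgs.restrict_scalars ℝ).of_le le_top : ContDiffAt ℝ ∞ g _)
    refine Complex.ofRealCLM.contDiff.contDiffAt.comp _ (ContDiffAt.log (h1.norm_sq ℝ) ?_)
    simpa using hg0
  have hc := contMDiffAt_chart (p.domChart_mem x₁) hz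
  have hlog : SmFun EX (fun w => ((Real.log (‖g (p.domChart x₁ w)‖ ^ 2) : ℝ) : ℂ)) z :=
    ContMDiffAt.comp z (g := fun y => ((Real.log (‖g y‖ ^ 2) : ℝ) : ℂ)) hgl.contMDiffAt hc
  have he : p.vertLog η x₁ =ᶠ[𝓝 z] fun w => ((Real.log (‖g (p.domChart x₁ w)‖ ^ 2) : ℝ) : ℂ) +
      p.vertLog η x₂ (F w) := by
    filter_upwards [(p.domChart x₁).open_source.mem_nhds hz,
      hF.continuous.continuousAt.preimage_mem_nhds ((p.domChart x₂).open_source.mem_nhds hFz)]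
      with w hw hFw
    have h1 := p.vertVol_transform hF hv hinv hw hFw
    change p.vertVol η x₁ w = ((‖g (p.domChart x₁ w)‖ ^ 2 : ℝ) : ℂ) * _ at h1
    have hne := p.vertVol_re_ne_zero hη x₁ hw
    have hne2 := p.vertVol_re_ne_zero hη x₂ hFw
    rw [vertLog, vertLog, h1, Complex.re_ofReal_mul, ← Complex.ofReal_add, ← Real.log_mul _ hne2]
    intro h
    rw [h1, Complex.re_ofReal_mul, h, zero_mul] at hne
    exact hne rfl
  have hsmF : SmFun EX (fun w => p.vertLog η x₂ (F w)) z :=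
    ContMDiffAt.comp (f := F) (g := p.vertLog η x₂) z hsm2 (ContMDiffAt.to_real (hF z))
  rw [pullback_ddbar (E := EX) (E' := EX) hsm2 (Filter.Eventually.of_forall hFc)
    (ContMDiffAt.to_real (hF z)), ddbar_congr he,
    ddbar_add hlog hsmF]
  have h2 := pullback_ddbar (E := EX) (E' := EX) (F := p.domChart x₁) (x := z)
    (f := fun y => ((Real.log (‖g y‖ ^ 2) : ℝ) : ℂ)) (smFun_iff_contDiffAt.2 hgl) (by
      filter_upwards [(p.domChart x₁).open_source.mem_nhds hz] with w hw
      exact mdifferentiableAt_chart (p.domChart_mem x₁) hw) hc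
  rw [← h2]
  have h3 : pullback (E' := EX) (p.domChart x₁)
      (ddbar (E := EX) fun y => ((Real.log (‖g y‖ ^ 2) : ℝ) : ℂ)) z = 0 := by
    ext u
    rw [pullback_apply, h0]
    rfl
  rw [h3, zero_add]

end Transform

theorem ddbar_vertLog_eq (hη : p.IsRelativelyKahler η) {x₁ x₂ z : X}
    (hz : z ∈ (p.domChart x₁).source) (hz' : z ∈ (p.domChart x₂).source) :
    ddbar (E := EX) (p.vertLog η x₂) z = ddbar (p.vertLog η x₁) z := by
  have := p.pullback_ddbar_vertLog (F := fun x => x) (η := η) contMDiff_id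
    (fun z w h => by rw [mD_id]; exact h) (pullback_id η) hη hz hz'
  rwa [pullback_id] at this

theorem relativeCurvature_eventuallyEq (hη : p.IsRelativelyKahler η) (x : X) {z : X}
    (hz : z ∈ (p.domChart x).source) : p.relativeCurvature η =ᶠ[𝓝 z]
      fun z => (-(1 / (2 * Real.pi)) : ℝ) • ddbar (p.vertLog η x) z := by
  filter_upwards [(p.domChart x).open_source.mem_nhds hz] with w hw
  rw [relativeCurvature_eq, p.ddbar_vertLog_eq hη (p.mem_domChart w) hw]

theorem eventually_smFun_vertLog (hη : p.IsRelativelyKahler η) (x : X) {z : X}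
    (hz : z ∈ (p.domChart x).source) : ∀ᶠ w in 𝓝 z, SmFun EX (p.vertLog η x) w := by
  filter_upwards [(p.domChart x).open_source.mem_nhds hz] with w hw
  exact p.smFun_vertLog hη x hw

theorem smoothAt_relativeCurvature (hη : p.IsRelativelyKahler η) (x : X) :
    SmoothAt (p.relativeCurvature η) x :=
  SmoothAt.congr ((smoothAt_ddbar (p.eventually_smFun_vertLog hη x (p.mem_domChart x))).const_smul _)
    (p.relativeCurvature_eventuallyEq hη x (p.mem_domChart x))

theorem dForm_relativeCurvature (hη : p.IsRelativelyKahler η) (x : X) :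
    dForm (p.relativeCurvature η) x = 0 := by
  rw [dForm_congr (p.relativeCurvature_eventuallyEq hη x (p.mem_domChart x)), dForm_const_smul,
    dForm_ddbar (p.eventually_smFun_vertLog hη x (p.mem_domChart x)), smul_zero]

theorem pullback_relativeCurvature (hη : p.IsRelativelyKahler η) {F : X → X}
    (hF : ContMDiff 𝓘(ℂ, EX) 𝓘(ℂ, EX) ω F)
    (hv : ∀ z w, mD EX EB p.proj z w = 0 → mD EX EB p.proj (F z) (mD EX EX F z w) = 0)
    (hinv : pullback F η = η) : pullback F (p.relativeCurvature η) = p.relativeCurvature η := by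
  funext x
  have h := p.pullback_ddbar_vertLog hF hv hinv hη (p.mem_domChart x) (p.mem_domChart (F x))
  rw [relativeCurvature_eq, ← h]
  rfl

/-- The restriction of the relative curvature to a fibre is the Ricci form. -/
theorem restrict_relativeCurvature (hη : p.IsRelativelyKahler η) (b : B) :
    p.restrict b (p.relativeCurvature η) = ricciForm (p.restrict b η) := by
  funext x
  have hb := p.mem_codChart x
  have hsm := p.smFun_vertLog hη x.1 (p.mem_domChart x.1)
  have h1 := pullback_ddbar (E := EX) (E' := Fin n → ℂ) (F := p.incl b) (x := x) hsm
    (Filter.Eventually.of_forall fun z => (p.contMDiff_incl b z).mdifferentiableAt (by simp))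
    (p.contMDiffAt_incl_real x)
  have h2 : (fun y : p.Fiber b => p.vertLog η x.1 (p.incl b y)) =ᶠ[𝓝 x] fun y : p.Fiber b =>
      (Real.log (coordRep (chartAt (Fin n → ℂ) x) (fun z => wpow (p.restrict b η z) n (2 * n))
      (chartAt (Fin n → ℂ) x y) (stdFrame n)).re : ℂ) := by
    filter_upwards [(chartAt (Fin n → ℂ) x).open_source.mem_nhds (mem_chart_source _ x)] with y hy
    have hy' : y ∈ (p.fibreChart x.1 hb).source := hy
    have hyt := (chartAt (Fin n → ℂ) x).map_source hy
    have hcD : cD (chartAt (Fin n → ℂ) x) (chartAt (Fin n → ℂ) x y) =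
        cD (p.fibreChart x.1 hb) (p.fibreChart x.1 hb y) := by
      refine mD_congr ?_
      filter_upwards [(chartAt (Fin n → ℂ) x).open_target.mem_nhds hyt] with w hw
      refine Fiber.ext ?_
      exact (p.fiberInv_val x hw).trans (p.fibreInv_val x.1 hb hw).symm
    have h3 := p.mD_incl_cD x.1 hb ((p.fibreChart x.1 hb).map_source hy')
    rw [(p.fibreChart x.1 hb).left_inv hy'] at h3
    have h4 : p.liftAt x.1 b (p.fibreChart x.1 hb y) = p.domChart x.1 y.1 :=
      p.liftAt_split hy' y.2
    have h5 : p.vertMap x.1 y.1 = (mD (Fin n → ℂ) EX (p.incl b) y).comp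
        (cD (chartAt (Fin n → ℂ) x) (chartAt (Fin n → ℂ) x y)) := by
      rw [hcD, h3, h4]
      rfl
    have h6 : p.vertVol η x.1 y.1 = coordRep (chartAt (Fin n → ℂ) x)
        (fun z => wpow (p.restrict b η z) n (2 * n)) (chartAt (Fin n → ℂ) x y) (stdFrame n) := by
      rw [vertVol_eq, h5, coordRep_apply, (chartAt (Fin n → ℂ) x).left_inv hy]
      change _ = altComp (wpow (p.restrict b η y) n) _ (2 * n) _
      rw [altComp_wpow]
      rfl
    rw [← h6]
    rfl
  rw [ricciForm, ← ddbar_congr h2, ← h1]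
  rfl

end Family

section ParameterDerivative

variable {A E F : Type*} [NormedAddCommGroup A] [NormedSpace ℝ A] [NormedAddCommGroup E]
  [NormedSpace ℂ E] [NormedAddCommGroup F] [NormedSpace ℂ F]

theorem two_le_infty : ((2 : ℕ) : WithTop ℕ∞) ≤ ∞ := by
  simpa using (WithTop.coe_le_coe.2 le_top : ((2 : ℕ∞) : WithTop ℕ∞) ≤ ∞)

theorem smul_eq_re_im {G : Type*} [AddCommGroup G] [Module ℂ G] (c : ℂ) (w : G) :
    c • w = (c.re : ℂ) • w + (c.im : ℂ) • (Complex.I • w) := by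
  rw [smul_smul, ← add_smul, Complex.re_add_im]

theorem differentiableAt_complex {f : E → F} {y : E} (h : DifferentiableAt ℝ f y)
    (hI : ∀ w, fderiv ℝ f y (Complex.I • w) = Complex.I • fderiv ℝ f y w) :
    DifferentiableAt ℂ f y := by
  rw [differentiableAt_iff_restrictScalars ℝ h]
  refine ⟨⟨⟨⟨fderiv ℝ f y, map_add _⟩, fun c w => ?_⟩, (fderiv ℝ f y).continuous⟩, rfl⟩
  change fderiv ℝ f y (c • w) = c • fderiv ℝ f y w
  rw [smul_eq_re_im c w, smul_eq_re_im c (fderiv ℝ f y w), map_add, Complex.coe_smul, Complex.coe_smul, map_smul, map_smul, hI]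
  rfl

variable {Φ : A × E → F} {s : A} {y : E} (v : A)

theorem contDiffAt_paramDeriv (h : ContDiffAt ℝ ∞ Φ (s, y)) :
    ContDiffAt ℝ ∞ (fun z => fderiv ℝ Φ (s, z) (v, 0)) y := by
  have h1 : ContDiffAt ℝ ∞ (fun q => fderiv ℝ Φ q (v, 0)) (s, y) :=
    (h.fderiv_right (m := ∞) le_rfl).clm_apply contDiffAt_const
  exact h1.comp y (contDiffAt_const.prodMk contDiffAt_id)

theorem fderiv_paramDeriv (h : ContDiffAt ℝ ∞ Φ (s, y)) (w : E) :
    fderiv ℝ (fun z => fderiv ℝ Φ (s, z) (v, 0)) y w =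
      fderiv ℝ (fun q => fderiv ℝ Φ q (0, w)) (s, y) (v, 0) := by
  have hd : DifferentiableAt ℝ (fderiv ℝ Φ) (s, y) :=
    (h.fderiv_right (m := ∞) le_rfl).differentiableAt (by simp)
  have h1 : HasFDerivAt (fun z : E => (s, z)) (ContinuousLinearMap.inr ℝ A E) y :=
    hasFDerivAt_prodMk_right _ _
  have h2 : fderiv ℝ (fun z => fderiv ℝ Φ (s, z)) y =
      (fderiv ℝ (fderiv ℝ Φ) (s, y)).comp (ContinuousLinearMap.inr ℝ A E) :=
    (hd.hasFDerivAt.comp y h1).fderiv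
  have h3 : DifferentiableAt ℝ (fun z => fderiv ℝ Φ (s, z)) y :=
    (hd.hasFDerivAt.comp y h1).differentiableAt
  rw [fderiv_clm_apply h3 (differentiableAt_const _), h2,
    fderiv_clm_apply hd (differentiableAt_const _)]
  simp only [fderiv_fun_const, Pi.zero_apply, ContinuousLinearMap.comp_zero, zero_add,
    ContinuousLinearMap.flip_apply, ContinuousLinearMap.comp_apply, ContinuousLinearMap.inr_apply]
  exact (h.isSymmSndFDerivAt (by simpa using two_le_infty)) _ _

theorem differentiableAt_paramDeriv (h : ContDiffAt ℝ ∞ Φ (s, y))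
    (hI : ∀ᶠ q in 𝓝 (s, y), ∀ w, fderiv ℝ Φ q (0, Complex.I • w) =
      Complex.I • fderiv ℝ Φ q (0, w)) :
    DifferentiableAt ℂ (fun z => fderiv ℝ Φ (s, z) (v, 0)) y := by
  refine differentiableAt_complex ((contDiffAt_paramDeriv v h).differentiableAt (by simp))
    fun w => ?_
  rw [fderiv_paramDeriv v h, fderiv_paramDeriv v h]
  have h1 : (fun q => fderiv ℝ Φ q (0, Complex.I • w)) =ᶠ[𝓝 (s, y)]
      fun q => Complex.I • fderiv ℝ Φ q (0, w) := by
    filter_upwards [hI] with q hq using hq w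
  have hd : DifferentiableAt ℝ (fun q => fderiv ℝ Φ q (0, w)) (s, y) :=
    ((h.fderiv_right (m := ∞) le_rfl).clm_apply contDiffAt_const).differentiableAt (by simp)
  rw [h1.fderiv_eq, fderiv_fun_const_smul hd]
  rfl

end ParameterDerivative

section InducedField

variable {EK K : Type*} [NormedAddCommGroup EK] [NormedSpace ℝ EK] [Group K] [TopologicalSpace K]
  [ChartedSpace EK K] [LieGroup 𝓘(ℝ, EK) ∞ K]
  {E M : Type*} [NormedAddCommGroup E] [NormedSpace ℂ E] [TopologicalSpace M] [ChartedSpace E M]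
  [IsManifold 𝓘(ℂ, E) ω M] [MulAction K M] (hM : IsHolomorphicAction EK K E M)

/-- The action in charts: at the identity of the group and a chart of the manifold. -/
def actChart (EK : Type*) [NormedAddCommGroup EK] [NormedSpace ℝ EK] {K : Type*} [Group K]
    [TopologicalSpace K] [ChartedSpace EK K] [MulAction K M] (k : K)
    (c c' : OpenPartialHomeomorph M E) (q : EK × E) : E :=
  c' ((chartAt EK k).symm q.1 • c.symm q.2)

section

include hM

theorem IsHolomorphicAction.contMDiffAt_real (k : K) (x : M) :
    ContMDiffAt 𝓘(ℝ, E) 𝓘(ℝ, E) ∞ (fun x : M => k • x) x := ContMDiffAt.to_real (hM.holomorphic k x)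

theorem IsHolomorphicAction.mdifferentiableAt_complex (k : K) (x : M) :
    MDifferentiableAt 𝓘(ℂ, E) 𝓘(ℂ, E) (fun x : M => k • x) x :=
  (hM.holomorphic k x).mdifferentiableAt (by simp)

theorem IsHolomorphicAction.mdifferentiableAt_real (k : K) (x : M) :
    MDifferentiableAt 𝓘(ℝ, E) 𝓘(ℝ, E) (fun x : M => k • x) x :=
  (hM.contMDiffAt_real k x).mdifferentiableAt (by simp)

theorem IsHolomorphicAction.contMDiffAt_orbit (k : K) (x : M) :
    ContMDiffAt 𝓘(ℝ, EK) 𝓘(ℝ, E) ∞ (fun k : K => k • x) k :=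
  (hM.smooth (k, x)).comp k (contMDiffAt_id.prodMk contMDiffAt_const)

theorem IsHolomorphicAction.continuous : Continuous fun q : K × M => q.1 • q.2 :=
  hM.smooth.continuous

theorem contDiffAt_actChart {c c' : OpenPartialHomeomorph M E}
    (hc : c ∈ IsManifold.maximalAtlas 𝓘(ℂ, E) ω M) (hc' : c' ∈ IsManifold.maximalAtlas 𝓘(ℂ, E) ω M)
    {k g : K} {x : M} (hg : g ∈ (chartAt EK k).source) (hx : x ∈ c.source)
    (hgx : g • x ∈ c'.source) :
    ContDiffAt ℝ ∞ (actChart EK k c c') (chartAt EK k g, c x) := by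
  rw [← contMDiffAt_iff_contDiffAt, modelWithCornersSelf_prod, ← chartedSpaceSelf_prod]
  have h1 : ContMDiffAt 𝓘(ℝ, EK) 𝓘(ℝ, EK) ∞ (chartAt EK k).symm (chartAt EK k g) :=
    (contMDiffOn_chart_symm (x := k)).contMDiffAt
      ((chartAt EK k).open_target.mem_nhds ((chartAt EK k).map_source hg))
  have h2 := contMDiffAt_chart_symm hc (c.map_source hx)
  have e1 := (chartAt EK k).left_inv hg
  have e2 := c.left_inv hx
  have h3 : ContMDiffAt (𝓘(ℝ, EK).prod 𝓘(ℝ, E)) (𝓘(ℝ, EK).prod 𝓘(ℝ, E)) ∞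
      (fun q : EK × E => ((chartAt EK k).symm q.1, c.symm q.2)) (chartAt EK k g, c x) :=
    h1.prodMap h2
  have h4 : ContMDiffAt 𝓘(ℝ, E) 𝓘(ℝ, E) ∞ c'
      ((chartAt EK k).symm (chartAt EK k g) • c.symm (c x)) := by
    rw [e1, e2]
    exact contMDiffAt_chart hc' hgx
  have h5 : ContMDiffAt (𝓘(ℝ, EK).prod 𝓘(ℝ, E)) 𝓘(ℝ, E) ∞
      (fun q : EK × E => (chartAt EK k).symm q.1 • c.symm q.2) (chartAt EK k g, c x) :=
    ContMDiffAt.comp (chartAt EK k g, c x) (hM.smooth _) h3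
  have h6 : ContMDiffAt (𝓘(ℝ, EK).prod 𝓘(ℝ, E)) 𝓘(ℝ, E) ∞
      (fun q : EK × E => c' ((chartAt EK k).symm q.1 • c.symm q.2)) (chartAt EK k g, c x) :=
    ContMDiffAt.comp (chartAt EK k g, c x) h4 h5
  exact h6

theorem eventually_actChart {c c' : OpenPartialHomeomorph M E}
    {k g : K} {x : M} (hg : g ∈ (chartAt EK k).source) (hx : x ∈ c.source)
    (hgx : g • x ∈ c'.source) : ∀ᶠ q in 𝓝 (chartAt EK k g, c x),
      (q.1 ∈ (chartAt EK k).target ∧ q.2 ∈ c.target) ∧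
        (chartAt EK k).symm q.1 • c.symm q.2 ∈ c'.source := by
  have h1 : ∀ᶠ q : EK × E in 𝓝 (chartAt EK k g, c x),
      q.1 ∈ (chartAt EK k).target ∧ q.2 ∈ c.target :=
    ((chartAt EK k).open_target.prod c.open_target).mem_nhds
      ⟨(chartAt EK k).map_source hg, c.map_source hx⟩
  have hcont : ContinuousAt (fun q : EK × E => (chartAt EK k).symm q.1 • c.symm q.2)
      (chartAt EK k g, c x) := by
    have h2 : ContinuousAt (fun q : EK × E => ((chartAt EK k).symm q.1, c.symm q.2))
        (chartAt EK k g, c x) :=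
      ((chartAt EK k).continuousAt_symm ((chartAt EK k).map_source hg)).prodMap
        (c.continuousAt_symm (c.map_source hx))
    exact hM.continuous.continuousAt.comp h2
  have h3 := hcont.eventually (c'.open_source.mem_nhds (by
    change (chartAt EK k).symm (chartAt EK k g) • c.symm (c x) ∈ _
    rwa [(chartAt EK k).left_inv hg, c.left_inv hx]))
  filter_upwards [h1, h3] with q hq hq' using ⟨hq, hq'⟩

theorem fderiv_actChart_right {c c' : OpenPartialHomeomorph M E}
    (hc : c ∈ IsManifold.maximalAtlas 𝓘(ℂ, E) ω M) (hc' : c' ∈ IsManifold.maximalAtlas 𝓘(ℂ, E) ω M)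
    {k : K} {q : EK × E} (hq : q.1 ∈ (chartAt EK k).target) (hq' : q.2 ∈ c.target)
    (hgx : (chartAt EK k).symm q.1 • c.symm q.2 ∈ c'.source) (w : E) :
    fderiv ℝ (actChart EK k c c') q (0, w) =
      fderiv ℝ (fun y => c' ((chartAt EK k).symm q.1 • c.symm y)) q.2 w := by
  have h := contDiffAt_actChart hM hc hc' ((chartAt EK k).map_target hq) (c.map_target hq') hgx
  rw [(chartAt EK k).right_inv hq, c.right_inv hq'] at h
  have h1 : HasFDerivAt (fun y : E => (q.1, y)) (ContinuousLinearMap.inr ℝ EK E) q.2 :=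
    hasFDerivAt_prodMk_right _ _
  have h2 := ((h.differentiableAt (by simp)).hasFDerivAt.comp q.2 h1).fderiv
  change fderiv ℝ (fun y => c' ((chartAt EK k).symm q.1 • c.symm y)) q.2 = _ at h2
  rw [h2]
  rfl

theorem fderiv_actChart_I {c c' : OpenPartialHomeomorph M E}
    (hc : c ∈ IsManifold.maximalAtlas 𝓘(ℂ, E) ω M) (hc' : c' ∈ IsManifold.maximalAtlas 𝓘(ℂ, E) ω M)
    {k : K} {q : EK × E} (hq : q.1 ∈ (chartAt EK k).target) (hq' : q.2 ∈ c.target)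
    (hgx : (chartAt EK k).symm q.1 • c.symm q.2 ∈ c'.source) (w : E) :
    fderiv ℝ (actChart EK k c c') q (0, Complex.I • w) =
      Complex.I • fderiv ℝ (actChart EK k c c') q (0, w) := by
  rw [fderiv_actChart_right hM hc hc' hq hq' hgx, fderiv_actChart_right hM hc hc' hq hq' hgx]
  have h1 : MDifferentiableAt 𝓘(ℂ, E) 𝓘(ℂ, E)
      (fun y => c' ((chartAt EK k).symm q.1 • c.symm y)) q.2 :=
    (mdifferentiableAt_chart hc' hgx).comp q.2
      (MDifferentiableAt.comp q.2 (hM.mdifferentiableAt_complex _ _)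
        (mdifferentiableAt_chart_symm hc hq'))
  rw [← mD_eq_fderiv]
  exact mD_J h1 w

/-- The induced vector field in a chart. -/
theorem mD_inducedField {c : OpenPartialHomeomorph M E}
    (hc : c ∈ IsManifold.maximalAtlas 𝓘(ℂ, E) ω M) {x : M} (hx : x ∈ c.source)
    (v : GroupLieAlgebra 𝓘(ℝ, EK) K) :
    mD E E c x (inducedField v x) =
      fderiv ℝ (actChart EK (1 : K) c c) (chartAt EK (1 : K) 1, c x) (v, 0) := by
  have hx1 : (1 : K) • x ∈ c.source := by rwa [one_smul]
  have h1 : mD EK E (fun k : K => c (k • x)) 1 =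
      (mD E E c ((1 : K) • x)).comp (mD EK E (fun k : K => k • x) 1) :=
    mD_comp ((contMDiffAt_chart hc hx1).mdifferentiableAt (by simp))
      ((hM.contMDiffAt_orbit 1 x).mdifferentiableAt (by simp))
  have h2 : mD EK E (fun k : K => c (k • x)) 1 =
      fderiv ℝ (fun s => c ((chartAt EK (1 : K)).symm s • x)) (chartAt EK (1 : K) 1) :=
    mD_eq (((contMDiffAt_chart hc hx1).comp (1 : K)
      (hM.contMDiffAt_orbit 1 x)).mdifferentiableAt (by simp))
  rw [one_smul, h2] at h1
  have h3 := contDiffAt_actChart hM hc hc (mem_chart_source EK (1 : K)) hx hx1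
  have h4 : HasFDerivAt (fun s : EK => (s, c x)) (ContinuousLinearMap.inl ℝ EK E)
      (chartAt EK (1 : K) 1) := hasFDerivAt_prodMk_left _ _
  have h5 := (HasFDerivAt.comp (chartAt EK (1 : K) 1)
    (h3.differentiableAt (by simp)).hasFDerivAt h4).fderiv
  have h6 : (actChart EK (1 : K) c c ∘ fun s => (s, c x)) =
      fun s => c ((chartAt EK (1 : K)).symm s • x) := by
    funext s
    simp only [Function.comp_apply, actChart, c.left_inv hx]
  rw [h6, h1] at h5
  exact congrFun (congrArg DFunLike.coe h5) v

/-- The expression of the induced vector field in a chart. -/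
def fieldRep (c : OpenPartialHomeomorph M E) (v : GroupLieAlgebra 𝓘(ℝ, EK) K) (y : E) : E :=
  fderiv ℝ (actChart EK (1 : K) c c) (chartAt EK (1 : K) 1, y) (v, 0)

theorem cD_fieldRep {c : OpenPartialHomeomorph M E}
    (hc : c ∈ IsManifold.maximalAtlas 𝓘(ℂ, E) ω M) {y : E} (hy : y ∈ c.target)
    (v : GroupLieAlgebra 𝓘(ℝ, EK) K) : cD c y (fieldRep c v y) = inducedField v (c.symm y) := by
  have h := mD_inducedField hM hc (c.map_target hy) v
  rw [c.right_inv hy] at h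
  rw [fieldRep, ← h]
  have h2 := cD_mD hc (c.map_target hy)
  rw [c.right_inv hy] at h2
  exact congrFun (congrArg DFunLike.coe h2) _

theorem contDiffAt_fieldRep {c : OpenPartialHomeomorph M E}
    (hc : c ∈ IsManifold.maximalAtlas 𝓘(ℂ, E) ω M) {y : E} (hy : y ∈ c.target)
    (v : GroupLieAlgebra 𝓘(ℝ, EK) K) : ContDiffAt ℝ ∞ (fieldRep (E := E) (M := M) c v) y := by
  have h := contDiffAt_actChart hM hc hc (mem_chart_source EK (1 : K)) (c.map_target hy)
    (by rw [one_smul]; exact c.map_target hy)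
  rw [c.right_inv hy] at h
  exact contDiffAt_paramDeriv (A := EK) v h

theorem differentiableAt_fieldRep {c : OpenPartialHomeomorph M E}
    (hc : c ∈ IsManifold.maximalAtlas 𝓘(ℂ, E) ω M) {y : E} (hy : y ∈ c.target)
    (v : GroupLieAlgebra 𝓘(ℝ, EK) K) : DifferentiableAt ℂ (fieldRep (E := E) (M := M) c v) y := by
  have h1 : (1 : K) • c.symm y ∈ c.source := by rw [one_smul]; exact c.map_target hy
  have h := contDiffAt_actChart hM hc hc (mem_chart_source EK (1 : K)) (c.map_target hy) h1
  have h2 := eventually_actChart hM (mem_chart_source EK (1 : K)) (c.map_target hy) h1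
  rw [c.right_inv hy] at h h2
  refine differentiableAt_paramDeriv (A := EK) v h ?_
  filter_upwards [h2] with q hq w
  exact fderiv_actChart_I hM hc hc hq.1.1 hq.1.2 hq.2 w

end

end InducedField

section OneForms

variable {E : Type*} [NormedAddCommGroup E] [NormedSpace ℂ E] [FiniteDimensional ℂ E]

/-- A form of degree one, as a linear map. -/
def oneFormCLM : (E [⋀^Fin 1]→L[ℝ] ℂ) →L[ℝ] E →L[ℝ] ℂ :=
  LinearMap.toContinuousLinearMap
    { toFun := fun α => (ContinuousAlternatingMap.ofSubsingleton ℝ E ℂ (0 : Fin 1)).symm α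
      map_add' := fun _ _ => rfl
      map_smul' := fun _ _ => rfl }

theorem oneFormCLM_apply (α : E [⋀^Fin 1]→L[ℝ] ℂ) (w : E) : oneFormCLM α w = α fun _ => w := rfl

theorem apply_fin_one (α : E [⋀^Fin 1]→L[ℝ] ℂ) (u : Fin 1 → E) : α u = oneFormCLM α (u 0) := by
  rw [oneFormCLM_apply]
  congr 1
  funext i
  rw [Subsingleton.elim i 0]

theorem extDeriv_oneForm {b : E → E [⋀^Fin 1]→L[ℝ] ℂ} {y : E} (h : DifferentiableAt ℝ b y)
    (u : Fin 2 → E) : extDeriv b y u =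
      oneFormCLM (fderiv ℝ b y (u 0)) (u 1) - oneFormCLM (fderiv ℝ b y (u 1)) (u 0) := by
  have h1 : ∀ (w : Fin 1 → E) e, fderiv ℝ (fun z => b z w) y e = oneFormCLM (fderiv ℝ b y e) (w 0) := by
    intro w e
    have h2 := ((ContinuousAlternatingMap.apply ℝ E ℂ w).hasFDerivAt.comp y h.hasFDerivAt).fderiv
    change fderiv ℝ (fun z => b z w) y = _ at h2
    rw [h2, ← apply_fin_one]
    rfl
  rw [extDeriv_apply h]
  simp only [h1]
  simp [Fin.removeNth]
  ring

end OneForms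

section Cartan

variable {EK K : Type*} [NormedAddCommGroup EK] [NormedSpace ℝ EK] [Group K] [TopologicalSpace K]
  [ChartedSpace EK K] [LieGroup 𝓘(ℝ, EK) ∞ K]
  {E M : Type*} [NormedAddCommGroup E] [NormedSpace ℂ E] [FiniteDimensional ℂ E]
  [TopologicalSpace M] [ChartedSpace E M]
  [IsManifold 𝓘(ℂ, E) ω M] [MulAction K M] (hM : IsHolomorphicAction EK K E M)
  {β : M → E [⋀^Fin 1]→L[ℝ] ℂ} {x : M} (hβ : SmoothAt β x) (v : GroupLieAlgebra 𝓘(ℝ, EK) K)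
include hM hβ

theorem apply_inducedField_coord {y : E} (hy : y ∈ (chartAt E x).target) :
    β ((chartAt E x).symm y) (fun _ => inducedField v ((chartAt E x).symm y)) =
      oneFormCLM (coordRep (chartAt E x) β y) (fieldRep (chartAt E x) v y) := by
  rw [oneFormCLM_apply, coordRep_apply, cD_fieldRep hM (chartAt_mem x) hy]

theorem smFun_apply_inducedField : SmFun E (fun z => β z fun _ => inducedField v z) x := by
  rw [smFun_iff (chartAt_mem x) (mem_chart_source E x)]
  refine ContDiffAt.congr_of_eventuallyEq (((oneFormCLM (E := E)).contDiff.contDiffAt.comp _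
    hβ).clm_apply (contDiffAt_fieldRep hM (chartAt_mem x) (mem_chart_target E x) v)) ?_
  filter_upwards [(chartAt E x).open_target.mem_nhds (mem_chart_target E x)] with y hy
  exact apply_inducedField_coord hM hβ v hy

/-- Cartan's formula for an invariant form of degree one. -/
theorem contract_dForm_invariant
    (hinv : ∀ᶠ z in 𝓝 x, ∀ g : K, pullback (E' := E) (fun x : M => g • x) β z = β z) :
    (dForm β x).curryLeft (inducedField v x) = -dF (fun z => β z fun _ => inducedField v z) x := by
  set c := chartAt E x with hc
  have hcm := chartAt_mem (E := E) x
  have hx : x ∈ c.source := mem_chart_source E x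
  have h1x : (1 : K) • x ∈ c.source := by rwa [one_smul]
  set y₀ := c x with hy₀
  set b := coordRep c β with hb
  have hbs : ContDiffAt ℝ ∞ b y₀ := hβ
  set Φ := actChart EK (1 : K) c c with hΦ
  set s₀ := chartAt EK (1 : K) 1 with hs₀
  have hΦs : ContDiffAt ℝ ∞ Φ (s₀, y₀) :=
    contDiffAt_actChart hM hcm hcm (mem_chart_source EK (1 : K)) hx h1x
  have hΦ0 : ∀ y ∈ c.target, Φ (s₀, y) = y := by
    intro y hy
    change c ((chartAt EK (1 : K)).symm (chartAt EK (1 : K) 1) • c.symm y) = y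
    rw [(chartAt EK (1 : K)).left_inv (mem_chart_source EK (1 : K)), one_smul, c.right_inv hy]
  have hyt : y₀ ∈ c.target := c.map_source hx
  set ξ := fieldRep (E := E) (M := M) c v with hξ
  have hξs : ContDiffAt ℝ ∞ ξ y₀ := contDiffAt_fieldRep hM hcm hyt v
  have hξx : ξ y₀ = inducedField v x := by
    have h := cD_fieldRep hM hcm hyt v
    have h2 := cD_chartAt (E := E) x
    rw [← hc, ← hy₀] at h2
    rw [h2, hy₀, c.left_inv hx] at h
    exact h
  have key : ∀ w, oneFormCLM (fderiv ℝ b y₀ (ξ y₀)) w + oneFormCLM (b y₀) (fderiv ℝ ξ y₀ w) = 0 := by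
    intro w
    set G : EK × E → ℂ := fun q => oneFormCLM (b (Φ q)) (fderiv ℝ Φ q (0, w)) with hG
    have hGe : G =ᶠ[𝓝 (s₀, y₀)] fun q => oneFormCLM (b q.2) w := by
      have h2 : ∀ᶠ q : EK × E in 𝓝 (s₀, y₀), ∀ g : K,
          pullback (E' := E) (fun x : M => g • x) β (c.symm q.2) = β (c.symm q.2) := by
        have h3 : ContinuousAt (fun q : EK × E => c.symm q.2) (s₀, y₀) :=
          ContinuousAt.comp (f := fun q : EK × E => q.2) (c.continuousAt_symm hyt)
            continuousAt_snd
        have h4 : ∀ᶠ z in 𝓝 (c.symm y₀), ∀ g : K,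
            pullback (E' := E) (fun x : M => g • x) β z = β z := by
          rwa [hy₀, c.left_inv hx]
        exact h3 h4
      filter_upwards [eventually_actChart hM (mem_chart_source EK (1 : K)) hx h1x, h2] with q hq hq2
      have h3 := coordRep_pullback hcm hcm (f := fun x : M => (chartAt EK (1 : K)).symm q.1 • x)
        (hM.mdifferentiableAt_real _ _) hq.1.2 hq.2 β
      have h4 : coordRep c (pullback (E' := E)
          (fun x : M => (chartAt EK (1 : K)).symm q.1 • x) β) q.2 = b q.2 := by
        ext u
        rw [coordRep_apply, hq2]
        rfl
      rw [h4] at h3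
      rw [h3, hG]
      simp only
      rw [oneFormCLM_apply, oneFormCLM_apply, fderiv_actChart_right hM hcm hcm hq.1.1 hq.1.2 hq.2]
      rfl
    have h5 := hGe.fderiv_eq (𝕜 := ℝ)
    have hbd := (hbs.differentiableAt (by simp)).hasFDerivAt
    have h6' : HasFDerivAt (fun y => oneFormCLM (b y) w)
        (((oneFormCLM (E := E)).flip w).comp (fderiv ℝ b y₀)) y₀ :=
      HasFDerivAt.comp (g := (oneFormCLM (E := E)).flip w) (f := b) y₀
        ((oneFormCLM (E := E)).flip w).hasFDerivAt hbd
    have h6 : HasFDerivAt (fun q : EK × E => oneFormCLM (b q.2) w)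
        ((((oneFormCLM (E := E)).flip w).comp (fderiv ℝ b y₀)).comp
          (ContinuousLinearMap.snd ℝ EK E)) (s₀, y₀) :=
      HasFDerivAt.comp (g := fun y => oneFormCLM (b y) w) (f := fun q : EK × E => q.2) (s₀, y₀)
        h6' hasFDerivAt_snd
    have hbs' : ContDiffAt ℝ ∞ b (Φ (s₀, y₀)) := by rwa [hΦ0 y₀ hyt]
    have h7 : HasFDerivAt (fun q => oneFormCLM (b (Φ q)))
        (((oneFormCLM (E := E)).comp (fderiv ℝ b (Φ (s₀, y₀)))).comp (fderiv ℝ Φ (s₀, y₀)))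
        (s₀, y₀) :=
      HasFDerivAt.comp (g := fun y => oneFormCLM (b y)) (f := Φ) (s₀, y₀)
        (HasFDerivAt.comp (g := oneFormCLM (E := E)) (f := b) _ (oneFormCLM (E := E)).hasFDerivAt
          (hbs'.differentiableAt (by simp)).hasFDerivAt)
        (hΦs.differentiableAt (by simp)).hasFDerivAt
    have h8 : DifferentiableAt ℝ (fun q => fderiv ℝ Φ q (0, w)) (s₀, y₀) :=
      ((hΦs.fderiv_right (m := ∞) le_rfl).clm_apply contDiffAt_const).differentiableAt (by simp)
    have h9 := DFunLike.congr_fun h5 (v, 0)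
    rw [hG, fderiv_clm_apply h7.differentiableAt h8, h7.fderiv, h6.fderiv, hΦ0 y₀ hyt] at h9
    have h10 : fderiv ℝ Φ (s₀, y₀) (0, w) = w := by
      have hq : s₀ ∈ (chartAt EK (1 : K)).target := mem_chart_target EK (1 : K)
      have h11 := fderiv_actChart_right hM hcm hcm (q := (s₀, y₀)) hq hyt (by
        change (chartAt EK (1 : K)).symm (chartAt EK (1 : K) 1) • c.symm (c x) ∈ _
        rwa [(chartAt EK (1 : K)).left_inv (mem_chart_source EK (1 : K)), c.left_inv hx]) w
      rw [h11]
      have h12 : (fun y => c ((chartAt EK (1 : K)).symm s₀ • c.symm y)) =ᶠ[𝓝 y₀] fun y => y := by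
        filter_upwards [c.open_target.mem_nhds hyt] with y hy using hΦ0 y hy
      change fderiv ℝ (fun y => c ((chartAt EK (1 : K)).symm s₀ • c.symm y)) y₀ w = w
      rw [h12.fderiv_eq, fderiv_fun_id]
      rfl
    have h13 := fderiv_paramDeriv (A := EK) v hΦs w
    change fderiv ℝ ξ y₀ w = _ at h13
    have h14 : fderiv ℝ Φ (s₀, y₀) (v, 0) = ξ y₀ := rfl
    simp only [h10] at h9
    rw [h13]
    refine Eq.trans ?_ (h9.trans ?_)
    · rw [add_comm]
      rfl
    · change oneFormCLM (fderiv ℝ b y₀ 0) w = 0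
      rw [map_zero, map_zero]
      rfl
  have hf : SmFun E (fun z => β z fun _ => inducedField v z) x := smFun_apply_inducedField hM hβ v
  ext u
  change dForm β x (Matrix.vecCons (inducedField v x) u) = -mD E ℂ _ x (u 0)
  have hfe : (fun y => (fun z => β z fun _ => inducedField v z) (c.symm y)) =ᶠ[𝓝 y₀]
      fun y => oneFormCLM (b y) (ξ y) := by
    filter_upwards [c.open_target.mem_nhds hyt] with y hy
    exact apply_inducedField_coord hM hβ v hy
  have hbd := hbs.differentiableAt (by simp)
  have h15 : HasFDerivAt (fun y => oneFormCLM (b y))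
      ((oneFormCLM (E := E)).comp (fderiv ℝ b y₀)) y₀ :=
    (oneFormCLM (E := E)).hasFDerivAt.comp _ hbd.hasFDerivAt
  rw [mD_eq_fderiv_chart hf.mdiff, ← hc, ← hy₀, hfe.fderiv_eq,
    fderiv_clm_apply h15.differentiableAt (hξs.differentiableAt (by simp)), h15.fderiv]
  change extDeriv b y₀ _ = _
  rw [extDeriv_oneForm hbd, ← hξx]
  have := key (u 0)
  change oneFormCLM (fderiv ℝ b y₀ (ξ y₀)) (u 0) - oneFormCLM (fderiv ℝ b y₀ (u 0)) (ξ y₀) =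
    -(oneFormCLM (b y₀) (fderiv ℝ ξ y₀ (u 0)) + oneFormCLM (fderiv ℝ b y₀ (u 0)) (ξ y₀))
  linear_combination this

end Cartan

section Naturality

variable {EK K : Type*} [NormedAddCommGroup EK] [NormedSpace ℝ EK] [Group K] [TopologicalSpace K]
  [ChartedSpace EK K] [LieGroup 𝓘(ℝ, EK) ∞ K]
  {E M : Type*} [NormedAddCommGroup E] [NormedSpace ℂ E] [TopologicalSpace M] [ChartedSpace E M]
  [IsManifold 𝓘(ℂ, E) ω M] [MulAction K M] (hM : IsHolomorphicAction EK K E M)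

include hM

theorem mD_equivariant_inducedField {E' M' : Type*} [NormedAddCommGroup E'] [NormedSpace ℂ E']
    [TopologicalSpace M'] [ChartedSpace E' M'] [MulAction K M']
    {f : M → M'} (hf : ∀ (k : K) x, f (k • x) = k • f x) {x : M}
    (hfx : MDifferentiableAt 𝓘(ℝ, E) 𝓘(ℝ, E') f x) (v : GroupLieAlgebra 𝓘(ℝ, EK) K) :
    mD E E' f x (inducedField v x) = inducedField v (f x) := by
  have h1 : mD EK E' (fun k : K => f (k • x)) 1 =
      (mD E E' f ((1 : K) • x)).comp (mD EK E (fun k : K => k • x) 1) :=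
    mD_comp (by rwa [one_smul]) ((hM.contMDiffAt_orbit 1 x).mdifferentiableAt (by simp))
  rw [one_smul] at h1
  have h2 : (fun k : K => f (k • x)) = fun k => k • f x := funext fun k => hf k x
  rw [h2] at h1
  exact (DFunLike.congr_fun h1 v).symm

theorem mD_smul_inducedField (k : K) (x : M) (v : GroupLieAlgebra 𝓘(ℝ, EK) K) :
    mD E E (fun x : M => k • x) x (inducedField v x) = inducedField (adjoint k v) (k • x) := by
  have h1 : mD EK E (fun g : K => k • g • x) 1 =
      (mD E E (fun x : M => k • x) ((1 : K) • x)).comp (mD EK E (fun g : K => g • x) 1) :=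
    mD_comp (hM.mdifferentiableAt_real _ _)
      ((hM.contMDiffAt_orbit 1 x).mdifferentiableAt (by simp))
  have h0 : k * (1 : K) * k⁻¹ = 1 := by group
  have hc : ContMDiff 𝓘(ℝ, EK) 𝓘(ℝ, EK) ∞ (fun g : K => k * g * k⁻¹) :=
    (contMDiff_const.mul contMDiff_id).mul contMDiff_const
  have h2 : mD EK E (fun g : K => (k * g * k⁻¹) • k • x) 1 =
      (mD EK E (fun g : K => g • k • x) (k * 1 * k⁻¹)).comp
        (mD EK EK (fun g : K => k * g * k⁻¹) 1) :=
    mD_comp ((hM.contMDiffAt_orbit _ _).mdifferentiableAt (by simp))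
      ((hc 1).mdifferentiableAt (by simp))
  rw [h0] at h2
  have h3 : (fun g : K => k • g • x) = fun g : K => (k * g * k⁻¹) • k • x := by
    funext g
    rw [smul_smul, smul_smul, inv_mul_cancel_right]
  rw [h3, h2, one_smul] at h1
  exact (DFunLike.congr_fun h1 v).symm

end Naturality

section Averaging

open MeasureTheory

variable {EK K : Type*} [NormedAddCommGroup EK] [NormedSpace ℝ EK] [Group K] [TopologicalSpace K]
  [ChartedSpace EK K] [LieGroup 𝓘(ℝ, EK) ∞ K] [T2Space K] [CompactSpace K] [MeasurableSpace K]
  [BorelSpace K]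
  {E M : Type*} [NormedAddCommGroup E] [NormedSpace ℂ E] [FiniteDimensional ℂ E]
  [TopologicalSpace M] [ChartedSpace E M]
  [IsManifold 𝓘(ℂ, E) ω M] [MulAction K M] (hM : IsHolomorphicAction EK K E M)
  (μ : Measure K) [IsFiniteMeasure μ]

/-- The functions on `K × U` that are smooth in the charts of `K`. -/
def smoothClass (EK K : Type*) [NormedAddCommGroup EK] [NormedSpace ℝ EK]
    [TopologicalSpace K] [ChartedSpace EK K] {E : Type*} [NormedAddCommGroup E] [NormedSpace ℝ E]
    (U : Set E) : Set (K → E → ℂ) :=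
  {F | ∀ k, ∀ y ∈ U, ContDiffAt ℝ ∞ (fun q : EK × E => F ((chartAt EK k).symm q.1) q.2)
    (chartAt EK k k, y)}

omit [Group K] [LieGroup 𝓘(ℝ, EK) ∞ K] [T2Space K] [CompactSpace K] [MeasurableSpace K]
  [BorelSpace K] [FiniteDimensional ℂ E] in
theorem continuousOn_of_smoothClass {U : Set E} {F : K → E → ℂ}
    (hF : ∀ k, ∀ y ∈ U, ContDiffAt ℝ ∞ (fun q : EK × E => F ((chartAt EK k).symm q.1) q.2)
      (chartAt EK k k, y)) :
    ContinuousOn (fun q : K × E => F q.1 q.2) (Set.univ ×ˢ U) := by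
  rintro ⟨k, y⟩ ⟨-, hy⟩
  have h1 : ContinuousAt (fun q : K × E => (chartAt EK k q.1, q.2)) (k, y) :=
    (ContinuousAt.comp (f := fun q : K × E => q.1)
      ((chartAt EK k).continuousAt (mem_chart_source EK k)) continuousAt_fst).prodMk continuousAt_snd
  have h2 := ContinuousAt.comp (f := fun q : K × E => (chartAt EK k q.1, q.2)) (x := (k, y))
    (hF k y hy).continuousAt h1
  refine (h2.congr ?_).continuousWithinAt
  have h3 : ∀ᶠ q : K × E in 𝓝 (k, y), q.1 ∈ (chartAt EK k).source :=
    continuousAt_fst ((chartAt EK k).open_source.mem_nhds (mem_chart_source EK k))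
  filter_upwards [h3] with q hq
  simp only [Function.comp_apply, (chartAt EK k).left_inv hq]

theorem contDiffAt_slice_of_smoothClass {U : Set E} {F : K → E → ℂ}
    (hF : ∀ k, ∀ y ∈ U, ContDiffAt ℝ ∞ (fun q : EK × E => F ((chartAt EK k).symm q.1) q.2)
      (chartAt EK k k, y)) (k : K) {y : E} (hy : y ∈ U) : ContDiffAt ℝ ∞ (F k) y := by
  have h := ContDiffAt.comp (f := fun z : E => (chartAt EK k k, z)) y (hF k y hy)
    (contDiffAt_const.prodMk contDiffAt_id)
  simpa [Function.comp_def, (chartAt EK k).left_inv (mem_chart_source EK k)] using h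

theorem fderiv_mem_smoothClass {U : Set E} {F : K → E → ℂ}
    (hF : ∀ k, ∀ y ∈ U, ContDiffAt ℝ ∞ (fun q : EK × E => F ((chartAt EK k).symm q.1) q.2)
      (chartAt EK k k, y)) (e : E) (k : K) (y : E) (hy : y ∈ U) :
    ContDiffAt ℝ ∞ (fun q : EK × E => fderiv ℝ (F ((chartAt EK k).symm q.1)) q.2 e)
      (chartAt EK k k, y) := by
  have h1 := ((hF k y hy).fderiv_right (m := ∞) le_rfl).clm_apply
    (contDiffAt_const (c := ((0 : EK), e)))
  refine h1.congr_of_eventuallyEq ?_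
  have h2 := ((hF k y hy).of_le (m := 1) (by simp)).eventually (by simp)
  filter_upwards [h2] with q hq
  have h3 := ((hq.differentiableAt (by simp)).hasFDerivAt.comp q.2
    (f := fun z : E => (q.1, z)) (hasFDerivAt_prodMk_right q.1 q.2)).fderiv
  change fderiv ℝ (F ((chartAt EK k).symm q.1)) q.2 = _ at h3
  rw [h3]
  rfl

theorem hasFDerivAt_integral_smoothClass {U : Set E} (hU : IsOpen U) {F : K → E → ℂ}
    (hF : ∀ k, ∀ y ∈ U, ContDiffAt ℝ ∞ (fun q : EK × E => F ((chartAt EK k).symm q.1) q.2)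
      (chartAt EK k k, y)) {y : E} (hy : y ∈ U) :
    ContDiffAt ℝ ∞ (fun y => ∫ k, F k y ∂μ) y ∧
      ∀ e, fderiv ℝ (fun y => ∫ k, F k y ∂μ) y e = ∫ k, fderiv ℝ (F k) y e ∂μ := by
  have : FiniteDimensional ℝ E := FiniteDimensional.complexToReal E
  have h1 := hasFDerivAt_integral_of_class μ isCompact_univ MeasurableSet.univ hU
    (smoothClass EK K U) (fun F hF => continuousOn_of_smoothClass hF)
    (fun F hF k _ y hy => (contDiffAt_slice_of_smoothClass hF k hy).differentiableAt (by simp))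
    (fun F hF e => fderiv_mem_smoothClass hF e) (F := F) hF hy
  have h2 := contDiffOn_integral_of_class μ isCompact_univ MeasurableSet.univ hU
    (smoothClass EK K U) (fun F hF => continuousOn_of_smoothClass hF)
    (fun F hF k _ y hy => (contDiffAt_slice_of_smoothClass hF k hy).differentiableAt (by simp))
    (fun F hF e => fderiv_mem_smoothClass hF e) (F := F) hF
  simp only [Measure.restrict_univ] at h1 h2
  refine ⟨h2.contDiffAt (hU.mem_nhds hy), fun e => ?_⟩
  rw [h1.1.fderiv, h1.2]

theorem integrable_of_smoothClass {U : Set E} {F : K → E → ℂ}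
    (hF : ∀ k, ∀ y ∈ U, ContDiffAt ℝ ∞ (fun q : EK × E => F ((chartAt EK k).symm q.1) q.2)
      (chartAt EK k k, y)) {y : E} (hy : y ∈ U) : Integrable (fun k => F k y) μ := by
  have h1 : ContinuousOn (fun k : K => F k y) Set.univ :=
    (continuousOn_of_smoothClass hF).comp (f := fun k : K => (k, y)) (by fun_prop)
      fun k _ => ⟨trivial, hy⟩
  have h2 := h1.integrableOn_compact (μ := μ) isCompact_univ
  rwa [integrableOn_univ] at h2

/-- The average of a form over the group. -/
def average {m : ℕ} (β : M → E [⋀^Fin m]→L[ℝ] ℂ) : M → E [⋀^Fin m]→L[ℝ] ℂ := fun x =>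
  ∫ k, pullback (E' := E) (fun x : M => k • x) β x ∂μ

variable {m : ℕ} {β : M → E [⋀^Fin m]→L[ℝ] ℂ} {P : Set M} (hP : IsOpen P)
  (hPK : ∀ (k : K), ∀ x ∈ P, k • x ∈ P) (hβ : ∀ x ∈ P, SmoothAt β x)

include hM hPK hβ

theorem pullback_mem_smoothClass {c : OpenPartialHomeomorph M E}
    (hc : c ∈ IsManifold.maximalAtlas 𝓘(ℂ, E) ω M) (u : Fin m → E) (k : K) (y : E)
    (hy : y ∈ c.target ∩ c.symm ⁻¹' P) :
    ContDiffAt ℝ ∞ (fun q : EK × E => coordRep c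
      (pullback (E' := E) (fun x : M => (chartAt EK k).symm q.1 • x) β) q.2 u)
      (chartAt EK k k, y) := by
  have hx := c.map_target hy.1
  set c' := chartAt E (k • c.symm y) with hc'
  have hcm' : c' ∈ IsManifold.maximalAtlas 𝓘(ℂ, E) ω M := chartAt_mem _
  have hkx : k • c.symm y ∈ c'.source := mem_chart_source E _
  have h1 := contDiffAt_actChart hM hc hcm' (mem_chart_source EK k) hx hkx
  have h2 := eventually_actChart hM (mem_chart_source EK k) hx hkx
  rw [c.right_inv hy.1] at h1 h2
  have h3 : actChart EK k c c' (chartAt EK k k, y) = c' (k • c.symm y) := by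
    rw [actChart, (chartAt EK k).left_inv (mem_chart_source EK k)]
  have h4 : ContDiffAt ℝ ∞ (coordRep c' β) (actChart EK k c c' (chartAt EK k k, y)) := by
    rw [h3]
    exact hβ _ (hPK k _ hy.2)
  have h5 : ContDiffAt ℝ ∞ (fun q => coordRep c' β (actChart EK k c c' q)
      fun i => fderiv ℝ (actChart EK k c c') q (0, u i)) (chartAt EK k k, y) :=
    contDiffAt_alt_apply (h4.comp _ h1)
      fun i => (h1.fderiv_right (m := ∞) le_rfl).clm_apply contDiffAt_const
  refine h5.congr_of_eventuallyEq ?_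
  filter_upwards [h2] with q hq
  rw [coordRep_pullback hcm' hc (hM.mdifferentiableAt_real _ _) hq.1.2 hq.2]
  simp only [fderiv_actChart_right hM hc hcm' hq.1.1 hq.1.2 hq.2]
  rfl

theorem integrable_pullback {x : M} (hx : x ∈ P) :
    Integrable (fun k : K => pullback (E' := E) (fun x : M => k • x) β x) μ := by
  have h1 : ContinuousOn (fun k : K => pullback (E' := E) (fun x : M => k • x) β x) Set.univ := by
    rw [continuous_alt_iff]
    intro u
    have h2 := continuousOn_of_smoothClass (EK := EK)
      (F := fun (k : K) y => coordRep (chartAt E x) (pullback (E' := E) (fun x : M => k • x) β) y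
        fun i => mD E E (chartAt E x) x (u i))
      (fun k y hy => pullback_mem_smoothClass hM hPK hβ (chartAt_mem (E := E) x)
        (fun i => mD E E (chartAt E x) x (u i)) k y hy)
    have h3 : ContinuousOn (fun k : K => (k, chartAt E x x)) Set.univ := by fun_prop
    refine (h2.comp h3 fun k _ => ⟨trivial, mem_chart_target E x, ?_⟩).congr fun k _ => ?_
    · rw [Set.mem_preimage, (chartAt E x).left_inv (mem_chart_source E x)]
      exact hx
    · simp only [Function.comp_apply, coordRep_apply]
      have h4 : ∀ i, cD (chartAt E x) (chartAt E x x) (mD E E (chartAt E x) x (u i)) = u i :=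
        fun i => DFunLike.congr_fun (cD_mD (chartAt_mem (E := E) x) (mem_chart_source E x)) (u i)
      simp only [h4]
      rw [(chartAt E x).left_inv (mem_chart_source E x)]
  have h2 := h1.integrableOn_compact (μ := μ) isCompact_univ
  rwa [integrableOn_univ] at h2

theorem average_apply {x : M} (hx : x ∈ P) (u : Fin m → E) :
    average μ β x u = ∫ k, pullback (E' := E) (fun x : M => k • x) β x u ∂μ :=
  ((ContinuousAlternatingMap.apply ℝ E ℂ u).integral_comp_comm
    (integrable_pullback hM μ hPK hβ hx)).symm

include hP

theorem coordRep_average {c : OpenPartialHomeomorph M E}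
    (hc : c ∈ IsManifold.maximalAtlas 𝓘(ℂ, E) ω M) {x : M} (hx : x ∈ c.source) (hxP : x ∈ P)
    (u : Fin m → E) :
    ContDiffAt ℝ ∞ (fun y => coordRep c (average μ β) y u) (c x) ∧
      ∀ e, fderiv ℝ (fun y => coordRep c (average μ β) y u) (c x) e =
        ∫ k, fderiv ℝ (fun y => coordRep c (pullback (E' := E) (fun x : M => k • x) β) y u)
          (c x) e ∂μ := by
  have hU : IsOpen (c.target ∩ c.symm ⁻¹' P) := c.symm.isOpen_inter_preimage hP
  have hxU : c x ∈ c.target ∩ c.symm ⁻¹' P :=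
    ⟨c.map_source hx, by rwa [Set.mem_preimage, c.left_inv hx]⟩
  have h := hasFDerivAt_integral_smoothClass (EK := EK) μ hU
    (F := fun (k : K) y => coordRep c (pullback (E' := E) (fun x : M => k • x) β) y u)
    (pullback_mem_smoothClass hM hPK hβ hc u) hxU
  have e : (fun y => coordRep c (average μ β) y u) =ᶠ[𝓝 (c x)] fun y => ∫ k, coordRep c
      (pullback (E' := E) (fun x : M => k • x) β) y u ∂μ := by
    filter_upwards [hU.mem_nhds hxU] with y hy
    rw [coordRep_apply, average_apply hM μ hPK hβ hy.2]
    rfl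
  refine ⟨h.1.congr_of_eventuallyEq e, fun w => ?_⟩
  rw [e.fderiv_eq, h.2]

theorem smoothAt_average {x : M} (hx : x ∈ P) : SmoothAt (average μ β) x := by
  rw [SmoothAt, contDiffAt_alt_iff]
  exact fun u => (coordRep_average hM μ hP hPK hβ (chartAt_mem x) (mem_chart_source E x) hx u).1

theorem dForm_average [IsProbabilityMeasure μ] {x : M} (hx : x ∈ P)
    {Ξ : E [⋀^Fin (m + 1)]→L[ℝ] ℂ}
    (hΞ : ∀ k : K, pullback (E' := E) (fun x : M => k • x) (dForm β) x = Ξ) :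
    dForm (average μ β) x = Ξ := by
  set c := chartAt E x with hc
  have hcm := chartAt_mem (E := E) x
  have hxc := mem_chart_source E x
  have hs : ∀ k : K, SmoothAt (pullback (E' := E) (fun x : M => k • x) β) x := fun k =>
    SmoothAt.pullback (hM.contMDiffAt_real k x) (hβ _ (hPK k x hx))
  have h1 := smoothAt_average hM μ hP hPK hβ hx
  ext u
  have hd : ∀ k : K, ∑ i : Fin (m + 1), (-1 : ℤ) ^ i.val • fderiv ℝ (fun y => coordRep c
      (pullback (E' := E) (fun x : M => k • x) β) y (i.removeNth u)) (c x) (u i) = Ξ u := by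
    intro k
    rw [← hΞ k, ← dForm_pullback (hM.contMDiffAt_real k x) (hβ _ (hPK k x hx)), dForm,
      extDeriv_apply (ContDiffAt.differentiableAt (hs k) (by simp))]
  rw [dForm, extDeriv_apply (ContDiffAt.differentiableAt h1 (by simp))]
  have h2 : ∀ i : Fin (m + 1), fderiv ℝ (fun y => coordRep c (average μ β) y (i.removeNth u))
      (c x) (u i) = ∫ k, fderiv ℝ (fun y => coordRep c
        (pullback (E' := E) (fun x : M => k • x) β) y (i.removeNth u)) (c x) (u i) ∂μ :=
    fun i => (coordRep_average hM μ hP hPK hβ hcm hxc hx _).2 _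
  have h3 : ∀ i : Fin (m + 1), Integrable (fun k : K => fderiv ℝ (fun y => coordRep c
      (pullback (E' := E) (fun x : M => k • x) β) y (i.removeNth u)) (c x) (u i)) μ := fun i =>
    integrable_of_smoothClass (EK := EK) μ (U := c.target ∩ c.symm ⁻¹' P)
      (F := fun (k : K) y => fderiv ℝ (fun y => coordRep c
        (pullback (E' := E) (fun x : M => k • x) β) y (i.removeNth u)) y (u i))
      (fderiv_mem_smoothClass (F := fun (k : K) y => coordRep c
        (pullback (E' := E) (fun x : M => k • x) β) y (i.removeNth u))
        (pullback_mem_smoothClass hM hPK hβ hcm _) (u i))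
      ⟨c.map_source hxc, by rwa [Set.mem_preimage, c.left_inv hxc]⟩
  have h4 : ∫ _k : K, Ξ u ∂μ = Ξ u := by simp
  rw [← h4, ← hc]
  rw [← integral_congr_ae (Filter.Eventually.of_forall hd)]
  simp only [h2, zsmul_eq_mul]
  rw [integral_finsetSum]
  · refine Finset.sum_congr rfl fun i _ => ?_
    rw [integral_const_mul]
  · exact fun i _ => (h3 i).const_mul _

theorem pullback_average [MeasurableMul K] [μ.IsMulRightInvariant] (g : K) {x : M} (hx : x ∈ P) :
    pullback (E' := E) (fun x : M => g • x) (average μ β) x = average μ β x := by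
  ext u
  rw [pullback_apply, average_apply hM μ hPK hβ (hPK g x hx), average_apply hM μ hPK hβ hx,
    ← integral_mul_right_eq_self (fun k : K => pullback (E' := E) (fun x : M => k • x) β x u) g]
  congr 1
  funext k
  rw [pullback_apply, pullback_apply]
  have h := mD_comp (E'' := E) (g := fun x : M => k • x) (f := fun x : M => g • x)
    (hM.mdifferentiableAt_real k (g • x)) (hM.mdifferentiableAt_real g x)
  simp only [smul_smul] at h
  rw [h, smul_smul]
  rfl

end Averaging

section Haar

open MeasureTheory

theorem exists_right_invariant_probability (K : Type*) [Group K] [TopologicalSpace K]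
    [IsTopologicalGroup K] [CompactSpace K] [T2Space K] [MeasurableSpace K] [BorelSpace K] :
    ∃ μ : Measure K, IsProbabilityMeasure μ ∧ μ.IsMulRightInvariant := by
  have h1 : IsProbabilityMeasure (Measure.haarMeasure (⊤ : TopologicalSpace.PositiveCompacts K)) :=
    ⟨Measure.haarMeasure_self⟩
  refine ⟨(Measure.haarMeasure (⊤ : TopologicalSpace.PositiveCompacts K)).inv, ⟨?_⟩, inferInstance⟩
  rw [Measure.inv_apply, Set.inv_univ, measure_univ]

end Haar

section Potential

variable {EK K : Type*} [NormedAddCommGroup EK] [NormedSpace ℝ EK] [Group K] [TopologicalSpace K]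
  [ChartedSpace EK K] [LieGroup 𝓘(ℝ, EK) ∞ K] [T2Space K] [CompactSpace K]
  {E T : Type*} [NormedAddCommGroup E] [NormedSpace ℂ E] [FiniteDimensional ℂ E]
  [TopologicalSpace T] [ChartedSpace E T]
  [IsManifold 𝓘(ℂ, E) ω T] [MulAction K T] (hT : IsHolomorphicAction EK K E T)
  {E' M : Type*} [NormedAddCommGroup E'] [NormedSpace ℂ E'] [FiniteDimensional ℂ E']
  [TopologicalSpace M] [ChartedSpace E' M]
  [IsManifold 𝓘(ℂ, E') ω M] [MulAction K M] (hM : IsHolomorphicAction EK K E' M)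

include hT hM

/-- If the pull-back of an invariant two-form is exact, its contraction with an induced field is
exact upstairs. -/
theorem exists_potential_of_primitive {f : T → M} (hf : ∀ (k : K) x, f (k • x) = k • f x)
    {P : Set T} (hP : IsOpen P) (hPK : ∀ (k : K), ∀ x ∈ P, k • x ∈ P)
    (hfs : ∀ x, MDifferentiableAt 𝓘(ℝ, E) 𝓘(ℝ, E') f x)
    {β : T → E [⋀^Fin 1]→L[ℝ] ℂ} (hβ : ∀ x ∈ P, SmoothAt β x)
    {η : M → E' [⋀^Fin 2]→L[ℝ] ℂ} (hη : InvariantForm K η)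
    (hd : ∀ x ∈ P, dForm β x = pullback (E' := E) f η x) (v : GroupLieAlgebra 𝓘(ℝ, EK) K) :
    ∃ F : T → ℂ, ∀ x ∈ P, SmFun E F x ∧
      ∀ w, mD E ℂ F x w = η (f x) ![inducedField v (f x), mD E E' f x w] := by
  let _ : MeasurableSpace K := borel K
  have : BorelSpace K := ⟨rfl⟩
  have : IsTopologicalGroup K := topologicalGroup_of_lieGroup 𝓘(ℝ, EK) ∞
  obtain ⟨μ, hμ, hμr⟩ := exists_right_invariant_probability K
  have hs : ∀ x ∈ P, SmoothAt (average μ β) x := fun x hx => smoothAt_average hT μ hP hPK hβ hx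
  have hk : ∀ x ∈ P, ∀ k : K, pullback (E' := E) (fun x : T => k • x) (dForm β) x =
      pullback (E' := E) f η x := by
    intro x hx k
    ext u
    rw [pullback_apply, hd _ (hPK k x hx), pullback_apply, pullback_apply]
    have h1 := mD_comp (E'' := E') (g := f) (f := fun x : T => k • x) (hfs (k • x))
      (hT.mdifferentiableAt_real k x)
    have h2 := mD_comp (E'' := E') (g := fun x : M => k • x) (f := f)
      (hM.mdifferentiableAt_real k (f x)) (hfs x)
    simp only [hf] at h1
    rw [h1] at h2
    have h3 := congrFun (hη k) (f x)
    rw [← h3, pullback_apply, hf]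
    congr 1
    funext i
    exact DFunLike.congr_fun h2 (u i)
  refine ⟨fun x => -(average μ β x fun _ => inducedField v x), fun x hx => ⟨?_, fun w => ?_⟩⟩
  · exact ContMDiffAt.neg (smFun_apply_inducedField hT (hs x hx) v)
  · have h1 := contract_dForm_invariant hT (hs x hx) v (by
      filter_upwards [hP.mem_nhds hx] with z hz g using pullback_average hT μ hP hPK hβ g hz)
    rw [dForm_average hT μ hP hPK hβ hx (hk x hx)] at h1
    have h2 : mD E ℂ (fun x => -(average μ β x fun _ => inducedField v x)) x =
        -mD E ℂ (fun x => average μ β x fun _ => inducedField v x) x := mfderiv_neg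
    have h3 := DFunLike.congr_fun h1 (fun _ => w)
    rw [h2]
    refine h3.symm.trans ?_
    change η (f x) (fun i => mD E E' f x (Matrix.vecCons (inducedField v x) (fun _ => w) i)) = _
    congr 1
    funext i
    refine Fin.cases ?_ (fun j => ?_) i
    · exact mD_equivariant_inducedField hT hf (hfs x) v
    · rw [Subsingleton.elim j 0]
      rfl

end Potential

section LineBundle

open Bundle (TotalSpace)

variable {E : Type*} [NormedAddCommGroup E] [NormedSpace ℂ E]
  {M : Type*} [TopologicalSpace M] [ChartedSpace E M]
  {N : M → Type*} [∀ x, AddCommGroup (N x)] [∀ x, Module ℂ (N x)] [∀ x, TopologicalSpace (N x)]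
  [TopologicalSpace (TotalSpace ℂ N)] [FiberBundle ℂ N] [VectorBundle ℂ ℂ N]

instance lineBundleChartedSpace : ChartedSpace (E × ℂ) (TotalSpace ℂ N) :=
  inferInstanceAs (ChartedSpace (ModelProd E ℂ) (TotalSpace ℂ N))

variable [IsManifold 𝓘(ℂ, E) ω M] [ContMDiffVectorBundle ω ℂ N 𝓘(ℂ, E)]

instance : IsManifold 𝓘(ℂ, E × ℂ) ω (TotalSpace ℂ N) := by
  have h : IsManifold (𝓘(ℂ, E).prod 𝓘(ℂ, ℂ)) ω (TotalSpace ℂ N) := inferInstance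
  rw [modelWithCornersSelf_prod]
  exact h

theorem contMDiff_bundleProj :
    ContMDiff 𝓘(ℂ, E × ℂ) 𝓘(ℂ, E) ω (TotalSpace.proj : TotalSpace ℂ N → M) := by
  have h := Bundle.contMDiff_proj (n := ω) (IB := 𝓘(ℂ, E)) (F := ℂ) (E := N)
  rw [modelWithCornersSelf_prod]
  exact h

theorem contMDiffAt_bundleCoord (x : M) {q : TotalSpace ℂ N}
    (hq : q.1 ∈ (trivializationAt ℂ N x).baseSet) :
    ContMDiffAt 𝓘(ℂ, E × ℂ) 𝓘(ℂ, ℂ) ω (fun q => (trivializationAt ℂ N x q).2) q := by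
  have h := (trivializationAt ℂ N x).contMDiffOn (n := ω) (IB := 𝓘(ℂ, E))
  have h1 := (h.contMDiffAt ((trivializationAt ℂ N x).open_source.mem_nhds
    ((trivializationAt ℂ N x).mem_source.2 hq))).snd
  rw [modelWithCornersSelf_prod]
  exact h1

/-- The point of the total space over `y` with coordinate `z` in the trivialisation at `x`. -/
def bundlePoint (N : M → Type*) [∀ x, AddCommGroup (N x)] [∀ x, Module ℂ (N x)]
    [∀ x, TopologicalSpace (N x)] [TopologicalSpace (TotalSpace ℂ N)] [FiberBundle ℂ N]
    [VectorBundle ℂ ℂ N] (x y : M) (z : ℂ) : TotalSpace ℂ N :=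
  ⟨y, (trivializationAt ℂ N x).symm y z⟩

theorem contMDiffAt_bundlePoint (x : M) {y : M} (hy : y ∈ (trivializationAt ℂ N x).baseSet)
    (z : ℂ) : ContMDiffAt (𝓘(ℂ, E).prod 𝓘(ℂ, ℂ)) 𝓘(ℂ, E × ℂ) ω
      (fun q : M × ℂ => bundlePoint N x q.1 q.2) (y, z) := by
  have h := (trivializationAt ℂ N x).contMDiffOn_symm (n := ω) (IB := 𝓘(ℂ, E))
  have hm : (y, z) ∈ (trivializationAt ℂ N x).target := (trivializationAt ℂ N x).mem_target.2 hy
  have h1 := h.contMDiffAt ((trivializationAt ℂ N x).open_target.mem_nhds hm)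
  rw [modelWithCornersSelf_prod]
  refine ContMDiffAt.congr_of_eventuallyEq h1 ?_
  filter_upwards [(trivializationAt ℂ N x).open_target.mem_nhds hm] with q hq
  exact (trivializationAt ℂ N x).mk_symm ((trivializationAt ℂ N x).mem_target.1 hq) q.2

theorem contMDiffAt_bundlePoint_left (x : M) {y : M}
    (hy : y ∈ (trivializationAt ℂ N x).baseSet) (z : ℂ) :
    ContMDiffAt 𝓘(ℂ, E) 𝓘(ℂ, E × ℂ) ω (fun y => bundlePoint N x y z) y :=
  ContMDiffAt.comp (g := fun q : M × ℂ => bundlePoint N x q.1 q.2) (f := fun y => (y, z)) y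
    (contMDiffAt_bundlePoint x hy z) (contMDiffAt_id.prodMk contMDiffAt_const)

theorem contMDiffAt_bundlePoint_right (x : M) {y : M}
    (hy : y ∈ (trivializationAt ℂ N x).baseSet) (z : ℂ) :
    ContMDiffAt 𝓘(ℂ, ℂ) 𝓘(ℂ, E × ℂ) ω (fun z => bundlePoint N x y z) z :=
  ContMDiffAt.comp (g := fun q : M × ℂ => bundlePoint N x q.1 q.2) (f := fun z => (y, z)) z
    (contMDiffAt_bundlePoint x hy z) (contMDiffAt_const.prodMk contMDiffAt_id)

theorem bundlePoint_coord (x : M) {q : TotalSpace ℂ N}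
    (hq : q.1 ∈ (trivializationAt ℂ N x).baseSet) :
    bundlePoint N x q.1 (trivializationAt ℂ N x q).2 = q := by
  obtain ⟨y, e⟩ := q
  exact congrArg (TotalSpace.mk y) ((trivializationAt ℂ N x).symm_apply_apply_mk hq e)

variable (H : HermitianMetric (E := E) N)

theorem HermitianMetric.normSq_bundlePoint (x : M) {y : M}
    (hy : y ∈ (trivializationAt ℂ N x).baseSet) (z : ℂ) :
    H.normSq (bundlePoint N x y z) = ‖z‖ ^ 2 * H.normSq (bundlePoint N x y 1) := by
  have h : (trivializationAt ℂ N x).symm y z = z • (trivializationAt ℂ N x).symm y (1 : ℂ) := by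
    rw [← (trivializationAt ℂ N x).symmₗ_apply (R := ℂ) hy,
      ← (trivializationAt ℂ N x).symmₗ_apply (R := ℂ) hy, ← map_smul, smul_eq_mul, mul_one]
  rw [bundlePoint, h, H.homogeneous]
  rfl

theorem bundlePoint_snd_ne_zero (x : M) {y : M}
    (hy : y ∈ (trivializationAt ℂ N x).baseSet) {z : ℂ} (hz : z ≠ 0) :
    (bundlePoint N x y z).2 ≠ 0 := by
  intro h
  have h1 := (trivializationAt ℂ N x).apply_mk_symm hy z
  change (trivializationAt ℂ N x).symm y z = 0 at h
  have h2 : trivializationAt ℂ N x (⟨y, 0⟩ : TotalSpace ℂ N) = (y, 0) :=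
    (trivializationAt ℂ N x).zeroSection ℂ hy
  rw [h, h2] at h1
  exact hz (congrArg Prod.snd h1).symm

theorem HermitianMetric.normSq_pos_iff (q : TotalSpace ℂ N) : 0 < H.normSq q ↔ q.2 ≠ 0 := by
  refine ⟨fun h h0 => ?_, fun h => H.pos q.1 q.2 h⟩
  have h1 := H.homogeneous q.1 0 q.2
  rw [zero_smul] at h1
  have h2 : q = ⟨q.1, 0⟩ := by rw [← h0]
  rw [h2, h1] at h
  simp at h

theorem HermitianMetric.smooth_real :
    ContMDiff 𝓘(ℝ, E × ℂ) 𝓘(ℝ, ℝ) ∞ H.normSq := by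
  have h := H.smooth
  rw [modelWithCornersSelf_prod]
  exact h

theorem SmFun.log {E M : Type*} [NormedAddCommGroup E] [NormedSpace ℂ E] [TopologicalSpace M]
    [ChartedSpace E M] {f : M → ℝ} {x : M} (hf : ContMDiffAt 𝓘(ℝ, E) 𝓘(ℝ, ℝ) ∞ f x)
    (h : f x ≠ 0) : SmFun E (fun y => (Real.log (f y) : ℂ)) x := by
  have h1 : ContDiffAt ℝ ∞ (fun t : ℝ => (Real.log t : ℂ)) (f x) :=
    Complex.ofRealCLM.contDiff.contDiffAt.comp (f x) (Real.contDiffAt_log.2 h)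
  exact ContMDiffAt.comp (g := fun t : ℝ => (Real.log t : ℂ)) (f := f) x h1.contMDiffAt hf

theorem smFun_log_metric {q : TotalSpace ℂ N} (hq : q.2 ≠ 0) :
    SmFun (E × ℂ) (fun q : TotalSpace ℂ N => (Real.log (H.normSq q) : ℂ)) q :=
  SmFun.log (H.smooth_real q) ((H.normSq_pos_iff q).2 hq).ne'

theorem smFun_log_metric_frame (x : M) {y : M} (hy : y ∈ (trivializationAt ℂ N x).baseSet) :
    SmFun E (fun y => (Real.log (H.normSq (bundlePoint N x y 1)) : ℂ)) y :=
  ContMDiffAt.comp (g := fun q : TotalSpace ℂ N => (Real.log (H.normSq q) : ℂ))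
    (f := fun y => bundlePoint N x y 1) y
    (smFun_log_metric H (bundlePoint_snd_ne_zero x hy one_ne_zero))
    (ContMDiffAt.to_real (contMDiffAt_bundlePoint_left x hy 1))

include H in
theorem isOpen_snd_ne_zero : IsOpen {q : TotalSpace ℂ N | q.2 ≠ 0} := by
  have h : {q : TotalSpace ℂ N | q.2 ≠ 0} = H.normSq ⁻¹' Set.Ioi 0 :=
    Set.ext fun q => (H.normSq_pos_iff q).symm
  rw [h]
  exact isOpen_Ioi.preimage H.smooth_real.continuous

variable [FiniteDimensional ℂ E]

theorem ddbar_log_metric {q : TotalSpace ℂ N} (hq : q.2 ≠ 0) :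
    (-(1 / (2 * Real.pi)) : ℝ) • ddbar (E := E × ℂ)
      (fun q : TotalSpace ℂ N => (Real.log (H.normSq q) : ℂ)) q =
      pullback (E' := E × ℂ) (TotalSpace.proj : TotalSpace ℂ N → M) H.curvature q := by
  set x := q.1 with hx
  have hxb : x ∈ (trivializationAt ℂ N x).baseSet := FiberBundle.mem_baseSet_trivializationAt' x
  set t : TotalSpace ℂ N → ℂ := fun q => (trivializationAt ℂ N x q).2 with ht
  have hN : ∀ᶠ q' in 𝓝 q, q'.1 ∈ (trivializationAt ℂ N x).baseSet :=
    (contMDiff_bundleProj (E := E) (N := N)).continuous.continuousAt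
      ((trivializationAt ℂ N x).open_baseSet.mem_nhds hxb)
  have ht0 : t q ≠ 0 := by
    intro h
    have h1 := H.normSq_bundlePoint x hxb (t q)
    rw [bundlePoint_coord x hxb, h] at h1
    have h2 := (H.normSq_pos_iff q).2 hq
    rw [h1] at h2
    simp at h2
  have htc := contMDiffAt_bundleCoord (E := E) x (q := q) hxb
  have hπ := contMDiff_bundleProj (E := E) (N := N)
  set u : M → ℂ := fun y => (Real.log (H.normSq (bundlePoint N x y 1)) : ℂ) with hu
  have hus : SmFun E u q.1 := smFun_log_metric_frame H x hxb
  have e : (fun q : TotalSpace ℂ N => (Real.log (H.normSq q) : ℂ)) =ᶠ[𝓝 q]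
      fun q' => (fun z : ℂ => (Real.log (‖z‖ ^ 2) : ℂ)) (t q') + u q'.1 := by
    filter_upwards [hN, htc.continuousAt.eventually_ne ht0] with q' hq' htq'
    have h1 := H.normSq_bundlePoint x hq' (t q')
    rw [bundlePoint_coord x hq'] at h1
    have h2 : 0 < H.normSq (bundlePoint N x q'.1 1) :=
      (H.normSq_pos_iff _).2 (bundlePoint_snd_ne_zero x hq' one_ne_zero)
    simp only [hu]
    rw [h1, Real.log_mul (by simpa using htq') h2.ne', Complex.ofReal_add]
  have hl : SmFun ℂ (fun z : ℂ => (Real.log (‖z‖ ^ 2) : ℂ)) (t q) :=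
    SmFun.log (contDiff_norm_sq ℝ).contDiffAt.contMDiffAt (by simpa using ht0)
  have htr : ContMDiffAt 𝓘(ℝ, E × ℂ) 𝓘(ℝ, ℂ) ∞ t q := ContMDiffAt.to_real htc
  have hπr : ContMDiffAt 𝓘(ℝ, E × ℂ) 𝓘(ℝ, E) ∞ (TotalSpace.proj : TotalSpace ℂ N → M) q :=
    ContMDiffAt.to_real (hπ q)
  have s1 : SmFun (E × ℂ) (fun q' => (fun z : ℂ => (Real.log (‖z‖ ^ 2) : ℂ)) (t q')) q :=
    ContMDiffAt.comp q hl htr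
  have s2 : SmFun (E × ℂ) (fun q' : TotalSpace ℂ N => u q'.1) q := ContMDiffAt.comp q hus hπr
  have d1 : ddbar (E := E × ℂ) (fun q' => (fun z : ℂ => (Real.log (‖z‖ ^ 2) : ℂ)) (t q')) q = 0 := by
    rw [← pullback_ddbar (E' := E × ℂ) hl ?_ htr]
    · ext w
      rw [pullback_apply, ddbar_log_normSq (g := fun z => z)
        (Filter.Eventually.of_forall fun z => ⟨differentiableAt_id, contDiffAt_id⟩) ht0]
      rfl
    · filter_upwards [hN] with q' hq'
      exact (contMDiffAt_bundleCoord (E := E) x hq').mdifferentiableAt (by simp)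
  have d2 : ddbar (E := E × ℂ) (fun q' : TotalSpace ℂ N => u q'.1) q =
      pullback (E' := E × ℂ) (TotalSpace.proj : TotalSpace ℂ N → M) (ddbar (E := E) u) q :=
    (pullback_ddbar (E' := E × ℂ) hus
      (Filter.Eventually.of_forall fun q' => (hπ q').mdifferentiableAt (by simp)) hπr).symm
  rw [ddbar_congr e, ddbar_add s1 s2, d1, zero_add, d2]
  rfl

variable {EK K : Type*} [NormedAddCommGroup EK] [NormedSpace ℝ EK] [Group K] [TopologicalSpace K]
  [ChartedSpace EK K] [LieGroup 𝓘(ℝ, EK) ∞ K] [T2Space K] [CompactSpace K]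
  [MulAction K M] (hM : IsHolomorphicAction EK K E M) [MulAction K (TotalSpace ℂ N)]
  (hN : IsLinearisation EK K (E := E) N)

include hN in
theorem IsLinearisation.isHolomorphicAction :
    IsHolomorphicAction EK K (E × ℂ) (TotalSpace ℂ N) := by
  constructor
  · have h := hN.smooth
    rw [modelWithCornersSelf_prod]
    exact h
  · have h := hN.holomorphic
    rw [modelWithCornersSelf_prod]
    exact h

include hN in
theorem IsLinearisation.proj_smul (k : K) (q : TotalSpace ℂ N) : (k • q).1 = k • q.1 := by
  obtain ⟨A, hA⟩ := hN.linear k q.1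
  rw [show q = ⟨q.1, q.2⟩ from rfl, hA]

include hN in
theorem IsLinearisation.smul_snd_ne_zero (k : K) (q : TotalSpace ℂ N) (hq : q.2 ≠ 0) :
    (k • q).2 ≠ 0 := by
  obtain ⟨A, hA⟩ := hN.linear k q.1
  have h1 : k • q = ⟨k • q.1, A q.2⟩ := hA q.2
  rw [h1]
  intro h
  have h2 : k • q = k • (⟨q.1, 0⟩ : TotalSpace ℂ N) := by
    rw [h1, hA, map_zero]
    exact congrArg _ h
  have h3 := MulAction.injective k h2
  apply hq
  rw [h3]

include hM hN in
/-- Existence of moment functions for a closed invariant form representing the first Chern class of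
a linearised `ℚ`-line bundle. -/
theorem exists_moment_function {r : ℕ} (hr : 0 < r) {η : M → E [⋀^Fin 2]→L[ℝ] ℂ}
    (hreal : RealForm η) (hc : RepresentsFirstChern N r η) (hinv : InvariantForm K η)
    (v : GroupLieAlgebra 𝓘(ℝ, EK) K) : ∃ f : M → ℝ, ∀ x, SmFun E (fun y => (f y : ℂ)) x ∧
      ∀ w, mD E ℂ (fun y => (f y : ℂ)) x w = η x ![inducedField v x, w] := by
  obtain ⟨H, γ, hγ, -, hcurv⟩ := hc
  set P : Set (TotalSpace ℂ N) := {q | q.2 ≠ 0} with hP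
  have hPo : IsOpen P := isOpen_snd_ne_zero H
  have hπ := contMDiff_bundleProj (E := E) (N := N)
  have hπr : ∀ q, ContMDiffAt 𝓘(ℝ, E × ℂ) 𝓘(ℝ, E) ∞ (TotalSpace.proj : TotalSpace ℂ N → M) q :=
    fun q => ContMDiffAt.to_real (hπ q)
  have hL : ∀ q ∈ P, SmFun (E × ℂ) (fun q : TotalSpace ℂ N => (Real.log (H.normSq q) : ℂ)) q :=
    fun q hq => smFun_log_metric H hq
  have hγs : ∀ x, SmoothAt γ x := smoothForm_iff.1 hγ
  set π : TotalSpace ℂ N → M := TotalSpace.proj with hπdef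
  set β : TotalSpace ℂ N → (E × ℂ) [⋀^Fin 1]→L[ℝ] ℂ := fun q =>
    (-(1 / (4 * Real.pi)) : ℝ) • dc (E := E × ℂ) (fun q => (Real.log (H.normSq q) : ℂ)) q +
      pullback (E' := E × ℂ) π γ q with hβ
  have hβs : ∀ q ∈ P, SmoothAt β q := fun q hq =>
    ((hL q hq).dc.const_smul _).add (SmoothAt.pullback (hπr q) (hγs _))
  have hβd : ∀ q ∈ P, dForm β q =
      pullback (E' := E × ℂ) π (fun x => (r : ℝ) • η x) q := by
    intro q hq
    have h1 : pullback (E' := E × ℂ) π (fun x => (r : ℝ) • η x) q =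
        pullback (E' := E × ℂ) π H.curvature q + pullback (E' := E × ℂ) π (dForm γ) q := by
      rw [funext hcurv]
      rfl
    rw [h1, hβ, dForm_add ((hL q hq).dc.const_smul _) (SmoothAt.pullback (hπr q) (hγs _)),
      dForm_const_smul, dForm_pullback (hπr q) (hγs _), ← ddbar_log_metric H hq, ddbar, smul_smul]
    congr 2
    ring
  have hri : InvariantForm K fun x => (r : ℝ) • η x := by
    intro g
    funext x
    rw [pullback_smul, hinv g]
  obtain ⟨F, hF⟩ := exists_potential_of_primitive hN.isHolomorphicAction hM hN.proj_smul hPo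
    (fun k q hq => hN.smul_snd_ne_zero k q hq) (fun q => (hπr q).mdifferentiableAt (by simp))
    hβs hri hβd v
  have hconst : ∀ x, ∀ y ∈ (trivializationAt ℂ N x).baseSet, ∀ z w : ℂ, z ≠ 0 → w ≠ 0 →
      F (bundlePoint N x y z) = F (bundlePoint N x y w) := by
    intro x y hy z w hz hw
    have hmd : ∀ z : ℂ, ContMDiffAt 𝓘(ℝ, ℂ) 𝓘(ℝ, E × ℂ) ∞ (fun z => bundlePoint N x y z) z :=
      fun z => ContMDiffAt.to_real (contMDiffAt_bundlePoint_right x hy z)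
    have hd : ∀ z ∈ ({0}ᶜ : Set ℂ), DifferentiableAt ℝ (fun z => F (bundlePoint N x y z)) z ∧
        fderiv ℝ (fun z => F (bundlePoint N x y z)) z = 0 := by
      intro z hz
      have hq := bundlePoint_snd_ne_zero (N := N) x hy hz
      have hmF := (hF _ hq).1.mdiff
      have hmz := (hmd z).mdifferentiableAt (by simp)
      refine ⟨mdifferentiableAt_iff_differentiableAt.1 (hmF.comp z hmz), ?_⟩
      rw [← mD_eq_fderiv, mD_comp hmF hmz]
      refine ContinuousLinearMap.ext fun a => ?_
      have h1 := mD_comp (E'' := E) (g := π) (f := fun z => bundlePoint N x y z) (x := z)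
        ((hπr _).mdifferentiableAt (by simp)) hmz
      have h2 : mD ℂ E (fun z : ℂ => π (bundlePoint N x y z)) z = 0 := mfderiv_const
      rw [h2] at h1
      rw [ContinuousLinearMap.comp_apply, (hF _ hq).2]
      exact ContinuousAlternatingMap.map_coord_zero _ 1 (DFunLike.congr_fun h1 a).symm
    exact isOpen_compl_singleton.is_const_of_fderiv_eq_zero
      (isConnected_compl_singleton_of_one_lt_rank (by simp) 0).isPreconnected
      (fun z hz => (hd z hz).1.differentiableWithinAt) (fun z hz => (hd z hz).2) hz hw
  set G : M → ℂ := fun y => (r : ℝ)⁻¹ • F (bundlePoint N y y 1) with hG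
  have hGs : ∀ x, SmFun E G x ∧ ∀ w, mD E ℂ G x w = η x ![inducedField v x, w] := by
    intro x
    have hxb : x ∈ (trivializationAt ℂ N x).baseSet := FiberBundle.mem_baseSet_trivializationAt' x
    have hq := bundlePoint_snd_ne_zero (N := N) x hxb one_ne_zero
    have hs := ContMDiffAt.to_real (contMDiffAt_bundlePoint_left (E := E) (N := N) x hxb 1)
    have e : G =ᶠ[𝓝 x] fun y => (r : ℝ)⁻¹ • F (bundlePoint N x y 1) := by
      filter_upwards [(trivializationAt ℂ N x).open_baseSet.mem_nhds hxb] with y hy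
      have hyb : y ∈ (trivializationAt ℂ N y).baseSet := FiberBundle.mem_baseSet_trivializationAt' y
      have h1 := bundlePoint_coord (N := N) x (q := bundlePoint N y y 1) hy
      simp only [hG]
      congr 1
      rw [← h1]
      refine hconst x y hy _ _ ?_ one_ne_zero
      intro h0
      have h2 := bundlePoint_snd_ne_zero (N := N) y hyb one_ne_zero
      have h3 := (H.normSq_pos_iff _).2 h2
      rw [← h1, h0] at h3
      have h4 := H.normSq_bundlePoint x hy 0
      rw [show (bundlePoint N y y 1).proj = y from rfl, h4] at h3
      simp at h3
    have hFs : SmFun E (fun y => F (bundlePoint N x y 1)) x := ContMDiffAt.comp x (hF _ hq).1 hs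
    have hGs : SmFun E (fun y => (r : ℝ)⁻¹ • F (bundlePoint N x y 1)) x :=
      ContMDiffAt.comp (I' := 𝓘(ℝ, ℂ)) (g := fun z : ℂ => (r : ℝ)⁻¹ • z) x
        (contDiff_const_smul _).contDiffAt.contMDiffAt hFs
    refine ⟨hGs.congr_of_eventuallyEq e, fun w => ?_⟩
    rw [mD_congr e, mD_const_smul hFs.mdiff,
      mD_comp (f := fun y => bundlePoint N x y 1) (hF _ hq).1.mdiff
        (hs.mdifferentiableAt (by simp))]
    have h1 := mD_comp (E'' := E) (g := π) (f := fun y => bundlePoint N x y 1) (x := x)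
      ((hπr _).mdifferentiableAt (by simp)) (hs.mdifferentiableAt (by simp))
    have h2 : mD E E (fun y : M => π (bundlePoint N x y 1)) x = ContinuousLinearMap.id ℝ E := mD_id x
    rw [h2] at h1
    have h3 := DFunLike.congr_fun h1 w
    change (r : ℝ)⁻¹ • mD (E × ℂ) ℂ F _ (mD E (E × ℂ) _ x w) = _
    rw [(hF _ hq).2]
    rw [ContinuousLinearMap.comp_apply] at h3
    rw [← h3]
    change (r : ℝ)⁻¹ • (r : ℝ) • η x _ = _
    rw [smul_smul, inv_mul_cancel₀ (by positivity), one_smul]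
    rfl
  have hre : ∀ z, ContMDiffAt 𝓘(ℝ, ℂ) 𝓘(ℝ, ℂ) ∞ (fun z : ℂ => (z.re : ℂ)) z := fun z =>
    (Complex.ofRealCLM.comp Complex.reCLM).contDiff.contDiffAt.contMDiffAt
  refine ⟨fun y => (G y).re, fun x => ⟨(hre (G x)).comp x (hGs x).1, fun w => ?_⟩⟩
  · have h1 := mD_comp (E'' := ℂ) (E := ℂ) (E' := E) (g := fun z : ℂ => (z.re : ℂ)) (f := G) (x := x)
      ((hre _).mdifferentiableAt (by simp)) (hGs x).1.mdiff
    have h2 : mD ℂ ℂ (fun z : ℂ => (z.re : ℂ)) (G x) = Complex.ofRealCLM.comp Complex.reCLM := by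
      rw [mD_eq_fderiv]
      exact (Complex.ofRealCLM.comp Complex.reCLM).fderiv
    rw [h1, h2, ContinuousLinearMap.comp_apply, (hGs x).2]
    exact Complex.ext rfl (hreal x _).symm

end LineBundle

section Hamiltonian

variable {EK K : Type*} [NormedAddCommGroup EK] [NormedSpace ℝ EK] [Group K] [TopologicalSpace K]
  [ChartedSpace EK K]
  {E : Type*} [NormedAddCommGroup E] [NormedSpace ℂ E]
  {M : Type*} [TopologicalSpace M] [ChartedSpace E M] [MulAction K M]
  [IsManifold 𝓘(ℂ, E) ω M] [FiniteDimensional ℂ E]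
  {η : M → E [⋀^Fin 2]→L[ℝ] ℂ} {v : GroupLieAlgebra 𝓘(ℝ, EK) K} {f : M → ℝ}

theorem contract_I_inducedField (hη : BalancedType η) {x : M}
    (hf : ∀ w, mD E ℂ (fun y => (f y : ℂ)) x w = η x ![inducedField v x, w]) :
    contract (fun x => (Complex.I • inducedField v x : E)) η x = dc (fun y => (f y : ℂ)) x := by
  ext u
  rw [dc_apply, hf]
  change η x (Matrix.vecCons _ u) = -η x _
  have h1 := hη x ![Complex.I • inducedField v x, u 0] Complex.I (by simp)
  have h2 : (Matrix.vecCons (Complex.I • inducedField v x) u : Fin 2 → E) =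
      ![Complex.I • inducedField v x, u 0] := by
    funext i
    fin_cases i <;> rfl
  have h3 : (fun i => Complex.I • (![Complex.I • inducedField v x, u 0] : Fin 2 → E) i) =
      Function.update ![inducedField v x, Complex.I • u 0] 0
        ((-1 : ℝ) • (![inducedField v x, Complex.I • u 0] : Fin 2 → E) 0) := by
    funext i
    fin_cases i
    · simp [smul_smul]
    · rfl
  rw [h2, ← h1, h3, ContinuousAlternatingMap.map_update_smul, Function.update_eq_self, neg_one_smul]

theorem isHamiltonian_of_moment_function (hη : BalancedType η) (hd : ∀ x, dForm η x = 0)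
    (hf : ∀ x, SmFun E (fun y => (f y : ℂ)) x ∧
      ∀ w, mD E ℂ (fun y => (f y : ℂ)) x w = η x ![inducedField v x, w]) :
    IsHamiltonian η v fun x => 2 * f x := by
  refine ⟨fun x => ?_, fun x => ?_⟩
  · have h1 : ContMDiffAt 𝓘(ℝ, ℂ) 𝓘(ℝ, ℝ) ∞ (fun z : ℂ => 2 * z.re) (f x) :=
      (contDiff_const.mul Complex.reCLM.contDiff).contDiffAt.contMDiffAt
    exact ContMDiffAt.comp (g := fun z : ℂ => 2 * z.re) (f := fun y => (f y : ℂ)) x h1 (hf x).1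
  · have h1 : contract (fun x => (Complex.I • inducedField v x : E)) η =
        dc (fun y => (f y : ℂ)) := funext fun x => contract_I_inducedField hη (hf x).2
    have h2 : contract (fun x => (Complex.I • inducedField v x : E)) (dForm η) x = 0 := by
      ext u
      rw [contract, hd]
      rfl
    have h3 : (fun x => ((2 * f x : ℝ) : ℂ)) = fun x => (2 : ℝ) • (f x : ℂ) := by
      funext x
      simp
    rw [lieDeriv, h1, h2, add_zero, h3, ddbar_const_smul (hf x).1, ddbar, smul_smul]
    norm_num

end Hamiltonian

section Trace

variable {n : ℕ}

theorem sum_update_stdFrame (γ : (Fin n → ℂ) [⋀^Fin (2 * n)]→L[ℝ] ℂ)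
    (A : (Fin n → ℂ) →ₗ[ℝ] (Fin n → ℂ)) :
    ∑ k, γ (Function.update (stdFrame n) k (A (stdFrame n k))) =
      ((LinearMap.trace ℝ (Fin n → ℂ) A : ℝ) : ℂ) * γ (stdFrame n) := by
  set b := stdBasis n with hb
  have hbf : (stdFrame n : Fin (2 * n) → (Fin n → ℂ)) = b :=
    funext fun k => (stdBasis_apply n k).symm
  rw [hbf, LinearMap.trace_eq_matrix_trace ℝ b, Matrix.trace, Complex.ofReal_sum, Finset.sum_mul]
  refine Finset.sum_congr rfl fun k _ => ?_
  have h1 : A (b k) = ∑ j, b.repr (A (b k)) j • b j := (b.sum_repr _).symm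
  have h2 : ∀ w, γ (Function.update b k w) =
      γ.toAlternatingMap.toMultilinearMap.toLinearMap b k w := fun w => rfl
  rw [h2, h1, map_sum, Finset.sum_eq_single k]
  · rw [map_smul, ← h2, Function.update_eq_self, Matrix.diag_apply, LinearMap.toMatrix_apply,
      Complex.real_smul]
  · intro j _ hj
    rw [map_smul, ← h2]
    have h3 : γ (Function.update b k (b j)) = 0 :=
      γ.toAlternatingMap.map_update_self b hj.symm
    rw [h3, smul_zero]
  · exact fun h => absurd (Finset.mem_univ k) h

theorem trace_restrictScalars_complex (T : (Fin n → ℂ) →ₗ[ℂ] (Fin n → ℂ)) :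
    LinearMap.trace ℝ (Fin n → ℂ) (T.restrictScalars ℝ) =
      2 * (∑ i, T (Pi.single i 1) i).re := by
  rw [LinearMap.trace_eq_matrix_trace ℝ (Pi.basis fun _ : Fin n => Complex.basisOneI),
    Matrix.trace, Fintype.sum_sigma, Complex.re_sum, Finset.mul_sum]
  refine Finset.sum_congr rfl fun i _ => ?_
  rw [Fin.sum_univ_two]
  simp only [Matrix.diag_apply, LinearMap.toMatrix_apply, Pi.basis_repr, Pi.basis_apply,
    Complex.coe_basisOneI_repr, Complex.coe_basisOneI, LinearMap.coe_restrictScalars]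
  have h1 : (Pi.single i Complex.I : Fin n → ℂ) = Complex.I • Pi.single i 1 := by
    rw [← Pi.single_smul, smul_eq_mul, mul_one]
  simp only [Matrix.cons_val_zero, Matrix.cons_val_one]
  rw [h1, map_smul]
  simp
  ring

end Trace

section Cartan

variable {E : Type*} [NormedAddCommGroup E] [NormedSpace ℂ E] [FiniteDimensional ℂ E]

theorem fderiv_curryLeft_apply {m : ℕ} {α : E → E [⋀^Fin (m + 1)]→L[ℝ] ℂ} {Y : E → E} {y : E}
    (hα : DifferentiableAt ℝ α y) (hY : DifferentiableAt ℝ Y y) (w : Fin m → E) (e : E) :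
    fderiv ℝ (fun z => (α z).curryLeft (Y z) w) y e =
      (fderiv ℝ α y e).curryLeft (Y y) w + (α y).curryLeft (fderiv ℝ Y y e) w := by
  let L : (E [⋀^Fin (m + 1)]→L[ℝ] ℂ) →L[ℝ] E →L[ℝ] ℂ := LinearMap.toContinuousLinearMap
    { toFun := fun α => (ContinuousAlternatingMap.apply ℝ E ℂ w).comp α.curryLeft
      map_add' := fun _ _ => rfl
      map_smul' := fun _ _ => rfl }
  have h1 : HasFDerivAt (fun z => L (α z)) (L.comp (fderiv ℝ α y)) y :=
    L.hasFDerivAt.comp y hα.hasFDerivAt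
  have h2 := fderiv_clm_apply h1.differentiableAt hY
  rw [h1.fderiv] at h2
  have h3 := DFunLike.congr_fun h2 e
  refine h3.trans ?_
  rw [add_comm]
  rfl

theorem smooth_curryLeft {m : ℕ} {α : E → E [⋀^Fin (m + 1)]→L[ℝ] ℂ} {Y : E → E} {y : E}
    (hα : ContDiffAt ℝ ∞ α y) (hY : ContDiffAt ℝ ∞ Y y) :
    ContDiffAt ℝ ∞ (fun z => (α z).curryLeft (Y z)) y := by
  rw [contDiffAt_alt_iff]
  intro u
  refine contDiffAt_alt_apply (v := fun i z => (Matrix.vecCons (Y z) u : Fin (m + 1) → E) i) hα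
    fun i => ?_
  refine Fin.cases ?_ (fun j => ?_) i
  · exact hY
  · exact contDiffAt_const

/-- Cartan's formula for a closed form and a vector field on a vector space. -/
theorem dAlt_iota_field {α : E → Alt E} {Y : E → E} {y : E} (hα : ContDiffAlt α y)
    (hY : ContDiffAt ℝ ∞ Y y) (h0 : dAlt α y = 0) (k : ℕ) (u : Fin k → E) :
    dAlt (fun z => iota (Y z) (α z)) y k u = dirAlt α y (Y y) k u +
      ∑ i, α y k (Function.update u i (fderiv ℝ Y y (u i))) := by
  have h1 := iota_dAlt hα (Y y)
  rw [h0, iota_zero] at h1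
  have h2 : dirAlt α y (Y y) k = dAlt (fun z => iota (Y y) (α z)) y k :=
    sub_eq_zero.1 (congrFun h1 k).symm
  rw [h2]
  cases k with
  | zero => simp [dAlt]
  | succ m =>
    have hd : DifferentiableAt ℝ (fun z => α z (m + 1)) y := (hα (m + 1)).differentiableAt (by simp)
    have hYd := hY.differentiableAt (by simp)
    change extDeriv (fun z => (α z (m + 1)).curryLeft (Y z)) y u =
      extDeriv (fun z => (α z (m + 1)).curryLeft (Y y)) y u + _
    rw [extDeriv_apply ((smooth_curryLeft (hα (m + 1)) hY).differentiableAt (by simp)),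
      extDeriv_apply ((smooth_curryLeft (hα (m + 1)) contDiffAt_const).differentiableAt (by simp)),
      ← Finset.sum_add_distrib]
    refine Finset.sum_congr rfl fun i _ => ?_
    rw [fderiv_curryLeft_apply hd hYd, fderiv_curryLeft_apply hd (differentiableAt_const _), smul_add,
      fderiv_fun_const]
    congr 1
    · simp
    · rw [← neg_one_pow_mul_insertNth (α y (m + 1)) i, zsmul_eq_mul, ← mul_assoc,
        Fin.insertNth_removeNth]
      push_cast
      rw [← mul_pow]
      simp

end Cartan

section CartanManifold

variable {E M : Type*} [NormedAddCommGroup E] [NormedSpace ℂ E] [FiniteDimensional ℂ E]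
  [TopologicalSpace M] [ChartedSpace E M] [IsManifold 𝓘(ℂ, E) ω M]
  {c : OpenPartialHomeomorph M E} (hc : c ∈ IsManifold.maximalAtlas 𝓘(ℂ, E) ω M)
include hc

theorem contDiffAlt_coordAlt {θ : M → Alt E} {y : E} (hy : y ∈ c.target)
    (hθ : SmoothAltAt θ (c.symm y)) : ContDiffAlt (coordAlt c θ) y := by
  intro k
  have h := (smoothAt_iff hc (c.map_target hy)).1 (hθ k)
  rwa [c.right_inv hy] at h

theorem coordAlt_dA {θ : M → Alt E} {y : E} (hy : y ∈ c.target)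
    (hθ : SmoothAltAt θ (c.symm y)) : coordAlt c (dA θ) y = dAlt (coordAlt c θ) y := by
  funext k
  cases k with
  | zero => rfl
  | succ k => exact coordRep_dForm hc hy (hθ k)

/-- Cartan's formula for powers of a closed two-form, in a chart. -/
theorem cartan_wpow {η : M → E [⋀^Fin 2]→L[ℝ] ℂ} (hη : ∀ x, SmoothAt η x)
    (hd : ∀ x, dForm η x = 0) {Y : M → E} {g : E → E} {y : E} (hy : y ∈ c.target)
    (hg : ContDiffAt ℝ ∞ g y) (hgY : ∀ z ∈ c.target, cD c z (g z) = Y (c.symm z))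
    (l k : ℕ) (u : Fin k → E) :
    (l : ℂ) * wedge (ofDegree 2 (dForm (contract Y η) (c.symm y))) (wpow (η (c.symm y)) (l - 1)) k
      (fun i => cD c y (u i)) =
      fderiv ℝ (fun z => coordAlt c (fun x => wpow (η x) l) z k) y (g y) u +
        ∑ i, coordAlt c (fun x => wpow (η x) l) y k (Function.update u i (fderiv ℝ g y (u i))) := by
  set α := coordAlt c (fun x => wpow (η x) l) with hα
  have hs := SmoothAltAt.wpow (hη (c.symm y)) l
  have hαs : ContDiffAlt α y := contDiffAlt_coordAlt hc hy hs
  have hαd : dAlt α y = 0 := by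
    rw [← coordAlt_dA hc hy hs]
    funext k
    rw [coordAlt, dA_wpow (hη _) (hd _)]
    rfl
  refine Eq.trans ?_ (dAlt_iota_field hαs hg hαd k u)
  have e : coordAlt c (fun x => iota (Y x) (wpow (η x) l)) =ᶠ[𝓝 y] fun z => iota (g z) (α z) := by
    filter_upwards [c.open_target.mem_nhds hy] with z hz
    simp only [hα, coordAlt]
    rw [← altComp_iota, hgY z hz]
  have hcs : SmoothAt (contract Y η) (c.symm y) := by
    rw [smoothAt_iff hc (c.map_target hy), c.right_inv hy]
    have h1 := (smoothAt_iff hc (c.map_target hy)).1 (hη (c.symm y))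
    rw [c.right_inv hy] at h1
    refine (smooth_curryLeft h1 hg).congr_of_eventuallyEq ?_
    filter_upwards [c.open_target.mem_nhds hy] with z hz
    ext w
    refine congrArg (η (c.symm z)) (funext fun i => ?_)
    exact Fin.cases (hgY z hz).symm (fun j => rfl) i
  have h1 : (fun x => iota (Y x) (wpow (η x) l)) =
      fun x => (l : ℂ) • wedge (ofDegree 1 (contract Y η x)) (wpow (η x) (l - 1)) :=
    funext fun x => iota_wpow _ _ _
  have hw := (smoothAltAt_ofDegree hcs).wedge (SmoothAltAt.wpow (hη (c.symm y)) (l - 1))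
  have h2 : dA (fun x => iota (Y x) (wpow (η x) l)) (c.symm y) =
      (l : ℂ) • wedge (ofDegree 2 (dForm (contract Y η) (c.symm y)))
        (wpow (η (c.symm y)) (l - 1)) := by
    rw [h1, dA_const_smul hw, dA_wedge (smoothAltAt_ofDegree hcs)
      (SmoothAltAt.wpow (hη (c.symm y)) (l - 1)), dA_ofDegree, dA_wpow (hη _) (hd _),
      wedge_zero_right, add_zero]
  have h3 : dAlt (fun z => iota (g z) (α z)) y =
      coordAlt c (dA fun x => iota (Y x) (wpow (η x) l)) y := by
    rw [coordAlt_dA hc hy (by rw [h1]; exact hw.const_smul _)]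
    funext j
    cases j with
    | zero => rfl
    | succ j =>
      refine (Filter.EventuallyEq.extDeriv_eq ?_).symm
      filter_upwards [e] with z hz
      rw [hz]
  rw [h3, coordAlt, h2]
  rfl

end CartanManifold

theorem det_cD_ne_zero {n : ℕ} {M : Type*} [TopologicalSpace M]
    [ChartedSpace (Fin n → ℂ) M] [IsManifold 𝓘(ℂ, Fin n → ℂ) ω M] {c : OpenPartialHomeomorph M (Fin n → ℂ)}
    (hc : c ∈ IsManifold.maximalAtlas 𝓘(ℂ, Fin n → ℂ) ω M) {y : Fin n → ℂ} (hy : y ∈ c.target) :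
    LinearMap.det (cD c y : (Fin n → ℂ) →ₗ[ℝ] (Fin n → ℂ)) ≠ 0 := by
  have h4 : (mD (Fin n → ℂ) (Fin n → ℂ) c (c.symm y) : (Fin n → ℂ) →ₗ[ℝ] (Fin n → ℂ)) ∘ₗ
      (cD c y : (Fin n → ℂ) →ₗ[ℝ] (Fin n → ℂ)) = LinearMap.id :=
    LinearMap.ext fun w => DFunLike.congr_fun (mD_cD hc hy) w
  intro h0
  have h5 := congrArg LinearMap.det h4
  rw [LinearMap.det_comp, h0, mul_zero, LinearMap.det_id] at h5
  exact zero_ne_one h5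

section HolomorphicDerivative

variable {E F : Type*} [NormedAddCommGroup E] [NormedSpace ℂ E] [NormedAddCommGroup F]
  [NormedSpace ℂ F]

theorem differentiableAt_fderiv_apply {g : E → F} {y : E} (hs : ContDiffAt ℝ ∞ g y)
    (hd : ∀ᶠ z in 𝓝 y, DifferentiableAt ℂ g z) (w : E) :
    DifferentiableAt ℂ (fun z => fderiv ℂ g z w) y := by
  have e : (fun z => fderiv ℂ g z w) =ᶠ[𝓝 y] fun z => fderiv ℝ g z w := by
    filter_upwards [hd] with z hz
    rw [hz.fderiv_restrictScalars ℝ]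
    rfl
  rw [e.differentiableAt_iff]
  have h1 : DifferentiableAt ℝ (fderiv ℝ g) y :=
    (hs.fderiv_right (m := ∞) le_rfl).differentiableAt (by simp)
  have h2 : ∀ w e, fderiv ℝ (fun z => fderiv ℝ g z w) y e = fderiv ℝ (fderiv ℝ g) y e w := by
    intro w e
    rw [fderiv_clm_apply h1 (differentiableAt_const _)]
    simp
  have hsymm := hs.isSymmSndFDerivAt (by simpa using two_le_infty)
  refine differentiableAt_complex (h1.clm_apply (differentiableAt_const _)) fun a => ?_
  rw [h2, h2, hsymm (Complex.I • a) w, hsymm a w, ← h2, ← h2]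
  have e2 : (fun z => fderiv ℝ g z (Complex.I • a)) =ᶠ[𝓝 y] fun z => Complex.I • fderiv ℝ g z a := by
    filter_upwards [hd] with z hz
    rw [hz.fderiv_restrictScalars ℝ]
    exact map_smul (fderiv ℂ g z) Complex.I a
  rw [e2.fderiv_eq, fderiv_fun_const_smul (h1.clm_apply (differentiableAt_const _))]
  rfl

theorem contDiffAt_fderiv_apply {g : E → F} {y : E} (hs : ContDiffAt ℝ ∞ g y)
    (hd : ∀ᶠ z in 𝓝 y, DifferentiableAt ℂ g z) (w : E) :
    ContDiffAt ℝ ∞ (fun z => fderiv ℂ g z w) y := by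
  refine ((hs.fderiv_right (m := ∞) le_rfl).clm_apply
    (contDiffAt_const (c := w))).congr_of_eventuallyEq ?_
  filter_upwards [hd] with z hz
  rw [hz.fderiv_restrictScalars ℝ]
  rfl

end HolomorphicDerivative

namespace Family

variable {n : ℕ} {EX EB X B : Type*} [NormedAddCommGroup EX] [NormedSpace ℂ EX]
  [FiniteDimensional ℂ EX] [NormedAddCommGroup EB] [NormedSpace ℂ EB] [FiniteDimensional ℂ EB]
  [TopologicalSpace X] [ChartedSpace EX X] [TopologicalSpace B] [ChartedSpace EB B]
  (p : Family n EX EB X B) {η : X → EX [⋀^Fin 2]→L[ℝ] ℂ}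
  [IsManifold 𝓘(ℂ, EX) ω X] [IsManifold 𝓘(ℂ, EB) ω B]

/-- The vertical part of an endomorphism of the tangent space. -/
def vertPart (x : X) (A : EX →L[ℂ] EX) : (Fin n → ℂ) →L[ℂ] (Fin n → ℂ) :=
  ((ContinuousLinearMap.snd ℂ EB (Fin n → ℂ)).comp
    (p.split x : EX →L[ℂ] EB × (Fin n → ℂ))).comp (A.comp (p.vert x))

theorem vert_vertPart (x : X) (A : EX →L[ℂ] EX) (w : Fin n → ℂ)
    (h : (p.split x (A (p.vert x w))).1 = 0) : p.vert x (p.vertPart x A w) = A (p.vert x w) := by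
  rw [vert_apply, ContinuousLinearEquiv.symm_apply_eq]
  exact Prod.ext h.symm rfl

/-- Cartan's formula for the vertical volume. -/
theorem cartan_vertVol (hη : p.IsRelativelyKahler η) (x : X) {Y : X → EX} {g : EX → EX} {y : EX}
    (hy : y ∈ (p.domChart x).target) (hg : ContDiffAt ℝ ∞ g y)
    (hgY : ∀ z ∈ (p.domChart x).target, cD (p.domChart x) z (g z) = Y ((p.domChart x).symm z))
    {S : (Fin n → ℂ) →L[ℂ] (Fin n → ℂ)} (hS : ∀ w, fderiv ℝ g y (p.vert x w) = p.vert x (S w)) :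
    (n : ℂ) * altComp (wedge (ofDegree 2 (dForm (contract Y η) ((p.domChart x).symm y)))
      (wpow (η ((p.domChart x).symm y)) (n - 1))) (p.vertMap x ((p.domChart x).symm y)) (2 * n)
        (stdFrame n) =
      fderiv ℝ (fun y => p.vertVol η x ((p.domChart x).symm y)) y (g y) +
        ((2 * (∑ i, S (Pi.single i 1) i).re : ℝ) : ℂ) *
          p.vertVol η x ((p.domChart x).symm y) := by
  have hs := smoothForm_iff.1 hη.smooth
  have hcm := p.domChart_mem x
  have hV : ∀ z ∈ (p.domChart x).target, p.vertVol η x ((p.domChart x).symm z) =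
      coordAlt (p.domChart x) (fun x => wpow (η x) n) z (2 * n)
        fun k => p.vert x (stdFrame n k) := by
    intro z hz
    change wpow _ n (2 * n) (fun k => cD (p.domChart x) (p.domChart x ((p.domChart x).symm z))
      (p.vert x (stdFrame n k))) = _
    rw [(p.domChart x).right_inv hz]
    rfl
  have h := cartan_wpow hcm hs hη.closed hy hg hgY n (2 * n) fun k => p.vert x (stdFrame n k)
  refine Eq.trans ?_ (h.trans ?_)
  · change _ * wedge _ _ (2 * n) (fun k => cD (p.domChart x)
      (p.domChart x ((p.domChart x).symm y)) (p.vert x (stdFrame n k))) = _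
    rw [(p.domChart x).right_inv hy]
  · have hα := contDiffAlt_coordAlt hcm hy (SmoothAltAt.wpow (hs ((p.domChart x).symm y)) n)
    have e : (fun y => p.vertVol η x ((p.domChart x).symm y)) =ᶠ[𝓝 y]
        fun z => coordAlt (p.domChart x) (fun x => wpow (η x) n) z (2 * n)
          fun k => p.vert x (stdFrame n k) := by
      filter_upwards [(p.domChart x).open_target.mem_nhds hy] with z hz using hV z hz
    have h1 := ((ContinuousAlternatingMap.apply ℝ EX ℂ
      fun k => p.vert x (stdFrame n k)).hasFDerivAt.comp y (hα.diff (2 * n)).hasFDerivAt).fderiv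
    change fderiv ℝ (fun z => coordAlt (p.domChart x) (fun x => wpow (η x) n) z (2 * n)
          fun k => p.vert x (stdFrame n k)) y = _ at h1
    rw [e.fderiv_eq, h1]
    congr 1
    have h2 := sum_update_stdFrame ((coordAlt (p.domChart x) (fun x => wpow (η x) n) y
      (2 * n)).compContinuousLinearMap ((p.vert x).restrictScalars ℝ))
      ((S : (Fin n → ℂ) →ₗ[ℂ] (Fin n → ℂ)).restrictScalars ℝ)
    rw [trace_restrictScalars_complex] at h2
    rw [hV y hy]
    refine Eq.trans (Finset.sum_congr rfl fun i _ => ?_) h2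
    rw [hS]
    change _ = coordAlt (p.domChart x) (fun x => wpow (η x) n) y (2 * n)
      (fun k => p.vert x (Function.update (stdFrame n) i (S (stdFrame n i)) k))
    congr 1
    funext k
    by_cases hk : k = i
    · subst hk
      simp
    · simp [Function.update_of_ne hk]

/-- The Laplacian along the fibres. -/
def vertLaplacian (η : X → EX [⋀^Fin 2]→L[ℝ] ℂ) (f : X → ℂ) (z : X) : ℂ :=
  laplacian (p.restrict (p.proj z) η) (fun y => f y.1) ⟨z, rfl⟩

theorem restrict_ddbar {f : X → ℂ} {b : B} (x : p.Fiber b) (hf : SmFun EX f x.1) :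
    p.restrict b (ddbar (E := EX) f) x = ddbar (E := Fin n → ℂ) (fun y : p.Fiber b => f y.1) x :=
  pullback_ddbar (E := EX) (E' := Fin n → ℂ) (F := p.incl b) hf
    (Filter.Eventually.of_forall fun z => (p.contMDiff_incl b z).mdifferentiableAt (by simp))
    (p.contMDiffAt_incl_real x)

theorem vertLaplacian_eq (hη : p.IsRelativelyKahler η) {f : X → ℂ} (x : X) {z : X}
    (hz : z ∈ (p.domChart x).source) (hf : SmFun EX f z) :
    ((2 * Real.pi : ℝ) : ℂ) * p.vertLaplacian η f z * p.vertVol η x z =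
      (n : ℂ) * altComp (wedge (ofDegree 2 (ddbar f z)) (wpow (η z) (n - 1))) (p.vertMap x z) (2 * n)
        (stdFrame n) := by
  have hb : p.proj z ∈ (p.codChart x).source := p.proj_mem x hz
  set z' : p.Fiber (p.proj z) := ⟨z, rfl⟩ with hz'
  set c := p.fibreChart x hb with hc
  have hzc : z' ∈ c.source := hz
  have hcm := p.fibreChart_mem x hb
  set A := cD c (c z') with hA
  have h1 := p.mD_incl_cD x hb (c.map_source hzc)
  rw [← hc, c.left_inv hzc] at h1
  have h2 : p.liftAt x (p.proj z) (c z') = p.domChart x z := p.liftAt_split hz rfl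
  rw [h2] at h1
  have hAd := det_cD_ne_zero hcm (c.map_source hzc)
  set W := wedge (ofDegree 2 (ddbar f z)) (wpow (η z) (n - 1)) with hW
  have h3 : p.vertLaplacian η f z = (1 / (2 * Real.pi) : ℝ) * n *
      topRatio (altComp W (p.vertMap x z)) (altComp (wpow (η z) n) (p.vertMap x z)) := by
    have h4 : p.vertMap x z = (mD (Fin n → ℂ) EX (p.incl (p.proj z)) z').comp A := h1.symm
    rw [h4, ← altComp_comp, ← altComp_comp, topRatio_altComp _ hAd, vertLaplacian, laplacian,
      ← p.restrict_ddbar z' hf, hW, altComp_wedge, altComp_ofDegree, altComp_wpow, altComp_wpow]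
    rfl
  have hV : p.vertVol η x z = altComp (wpow (η z) n) (p.vertMap x z) (2 * n) (stdFrame n) := rfl
  have hV0 := p.vertVol_ne_zero hη x hz
  rw [hV] at hV0
  rw [h3, hV, topRatio]
  have hpi : (Real.pi : ℂ) ≠ 0 := by exact_mod_cast Real.pi_ne_zero
  push_cast
  field_simp

theorem fderiv_vertLog (hη : p.IsRelativelyKahler η) (x : X) {y : EX}
    (hy : y ∈ (p.domChart x).target) (w : EX) :
    fderiv ℝ (fun y => p.vertLog η x ((p.domChart x).symm y)) y w *
      p.vertVol η x ((p.domChart x).symm y) =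
      fderiv ℝ (fun y => p.vertVol η x ((p.domChart x).symm y)) y w := by
  have hz := (p.domChart x).map_target hy
  set V : EX → ℂ := fun y => p.vertVol η x ((p.domChart x).symm y) with hV
  have hVs : DifferentiableAt ℝ V y := by
    have h1 := (smFun_iff (p.domChart_mem x) hz).1
      (p.smFun_vertVol (smoothForm_iff.1 hη.smooth) x hz)
    rw [(p.domChart x).right_inv hy] at h1
    exact h1.differentiableAt (by simp)
  have hre : ∀ y, ((V y).re : ℂ) = V y := fun y => p.vertVol_real hη x _
  have h1 : HasFDerivAt (fun y => (V y).re) (Complex.reCLM.comp (fderiv ℝ V y)) y :=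
    Complex.reCLM.hasFDerivAt.comp y hVs.hasFDerivAt
  have h2 : HasFDerivAt (fun y => ((V y).re : ℂ))
      (Complex.ofRealCLM.comp (Complex.reCLM.comp (fderiv ℝ V y))) y :=
    Complex.ofRealCLM.hasFDerivAt.comp y h1
  have h3 : HasFDerivAt (fun y => (Real.log (V y).re : ℂ))
      (Complex.ofRealCLM.comp ((V y).re⁻¹ • Complex.reCLM.comp (fderiv ℝ V y))) y :=
    Complex.ofRealCLM.hasFDerivAt.comp y (h1.log (p.vertVol_re_ne_zero hη x hz))
  have h4 := h2.fderiv
  rw [funext hre] at h4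
  change fderiv ℝ (fun y => (Real.log (V y).re : ℂ)) y w * V y = fderiv ℝ V y w
  rw [h3.fderiv]
  have h5 := DFunLike.congr_fun h4 w
  rw [h5]
  have h6 : ((V y).re : ℂ) ≠ 0 := by
    rw [hre]
    exact p.vertVol_ne_zero hη x hz
  change (((V y).re⁻¹ * (fderiv ℝ V y w).re : ℝ) : ℂ) * V y = ((fderiv ℝ V y w).re : ℂ)
  have h7 : V y = ((V y).re : ℂ) := (hre y).symm
  generalize (fderiv ℝ V y w).re = a
  rw [h7, Complex.ofReal_re]
  push_cast
  field_simp

end Family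

namespace Family

variable {n : ℕ} {EX EB EK X B K : Type*} [NormedAddCommGroup EX] [NormedSpace ℂ EX]
  [FiniteDimensional ℂ EX] [NormedAddCommGroup EB] [NormedSpace ℂ EB] [FiniteDimensional ℂ EB]
  [NormedAddCommGroup EK] [NormedSpace ℝ EK]
  [TopologicalSpace X] [ChartedSpace EX X] [TopologicalSpace B] [ChartedSpace EB B]
  [Group K] [TopologicalSpace K] [ChartedSpace EK K] [LieGroup 𝓘(ℝ, EK) ∞ K]
  [MulAction K X] [MulAction K B]
  (p : Family n EX EB X B) {η : X → EX [⋀^Fin 2]→L[ℝ] ℂ}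
  [IsManifold 𝓘(ℂ, EX) ω X] [IsManifold 𝓘(ℂ, EB) ω B]
  (hX : IsHolomorphicAction EK K EX X) (hB : IsHolomorphicAction EK K EB B)
  (hequiv : ∀ (k : K) (x : X), p.proj (k • x) = k • p.proj x)

include hX hequiv

theorem mD_proj_inducedField (v : GroupLieAlgebra 𝓘(ℝ, EK) K) (x : X) :
    mD EX EB p.proj x (inducedField v x) = inducedField v (p.proj x) :=
  mD_equivariant_inducedField hX hequiv ((p.contMDiffAt_proj_real x).mdifferentiableAt (by simp)) v

include hB

theorem split_fieldRep (x : X) {y : EX} (hy : y ∈ (p.domChart x).target)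
    (v : GroupLieAlgebra 𝓘(ℝ, EK) K) :
    (p.split x (fieldRep (p.domChart x) v y)).1 =
      fieldRep (p.codChart x) v (p.split x y).1 := by
  have hz := (p.domChart x).map_target hy
  have h1 := p.split_mD_domChart x hz (inducedField v ((p.domChart x).symm y))
  rw [mD_inducedField hX (p.domChart_mem x) hz, p.mD_proj_inducedField hX hequiv,
    mD_inducedField hB (p.codChart_mem x) (p.proj_mem x hz), p.codChart_proj x hz,
    (p.domChart x).right_inv hy] at h1
  exact h1

theorem vert_vertPart_fieldRep (x : X) {y : EX} (hy : y ∈ (p.domChart x).target)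
    (v : GroupLieAlgebra 𝓘(ℝ, EK) K) (w : Fin n → ℂ) :
    p.vert x (p.vertPart x (fderiv ℂ (fieldRep (p.domChart x) v) y) w) =
      fderiv ℂ (fieldRep (p.domChart x) v) y (p.vert x w) := by
  refine p.vert_vertPart x _ w ?_
  have hz := (p.domChart x).map_target hy
  let P : EX →L[ℂ] EB := (ContinuousLinearMap.fst ℂ EB (Fin n → ℂ)).comp
    (p.split x : EX →L[ℂ] EB × (Fin n → ℂ))
  have hP : P y ∈ (p.codChart x).target := by
    have h := p.codChart_proj x hz
    rw [(p.domChart x).right_inv hy] at h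
    change (p.split x y).1 ∈ _
    rw [← h]
    exact (p.codChart x).map_source (p.proj_mem x hz)
  have e : (fun z => P (fieldRep (p.domChart x) v z)) =ᶠ[𝓝 y]
      fun z => fieldRep (p.codChart x) v (P z) := by
    filter_upwards [(p.domChart x).open_target.mem_nhds hy] with z hz
    exact p.split_fieldRep hX hB hequiv x hz v
  have h1 := P.hasFDerivAt.comp y
    (differentiableAt_fieldRep hX (p.domChart_mem x) hy v).hasFDerivAt
  have h2 := HasFDerivAt.comp (g := fieldRep (p.codChart x) v) (f := P) y
    (differentiableAt_fieldRep hB (p.codChart_mem x) hP v).hasFDerivAt P.hasFDerivAt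
  have h3 := DFunLike.congr_fun ((h1.congr_of_eventuallyEq e.symm).unique h2) (p.vert x w)
  have h4 : P (p.vert x w) = 0 := by
    change (p.split x ((p.split x).symm (0, w))).1 = 0
    simp
  change P _ = 0
  refine h3.trans ?_
  change fderiv ℂ (fieldRep (p.codChart x) v) (P y) (P (p.vert x w)) = 0
  rw [h4, map_zero]

omit [LieGroup 𝓘(ℝ, EK) ∞ K] [IsManifold 𝓘(ℂ, EB) ω B] in
omit hX hB hequiv in
/-- The trace of the vertical part of the derivative of the induced field. -/
def vertTrace (v : GroupLieAlgebra 𝓘(ℝ, EK) K) (x : X) (y : EX) : ℂ :=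
  ∑ i, p.vertPart x (fderiv ℂ (fieldRep (p.domChart x) v) y) (Pi.single i 1) i

omit hB hequiv [IsManifold 𝓘(ℂ, EB) ω B] [FiniteDimensional ℂ EB] [MulAction K B] in
theorem differentiableAt_vertTrace (v : GroupLieAlgebra 𝓘(ℝ, EK) K) (x : X) {y : EX}
    (hy : y ∈ (p.domChart x).target) :
    DifferentiableAt ℂ (p.vertTrace v x) y ∧ ContDiffAt ℝ ∞ (p.vertTrace v x) y := by
  have hs := contDiffAt_fieldRep hX (p.domChart_mem x) hy v
  have hd : ∀ᶠ z in 𝓝 y, DifferentiableAt ℂ (fieldRep (p.domChart x) v) z := by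
    filter_upwards [(p.domChart x).open_target.mem_nhds hy] with z hz
    exact differentiableAt_fieldRep hX (p.domChart_mem x) hz v
  let Q : Fin n → EX →L[ℂ] ℂ := fun i => (ContinuousLinearMap.proj i).comp
    ((ContinuousLinearMap.snd ℂ EB (Fin n → ℂ)).comp (p.split x : EX →L[ℂ] EB × (Fin n → ℂ)))
  have e : p.vertTrace v x = fun y => ∑ i, Q i (fderiv ℂ (fieldRep (p.domChart x) v) y
      (p.vert x (Pi.single i 1))) := rfl
  rw [e]
  exact ⟨DifferentiableAt.fun_sum fun i _ =>
    (Q i).differentiableAt.comp y (differentiableAt_fderiv_apply hs hd _),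
    ContDiffAt.sum fun i _ =>
    ((Q i).restrictScalars ℝ).contDiff.contDiffAt.comp y (contDiffAt_fderiv_apply hs hd _)⟩

variable {f : X → ℝ} {v : GroupLieAlgebra 𝓘(ℝ, EK) K}
  (hf : ∀ x, SmFun EX (fun y => (f y : ℂ)) x ∧
    ∀ w, mD EX ℂ (fun y => (f y : ℂ)) x w = η x ![inducedField v x, w])

include hf

theorem fderiv_vertLog_fieldRep (hη : p.IsRelativelyKahler η) (x : X) {y : EX}
    (hy : y ∈ (p.domChart x).target) :
    fderiv ℝ (fun y => p.vertLog η x ((p.domChart x).symm y)) y (fieldRep (p.domChart x) v y) =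
        ((-2 * (p.vertTrace v x y).re : ℝ) : ℂ) ∧
      fderiv ℝ (fun y => p.vertLog η x ((p.domChart x).symm y)) y
          (Complex.I • fieldRep (p.domChart x) v y) - ((2 * (p.vertTrace v x y).im : ℝ) : ℂ) =
        ((4 * Real.pi : ℝ) : ℂ) *
          p.vertLaplacian η (fun y => (f y : ℂ)) ((p.domChart x).symm y) := by
  have hz := (p.domChart x).map_target hy
  have hV0 := p.vertVol_ne_zero hη x hz
  have hs := contDiffAt_fieldRep hX (p.domChart_mem x) hy v
  have hd := differentiableAt_fieldRep hX (p.domChart_mem x) hy v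
  have hT := p.vert_vertPart_fieldRep hX hB hequiv x hy v
  have hR : ∀ w, fderiv ℝ (fieldRep (p.domChart x) v) y w =
      fderiv ℂ (fieldRep (p.domChart x) v) y w := by
    intro w
    rw [hd.fderiv_restrictScalars ℝ]
    rfl
  have e1 : contract (fun z => inducedField v z) η = dF (E := EX) fun y => (f y : ℂ) := by
    funext z
    ext u
    rw [dF_apply, (hf z).2]
    change η z (Matrix.vecCons _ u) = _
    congr 1
    funext i
    fin_cases i <;> rfl
  have e2 : contract (fun z => (Complex.I • inducedField v z : EX)) η = dc fun y => (f y : ℂ) :=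
    funext fun z => contract_I_inducedField hη.type (hf z).2
  have c1 := p.cartan_vertVol hη x (Y := fun z => inducedField v z)
    (g := fieldRep (p.domChart x) v) hy hs
    (fun z hz => cD_fieldRep hX (p.domChart_mem x) hz v)
    (S := p.vertPart x (fderiv ℂ (fieldRep (p.domChart x) v) y)) (fun w => by rw [hR, hT])
  have c2 := p.cartan_vertVol hη x (Y := fun z => (Complex.I • inducedField v z : EX))
    (g := fun y => Complex.I • fieldRep (p.domChart x) v y) hy (hs.const_smul _)
    (fun z hz => by
      rw [cD_J (p.domChart_mem x) hz, cD_fieldRep hX (p.domChart_mem x) hz v])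
    (S := Complex.I • p.vertPart x (fderiv ℂ (fieldRep (p.domChart x) v) y)) (fun w => by
      rw [fderiv_fun_const_smul (hs.differentiableAt (by simp))]
      change Complex.I • fderiv ℝ (fieldRep (p.domChart x) v) y (p.vert x w) =
        p.vert x (Complex.I • p.vertPart x (fderiv ℂ (fieldRep (p.domChart x) v) y) w)
      rw [hR, map_smul, hT])
  rw [e1, dForm_dF (Filter.Eventually.of_forall fun z => (hf z).1)] at c1
  have h0 : wedge (ofDegree 2 (0 : EX [⋀^Fin 2]→L[ℝ] ℂ))
      (wpow (η ((p.domChart x).symm y)) (n - 1)) = 0 := by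
    rw [ofDegree, Pi.single_zero, wedge_zero_left]
  have hdc : dForm (dc fun y => (f y : ℂ)) ((p.domChart x).symm y) =
      (2 : ℝ) • ddbar (E := EX) (fun y => (f y : ℂ)) ((p.domChart x).symm y) := by
    rw [ddbar, smul_smul]
    norm_num
  have hL := p.vertLaplacian_eq hη x hz (hf ((p.domChart x).symm y)).1
  have h2 : altComp (wedge (ofDegree 2 ((2 : ℝ) • ddbar (E := EX) (fun y => (f y : ℂ))
      ((p.domChart x).symm y))) (wpow (η ((p.domChart x).symm y)) (n - 1)))
      (p.vertMap x ((p.domChart x).symm y)) (2 * n) (stdFrame n) =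
      2 * altComp (wedge (ofDegree 2 (ddbar (E := EX) (fun y => (f y : ℂ))
      ((p.domChart x).symm y))) (wpow (η ((p.domChart x).symm y)) (n - 1)))
      (p.vertMap x ((p.domChart x).symm y)) (2 * n) (stdFrame n) := by
    have h3 : ∀ γ : EX [⋀^Fin 2]→L[ℝ] ℂ, ofDegree 2 ((2 : ℝ) • γ) = (2 : ℂ) • ofDegree 2 γ := by
      intro γ
      have h4 : (2 : ℝ) • γ = (2 : ℂ) • γ := by
        ext u
        simp
      rw [h4, ofDegree, Pi.single_smul]
      rfl
    rw [h3, wedge_smul_left]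
    rfl
  rw [e2, hdc, h2] at c2
  rw [h0] at c1
  have htr : ∑ i, (Complex.I • p.vertPart x (fderiv ℂ (fieldRep (p.domChart x) v) y))
      (Pi.single i 1) i = Complex.I * p.vertTrace v x y := by
    rw [vertTrace, Finset.mul_sum]
    rfl
  rw [htr, ← p.fderiv_vertLog hη x hy] at c2
  rw [← p.fderiv_vertLog hη x hy] at c1
  change _ = _ + ((2 * (p.vertTrace v x y).re : ℝ) : ℂ) * _ at c1
  constructor
  · refine mul_right_cancel₀ hV0 ?_
    have c3 : (n : ℂ) * altComp (0 : Alt EX) (p.vertMap x ((p.domChart x).symm y)) (2 * n)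
        (stdFrame n) = 0 := mul_zero _
    rw [c3] at c1
    push_cast at c1 ⊢
    linear_combination -c1
  · refine mul_right_cancel₀ hV0 ?_
    simp only [Complex.mul_re, Complex.I_re, Complex.I_im, zero_mul, one_mul, zero_sub] at c2
    push_cast at c2 hL ⊢
    linear_combination -c2 - 2 * hL

/-- The moment map of the relative curvature. -/
theorem relativeCurvature_inducedField (hη : p.IsRelativelyKahler η) (x : X) :
    SmFun EX (p.vertLaplacian η fun y => (f y : ℂ)) x ∧ ∀ w,
      p.relativeCurvature η x ![inducedField v x, w] =
        -mD EX ℂ (p.vertLaplacian η fun y => (f y : ℂ)) x w := by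
  set c := p.domChart x with hc
  have hx : x ∈ c.source := p.mem_domChart x
  have hcm := p.domChart_mem x
  have hy : c x ∈ c.target := c.map_source hx
  set u : EX → ℂ := fun y => p.vertLog η x (c.symm y) with hu
  set L := p.vertLaplacian η fun y => (f y : ℂ) with hL
  have hus : ContDiffAt ℝ ∞ u (c x) := (smFun_iff hcm hx).1 (p.smFun_vertLog hη x hx)
  have hfs := contDiffAt_fieldRep hX hcm hy v
  have hκ := p.differentiableAt_vertTrace hX v x hy
  have key : (fun y => fderiv ℝ u y (Complex.I • fieldRep c v y) -
      ((2 * (p.vertTrace v x y).im : ℝ) : ℂ)) =ᶠ[𝓝 (c x)]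
      fun y => ((4 * Real.pi : ℝ) : ℂ) * L (c.symm y) := by
    filter_upwards [c.open_target.mem_nhds hy] with y hy
    exact (p.fderiv_vertLog_fieldRep hX hB hequiv hf hη x hy).2
  have hLs : ContDiffAt ℝ ∞ (fun y => L (c.symm y)) (c x) := by
    have h1 : ContDiffAt ℝ ∞ (fun y => fderiv ℝ u y (Complex.I • fieldRep c v y) -
        ((2 * (p.vertTrace v x y).im : ℝ) : ℂ)) (c x) :=
      ((hus.fderiv_right (m := ∞) le_rfl).clm_apply (hfs.const_smul Complex.I)).sub
        (Complex.ofRealCLM.contDiff.contDiffAt.comp (c x)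
          (contDiffAt_const.mul (Complex.imCLM.contDiff.contDiffAt.comp (c x) hκ.2)))
    have h2 := (h1.congr_of_eventuallyEq key.symm).const_smul (((4 * Real.pi : ℝ) : ℂ)⁻¹)
    refine h2.congr_of_eventuallyEq (Filter.Eventually.of_forall fun y => ?_)
    have h4 : ((4 * Real.pi : ℝ) : ℂ) ≠ 0 := by
      exact_mod_cast (by positivity : (4 * Real.pi : ℝ) ≠ 0)
    change _ = ((4 * Real.pi : ℝ) : ℂ)⁻¹ * (((4 * Real.pi : ℝ) : ℂ) * L (c.symm y))
    rw [inv_mul_cancel_left₀ h4]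
  have hLm : SmFun EX L x := (smFun_iff hcm hx).2 hLs
  refine ⟨hLm, fun w => ?_⟩
  have h1 := ddbar_holomorphicField (hus.of_le (by simpa using two_le_infty))
    (differentiableAt_fieldRep hX hcm hy v) hκ.1 (by
      filter_upwards [c.open_target.mem_nhds hy] with y hy
      exact (p.fderiv_vertLog_fieldRep hX hB hequiv hf hη x hy).1) (mD EX EX c x w)
  rw [key.fderiv_eq, fderiv_const_mul (hLs.differentiableAt (by simp))] at h1
  have h2 : pullback (E' := EX) c.symm (ddbar (E := EX) (p.vertLog η x)) (c x) =
      ddbar (E := EX) u (c x) :=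
    pullback_ddbar (E := EX) (F := c.symm) (by
        rw [c.left_inv hx]
        exact p.smFun_vertLog hη x hx)
      (by
        filter_upwards [c.open_target.mem_nhds hy] with y hy
        exact mdifferentiableAt_chart_symm hcm hy)
      (contMDiffAt_chart_symm hcm hy)
  have h3 : ∀ w, cD c (c x) (mD EX EX c x w) = w := fun w => DFunLike.congr_fun (cD_mD hcm hx) w
  have h4 : cD c (c x) (fieldRep c v (c x)) = inducedField v x := by
    rw [cD_fieldRep hX hcm hy, c.left_inv hx]
  have h5 : mD EX ℂ L x w = fderiv ℝ (fun y => L (c.symm y)) (c x) (mD EX EX c x w) := by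
    have h6 : (fun y => L y) =ᶠ[𝓝 x] fun y => (fun z => L (c.symm z)) (c y) := by
      filter_upwards [c.open_source.mem_nhds hx] with y hy
      rw [c.left_inv hy]
    have h7 := mD_comp (E'' := ℂ) (g := fun z => L (c.symm z)) (f := c)
      (hLs.differentiableAt (by simp)).mdifferentiableAt
      ((contMDiffAt_chart hcm hx).mdifferentiableAt (by simp))
    rw [mD_eq_fderiv] at h7
    exact DFunLike.congr_fun ((mD_congr h6).trans h7) w
  have h8 : ddbar (p.vertLog η x) x ![inducedField v x, w] =
      ddbar (E := EX) u (c x) ![fieldRep c v (c x), mD EX EX c x w] := by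
    rw [← h2, pullback_apply, c.left_inv hx]
    congr 1
    funext i
    fin_cases i
    · exact h4.symm
    · exact (h3 w).symm
  rw [p.relativeCurvature_eq, h5]
  change (-(1 / (2 * Real.pi)) : ℝ) • ddbar (p.vertLog η x) x ![inducedField v x, w] = _
  rw [h8, h1]
  change (-(1 / (2 * Real.pi)) : ℝ) • (1 / 2 : ℝ) • (((4 * Real.pi : ℝ) : ℂ) * _) = _
  rw [Complex.real_smul, Complex.real_smul]
  have hpi : (Real.pi : ℂ) ≠ 0 := by exact_mod_cast Real.pi_ne_zero
  push_cast
  field_simp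
  norm_num

end Family

section AltSums

variable {E E' ι : Type*} [NormedAddCommGroup E] [NormedSpace ℂ E]
  [NormedAddCommGroup E'] [NormedSpace ℂ E'] (s : Finset ι) (α : ι → Alt E)

theorem altComp_sum (A : E' →L[ℝ] E) : altComp (∑ i ∈ s, α i) A = ∑ i ∈ s, altComp (α i) A := by
  funext k
  ext u
  simp [altComp, Finset.sum_apply]

theorem altComp_smul (a : ℂ) (β : Alt E) (A : E' →L[ℝ] E) :
    altComp (a • β) A = a • altComp β A := rfl

theorem iota_sum (x : E) : iota x (∑ i ∈ s, α i) = ∑ i ∈ s, iota x (α i) := by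
  classical
  induction s using Finset.induction_on with
  | empty => simp [iota_zero]
  | insert i s hi ih => rw [Finset.sum_insert hi, Finset.sum_insert hi, iota_add, ih]

end AltSums

section FibreMoment

variable {n : ℕ} {M : Type*} [TopologicalSpace M] [ChartedSpace (Fin n → ℂ) M]

theorem SmFun.mul {E N : Type*} [NormedAddCommGroup E] [NormedSpace ℂ E] [TopologicalSpace N]
    [ChartedSpace E N] {f g : N → ℂ} {x : N} (hf : SmFun E f x) (hg : SmFun E g x) :
    SmFun E (fun y => f y * g y) x :=
  ContDiff.comp_contMDiffAt (g := fun q : ℂ × ℂ => q.1 * q.2) contDiff_mul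
    (ContMDiffAt.prodMk_space hf hg)

theorem smFun_const {E N : Type*} [NormedAddCommGroup E] [NormedSpace ℂ E] [TopologicalSpace N]
    [ChartedSpace E N] (a : ℂ) (x : N) : SmFun E (fun _ : N => a) x := contMDiffAt_const

theorem ddbar_const {E N : Type*} [NormedAddCommGroup E] [NormedSpace ℂ E]
    [FiniteDimensional ℂ E] [TopologicalSpace N] [ChartedSpace E N] [IsManifold 𝓘(ℂ, E) ω N] (a : ℂ) (x : N) : ddbar (E := E) (fun _ : N => a) x = 0 := by
  have h : dc (E := E) (fun _ : N => a) = fun _ => 0 := by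
    funext x
    ext u
    have h1 : mD E ℂ (fun _ : N => a) x = 0 := mfderiv_const
    rw [dc_apply, h1]
    simp
  rw [ddbar, h, dForm_zero, smul_zero]

theorem laplacian_const [IsManifold 𝓘(ℂ, Fin n → ℂ) ω M]
    (η : M → (Fin n → ℂ) [⋀^Fin 2]→L[ℝ] ℂ) (a : ℂ) (x : M) :
    laplacian η (fun _ => a) x = 0 := by
  rw [laplacian, ddbar_const, ofDegree, Pi.single_zero, wedge_zero_left, topRatio]
  simp

variable [IsManifold 𝓘(ℂ, Fin n → ℂ) ω M]

theorem smFun_topRatio {α β : M → Alt (Fin n → ℂ)} {x : M} (hα : SmoothAltAt α x)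
    (hβ : SmoothAltAt β x) (h0 : β x (2 * n) (stdFrame n) ≠ 0) :
    SmFun (Fin n → ℂ) (fun y => topRatio (α y) (β y)) x := by
  have hcm := chartAt_mem (E := Fin n → ℂ) x
  set c := chartAt (Fin n → ℂ) x with hc
  have hx : x ∈ c.source := mem_chart_source _ x
  refine (smFun_iff hcm hx).2 ?_
  have e : (fun y => topRatio (α (c.symm y)) (β (c.symm y))) =ᶠ[𝓝 (c x)]
      fun y => coordAlt c α y (2 * n) (stdFrame n) * (coordAlt c β y (2 * n) (stdFrame n))⁻¹ := by
    filter_upwards [c.open_target.mem_nhds (c.map_source hx)] with y hy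
    exact (topRatio_altComp (cD c y) (det_cD_ne_zero hcm hy)).symm
  refine ContDiffAt.congr_of_eventuallyEq ?_ e
  have h1 : ∀ {α : M → Alt (Fin n → ℂ)}, SmoothAltAt α x →
      ContDiffAt ℝ ∞ (fun y => coordAlt c α y (2 * n) (stdFrame n)) (c x) := fun h =>
    contDiffAt_alt_iff.1 (h (2 * n)) _
  refine (h1 hα).mul ((h1 hβ).inv ?_)
  rwa [hc, coordAlt_chartAt]

variable {Z : CentralCharge n} {ε : ℝ} {η : M → (Fin n → ℂ) [⋀^Fin 2]→L[ℝ] ℂ}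
  {θ : M → Alt (Fin n → ℂ)} (hη : ∀ x, SmoothAt η x) (hρ : ∀ x, SmoothAt (ricciForm η) x)
  (hθ : ∀ x, SmoothAltAt θ x) (h0 : ∀ x, wpow (η x) n (2 * n) (stdFrame n) ≠ 0)

include hη h0

theorem smFun_laplacian {f : M → ℂ} (hf : ∀ x, SmFun (Fin n → ℂ) f x) (x : M) :
    SmFun (Fin n → ℂ) (laplacian η f) x :=
  SmFun.mul (smFun_const _ _) (smFun_topRatio ((smoothAltAt_ofDegree (smoothAt_ddbar
    (Filter.Eventually.of_forall hf))).wedge (SmoothAltAt.wpow (hη x) _))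
    (SmoothAltAt.wpow (hη x) _) (h0 x))

include hρ hθ

theorem smFun_chernRatio (l j : ℕ) (x : M) : SmFun (Fin n → ℂ) (fun x =>
    topRatio (powWedge (η x) (ricciForm η x) (θ x) l j) (wpow (η x) n)) x :=
  smFun_topRatio (SmoothAltAt.powWedge (hη x) (hρ x) (hθ x) l j) (SmoothAltAt.wpow (hη x) n) (h0 x)

theorem smFun_zFunction (x : M) : SmFun (Fin n → ℂ) (zFunction Z ε η θ) x :=
  ContMDiffAt.sum fun l _ => ContMDiffAt.sum fun j _ => SmFun.mul (smFun_const _ _)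
    ((smFun_chernRatio hη hρ hθ h0 l j x).sub (SmFun.mul (smFun_const _ _)
      (smFun_laplacian hη h0 (smFun_chernRatio hη hρ hθ h0 (l + 1) (j - 1)) x)))

theorem smoothAt_zFunction_smul {f : M → ℂ} (hf : ∀ x, SmFun (Fin n → ℂ) f x) (x : M) :
    SmoothAt (fun x => (f x * zFunction Z ε η θ x) • wpow (η x) n (2 * n)) x :=
  SmoothAt.fun_smul (SmFun.mul (hf x) (smFun_zFunction hη hρ hθ h0 x)) (SmoothAltAt.wpow (hη x) n _)

variable [T2Space M] [CompactSpace M]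

theorem integral_mul_zFunction (hd : ∀ x, dForm η x = 0)
    (hJ : ∀ x, (η x).compContinuousLinearMap J = η x) {f : M → ℂ}
    (hf : ∀ x, SmFun (Fin n → ℂ) f x) :
    integral (fun x => (f x * zFunction Z ε η θ x) • wpow (η x) n (2 * n)) =
      integral (fun x => (∑ l ∈ Finset.range (n + 1), ∑ j ∈ Finset.range (n + 1), Z.coeff ε l j •
        (f x • powWedge (η x) (ricciForm η x) (θ x) l j +
          (-(j / (l + 1) : ℂ)) • laplacian η f x •
            powWedge (η x) (ricciForm η x) (θ x) (l + 1) (j - 1))) (2 * n)) := by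
  set P : ℕ → ℕ → M → Alt (Fin n → ℂ) := fun l j x => powWedge (η x) (ricciForm η x) (θ x) l j
    with hP
  set T : ℕ → ℕ → M → ℂ := fun l j x => topRatio (P l j x) (wpow (η x) n) with hT
  have hTs : ∀ l j x, SmFun (Fin n → ℂ) (T l j) x := smFun_chernRatio hη hρ hθ h0
  have hPs : ∀ l j x, SmoothAltAt (P l j) x := fun l j x =>
    SmoothAltAt.powWedge (hη x) (hρ x) (hθ x) l j
  have hTP : ∀ l j x, T l j x • wpow (η x) n (2 * n) = P l j x (2 * n) := fun l j x =>
    topRatio_smul (h0 x)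
  have hWs : ∀ x, SmoothAt (fun x => wpow (η x) n (2 * n)) x := fun x =>
    SmoothAltAt.wpow (hη x) n _
  have hLs : ∀ l j x, SmFun (Fin n → ℂ) (laplacian η (T l j)) x := fun l j =>
    smFun_laplacian hη h0 (hTs l j)
  have hLf := smFun_laplacian hη h0 hf
  have key : ∀ l j, integral (fun x => Z.coeff ε l j • (f x • P l j x (2 * n) +
        (-(j / (l + 1) : ℂ)) • f x • laplacian η (T (l + 1) (j - 1)) x • wpow (η x) n (2 * n))) =
      integral (fun x => Z.coeff ε l j • (f x • P l j x (2 * n) +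
        (-(j / (l + 1) : ℂ)) • laplacian η f x • P (l + 1) (j - 1) x (2 * n))) := by
    intro l j
    have s1 : ∀ x, SmoothAt (fun x => f x • P l j x (2 * n)) x := fun x =>
      SmoothAt.fun_smul (hf x) (hPs l j x _)
    have s2 : ∀ x, SmoothAt (fun x => (-(j / (l + 1) : ℂ)) • f x •
        laplacian η (T (l + 1) (j - 1)) x • wpow (η x) n (2 * n)) x := fun x =>
      SmoothAt.fun_smul (smFun_const _ _) (SmoothAt.fun_smul (hf x) (SmoothAt.fun_smul (hLs _ _ x) (hWs x)))
    have s3 : ∀ x, SmoothAt (fun x => (-(j / (l + 1) : ℂ)) • laplacian η f x •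
        P (l + 1) (j - 1) x (2 * n)) x := fun x =>
      SmoothAt.fun_smul (smFun_const _ _) (SmoothAt.fun_smul (hLf x) (hPs _ _ x _))
    rw [integral_const_smul, integral_const_smul, integral_add s1 s2, integral_add s1 s3,
      integral_const_smul, integral_const_smul,
      integral_laplacian_comm hη hd hJ h0 (hTs (l + 1) (j - 1)) hf]
    congr 3
    refine integral_congr_form fun x => ?_
    rw [smul_comm, hTP]
  have t1 : ∀ l j x, SmoothAt (fun x => Z.coeff ε l j • (f x • P l j x (2 * n) +
        (-(j / (l + 1) : ℂ)) • f x • laplacian η (T (l + 1) (j - 1)) x • wpow (η x) n (2 * n))) x :=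
    fun l j x => SmoothAt.fun_smul (smFun_const _ _) (SmoothAt.add (SmoothAt.fun_smul (hf x) (hPs l j x _))
      (SmoothAt.fun_smul (smFun_const _ _) (SmoothAt.fun_smul (hf x) (SmoothAt.fun_smul (hLs _ _ x) (hWs x)))))
  have t2 : ∀ l j x, SmoothAt (fun x => Z.coeff ε l j • (f x • P l j x (2 * n) +
        (-(j / (l + 1) : ℂ)) • laplacian η f x • P (l + 1) (j - 1) x (2 * n))) x :=
    fun l j x => SmoothAt.fun_smul (smFun_const _ _) (SmoothAt.add (SmoothAt.fun_smul (hf x) (hPs l j x _))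
      (SmoothAt.fun_smul (smFun_const _ _) (SmoothAt.fun_smul (hLf x) (hPs _ _ x _))))
  have e1 : ∀ x, (f x * zFunction Z ε η θ x) • wpow (η x) n (2 * n) =
      ∑ l ∈ Finset.range (n + 1), ∑ j ∈ Finset.range (n + 1), Z.coeff ε l j •
        (f x • P l j x (2 * n) + (-(j / (l + 1) : ℂ)) • f x •
          laplacian η (T (l + 1) (j - 1)) x • wpow (η x) n (2 * n)) := by
    intro x
    simp only [zFunction, Finset.mul_sum, Finset.sum_smul]
    refine Finset.sum_congr rfl fun l _ => Finset.sum_congr rfl fun j _ => ?_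
    rw [← hTP]
    simp only [smul_smul, ← add_smul, hT, hP]
    congr 1
    ring
  have e2 : ∀ x, (∑ l ∈ Finset.range (n + 1), ∑ j ∈ Finset.range (n + 1), Z.coeff ε l j •
        (f x • P l j x + (-(j / (l + 1) : ℂ)) • laplacian η f x • P (l + 1) (j - 1) x)) (2 * n) =
      ∑ l ∈ Finset.range (n + 1), ∑ j ∈ Finset.range (n + 1), Z.coeff ε l j •
        (f x • P l j x (2 * n) + (-(j / (l + 1) : ℂ)) • laplacian η f x •
          P (l + 1) (j - 1) x (2 * n)) := by
    intro x
    simp only [Finset.sum_apply]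
    rfl
  rw [integral_congr_form e1, integral_congr_form e2, integral_sum _ fun l _ x =>
    smoothAt_sum _ fun j _ => t1 l j x, integral_sum _ fun l _ x => smoothAt_sum _ fun j _ => t2 l j x]
  refine Finset.sum_congr rfl fun l _ => ?_
  rw [integral_sum _ fun j _ x => t1 l j x, integral_sum _ fun j _ x => t2 l j x]
  exact Finset.sum_congr rfl fun j _ => key l j

theorem integral_zFunction (hd : ∀ x, dForm η x = 0)
    (hJ : ∀ x, (η x).compContinuousLinearMap J = η x) :
    integral (fun x => zFunction Z ε η θ x • wpow (η x) n (2 * n)) = centralCharge Z ε η θ := by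
  have h := integral_mul_zFunction (Z := Z) (ε := ε) hη hρ hθ h0 hd hJ (f := fun _ => 1)
    (smFun_const 1)
  simp only [one_mul, one_smul, laplacian_const, zero_smul, smul_zero, add_zero] at h
  rw [h, centralCharge]
  have e : ∀ x, (∑ l ∈ Finset.range (n + 1), ∑ j ∈ Finset.range (n + 1), Z.coeff ε l j •
      powWedge (η x) (ricciForm η x) (θ x) l j) (2 * n) =
      ∑ l ∈ Finset.range (n + 1), ∑ j ∈ Finset.range (n + 1), Z.coeff ε l j •
        powWedge (η x) (ricciForm η x) (θ x) l j (2 * n) := by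
    intro x
    simp only [Finset.sum_apply]
    rfl
  have t : ∀ l j x, SmoothAt (fun x => Z.coeff ε l j •
      powWedge (η x) (ricciForm η x) (θ x) l j (2 * n)) x := fun l j x =>
    SmoothAt.fun_smul (smFun_const _ _) (SmoothAltAt.powWedge (hη x) (hρ x) (hθ x) l j _)
  rw [integral_congr_form e, integral_sum _ fun l _ x => smoothAt_sum _ fun j _ => t l j x]
  refine Finset.sum_congr rfl fun l _ => ?_
  rw [integral_sum _ fun j _ x => t l j x]
  exact Finset.sum_congr rfl fun j _ => integral_const_smul _ _

end FibreMoment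

namespace Family

variable {n : ℕ} {EX EB X B : Type*} [NormedAddCommGroup EX] [NormedSpace ℂ EX]
  [FiniteDimensional ℂ EX] [NormedAddCommGroup EB] [NormedSpace ℂ EB] [FiniteDimensional ℂ EB]
  [TopologicalSpace X] [ChartedSpace EX X] [TopologicalSpace B] [ChartedSpace EB B]
  (p : Family n EX EB X B) {η : X → EX [⋀^Fin 2]→L[ℝ] ℂ} {θ : X → Alt EX}
  [IsManifold 𝓘(ℂ, EX) ω X] [IsManifold 𝓘(ℂ, EB) ω B]

theorem vertMap_eq_incl {b : B} (x : p.Fiber b) : p.vertMap x.1 x.1 =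
    (mD (Fin n → ℂ) EX (p.incl b) x).comp
      (cD (p.fibreChart x.1 (p.mem_codChart x)) (p.fibreChart x.1 (p.mem_codChart x) x)) := by
  have hx : x ∈ (p.fibreChart x.1 (p.mem_codChart x)).source := p.mem_domChart x.1
  have h := p.mD_incl_cD x.1 (p.mem_codChart x) ((p.fibreChart x.1 (p.mem_codChart x)).map_source hx)
  rw [(p.fibreChart x.1 (p.mem_codChart x)).left_inv hx] at h
  have h2 : p.liftAt x.1 b (p.fibreChart x.1 (p.mem_codChart x) x) = p.domChart x.1 x.1 :=
    p.liftAt_split (p.mem_domChart x.1) x.2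
  rw [h, h2]
  rfl

theorem exists_mD_incl {b : B} (x : p.Fiber b) {w : EX} (hw : mD EX EB p.proj x.1 w = 0) :
    ∃ s, mD (Fin n → ℂ) EX (p.incl b) x s = w := by
  obtain ⟨w', h⟩ := p.eq_cD_vert x.1 (p.mem_domChart x.1) hw
  exact ⟨_, (DFunLike.congr_fun (p.vertMap_eq_incl x) w').symm.trans h.symm⟩

theorem mD_proj_tangentLift (x : X) (u : EB) : mD EX EB p.proj x (p.tangentLift x u) = u := by
  have h : ∃ w : EX, mD EX EB p.proj x w = u := by
    have hx := p.mem_domChart x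
    have hy := (p.domChart x).map_source hx
    have h1 := p.mD_proj_cD x hy
      ((p.split x).symm (mD EB EB (p.codChart x) (p.proj x) u, 0))
    rw [(p.domChart x).left_inv hx, ContinuousLinearEquiv.apply_symm_apply] at h1
    have h2 := fun w => DFunLike.congr_fun (cD_mD (p.codChart_mem x) (p.proj_mem x hx)) w
    exact ⟨_, (h2 _).symm.trans ((congrArg
      (cD (p.codChart x) (p.codChart x (p.proj x))) h1).trans (h2 u))⟩
  exact Classical.epsilon_spec h

section Fibre

variable (hη : p.IsRelativelyKahler η) (hθ : ∀ x, SmoothAltAt θ x) {b : B}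

include hη in
theorem smoothAt_restrict_metric (x : p.Fiber b) : SmoothAt (p.restrict b η) x :=
  p.smoothAt_restrict (smoothForm_iff.1 hη.smooth x.1)

include hη in
theorem smoothAt_ricci_restrict (x : p.Fiber b) : SmoothAt (ricciForm (p.restrict b η)) x := by
  rw [← p.restrict_relativeCurvature hη b]
  exact p.smoothAt_restrict (p.smoothAt_relativeCurvature hη x.1)

include hθ in
theorem smoothAltAt_restrictAlt (x : p.Fiber b) : SmoothAltAt (p.restrictAlt b θ) x := fun k =>
  p.smoothAt_restrict (hθ x.1 k)

include hη in
theorem dForm_restrict_metric (x : p.Fiber b) : dForm (p.restrict b η) x = 0 := by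
  refine (dForm_pullback (p.contMDiffAt_incl_real x) (smoothForm_iff.1 hη.smooth x.1)).trans ?_
  ext u
  rw [pullback_apply]
  exact congrArg (fun γ : EX [⋀^Fin 3]→L[ℝ] ℂ => γ _) (hη.closed x.1)

include hη in
theorem restrict_metric_J (x : p.Fiber b) :
    (p.restrict b η x).compContinuousLinearMap J = p.restrict b η x := by
  ext u
  refine Eq.trans ?_ (BalancedType.apply_I hη.type x.1 _)
  change η x.1 (fun i => mD (Fin n → ℂ) EX (p.incl b) x (Complex.I • u i)) = _
  congr 1
  funext i
  exact mD_J ((p.contMDiff_incl b x).mdifferentiableAt (by simp)) (u i)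

include hη in
theorem wpow_restrict_ne_zero (x : p.Fiber b) :
    wpow (p.restrict b η x) n (2 * n) (stdFrame n) ≠ 0 := by
  intro h0
  refine p.vertVol_ne_zero hη x.1 (p.mem_domChart x.1) ?_
  have h1 : p.vertVol η x.1 x.1 = altComp (altComp (wpow (η x.1) n)
      (mD (Fin n → ℂ) EX (p.incl b) x)) (cD (p.fibreChart x.1 (p.mem_codChart x))
        (p.fibreChart x.1 (p.mem_codChart x) x)) (2 * n) (stdFrame n) := by
    rw [altComp_comp, ← p.vertMap_eq_incl]
    rfl
  rw [h1, altComp_wpow]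
  have h2 := top_eq_zero (α := wpow (p.restrict b η x) n (2 * n)) h0
  change wpow (p.restrict b η x) n (2 * n) _ = 0
  rw [h2]
  rfl

end Fibre

/-- A primitive of the contraction of `zForm` with an induced field that has moment functions `f`
with respect to the metric and `-L` with respect to the relative curvature. -/
def momentPrimitive (Z : CentralCharge n) (ε : ℝ) (η : X → EX [⋀^Fin 2]→L[ℝ] ℂ) (θ : X → Alt EX)
    (f L : X → ℂ) : X → Alt EX := fun x =>
  ∑ l ∈ Finset.range (n + 1), ∑ j ∈ Finset.range (n + 1), Z.coeff ε l j •
    (f x • powWedge (η x) (p.relativeCurvature η x) (θ x) l j +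
      (-(j / (l + 1) : ℂ)) • L x •
        powWedge (η x) (p.relativeCurvature η x) (θ x) (l + 1) (j - 1))

variable {Z : CentralCharge n} {ε : ℝ} (hη : p.IsRelativelyKahler η)
  (hθ : ∀ x, SmoothAltAt θ x) {f L : X → ℂ} (hf : ∀ x, SmFun EX f x) (hL : ∀ x, SmFun EX L x)

include hη hθ hf

section

include hL

theorem smoothAltAt_momentPrimitive (x : X) :
    SmoothAltAt (p.momentPrimitive Z ε η θ f L) x := by
  have hP := fun l j => SmoothAltAt.powWedge (smoothForm_iff.1 hη.smooth x)
    (p.smoothAt_relativeCurvature hη x) (hθ x) l j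
  exact SmoothAltAt.sum _ fun l _ => SmoothAltAt.sum _ fun j _ =>
    ((SmoothAltAt.fun_smul (hf x) (hP l j)).add
      ((SmoothAltAt.fun_smul (hL x) (hP (l + 1) (j - 1))).const_smul _)).const_smul _

theorem dA_momentPrimitive (hθd : ∀ x, dA θ x = 0) {x ξ : _}
    (hfξ : dF (E := EX) f x = (η x).curryLeft ξ)
    (hLξ : dF (E := EX) L x = -(p.relativeCurvature η x).curryLeft ξ) (hξ : iota ξ (θ x) = 0) :
    dA (p.momentPrimitive Z ε η θ f L) x = iota ξ (p.zForm Z ε η θ x) := by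
  have hP := fun l j => SmoothAltAt.powWedge (smoothForm_iff.1 hη.smooth x)
    (p.smoothAt_relativeCurvature hη x) (hθ x) l j
  have hdP := fun l j => dA_powWedge (smoothForm_iff.1 hη.smooth x)
    (p.smoothAt_relativeCurvature hη x) (hθ x) (hη.closed x) (p.dForm_relativeCurvature hη x)
    (hθd x) l j
  have h1 := fun l j => SmoothAltAt.fun_smul (hf x) (hP l j)
  have h2 := fun (l j : ℕ) => (SmoothAltAt.fun_smul (hL x) (hP (l + 1) (j - 1))).const_smul
    (-(j / (l + 1) : ℂ))
  have h3 := fun l j => ((h1 l j).add (h2 l j)).const_smul (Z.coeff ε l j)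
  have e : p.momentPrimitive Z ε η θ f L = fun x => ∑ l ∈ Finset.range (n + 1),
    ∑ j ∈ Finset.range (n + 1), Z.coeff ε l j •
    (f x • powWedge (η x) (p.relativeCurvature η x) (θ x) l j +
      (-(j / (l + 1) : ℂ)) • L x •
        powWedge (η x) (p.relativeCurvature η x) (θ x) (l + 1) (j - 1)) := rfl
  rw [e, dA_sum _ fun l _ => SmoothAltAt.sum _ fun j _ => h3 l j, zForm, iota_sum]
  refine Finset.sum_congr rfl fun l _ => ?_
  rw [dA_sum _ fun j _ => h3 l j, iota_sum]
  refine Finset.sum_congr rfl fun j _ => ?_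
  rw [dA_const_smul ((h1 l j).add (h2 l j)), dA_add (h1 l j) (h2 l j),
    dA_const_smul (SmoothAltAt.fun_smul (hL x) (hP (l + 1) (j - 1))),
    dA_fun_smul (hf x) (hP l j), dA_fun_smul (hL x) (hP (l + 1) (j - 1)), hdP, hdP, smul_zero,
    smul_zero, add_zero, add_zero, hfξ, hLξ, iota_smul, iota_powWedge _ _ _ _ hξ]
  have h4 : ofDegree 1 (-(p.relativeCurvature η x).curryLeft ξ) =
      -ofDegree 1 ((p.relativeCurvature η x).curryLeft ξ) := Pi.single_neg _ _
  have h5 : (l : ℂ) + 1 ≠ 0 := by exact_mod_cast Nat.succ_ne_zero l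
  rw [h4, wedge_neg_left, Nat.add_sub_cancel]
  simp only [smul_add, smul_neg, neg_smul, neg_neg, smul_smul]
  push_cast
  congr 2
  · field_simp
  · ring

end

/-- The integral of `f Z̃_ε ωⁿ` over a fibre. -/
def fibreMoment [T2Space X] (Z : CentralCharge n) (ε : ℝ) (η : X → EX [⋀^Fin 2]→L[ℝ] ℂ)
    (θ : X → Alt EX) (f : X → ℂ) (b : B) : ℂ :=
  integral fun x : p.Fiber b => (f x.1 * zFunction Z ε (p.restrict b η) (p.restrictAlt b θ) x) •
    wpow (p.restrict b η x) n (2 * n)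

variable [T2Space X]

omit hη hθ in
theorem smFun_comp_val {b : B} (x : p.Fiber b) :
    SmFun (Fin n → ℂ) (fun y : p.Fiber b => f y.1) x :=
  ContMDiffAt.comp (g := f) (f := p.incl b) x (hf x.1) (p.contMDiffAt_incl_real x)

theorem smoothAt_fibreMoment {b : B} (x : p.Fiber b) : SmoothAt (fun x : p.Fiber b =>
    (f x.1 * zFunction Z ε (p.restrict b η) (p.restrictAlt b θ) x) •
      wpow (p.restrict b η x) n (2 * n)) x :=
  smoothAt_zFunction_smul (p.smoothAt_restrict_metric hη) (p.smoothAt_ricci_restrict hη)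
    (p.smoothAltAt_restrictAlt hθ) (p.wpow_restrict_ne_zero hη) (p.smFun_comp_val hf) x

theorem fibreMoment_eq (b : B) : p.fibreMoment Z ε η θ f b = integral (p.restrict b fun x =>
    p.momentPrimitive Z ε η θ f (p.vertLaplacian η f) x (2 * n)) := by
  refine (integral_mul_zFunction (p.smoothAt_restrict_metric hη) (p.smoothAt_ricci_restrict hη)
    (p.smoothAltAt_restrictAlt hθ) (p.wpow_restrict_ne_zero hη) (p.dForm_restrict_metric hη)
    (p.restrict_metric_J hη) (p.smFun_comp_val hf)).trans (integral_congr_form fun x => ?_)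
  rw [← p.restrict_relativeCurvature hη b]
  change _ = altComp (p.momentPrimitive Z ε η θ f (p.vertLaplacian η f) x.1)
    (mD (Fin n → ℂ) EX (p.incl b) x) (2 * n)
  have hx : p.vertLaplacian η f x.1 = laplacian (p.restrict b η) (fun y => f y.1) x := by
    obtain ⟨z, rfl⟩ := x
    rfl
  have hP : ∀ l j, powWedge (p.restrict b η x) (p.restrict b (p.relativeCurvature η) x)
      (p.restrictAlt b θ x) l j = altComp (powWedge (η x.1) (p.relativeCurvature η x.1) (θ x.1) l j)
        (mD (Fin n → ℂ) EX (p.incl b) x) := by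
    intro l j
    rw [altComp_powWedge]
    rfl
  rw [momentPrimitive, altComp_sum]
  refine congrFun (Finset.sum_congr rfl fun l _ => ?_) _
  rw [altComp_sum]
  refine Finset.sum_congr rfl fun j _ => ?_
  rw [hP, hP, altComp_smul, altComp_add, altComp_smul, altComp_smul, altComp_smul, hx]

omit hf in
theorem momentPairing_eq {h : X → ℝ} (φ : ℝ) (hh : ∀ x, SmFun EX (fun y => (h y : ℂ)) x) (b : B) :
    p.momentPairing Z ε φ η θ h b = -(1 / 2) *
      (Complex.exp (-(Complex.I * φ)) * p.fibreMoment Z ε η θ (fun y => (h y : ℂ)) b).im := by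
  have h1 := integral_postcomp (Complex.ofRealCLM.comp (Complex.imCLM.comp
    (ContinuousLinearMap.mul ℝ ℂ (Complex.exp (-(Complex.I * φ))))))
    (p.smoothAt_fibreMoment (Z := Z) (ε := ε) hη hθ hh (b := b))
    (ζ := fun x : p.Fiber b => ((h x.1 * (Complex.exp (-(Complex.I * φ)) *
      zFunction Z ε (p.restrict b η) (p.restrictAlt b θ) x).im : ℝ) : ℂ) •
        wpow (p.restrict b η x) n (2 * n)) (fun x u => by
      have h2 := wpow_real (α := p.restrict b η x) (fun u => hη.real x.1 _) n (2 * n) u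
      have h3 : wpow (p.restrict b η x) n (2 * n) u =
          ((wpow (p.restrict b η x) n (2 * n) u).re : ℂ) := Complex.ext rfl (by simp [h2])
      change _ * wpow (p.restrict b η x) n (2 * n) u = ((Complex.exp (-(Complex.I * φ)) *
        (((h x.1 : ℂ) * zFunction Z ε (p.restrict b η) (p.restrictAlt b θ) x) *
          wpow (p.restrict b η x) n (2 * n) u)).im : ℂ)
      rw [h3]
      generalize (wpow (p.restrict b η x) n (2 * n) u).re = r
      rw [← Complex.ofReal_mul, show Complex.exp (-(Complex.I * φ)) *
        (((h x.1 : ℂ) * zFunction Z ε (p.restrict b η) (p.restrictAlt b θ) x) * (r : ℂ)) =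
        ((h x.1 * r : ℝ) : ℂ) * (Complex.exp (-(Complex.I * φ)) *
          zFunction Z ε (p.restrict b η) (p.restrictAlt b θ) x) by push_cast; ring,
        Complex.im_ofReal_mul]
      congr 1
      ring)
  rw [momentPairing, h1]
  rfl

theorem fibreMoment_add {g : X → ℂ} (hg : ∀ x, SmFun EX g x) (b : B) :
    p.fibreMoment Z ε η θ (fun x => f x + g x) b =
      p.fibreMoment Z ε η θ f b + p.fibreMoment Z ε η θ g b := by
  rw [fibreMoment, fibreMoment, fibreMoment,
    ← integral_add (p.smoothAt_fibreMoment hη hθ hf) (p.smoothAt_fibreMoment hη hθ hg)]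
  refine integral_congr_form fun x => ?_
  rw [add_mul, add_smul]

omit hη hθ hf in
theorem fibreMoment_congr {f g : X → ℂ} {b : B} (h : ∀ x : p.Fiber b, f x.1 = g x.1) :
    p.fibreMoment Z ε η θ f b = p.fibreMoment Z ε η θ g b :=
  integral_congr_form fun x => by rw [h]

omit hη hθ hf in
theorem fibreMoment_const_mul (f : X → ℂ) (a : ℂ) (b : B) :
    p.fibreMoment Z ε η θ (fun x => a * f x) b = a * p.fibreMoment Z ε η θ f b := by
  rw [fibreMoment, fibreMoment, ← integral_const_smul]
  refine integral_congr_form fun x => ?_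
  rw [smul_smul, mul_assoc]

omit hf in
theorem fibreMoment_one (b : B) :
    p.fibreMoment Z ε η θ (fun _ => 1) b = p.fibreCharge Z ε η θ b := by
  refine Eq.trans (integral_congr_form fun x => ?_) (integral_zFunction
    (p.smoothAt_restrict_metric hη) (p.smoothAt_ricci_restrict hη)
    (p.smoothAltAt_restrictAlt hθ) (p.wpow_restrict_ne_zero hη) (p.dForm_restrict_metric hη)
    (p.restrict_metric_J hη))
  rw [one_mul]

end Family

namespace Family

variable {n : ℕ} {EX EB X B : Type*} [NormedAddCommGroup EX] [NormedSpace ℂ EX]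
  [FiniteDimensional ℂ EX] [NormedAddCommGroup EB] [NormedSpace ℂ EB] [FiniteDimensional ℂ EB]
  [TopologicalSpace X] [ChartedSpace EX X] [TopologicalSpace B] [ChartedSpace EB B]
  (p : Family n EX EB X B) {η : X → EX [⋀^Fin 2]→L[ℝ] ℂ} {θ : X → Alt EX}
  [IsManifold 𝓘(ℂ, EX) ω X] [IsManifold 𝓘(ℂ, EB) ω B]
  [T2Space X] [T2Space B] [SecondCountableTopology X]
  {Z : CentralCharge n} {ε : ℝ} (hη : p.IsRelativelyKahler η)
  (hθ : ∀ x, SmoothAltAt θ x) (hθd : ∀ x, dA θ x = 0)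

include hη hθ hθd

/-- The derivative of the fibre integral of `f Z̃_ε ωⁿ`. -/
theorem fibreMoment_deriv {f : X → ℂ} (hf : ∀ x, SmFun EX f x)
    (hL : ∀ x, SmFun EX (p.vertLaplacian η f) x) {ξ : X → EX} {b : B} {ξB : EB}
    (hξB : ∀ x : p.Fiber b, mD EX EB p.proj x.1 (ξ x.1) = ξB)
    (hfξ : ∀ x, dF (E := EX) f x = (η x).curryLeft (ξ x))
    (hLξ : ∀ x, dF (E := EX) (p.vertLaplacian η f) x =
      -(p.relativeCurvature η x).curryLeft (ξ x)) (hξ : ∀ x, iota (ξ x) (θ x) = 0) :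
    SmFun EB (p.fibreMoment Z ε η θ f) b ∧ ∀ u, mD EB ℂ (p.fibreMoment Z ε η θ f) b u =
      p.fibreIntegral (p.zForm Z ε η θ) b ξB u := by
  have h := p.fibre_integration (Ψ := fun x =>
    p.momentPrimitive Z ε η θ f (p.vertLaplacian η f) x (2 * n))
    (fun x => p.smoothAltAt_momentPrimitive hη hθ hf hL x _) b
  rw [← funext (p.fibreMoment_eq hη hθ hf)] at h
  refine ⟨h.1, fun u => ?_⟩
  rw [h.2 u (fun x => p.tangentLift x.1 u) fun x => p.mD_proj_tangentLift x.1 u]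
  refine integral_congr_form fun x => ?_
  ext t
  have h1 : dForm (fun x => p.momentPrimitive Z ε η θ f (p.vertLaplacian η f) x (2 * n)) x.1 =
      iota (ξ x.1) (p.zForm Z ε η θ x.1) (2 * n + 1) :=
    congrFun (p.dA_momentPrimitive hη hθ hf hL hθd (hfξ x.1) (hLξ x.1) (hξ x.1)) (2 * n + 1)
  set A := mD (Fin n → ℂ) EX (p.incl b) x with hA
  set w := p.tangentLift x.1 u
  set Ξ := p.zForm Z ε η θ x.1 with hΞ
  change dForm _ x.1 (Matrix.vecCons w fun i => A (t i)) =
    iota w (iota (p.tangentLift x.1 ξB) Ξ) (2 * n) fun i => A (t i)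
  rw [h1]
  change iota w (iota (ξ x.1) Ξ) (2 * n) (fun i => A (t i)) = _
  obtain ⟨s, hs⟩ := p.exists_mD_incl x (w := p.tangentLift x.1 ξB - ξ x.1) (by
    rw [map_sub, p.mD_proj_tangentLift, hξB, sub_self])
  have h2 : p.tangentLift x.1 ξB = ξ x.1 + A s := by
    rw [hA, hs]
    abel
  have h3 : iota w (iota (A s) Ξ) = -iota (A s) (iota w Ξ) := by
    have h4 := iota_iota_self (w + A s) Ξ
    simp only [iota_add_vec, iota_add, iota_iota_self, zero_add, add_zero] at h4
    exact eq_neg_of_add_eq_zero_right h4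
  have h5 : iota (A s) (iota w Ξ) (2 * n) (fun i => A (t i)) = 0 := by
    have h6 := top_vertical_eq_zero (iota w Ξ (2 * n + 1)) A (Matrix.vecCons s t)
    rw [← h6, iota_apply]
    congr 1
    funext i
    refine Fin.cases rfl (fun i => rfl) i
  rw [h2, iota_add_vec, iota_add, h3]
  change _ = iota w (iota (ξ x.1) Ξ) (2 * n) (fun i => A (t i)) -
    iota (A s) (iota w Ξ) (2 * n) (fun i => A (t i))
  rw [h5, sub_zero]

/-- The central charge is locally constant. -/
theorem fibreCharge_deriv (b : B) : SmFun EB (p.fibreCharge Z ε η θ) b ∧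
    mD EB ℂ (p.fibreCharge Z ε η θ) b = 0 := by
  have hf : ∀ x, SmFun EX (fun _ : X => (1 : ℂ)) x := smFun_const 1
  have hL0 : p.vertLaplacian η (fun _ => 1) = fun _ => 0 := by
    funext x
    rw [vertLaplacian, laplacian_const]
  have hc : ∀ a : ℂ, ∀ x, dF (E := EX) (fun _ : X => a) x = 0 := by
    intro a x
    have h1 : mD EX ℂ (fun _ : X => a) x = 0 := mfderiv_const
    ext u
    rw [dF_apply, h1]
    rfl
  have h0 : ∀ {k : ℕ} (α : EX [⋀^Fin (k + 1)]→L[ℝ] ℂ), α.curryLeft 0 = 0 := by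
    intro k α
    ext u
    exact α.map_coord_zero 0 rfl
  have h := p.fibre_integration (Ψ := fun x =>
    p.momentPrimitive Z ε η θ (fun _ => 1) (p.vertLaplacian η fun _ => 1) x (2 * n))
    (fun x => p.smoothAltAt_momentPrimitive hη hθ hf (by rw [hL0]; exact smFun_const 0) x _) b
  rw [← funext (p.fibreMoment_eq hη hθ hf), funext (p.fibreMoment_one hη hθ)] at h
  refine ⟨h.1, ContinuousLinearMap.ext fun u => ?_⟩
  rw [h.2 u (fun x => p.tangentLift x.1 u) fun x => p.mD_proj_tangentLift x.1 u]
  refine (integral_congr_form fun x => ?_).trans integral_zero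
  have h1 : dForm (fun x => p.momentPrimitive Z ε η θ (fun _ => 1)
      (p.vertLaplacian η fun _ => 1) x (2 * n)) x.1 =
      iota 0 (p.zForm Z ε η θ x.1) (2 * n + 1) := by
    rw [hL0]
    exact congrFun (p.dA_momentPrimitive hη hθ hf (smFun_const 0) hθd (by rw [hc, h0])
      (by rw [hc, h0, neg_zero]) (funext fun k => h0 _)) (2 * n + 1)
  rw [contractFibre, h1, iota, h0]
  rfl

end Family

section Naturality

variable {n : ℕ} {M M' : Type*} [TopologicalSpace M] [ChartedSpace (Fin n → ℂ) M]
  [TopologicalSpace M'] [ChartedSpace (Fin n → ℂ) M']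
  [IsManifold 𝓘(ℂ, Fin n → ℂ) ω M] [IsManifold 𝓘(ℂ, Fin n → ℂ) ω M']
  {e : M' → M} (he : ContMDiff 𝓘(ℂ, Fin n → ℂ) 𝓘(ℂ, Fin n → ℂ) ω e)
  (hdet : ∀ x, LinearMap.det
    (mD (Fin n → ℂ) (Fin n → ℂ) e x : (Fin n → ℂ) →ₗ[ℝ] (Fin n → ℂ)) ≠ 0)
  {η : M → (Fin n → ℂ) [⋀^Fin 2]→L[ℝ] ℂ} {θ : M → Alt (Fin n → ℂ)}

include he hdet

theorem laplacian_pullback {f : M → ℂ} (x : M') (hf : SmFun (Fin n → ℂ) f (e x)) :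
    laplacian (pullback (E' := Fin n → ℂ) e η) (fun y => f (e y)) x = laplacian η f (e x) := by
  have h1 := topRatio_altComp (α := wedge (ofDegree 2 (ddbar f (e x))) (wpow (η (e x)) (n - 1)))
    (β := wpow (η (e x)) n) _ (hdet x)
  rw [altComp_wedge, altComp_ofDegree, altComp_wpow, altComp_wpow] at h1
  have h2 := pullback_ddbar (E := Fin n → ℂ) (E' := Fin n → ℂ) (F := e) hf
    (Filter.Eventually.of_forall fun z => (he z).mdifferentiableAt (by simp))
    (ContMDiffAt.to_real (he x))
  rw [laplacian, laplacian, ← h1, ← h2]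
  rfl

theorem zFunction_pullback {Z : CentralCharge n} {ε : ℝ} (hη : ∀ x, SmoothAt η x)
    (hρ : ∀ x, SmoothAt (ricciForm η) x) (hθ : ∀ x, SmoothAltAt θ x)
    (h0 : ∀ x, wpow (η x) n (2 * n) (stdFrame n) ≠ 0)
    (hric : ricciForm (pullback (E' := Fin n → ℂ) e η) = pullback e (ricciForm η)) (x : M') :
    zFunction Z ε (pullback (E' := Fin n → ℂ) e η) (pullAlt e θ) x = zFunction Z ε η θ (e x) := by
  have h1 : ∀ l j y, topRatio (powWedge (pullback (E' := Fin n → ℂ) e η y)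
      (ricciForm (pullback (E' := Fin n → ℂ) e η) y) (pullAlt (E' := Fin n → ℂ) e θ y) l j)
      (wpow (pullback (E' := Fin n → ℂ) e η y) n) =
      topRatio (powWedge (η (e y)) (ricciForm η (e y)) (θ (e y)) l j) (wpow (η (e y)) n) := by
    intro l j y
    have h2 := topRatio_altComp (α := powWedge (η (e y)) (ricciForm η (e y)) (θ (e y)) l j)
      (β := wpow (η (e y)) n) _ (hdet y)
    rw [altComp_powWedge, altComp_wpow] at h2
    rw [hric, ← h2]
    rfl
  rw [zFunction, zFunction]
  refine Finset.sum_congr rfl fun l _ => Finset.sum_congr rfl fun j _ => ?_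
  rw [h1, funext (h1 (l + 1) (j - 1)), laplacian_pullback he hdet x
    (smFun_chernRatio hη hρ hθ h0 (l + 1) (j - 1) (e x))]

end Naturality

namespace Family

variable {n : ℕ} {EX EB EK X B K : Type*} [NormedAddCommGroup EX] [NormedSpace ℂ EX]
  [FiniteDimensional ℂ EX] [NormedAddCommGroup EB] [NormedSpace ℂ EB] [FiniteDimensional ℂ EB]
  [NormedAddCommGroup EK] [NormedSpace ℝ EK]
  [TopologicalSpace X] [ChartedSpace EX X] [TopologicalSpace B] [ChartedSpace EB B]
  [Group K] [TopologicalSpace K] [ChartedSpace EK K] [LieGroup 𝓘(ℝ, EK) ∞ K]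
  [MulAction K X] [MulAction K B]
  (p : Family n EX EB X B) {η : X → EX [⋀^Fin 2]→L[ℝ] ℂ} {θ : X → Alt EX}
  [IsManifold 𝓘(ℂ, EX) ω X] [IsManifold 𝓘(ℂ, EB) ω B]
  (hX : IsHolomorphicAction EK K EX X)
  (hequiv : ∀ (k : K) (x : X), p.proj (k • x) = k • p.proj x)

/-- The action of a group element between two fibres. -/
def fibreMap (k : K) (b b' : B) (h : k • b = b') (x : p.Fiber b) : p.Fiber b' :=
  ⟨k • x.1, by rw [hequiv, x.2, h]⟩

include hX

theorem contMDiff_fibreMap (k : K) (b b' : B) (h : k • b = b') :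
    ContMDiff 𝓘(ℂ, Fin n → ℂ) 𝓘(ℂ, Fin n → ℂ) ω (p.fibreMap hequiv k b b' h) := fun x =>
  p.contMDiffAt_fiber ((hX.holomorphic k).comp (p.contMDiff_incl b) x)

/-- The action of a group element, as a homeomorphism between fibres. -/
def fibreHomeo (k : K) (b : B) : p.Fiber b ≃ₜ p.Fiber (k • b) where
  toFun := p.fibreMap hequiv k b (k • b) rfl
  invFun := p.fibreMap hequiv k⁻¹ (k • b) b (inv_smul_smul k b)
  left_inv x := Fiber.ext (inv_smul_smul k x.1)
  right_inv x := Fiber.ext (smul_inv_smul k x.1)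
  continuous_toFun := (p.contMDiff_fibreMap hX hequiv k b _ rfl).continuous
  continuous_invFun := (p.contMDiff_fibreMap hX hequiv k⁻¹ _ b _).continuous

theorem contMDiff_fibreHomeo (k : K) (b : B) :
    ContMDiff 𝓘(ℂ, Fin n → ℂ) 𝓘(ℂ, Fin n → ℂ) ω (p.fibreHomeo hX hequiv k b) :=
  p.contMDiff_fibreMap hX hequiv k b _ rfl

theorem contMDiff_fibreHomeo_symm (k : K) (b : B) :
    ContMDiff 𝓘(ℂ, Fin n → ℂ) 𝓘(ℂ, Fin n → ℂ) ω (p.fibreHomeo hX hequiv k b).symm :=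
  p.contMDiff_fibreMap hX hequiv k⁻¹ _ b (inv_smul_smul k b)

theorem det_fibreHomeo (k : K) (b : B) (x : p.Fiber b) : LinearMap.det
    (mD (Fin n → ℂ) (Fin n → ℂ) (p.fibreHomeo hX hequiv k b) x :
      (Fin n → ℂ) →ₗ[ℝ] (Fin n → ℂ)) ≠ 0 := by
  set e := p.fibreHomeo hX hequiv k b with he
  have h1 := mD_comp (E'' := Fin n → ℂ) (E := Fin n → ℂ) (E' := Fin n → ℂ) (g := e.symm) (f := e)
    (x := x)
    ((ContMDiffAt.to_real (p.contMDiff_fibreHomeo_symm hX hequiv k b (e x))).mdifferentiableAt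
      (by simp))
    ((ContMDiffAt.to_real (p.contMDiff_fibreHomeo hX hequiv k b x)).mdifferentiableAt (by simp))
  have h2 : (fun y => e.symm (e y)) = fun y => y := funext e.symm_apply_apply
  rw [h2, mD_id] at h1
  intro h0
  have h4 : (mD (Fin n → ℂ) (Fin n → ℂ) e.symm (e x) : (Fin n → ℂ) →ₗ[ℝ] (Fin n → ℂ)) ∘ₗ
      (mD (Fin n → ℂ) (Fin n → ℂ) e x : (Fin n → ℂ) →ₗ[ℝ] (Fin n → ℂ)) = LinearMap.id :=
    LinearMap.ext fun w => (DFunLike.congr_fun h1 w).symm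
  have h5 := congrArg LinearMap.det h4
  rw [LinearMap.det_comp, h0, mul_zero, LinearMap.det_id] at h5
  exact zero_ne_one h5

theorem pullback_restrict_invariant {k : ℕ} {ζ : X → EX [⋀^Fin k]→L[ℝ] ℂ}
    (hζ : InvariantForm K ζ) (g : K) (b : B) :
    pullback (E' := Fin n → ℂ) (p.fibreHomeo hX hequiv g b) (p.restrict (g • b) ζ) =
      p.restrict b ζ := by
  funext x
  have h1 : (fun z => p.incl (g • b) (p.fibreHomeo hX hequiv g b z)) =
      fun z => g • p.incl b z := rfl
  rw [restrict, pullback_pullback (E'' := Fin n → ℂ) (E' := Fin n → ℂ)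
    ((p.contMDiffAt_incl_real _).mdifferentiableAt (by simp))
    ((ContMDiffAt.to_real (p.contMDiff_fibreHomeo hX hequiv g b x)).mdifferentiableAt (by simp)),
    h1, ← pullback_pullback (E'' := Fin n → ℂ) (E' := EX) (g := fun x : X => g • x) (f := p.incl b)
    (hX.mdifferentiableAt_real g _) ((p.contMDiffAt_incl_real x).mdifferentiableAt (by simp)), hζ g]
  rfl

variable (hB : IsHolomorphicAction EK K EB B)

include hequiv hB

theorem invariant_relativeCurvature (hη : p.IsRelativelyKahler η) (hinv : InvariantForm K η) :
    InvariantForm K (p.relativeCurvature η) := fun g =>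
  p.pullback_relativeCurvature hη (hX.holomorphic g) (fun z w hw => by
    have h1 := mD_comp (E'' := EB) (g := p.proj) (f := fun x : X => g • x) (x := z)
      ((p.contMDiffAt_proj_real (g • z)).mdifferentiableAt (by simp))
      (hX.mdifferentiableAt_real g z)
    have h2 : (fun y => p.proj (g • y)) = fun y => g • p.proj y := funext fun y => hequiv g y
    have h3 := mD_comp (E'' := EB) (g := fun b : B => g • b) (f := p.proj) (x := z)
      (hB.mdifferentiableAt_real g (p.proj z))
      ((p.contMDiffAt_proj_real z).mdifferentiableAt (by simp))
    rw [h2, h3] at h1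
    refine (DFunLike.congr_fun h1 w).symm.trans ?_
    change mD EB EB (fun b : B => g • b) (p.proj z) (mD EX EB p.proj z w) = 0
    rw [hw, map_zero]) (hinv g)

/-- The fibre integral of `f Z̃_ε ωⁿ` is natural. -/
theorem fibreMoment_smul [T2Space X] {Z : CentralCharge n} {ε : ℝ} (hη : p.IsRelativelyKahler η)
    (hinv : InvariantForm K η) (hθ : ∀ x, SmoothAltAt θ x)
    (hθinv : ∀ k, InvariantForm K fun x => θ x k) {f : X → ℂ} (hf : ∀ x, SmFun EX f x) (g : K)
    (b : B) : p.fibreMoment Z ε η θ f (g • b) = p.fibreMoment Z ε η θ (fun x => f (g • x)) b := by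
  have hinvρ := p.invariant_relativeCurvature hX hequiv hB hη hinv
  set e := p.fibreHomeo hX hequiv g b with he
  have h1 : pullback (E' := Fin n → ℂ) e (p.restrict (g • b) η) = p.restrict b η :=
    p.pullback_restrict_invariant hX hequiv hinv g b
  have h2 : pullAlt (E' := Fin n → ℂ) e (p.restrictAlt (g • b) θ) = p.restrictAlt b θ := by
    funext x k
    exact congrFun (p.pullback_restrict_invariant hX hequiv (hθinv k) g b) x
  have h3 : ricciForm (p.restrict b η) =
      pullback (E' := Fin n → ℂ) e (ricciForm (p.restrict (g • b) η)) := by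
    rw [← p.restrict_relativeCurvature hη, ← p.restrict_relativeCurvature hη]
    exact (p.pullback_restrict_invariant hX hequiv hinvρ g b).symm
  have h4 : ∀ x, zFunction Z ε (p.restrict b η) (p.restrictAlt b θ) x =
      zFunction Z ε (p.restrict (g • b) η) (p.restrictAlt (g • b) θ) (e x) := by
    intro x
    have h5 := zFunction_pullback (Z := Z) (ε := ε) (p.contMDiff_fibreHomeo hX hequiv g b)
      (p.det_fibreHomeo hX hequiv g b) (p.smoothAt_restrict_metric hη)
      (p.smoothAt_ricci_restrict hη) (p.smoothAltAt_restrictAlt hθ) (p.wpow_restrict_ne_zero hη)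
      (by rw [← he, h1, h3]) x
    rw [← he, h1, h2] at h5
    exact h5
  rw [fibreMoment, fibreMoment, ← integral_pullback e (p.contMDiff_fibreHomeo hX hequiv g b)
    (p.contMDiff_fibreHomeo_symm hX hequiv g b) (p.smoothAt_fibreMoment hη hθ hf)]
  refine integral_congr_form fun x => ?_
  rw [h4, ← h1]
  have h6 := altComp_wpow (p.restrict (g • b) η (e x)) n (mD (Fin n → ℂ) (Fin n → ℂ) e x)
  change _ = (f (g • x.1) * _) • wpow ((p.restrict (g • b) η (e x)).compContinuousLinearMap
    (mD (Fin n → ℂ) (Fin n → ℂ) e x)) n (2 * n)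
  rw [← h6]
  rfl

end Family

section MaximumPrinciple

open Metric

theorem eq_of_ddbar_eq_zero_of_le {g : ℂ → ℂ} (hg : ∀ ζ ∈ ball (0 : ℂ) 2, ContDiffAt ℝ ∞ g ζ)
    (h0 : ∀ ζ ∈ ball (0 : ℂ) 2, ddbar (E := ℂ) g ζ = 0)
    (hmax : ∀ ζ ∈ ball (0 : ℂ) 2, (g ζ).re ≤ (g 0).re) : (g 1).re = (g 0).re := by
  have hlap : ∀ ζ ∈ ball (0 : ℂ) 2, _root_.Laplacian.laplacian g ζ = 0 := by
    intro ζ hζ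
    have h1 := ddbar_eq ((hg ζ hζ).of_le (by simpa using two_le_infty)) ![1, Complex.I]
    rw [h0 ζ hζ] at h1
    change (0 : ℂ) = _ at h1
    rw [InnerProductSpace.laplacian_eq_iteratedFDeriv_complexPlane]
    simp only [iteratedFDeriv_two_apply]
    simp only [Matrix.cons_val_zero, Matrix.cons_val_one,
      smul_eq_mul, mul_one, Complex.I_mul_I, map_neg, sub_neg_eq_add] at h1 ⊢
    rw [add_comm]
    exact ((smul_eq_zero.1 h1.symm).resolve_left (by norm_num))
  have hharm : InnerProductSpace.HarmonicOnNhd g (ball 0 2) := fun ζ hζ =>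
    ⟨(hg ζ hζ).of_le (by simpa using two_le_infty), by
      filter_upwards [isOpen_ball.mem_nhds hζ] with z hz using hlap z hz⟩
  obtain ⟨F, hF, hFg⟩ := (hharm.comp_CLM Complex.reCLM).exists_analyticOnNhd_ball_re_eq
  have hn : ∀ ζ ∈ ball (0 : ℂ) 2, ‖Complex.exp (F ζ)‖ = Real.exp (g ζ).re := by
    intro ζ hζ
    rw [Complex.norm_exp]
    exact congrArg _ (hFg hζ)
  have hc0 : (0 : ℂ) ∈ ball (0 : ℂ) 2 := by simp
  have hc1 : (1 : ℂ) ∈ ball (0 : ℂ) 2 := by simp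
  have h2 := Complex.norm_eqOn_of_isPreconnected_of_isMaxOn (f := fun ζ => Complex.exp (F ζ))
    (convex_ball (0 : ℂ) 2).isPreconnected isOpen_ball
    (fun ζ hζ => (hF ζ hζ).differentiableAt.cexp.differentiableWithinAt) hc0
    (fun ζ hζ => by
      change ‖Complex.exp (F ζ)‖ ≤ ‖Complex.exp (F 0)‖
      rw [hn ζ hζ, hn 0 hc0]
      exact Real.exp_le_exp.2 (hmax ζ hζ)) hc1
  change ‖Complex.exp (F 1)‖ = ‖Complex.exp (F 0)‖ at h2
  rw [hn 1 hc1, hn 0 hc0] at h2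
  exact Real.exp_injective h2

variable {E M : Type*} [NormedAddCommGroup E] [NormedSpace ℂ E] [FiniteDimensional ℂ E]
  [TopologicalSpace M] [ChartedSpace E M] [IsManifold 𝓘(ℂ, E) ω M]

/-- Pluriharmonic functions on connected compact complex manifolds are constant. -/
theorem exists_eq_const_of_ddbar_eq_zero [CompactSpace M] [ConnectedSpace M] {u : M → ℝ}
    (hu : ∀ x, SmFun E (fun y => (u y : ℂ)) x) (h0 : ∀ x, ddbar (E := E) (fun y => (u y : ℂ)) x = 0) :
    ∃ a, ∀ x, u x = a := by
  have hcont : Continuous u := by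
    have h1 : Continuous fun y => (u y : ℂ) :=
      continuous_iff_continuousAt.2 fun x => ContMDiffAt.continuousAt (hu x)
    exact Complex.continuous_re.comp h1
  obtain ⟨x₀, -, hx₀⟩ := isCompact_univ.exists_isMaxOn Set.univ_nonempty hcont.continuousOn
  refine ⟨u x₀, fun x => ?_⟩
  suffices h : {x | u x = u x₀} = Set.univ from (Set.ext_iff.1 h x).2 trivial
  refine IsClopen.eq_univ ⟨isClosed_eq hcont continuous_const, isOpen_iff_mem_nhds.2 ?_⟩ ⟨x₀, rfl⟩
  intro x hx
  change u x = u x₀ at hx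
  have hcm := chartAt_mem (E := E) x
  set c := chartAt E x with hc
  have hxc : x ∈ c.source := mem_chart_source _ x
  obtain ⟨r, hr, hrc⟩ := Metric.isOpen_iff.1 c.open_target _ (c.map_source hxc)
  filter_upwards [c.open_source.mem_nhds hxc, (c.continuousAt hxc).preimage_mem_nhds
    (ball_mem_nhds (c x) (half_pos hr))] with z hzc hz
  have hz : ‖c z - c x‖ < r / 2 := by simpa [dist_eq_norm] using hz
  let ℓ : ℂ → E := fun ζ => c x + ζ • (c z - c x)
  have hℓ : ∀ ζ ∈ ball (0 : ℂ) 2, ℓ ζ ∈ c.target := by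
    intro ζ hζ
    refine hrc ?_
    have h2 : ‖ζ‖ < 2 := by simpa using hζ
    have h3 : ‖ζ • (c z - c x)‖ < r := by
      rw [norm_smul]
      nlinarith [norm_nonneg (c z - c x), norm_nonneg ζ]
    simpa [ℓ, dist_eq_norm] using h3
  have hℓd : ContDiff ℂ ω ℓ := contDiff_const.add (contDiff_id.smul contDiff_const)
  have hs : ∀ ζ ∈ ball (0 : ℂ) 2, ContMDiffAt 𝓘(ℂ, ℂ) 𝓘(ℂ, E) ω (fun ζ => c.symm (ℓ ζ)) ζ := by
    intro ζ hζ
    exact ContMDiffAt.comp (g := c.symm) (f := ℓ) ζ ((contMDiffOn_symm_of_mem_maximalAtlas hcm).contMDiffAt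
      (c.open_target.mem_nhds (hℓ ζ hζ))) hℓd.contDiffAt.contMDiffAt
  have h1 := eq_of_ddbar_eq_zero_of_le (g := fun ζ => (u (c.symm (ℓ ζ)) : ℂ))
    (fun ζ hζ => smFun_iff_contDiffAt.1 (ContMDiffAt.comp (g := fun y => (u y : ℂ))
      (f := fun ζ => c.symm (ℓ ζ)) ζ (hu _) (ContMDiffAt.to_real (hs ζ hζ))))
    (fun ζ hζ => by
      rw [← pullback_ddbar (E := E) (E' := ℂ) (f := fun y => (u y : ℂ))
        (F := fun ζ => c.symm (ℓ ζ)) (hu _) (by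
        filter_upwards [isOpen_ball.mem_nhds hζ] with z hz
        exact (hs z hz).mdifferentiableAt (by simp)) (ContMDiffAt.to_real (hs ζ hζ))]
      ext w
      rw [pullback_apply, h0]
      rfl)
    (fun ζ hζ => by
      have h2 : c.symm (ℓ 0) = x := by simp [ℓ, c.left_inv hxc]
      simp only [Complex.ofReal_re, h2, hx]
      exact hx₀ (Set.mem_univ _))
  have h2 : c.symm (ℓ 0) = x := by simp [ℓ, c.left_inv hxc]
  have h3 : c.symm (ℓ 1) = z := by simp [ℓ, c.left_inv hzc]
  simp only [Complex.ofReal_re, h2, h3] at h1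
  exact h1.trans hx

/-- Functions with vanishing differential are locally constant. -/
theorem isLocallyConstant_of_mD_eq_zero {C : M → ℂ} (hC : ∀ x, SmFun E C x)
    (h0 : ∀ x, mD E ℂ C x = 0) : IsLocallyConstant C := by
  refine (IsLocallyConstant.iff_eventually_eq C).2 fun x => ?_
  have hcm := chartAt_mem (E := E) x
  set c := chartAt E x with hc
  have hxc : x ∈ c.source := mem_chart_source _ x
  obtain ⟨r, hr, hrc⟩ := Metric.isOpen_iff.1 c.open_target _ (c.map_source hxc)
  have hd : ∀ y ∈ ball (c x) r, HasFDerivAt (fun y => C (c.symm y)) (0 : E →L[ℝ] ℂ) y := by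
    intro y hy
    have h1 := (smFun_iff hcm (c.map_target (hrc hy))).1 (hC _)
    rw [c.right_inv (hrc hy)] at h1
    have h2 := mD_comp (E'' := ℂ) (g := C) (f := c.symm) (hC (c.symm y)).mdiff
      ((contMDiffAt_chart_symm hcm (hrc hy)).mdifferentiableAt (by simp))
    rw [h0, ContinuousLinearMap.zero_comp, mD_eq_fderiv] at h2
    rw [← h2]
    exact (h1.differentiableAt (by simp)).hasFDerivAt
  filter_upwards [c.open_source.mem_nhds hxc, (c.continuousAt hxc).preimage_mem_nhds
    (ball_mem_nhds (c x) hr)] with z hzc hz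
  have h3 := isOpen_ball.is_const_of_fderiv_eq_zero (𝕜 := ℝ) (convex_ball (c x) r).isPreconnected
    (fun y hy => (hd y hy).differentiableAt.differentiableWithinAt)
    (fun y hy => (hd y hy).fderiv) hz (mem_ball_self hr)
  simpa [c.left_inv hxc, c.left_inv hzc] using h3

theorem IsLocallyConstant.apply_eq_of_localOrbit {EK K : Type*} [NormedAddCommGroup EK]
    [NormedSpace ℝ EK] [Group K] [TopologicalSpace K] [ChartedSpace EK K] [MulAction K M]
    {C : M → ℂ} (hC : IsLocallyConstant C) (hinv : ∀ (k : K) x, C (k • x) = C x) {x₀ : M}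
    (hdense : Dense (localOrbit EK K E x₀)) (x : M) : C x = C x₀ := by
  have h1 : ∀ x ∈ localOrbit EK K E x₀, C x = C x₀ := by
    intro x hx
    induction hx with
    | refl => rfl
    | tail _ h ih =>
      rw [← ih]
      rcases h with ⟨k, rfl⟩ | ⟨v, w, γ, hγ, rfl, rfl⟩
      · exact hinv k _
      · exact hC.apply_eq_of_isPreconnected (isPreconnected_Icc.image γ hγ.continuousOn)
          (Set.mem_image_of_mem _ (by simp)) (Set.mem_image_of_mem _ (by simp))
  exact congrFun (Continuous.ext_on hdense hC.continuous continuous_const h1) x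

end MaximumPrinciple

section MomentFunction

variable {EK E M K : Type*} [NormedAddCommGroup EK] [NormedSpace ℝ EK]
  [NormedAddCommGroup E] [NormedSpace ℂ E] [FiniteDimensional ℂ E]
  [TopologicalSpace M] [ChartedSpace E M] [IsManifold 𝓘(ℂ, E) ω M]
  [Group K] [TopologicalSpace K] [ChartedSpace EK K] [LieGroup 𝓘(ℝ, EK) ∞ K] [MulAction K M]
  {η : M → E [⋀^Fin 2]→L[ℝ] ℂ}

/-- `f` is a smooth function with `df = ι_v η`. -/
abbrev IsMomentFunction (η : M → E [⋀^Fin 2]→L[ℝ] ℂ) (v : GroupLieAlgebra 𝓘(ℝ, EK) K)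
    (f : M → ℝ) : Prop :=
  ∀ x, SmFun E (fun y => (f y : ℂ)) x ∧
    ∀ w, mD E ℂ (fun y => (f y : ℂ)) x w = η x ![inducedField v x, w]

theorem IsMomentFunction.add {v v' : GroupLieAlgebra 𝓘(ℝ, EK) K} {f f' : M → ℝ}
    (hf : IsMomentFunction η v f) (hf' : IsMomentFunction η v' f') :
    IsMomentFunction η (v + v') fun x => f x + f' x := by
  intro x
  simp only [Complex.ofReal_add]
  refine ⟨(hf x).1.add (hf' x).1, fun w => ?_⟩
  have h : inducedField (v + v') x = (inducedField v x + inducedField v' x : E) := map_add _ _ _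
  rw [mD_add (hf x).1.mdiff (hf' x).1.mdiff, h]
  exact (congrArg₂ _ ((hf x).2 w) ((hf' x).2 w)).trans ((η x).map_vecCons_add ![w] _ _).symm

theorem IsMomentFunction.const_smul {v : GroupLieAlgebra 𝓘(ℝ, EK) K} {f : M → ℝ}
    (hf : IsMomentFunction η v f) (a : ℝ) : IsMomentFunction η (a • v) fun x => a * f x := by
  intro x
  have e : (fun y => ((a * f y : ℝ) : ℂ)) = fun y => a • (f y : ℂ) := by
    funext y
    simp
  have h : inducedField (a • v) x = (a • inducedField v x : E) := map_smul _ _ _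
  rw [e]
  refine ⟨(smFun_const (a : ℂ) x).mul (hf x).1 |>.congr_of_eventuallyEq
    (Filter.Eventually.of_forall fun y => by simp), fun w => ?_⟩
  rw [mD_const_smul (hf x).1.mdiff, h]
  exact (congrArg _ ((hf x).2 w)).trans ((η x).map_vecCons_smul ![w] _ _).symm

theorem IsMomentFunction.comp_smul (hM : IsHolomorphicAction EK K E M) (hinv : InvariantForm K η)
    {k : K} {v : GroupLieAlgebra 𝓘(ℝ, EK) K} {f : M → ℝ}
    (hf : IsMomentFunction η (adjoint k v) f) : IsMomentFunction η v fun x => f (k • x) := by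
  intro x
  refine ⟨ContMDiffAt.comp (g := fun y => (f y : ℂ)) (f := fun x => k • x) x (hf (k • x)).1
    (hM.contMDiffAt_real k x), fun w => ?_⟩
  have h1 := mD_comp (E'' := ℂ) (g := fun y => (f y : ℂ)) (f := fun x => k • x)
    (hf (k • x)).1.mdiff (hM.mdifferentiableAt_real k x)
  rw [h1]
  refine ((hf (k • x)).2 _).trans ?_
  rw [← mD_smul_inducedField hM, ← congrFun (hinv k) x, pullback_apply]
  congr 1
  funext i
  fin_cases i <;> rfl

end MomentFunction

namespace Family

variable {n : ℕ} {EX EB EK X B K : Type*} [NormedAddCommGroup EX] [NormedSpace ℂ EX]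
  [FiniteDimensional ℂ EX] [NormedAddCommGroup EB] [NormedSpace ℂ EB] [FiniteDimensional ℂ EB]
  [NormedAddCommGroup EK] [NormedSpace ℝ EK]
  [TopologicalSpace X] [ChartedSpace EX X] [TopologicalSpace B] [ChartedSpace EB B]
  [Group K] [TopologicalSpace K] [ChartedSpace EK K] [LieGroup 𝓘(ℝ, EK) ∞ K]
  [MulAction K X] [MulAction K B]
  (p : Family n EX EB X B) {η : X → EX [⋀^Fin 2]→L[ℝ] ℂ} {θ : X → Alt EX}
  [IsManifold 𝓘(ℂ, EX) ω X] [IsManifold 𝓘(ℂ, EB) ω B]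

/-- Horizontality over a dense set extends to the total space. -/
theorem iota_inducedField_eq_zero (hX : IsHolomorphicAction EK K EX X)
    (hθ : ∀ x, SmoothAltAt θ x) {B₀ : Set B} (hB₀ : Dense B₀)
    (hθG : p.IsTransported EK K B₀ θ) (v : GroupLieAlgebra 𝓘(ℝ, EK) K) (x : X) :
    iota (inducedField v x) (θ x) = 0 := by
  funext k
  ext t
  have hcm := p.domChart_mem x
  set c := p.domChart x with hc
  have hx : x ∈ c.source := p.mem_domChart x
  have hpx := p.proj_mem x hx
  let s : B → EX := fun b => (p.split x).symm (p.codChart x b, (p.split x (c x)).2)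
  have hs0 : s (p.proj x) = c x := by
    change (p.split x).symm (p.codChart x (p.proj x), _) = _
    rw [p.codChart_proj x hx, Prod.mk.eta, ContinuousLinearEquiv.symm_apply_apply]
  have hsc : ContinuousAt s (p.proj x) :=
    (p.split x).symm.continuous.continuousAt.comp
      (((p.codChart x).continuousAt hpx).prodMk continuousAt_const)
  set u : Fin k → EX := fun i => mD EX EX c x (t i) with hu
  let F : EX → ℂ := fun y => coordRep c (fun z => θ z (k + 1)) y
    (Matrix.vecCons (fieldRep c v y) u)
  have hy := c.map_source hx
  have hF : ContinuousAt F (c x) := by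
    refine ContDiffAt.continuousAt (n := ∞) (contDiffAt_alt_apply
      (v := fun i y => (Matrix.vecCons (fieldRep c v y) u : Fin (k + 1) → EX) i)
      ((smoothAt_iff hcm hx).1 (hθ x (k + 1))) fun i => ?_)
    refine Fin.cases ?_ (fun i => ?_) i
    · exact contDiffAt_fieldRep hX hcm hy v
    · exact contDiffAt_const
  have hval : ∀ y ∈ c.target, F y = iota (inducedField v (c.symm y)) (θ (c.symm y)) k
      fun i => cD c y (u i) := by
    intro y hy
    change θ (c.symm y) (k + 1) (fun i => cD c y _) = _
    rw [iota_apply, ← cD_fieldRep hX hcm hy v]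
    congr 1
    funext i
    refine Fin.cases rfl (fun i => rfl) i
  have h1 : F (c x) = iota (inducedField v x) (θ x) k t := by
    rw [hval _ hy, c.left_inv hx]
    congr 1
    funext i
    exact DFunLike.congr_fun (cD_mD hcm hx) (t i)
  rw [← h1]
  by_contra hne
  have h2 : ∀ᶠ b in 𝓝 (p.proj x), F (s b) ≠ 0 ∧ s b ∈ c.target ∧ b ∈ (p.codChart x).source := by
    have h3 : ContinuousAt (fun b => F (s b)) (p.proj x) :=
      ContinuousAt.comp (g := F) (f := s) (by rwa [hs0]) hsc
    filter_upwards [h3.eventually_ne (by rwa [hs0]),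
      hsc.preimage_mem_nhds (by rw [hs0]; exact c.open_target.mem_nhds hy),
      (p.codChart x).open_source.mem_nhds hpx] with b h4 h5 h6 using ⟨h4, h5, h6⟩
  obtain ⟨b, hb, h4, h5, h6⟩ := ((mem_closure_iff_frequently.1 (hB₀ (p.proj x))).and_eventually
    h2).exists
  refine h4 ?_
  have h7 : p.proj (c.symm (s b)) = b := p.proj_symm x h6 h5 (by simp [s])
  rw [hval _ h5]
  have h8 := (hθG.horizontal (c.symm (s b)) (by rwa [h7]) v k).1
  change (θ (c.symm (s b)) (k + 1)).curryLeft _ _ = 0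
  rw [h8]
  rfl

instance (b : B) : ConnectedSpace (p.Fiber b) := by
  rw [connectedSpace_iff_univ]
  have hr : Fiber.val '' (Set.univ : Set (p.Fiber b)) = p.proj ⁻¹' {b} :=
    Set.ext fun x => ⟨fun ⟨z, _, hz⟩ => hz ▸ z.proj_val, fun hx => ⟨⟨x, hx⟩, trivial, rfl⟩⟩
  obtain ⟨x⟩ := p.exists_fiber b
  refine ⟨⟨x, trivial⟩, ?_⟩
  rw [← (p.isEmbedding_val b).isInducing.isPreconnected_image, hr]
  exact (p.connected b).isPreconnected

variable [T2Space X] {Z : CentralCharge n} {ε φ : ℝ}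
  (hη : p.IsRelativelyKahler η) (hθ : ∀ x, SmoothAltAt θ x)

include hη hθ

/-- Two functions with the same `i ∂∂̄` have the same pairing on fibres of phase `φ`. -/
theorem momentPairing_congr {h h' : X → ℝ} (hh : ∀ x, SmFun EX (fun y => (h y : ℂ)) x)
    (hh' : ∀ x, SmFun EX (fun y => (h' y : ℂ)) x)
    (hd : ∀ x, ddbar (E := EX) (fun y => (h y : ℂ)) x = ddbar (fun y => (h' y : ℂ)) x) {b : B}
    (hb : (Complex.exp (-(Complex.I * φ)) * p.fibreCharge Z ε η θ b).im = 0) :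
    p.momentPairing Z ε φ η θ h b = p.momentPairing Z ε φ η θ h' b := by
  set g : X → ℝ := fun x => h x - h' x with hgdef
  have ge : (fun y => (g y : ℂ)) = fun y => (h y : ℂ) + (-1 : ℝ) • (h' y : ℂ) := by
    funext y
    simp [g, sub_eq_add_neg]
  have hs : ∀ x, SmFun EX (fun y => (-1 : ℝ) • (h' y : ℂ)) x := fun x =>
    ((smFun_const (-1) x).mul (hh' x)).congr_of_eventuallyEq
      (Filter.Eventually.of_forall fun y => by simp)
  have hg : ∀ x, SmFun EX (fun y => (g y : ℂ)) x := fun x => by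
    rw [ge]
    exact (hh x).add (hs x)
  have hg0 : ∀ x, ddbar (E := EX) (fun y => (g y : ℂ)) x = 0 := by
    intro x
    rw [ge, ddbar_add (hh x) (hs x), ddbar_const_smul (hh' x), hd, neg_one_smul, add_neg_cancel]
  obtain ⟨a, ha⟩ := exists_eq_const_of_ddbar_eq_zero (M := p.Fiber b) (E := Fin n → ℂ)
    (u := fun x => g x.1) (p.smFun_comp_val hg) fun x => by
      rw [← p.restrict_ddbar x (hg x.1)]
      ext u
      exact congrArg (fun γ : EX [⋀^Fin 2]→L[ℝ] ℂ => γ _) (hg0 x.1)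
  have h1 : p.fibreMoment Z ε η θ (fun y => (h y : ℂ)) b =
      p.fibreMoment Z ε η θ (fun y => (h' y : ℂ)) b + a * p.fibreCharge Z ε η θ b := by
    rw [← p.fibreMoment_one hη hθ, ← p.fibreMoment_const_mul, ← p.fibreMoment_add hη hθ hh'
      (fun x => (smFun_const (a : ℂ) x).mul (smFun_const 1 x))]
    refine p.fibreMoment_congr fun x => ?_
    rw [← ha x]
    simp [g]
  rw [p.momentPairing_eq hη hθ φ hh, p.momentPairing_eq hη hθ φ hh', h1, mul_add, mul_left_comm,
    Complex.add_im, Complex.im_ofReal_mul, hb, mul_zero, add_zero]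

theorem momentPairing_two_mul {f : X → ℝ} (hf : ∀ x, SmFun EX (fun y => (f y : ℂ)) x) (b : B) :
    p.momentPairing Z ε φ η θ (fun x => 2 * f x) b =
      -(Complex.exp (-(Complex.I * φ)) * p.fibreMoment Z ε η θ (fun y => (f y : ℂ)) b).im := by
  have h1 : ∀ x, SmFun EX (fun y => ((2 * f y : ℝ) : ℂ)) x := fun x => by
    simp only [Complex.ofReal_mul]
    exact (smFun_const _ x).mul (hf x)
  rw [p.momentPairing_eq hη hθ φ h1]
  simp only [Complex.ofReal_mul]
  rw [p.fibreMoment_const_mul, mul_left_comm, Complex.im_ofReal_mul]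
  ring

theorem momentPairing_deriv [T2Space B] [SecondCountableTopology X]
    (hX : IsHolomorphicAction EK K EX X) (hB : IsHolomorphicAction EK K EB B)
    (hequiv : ∀ (k : K) (x : X), p.proj (k • x) = k • p.proj x) (hθd : ∀ x, dA θ x = 0)
    {v : GroupLieAlgebra 𝓘(ℝ, EK) K} {f : X → ℝ} (hf : IsMomentFunction η v f)
    (hv : ∀ x, iota (inducedField v x) (θ x) = 0) (b : B) :
    ContMDiffAt 𝓘(ℝ, EB) 𝓘(ℝ, ℝ) ∞ (p.momentPairing Z ε φ η θ fun x => 2 * f x) b ∧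
      ∀ u, (mfderiv 𝓘(ℝ, EB) 𝓘(ℝ, ℝ) (p.momentPairing Z ε φ η θ fun x => 2 * f x) b :
        EB →L[ℝ] ℝ) u = -p.momentForm Z ε φ η θ b (inducedField v b) u := by
  have hL := p.relativeCurvature_inducedField hX hB hequiv hf hη
  have h := p.fibreMoment_deriv (Z := Z) (ε := ε) hη hθ hθd (fun x => (hf x).1)
    (fun x => (hL x).1) (ξ := fun x => inducedField v x) (b := b) (ξB := inducedField v b)
    (fun x => by rw [p.mD_proj_inducedField hX hequiv, x.2])
    (fun x => by
      ext u
      rw [dF_apply, (hf x).2]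
      refine congrArg (η x) (funext fun i => ?_)
      refine Fin.cases rfl (fun i => ?_) i
      rw [Subsingleton.elim i 0]
      rfl)
    (fun x => by
      ext u
      rw [dF_apply, ← neg_eq_iff_eq_neg.2 ((hL x).2 (u 0)).symm.symm]
      refine congrArg (fun z : ℂ => -z) (congrArg (p.relativeCurvature η x) (funext fun i => ?_))
      refine Fin.cases rfl (fun i => ?_) i
      rw [Subsingleton.elim i 0]
      rfl) hv
  let L : ℂ →L[ℝ] ℝ := -(Complex.imCLM.comp
    (ContinuousLinearMap.mul ℝ ℂ (Complex.exp (-(Complex.I * φ)))))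
  have e : (p.momentPairing Z ε φ η θ fun x => 2 * f x) =
      fun b => L (p.fibreMoment Z ε η θ (fun y => (f y : ℂ)) b) :=
    funext fun b => p.momentPairing_two_mul hη hθ (fun x => (hf x).1) b
  have hLs : ContMDiff 𝓘(ℝ, ℂ) 𝓘(ℝ, ℝ) ∞ L := L.contMDiff
  rw [e]
  refine ⟨ContMDiffAt.comp (g := L) (f := p.fibreMoment Z ε η θ fun y => (f y : ℂ)) b (hLs _) h.1,
    fun u => ?_⟩
  have h2 := mfderiv_comp (I' := 𝓘(ℝ, ℂ)) b ((hLs _).mdifferentiableAt (by simp)) h.1.mdiff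
  rw [L.mfderiv_eq] at h2
  refine (DFunLike.congr_fun h2 u).trans (congrArg L (h.2 u))

end Family

end ZMoment

end

open ZMoment

theorem mainTheorem5 {n : ℕ}
    {EX EB EK X B K : Type*}
    [NormedAddCommGroup EX] [NormedSpace ℂ EX] [FiniteDimensional ℂ EX]
    [NormedAddCommGroup EB] [NormedSpace ℂ EB] [FiniteDimensional ℂ EB]
    [NormedAddCommGroup EK] [NormedSpace ℝ EK] [FiniteDimensional ℝ EK]
    [TopologicalSpace X] [ChartedSpace EX X] [IsManifold 𝓘(ℂ, EX) ω X] [T2Space X]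
    [SecondCountableTopology X]
    [TopologicalSpace B] [ChartedSpace EB B] [IsManifold 𝓘(ℂ, EB) ω B] [T2Space B]
    [SecondCountableTopology B]
    [Group K] [TopologicalSpace K] [ChartedSpace EK K] [LieGroup 𝓘(ℝ, EK) ∞ K] [T2Space K]
    [CompactSpace K]
    [MulAction K X] [MulAction K B]
    (p : ZMoment.Family n EX EB X B)
    (hX : ZMoment.IsHolomorphicAction EK K EX X) (hB : ZMoment.IsHolomorphicAction EK K EB B)
    (hequiv : ∀ (k : K) (x : X), p.proj (k • x) = k • p.proj x)
    (N : X → Type*) [∀ x, AddCommGroup (N x)] [∀ x, Module ℂ (N x)]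
    [∀ x, TopologicalSpace (N x)] [TopologicalSpace (Bundle.TotalSpace ℂ N)] [FiberBundle ℂ N]
    [VectorBundle ℂ ℂ N] [ContMDiffVectorBundle ω ℂ N 𝓘(ℂ, EX)]
    [MulAction K (Bundle.TotalSpace ℂ N)] (hN : ZMoment.IsLinearisation EK K (E := EX) N)
    (r : ℕ) (hr : 0 < r)
    (ω₂ : X → EX [⋀^Fin 2]→L[ℝ] ℂ) (hω : p.IsRelativelyKahler ω₂)
    (hc : ZMoment.RepresentsFirstChern N r ω₂) (hinv : ZMoment.InvariantForm K ω₂)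
    (b₀ : B) (hopen : IsOpen (ZMoment.localOrbit EK K EB b₀))
    (hdense : Dense (ZMoment.localOrbit EK K EB b₀))
    (θ : X → ZMoment.Alt EX) (hθ : ZMoment.IsUnipotentForm θ)
    (hθG : p.IsTransported EK K (ZMoment.localOrbit EK K EB b₀) θ)
    (Z : ZMoment.CentralCharge n) (ε : ℝ) (hε : 0 < ε)
    (hZ : p.fibreCharge Z ε ω₂ θ b₀ ≠ 0)
    (φ : ℝ) (hφ : φ = (p.fibreCharge Z ε ω₂ θ b₀).arg) :
    (∀ v : GroupLieAlgebra 𝓘(ℝ, EK) K, ∃ h : X → ℝ, ZMoment.IsHamiltonian ω₂ v h) ∧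
    ∃ μ : B → Module.Dual ℝ (GroupLieAlgebra 𝓘(ℝ, EK) K),
      (∀ (v : GroupLieAlgebra 𝓘(ℝ, EK) K) (h : X → ℝ), ZMoment.IsHamiltonian ω₂ v h →
        ∀ b, μ b v = p.momentPairing Z ε φ ω₂ θ h b) ∧
      ZMoment.IsMomentMap (p.momentForm Z ε φ ω₂ θ) μ := by
  have hθs : ∀ x, SmoothAltAt θ x := fun x k => smoothForm_iff.1 (hθ.smooth k) x
  have hθd : ∀ x, dA θ x = 0 := fun x => funext fun k => by
    cases k with
    | zero => rfl
    | succ k => exact hθ.closed k x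
  have hv : ∀ (v : GroupLieAlgebra 𝓘(ℝ, EK) K) (x : X), iota (inducedField v x) (θ x) = 0 :=
    fun v x => p.iota_inducedField_eq_zero hX hθs hdense hθG v x
  choose f hf using exists_moment_function hX hN hr hω.real hc hinv
  have hm : ∀ v, IsMomentFunction ω₂ v (f v) := hf
  have hham : ∀ v, IsHamiltonian ω₂ v fun x => 2 * f v x := fun v =>
    isHamiltonian_of_moment_function hω.type hω.closed (hf v)
  have hcharge : ∀ b, (Complex.exp (-(Complex.I * φ)) * p.fibreCharge Z ε ω₂ θ b).im = 0 := by
    intro b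
    have hC := p.fibreCharge_deriv (Z := Z) (ε := ε) hω hθs hθd
    rw [(isLocallyConstant_of_mD_eq_zero (fun b => (hC b).1) fun b =>
      (hC b).2).apply_eq_of_localOrbit (fun k b => by
        rw [← p.fibreMoment_one hω hθs, ← p.fibreMoment_one hω hθs]
        exact p.fibreMoment_smul hX hequiv hB hω hinv hθs hθG.invariant (smFun_const 1) k b)
      hdense b, ← Complex.norm_mul_exp_arg_mul_I (p.fibreCharge Z ε ω₂ θ b₀), ← hφ,
      mul_left_comm, ← Complex.exp_add, mul_comm (φ : ℂ), neg_add_cancel, Complex.exp_zero, mul_one,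
      Complex.ofReal_im]
  have huniq : ∀ (v : GroupLieAlgebra 𝓘(ℝ, EK) K) (h h' : X → ℝ), IsHamiltonian ω₂ v h →
      IsHamiltonian ω₂ v h' → ∀ b,
      p.momentPairing Z ε φ ω₂ θ h b = p.momentPairing Z ε φ ω₂ θ h' b := fun v h h' hh hh' b =>
    p.momentPairing_congr hω hθs (fun x => smFun_ofReal (hh.smooth x))
      (fun x => smFun_ofReal (hh'.smooth x)) (fun x => (hh.eq x).symm.trans (hh'.eq x)) (hcharge b)
  have hpair : ∀ (v : GroupLieAlgebra 𝓘(ℝ, EK) K) (g : X → ℝ), IsMomentFunction ω₂ v g → ∀ b,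
      p.momentPairing Z ε φ ω₂ θ (fun x => 2 * f v x) b =
        -(Complex.exp (-(Complex.I * φ)) * p.fibreMoment Z ε ω₂ θ (fun y => (g y : ℂ)) b).im :=
    fun v g hg b => (huniq v _ _ (hham v)
      (isHamiltonian_of_moment_function hω.type hω.closed hg) b).trans
      (p.momentPairing_two_mul hω hθs (fun x => (hg x).1) b)
  refine ⟨fun v => ⟨_, hham v⟩, fun b =>
    { toFun := fun v => p.momentPairing Z ε φ ω₂ θ (fun x => 2 * f v x) b
      map_add' := fun v v' => ?_
      map_smul' := fun a v => ?_ }, fun v h hh b => huniq v _ _ (hham v) hh b,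
    fun v b => (p.momentPairing_deriv hω hθs hX hB hequiv hθd (hf v) (hv v) b).1,
    fun v b => (p.momentPairing_deriv hω hθs hX hB hequiv hθd (hf v) (hv v) b).2,
    fun k b v => ?_⟩
  · rw [hpair _ _ ((hm v).add (hm v')), hpair _ _ (hf v), hpair _ _ (hf v')]
    simp only [Complex.ofReal_add]
    rw [p.fibreMoment_add hω hθs (fun x => (hf v x).1) (fun x => (hf v' x).1), mul_add,
      Complex.add_im, neg_add]
  · rw [hpair _ _ ((hm v).const_smul a), hpair _ _ (hf v)]
    simp only [Complex.ofReal_mul]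
    rw [p.fibreMoment_const_mul, mul_left_comm, Complex.im_ofReal_mul, RingHom.id_apply,
      smul_eq_mul, mul_neg]
  · change p.momentPairing Z ε φ ω₂ θ (fun x => 2 * f (adjoint k v) x) (k • b) =
      p.momentPairing Z ε φ ω₂ θ (fun x => 2 * f v x) b
    rw [hpair _ _ (hf _), hpair v _ ((hm (adjoint k v)).comp_smul hX hinv),
      p.fibreMoment_smul hX hequiv hB hω hinv hθs hθG.invariant (fun x => (hf _ x).1)]
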